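/- Let $\omega>0$, $\alpha\in\mathbb R$, and let $H_\alpha^\omega$ be the self-adjoint, bounded below operator in $L^2(\mathbb R^2)$ associated with the closed quadratic form $$F_\alpha^\omega[u]=\int_{\mathbb R^2}\Big\{\tfrac12|\partial_x u|^2+\tfrac12|\partial_y u|^2+\tfrac{\omega^2y^2}{2}|u|^2-\tfrac{\omega}{2}|u|^2\Big\}\,dx\,dy+\alpha\int_{\mathbb R}|u(x,x)|^2\,dx$$ with domain $\{u\in H^1(\mathbb R^2)\,:\,yu\in L^2(\mathbb R^2)\}$, where $u(x,x)$ is the trace of $u$ on the diagonal. For $\lambda>0$ let $$G_\omega^\lambda(x,y;x',y')=\frac{1}{\sqrt2\,\pi}\int_0^1\frac{\nu^{\lambda/\omega-1}}{\sqrt{1-\nu^2}\sqrt{\ln(1/\nu)}}\exp\Big\{-\tfrac{\omega}{2}\tfrac{1-\nu}{1+\nu}(y^2+y'^2)-\tfrac{\omega}{2\ln(1/\nu)}(x-x')^2-\tfrac{\omega\nu}{1-\nu^2}(y-y')^2\Big\}\,d\nu$$ be the integral kernel of $(H_0^\omega+\lambda)^{-1}$, and for $q\in L^2(\mathbb R)$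 put $(\mathcal G_\omega^\lambda q)(x,y)=\int_{\mathbb R} G_\omega^\lambda(x,y;x',x')\,q(x')\,dx'$ and $(K_\omega^\lambda q)(x)=\int_{\mathbb R} G_\omega^\lambda(x,x;x',x')\,q(x')\,dx'$. (1) If $\alpha\ge0$, then $H_\alpha^\omega$ has no negative eigenvalues. (2) If $\alpha<0$, then $H_\alpha^\omega$ has, counted with multiplicity, a finite number $N_\omega(\alpha)$ of negative eigenvalues $-E_0(\alpha,\omega)\le -E_1(\alpha,\omega)\le\dots<0$. They satisfy $N_\omega(\alpha)=N_1(\alpha/\sqrt\omega)$ and $E_n(\alpha,\omega)=\omega\,E_n(\alpha/\sqrt\omega,1)$ for all $n<N_\omega(\alpha)$. (3) Let $\alpha<0$ and $E>0$. Every $u$ in the domain of $H_\alpha^\omega$ with $H_\alpha^\omega u=-Eu$ is of the form $u=\mathcal G_\omega^{E}q$ for exactly one solution $q\in L^2(\mathbb R)$ of $q+\alpha K_\omega^{E}q=0$, and conversely, for every such solution $q$, the function $\mathcal G_\omega^Eq$ is in the domain and $H_\alpha^\omega \mathcal G_\omega^Eq=-E\,\mathcal G_\omega^Eq$. In particular this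 describes the eigenvectors for $E=E_n(\alpha,\omega)$. For $E=E_0(\alpha,\omega)$ the solution $q$ is unique up to a phase once its $L^2$-norm is fixed. (4) For every $\omega>0$ there is $\alpha_0>0$ (depending on $\omega$) such that $N_\omega(\alpha)=1$ for $-\alpha_0\le\alpha<0$ and $N_\omega(\alpha)>1$ for $\alpha<-\alpha_0$. (5) For every fixed $\omega>0$, $E_0(\alpha,\omega)\sim\alpha^2/2$ as $\alpha\to0^-$. -/

import Mathlib

open MeasureTheory Filter Topology

namespace ZeroRange

noncomputable section

/-- The Hilbert space of complex square integrable functions of `(x, y)`. -/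
abbrev L2Plane : Type := Lp ℂ 2 (volume : Measure (ℝ × ℝ))

/-- The Hilbert space of complex square integrable functions on the line. -/
abbrev L2Line : Type := Lp ℂ 2 (volume : Measure ℝ)

/-- Smooth compactly supported functions on the plane. -/
structure IsTest (φ : ℝ × ℝ → ℂ) : Prop where
  smooth : ContDiff ℝ ((⊤ : ℕ∞) : WithTop ℕ∞) φ
  compact : HasCompactSupport φ

/-- `g` is the weak derivative of `u` in the direction `v`. -/
def HasWeakDeriv (v : ℝ × ℝ) (u g : L2Plane) : Prop :=
  ∀ φ : ℝ × ℝ → ℂ, IsTest φ →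
    ∫ p, u p * fderiv ℝ φ p v = - ∫ p, g p * φ p

/-- For `u` in `H¹` with weak derivatives `ux`, `uy`: the function `g` is the restriction (trace)
`x ↦ u (x, x)`, obtained by continuous extension from test functions. -/
def HasDiagTrace (u ux uy : L2Plane) (g : L2Line) : Prop :=
  ∃ φ : ℕ → ℝ × ℝ → ℂ, (∀ n, IsTest (φ n)) ∧
    Tendsto (fun n => eLpNorm (fun p => φ n p - u p) 2 volume) atTop (𝓝 0) ∧
    Tendsto (fun n => eLpNorm (fun p => fderiv ℝ (φ n) p (1, 0) - ux p) 2 volume)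
      atTop (𝓝 0) ∧
    Tendsto (fun n => eLpNorm (fun p => fderiv ℝ (φ n) p (0, 1) - uy p) 2 volume)
      atTop (𝓝 0) ∧
    Tendsto (fun n => eLpNorm (fun x : ℝ => φ n (x, x) - g x) 2 volume) atTop (𝓝 0)

/-- An element `fn` of the form domain `{u ∈ H¹(ℝ²) | y u ∈ L²(ℝ²)}`, together with its partial
derivatives, the function `y u` and its trace on the diagonal (all determined by `fn`). -/
structure FormElement where
  /-- the function `u` -/
  fn : L2Plane
  /-- the weak derivative in `x` -/
  dx : L2Plane
  /-- the weak derivative in `y` -/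
  dy : L2Plane
  /-- the function `y u` -/
  yfn : L2Plane
  /-- the trace `u (x, x)` -/
  tr : L2Line
  hasWeakDeriv_dx : HasWeakDeriv (1, 0) fn dx
  hasWeakDeriv_dy : HasWeakDeriv (0, 1) fn dy
  yfn_ae : ∀ᵐ p : ℝ × ℝ, yfn p = (p.2 : ℂ) * fn p
  hasDiagTrace : HasDiagTrace fn dx dy tr

/-- The sesquilinear form of the quadratic form
`∫ (|∂ₓu|²/2 + |∂ᵧu|²/2 + ω² y² |u|²/2 - ω |u|²/2) + α ∫ |u(x,x)|²`
(conjugate linear in the first argument). -/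
def form (ω α : ℝ) (V U : FormElement) : ℂ :=
  (1 / 2 : ℂ) * inner ℂ V.dx U.dx + (1 / 2 : ℂ) * inner ℂ V.dy U.dy
    + ((ω ^ 2 / 2 : ℝ) : ℂ) * inner ℂ V.yfn U.yfn - ((ω / 2 : ℝ) : ℂ) * inner ℂ V.fn U.fn
    + (α : ℂ) * inner ℂ V.tr U.tr

theorem IsTest.memLp {φ : ℝ × ℝ → ℂ} (h : IsTest φ) : MemLp φ 2 volume :=
  h.smooth.continuous.memLp_of_hasCompactSupport h.compact

theorem IsTest.memLp_fderiv {φ : ℝ × ℝ → ℂ} (h : IsTest φ) (v : ℝ × ℝ) :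
    MemLp (fun p => fderiv ℝ φ p v) 2 volume := by
  have hc : Continuous fun p => fderiv ℝ φ p v :=
    (h.smooth.continuous_fderiv (by simp)).clm_apply continuous_const
  exact hc.memLp_of_hasCompactSupport (h.compact.fderiv_apply ℝ v)

theorem IsTest.memLp_diag {φ : ℝ × ℝ → ℂ} (h : IsTest φ) :
    MemLp (fun x : ℝ => φ (x, x)) 2 volume := by
  have hd : Topology.IsClosedEmbedding (fun x : ℝ => (x, x)) :=
    AntilipschitzWith.isClosedEmbedding (K := 1)
      (AntilipschitzWith.of_le_mul_dist fun a b => by simp [Prod.dist_eq])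
      (uniformContinuous_id.prodMk uniformContinuous_id)
  exact (h.smooth.continuous.comp (by fun_prop)).memLp_of_hasCompactSupport
    (h.compact.comp_isClosedEmbedding hd)

theorem IsTest.add {φ ψ : ℝ × ℝ → ℂ} (h : IsTest φ) (k : IsTest ψ) : IsTest (φ + ψ) :=
  ⟨h.smooth.add k.smooth, h.compact.add k.compact⟩

theorem IsTest.smul {φ : ℝ × ℝ → ℂ} (h : IsTest φ) (c : ℂ) : IsTest (c • φ) :=
  ⟨h.smooth.const_smul c, h.compact.smul_left (f := fun _ => c)⟩

theorem IsTest.zero : IsTest (0 : ℝ × ℝ → ℂ) := ⟨contDiff_const, HasCompactSupport.zero⟩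

theorem IsTest.differentiable {φ : ℝ × ℝ → ℂ} (h : IsTest φ) : Differentiable ℝ φ :=
  h.smooth.differentiable (by simp)

theorem HasWeakDeriv.add {v : ℝ × ℝ} {u g u' g' : L2Plane} (h : HasWeakDeriv v u g)
    (h' : HasWeakDeriv v u' g') : HasWeakDeriv v (u + u') (g + g') := by
  intro φ hφ
  have e1 : ∫ p, (u + u' : L2Plane) p * fderiv ℝ φ p v
      = ∫ p, (u p * fderiv ℝ φ p v + u' p * fderiv ℝ φ p v) := by
    refine integral_congr_ae ?_
    filter_upwards [Lp.coeFn_add u u'] with p hp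
    rw [hp, Pi.add_apply, add_mul]
  have e2 : ∫ p, (g + g' : L2Plane) p * φ p = ∫ p, (g p * φ p + g' p * φ p) := by
    refine integral_congr_ae ?_
    filter_upwards [Lp.coeFn_add g g'] with p hp
    rw [hp, Pi.add_apply, add_mul]
  have i (f : L2Plane) : Integrable (fun p => f p * fderiv ℝ φ p v) volume :=
    (Lp.memLp f).integrable_mul (hφ.memLp_fderiv v)
  have j (f : L2Plane) : Integrable (fun p => f p * φ p) volume :=
    (Lp.memLp f).integrable_mul hφ.memLp
  rw [e1, e2, integral_add (i u) (i u'), integral_add (j g) (j g'), h φ hφ, h' φ hφ, neg_add]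

theorem HasWeakDeriv.smul {v : ℝ × ℝ} {u g : L2Plane} (h : HasWeakDeriv v u g) (c : ℂ) :
    HasWeakDeriv v (c • u) (c • g) := by
  intro φ hφ
  have e1 : ∫ p, (c • u : L2Plane) p * fderiv ℝ φ p v
      = ∫ p, c * (u p * fderiv ℝ φ p v) := by
    refine integral_congr_ae ?_
    filter_upwards [Lp.coeFn_smul c u] with p hp
    rw [hp, Pi.smul_apply, smul_eq_mul, mul_assoc]
  have e2 : ∫ p, (c • g : L2Plane) p * φ p = ∫ p, c * (g p * φ p) := by
    refine integral_congr_ae ?_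
    filter_upwards [Lp.coeFn_smul c g] with p hp
    rw [hp, Pi.smul_apply, smul_eq_mul, mul_assoc]
  rw [e1, e2, integral_const_mul, integral_const_mul, h φ hφ, mul_neg]

theorem tendsto_eLpNorm_add {β : Type*} [MeasurableSpace β] {μ : Measure β}
    {a a' : ℕ → β → ℂ} {f f' : Lp ℂ 2 μ}
    (ma : ∀ n, MemLp (a n) 2 μ) (ma' : ∀ n, MemLp (a' n) 2 μ)
    (h : Tendsto (fun n => eLpNorm (fun p => a n p - f p) 2 μ) atTop (𝓝 0))
    (h' : Tendsto (fun n => eLpNorm (fun p => a' n p - f' p) 2 μ) atTop (𝓝 0)) :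
    Tendsto (fun n => eLpNorm (fun p => (a n p + a' n p) - (f + f' : Lp ℂ 2 μ) p) 2 μ)
      atTop (𝓝 0) := by
  have hs := h.add h'
  rw [add_zero] at hs
  refine tendsto_of_tendsto_of_tendsto_of_le_of_le tendsto_const_nhds hs
    (fun _ => zero_le) fun n => ?_
  refine le_trans (le_of_eq ?_) (eLpNorm_add_le (((ma n).sub (Lp.memLp f)).1)
    (((ma' n).sub (Lp.memLp f')).1) (by norm_num))
  refine eLpNorm_congr_ae ?_
  filter_upwards [Lp.coeFn_add f f'] with p hp
  simp only [hp, Pi.add_apply]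
  ring

theorem tendsto_eLpNorm_smul {β : Type*} [MeasurableSpace β] {μ : Measure β}
    {a : ℕ → β → ℂ} {f : Lp ℂ 2 μ} (c : ℂ)
    (h : Tendsto (fun n => eLpNorm (fun p => a n p - f p) 2 μ) atTop (𝓝 0)) :
    Tendsto (fun n => eLpNorm (fun p => c * a n p - (c • f : Lp ℂ 2 μ) p) 2 μ)
      atTop (𝓝 0) := by
  have hs := ENNReal.Tendsto.const_mul (a := ‖c‖ₑ) h (Or.inr (by simp))
  rw [mul_zero] at hs
  refine hs.congr fun n => ?_
  rw [← eLpNorm_const_smul]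
  refine eLpNorm_congr_ae ?_
  filter_upwards [Lp.coeFn_smul c f] with p hp
  simp only [hp, Pi.smul_apply, smul_eq_mul]
  ring

theorem HasDiagTrace.add {u ux uy u' ux' uy' : L2Plane} {g g' : L2Line}
    (h : HasDiagTrace u ux uy g) (h' : HasDiagTrace u' ux' uy' g') :
    HasDiagTrace (u + u') (ux + ux') (uy + uy') (g + g') := by
  obtain ⟨φ, t, a, b, c, d⟩ := h
  obtain ⟨φ', t', a', b', c', d'⟩ := h'
  have key (v : ℝ × ℝ) (n : ℕ) (p : ℝ × ℝ) : fderiv ℝ (φ n + φ' n) p v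
      = fderiv ℝ (φ n) p v + fderiv ℝ (φ' n) p v := by
    rw [fderiv_add ((t n).differentiable p) ((t' n).differentiable p)]; rfl
  refine ⟨fun n => φ n + φ' n, fun n => (t n).add (t' n), ?_, ?_, ?_, ?_⟩
  · exact tendsto_eLpNorm_add (fun n => (t n).memLp) (fun n => (t' n).memLp) a a'
  · simp only [key]
    exact tendsto_eLpNorm_add (fun n => (t n).memLp_fderiv _) (fun n => (t' n).memLp_fderiv _) b b'
  · simp only [key]
    exact tendsto_eLpNorm_add (fun n => (t n).memLp_fderiv _) (fun n => (t' n).memLp_fderiv _) c c'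
  · exact tendsto_eLpNorm_add (fun n => (t n).memLp_diag) (fun n => (t' n).memLp_diag) d d'

theorem HasDiagTrace.smul {u ux uy : L2Plane} {g : L2Line}
    (h : HasDiagTrace u ux uy g) (z : ℂ) : HasDiagTrace (z • u) (z • ux) (z • uy) (z • g) := by
  obtain ⟨φ, t, a, b, c, d⟩ := h
  have key (v : ℝ × ℝ) (n : ℕ) (p : ℝ × ℝ) : fderiv ℝ (z • φ n) p v
      = z * fderiv ℝ (φ n) p v := by
    rw [fderiv_const_smul ((t n).differentiable p)]; rfl
  refine ⟨fun n => z • φ n, fun n => (t n).smul z, ?_, ?_, ?_, ?_⟩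
  · exact tendsto_eLpNorm_smul z a
  · simp only [key]
    exact tendsto_eLpNorm_smul z b
  · simp only [key]
    exact tendsto_eLpNorm_smul z c
  · exact tendsto_eLpNorm_smul z d

/-- Sum in the form domain. -/
def FormElement.add (U V : FormElement) : FormElement where
  fn := U.fn + V.fn
  dx := U.dx + V.dx
  dy := U.dy + V.dy
  yfn := U.yfn + V.yfn
  tr := U.tr + V.tr
  hasWeakDeriv_dx := U.hasWeakDeriv_dx.add V.hasWeakDeriv_dx
  hasWeakDeriv_dy := U.hasWeakDeriv_dy.add V.hasWeakDeriv_dy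
  yfn_ae := by
    filter_upwards [U.yfn_ae, V.yfn_ae, Lp.coeFn_add U.fn V.fn, Lp.coeFn_add U.yfn V.yfn]
      with p h1 h2 h3 h4
    rw [h3, h4, Pi.add_apply, Pi.add_apply, h1, h2, mul_add]
  hasDiagTrace := U.hasDiagTrace.add V.hasDiagTrace

/-- Scalar multiple in the form domain. -/
def FormElement.smul (c : ℂ) (U : FormElement) : FormElement where
  fn := c • U.fn
  dx := c • U.dx
  dy := c • U.dy
  yfn := c • U.yfn
  tr := c • U.tr
  hasWeakDeriv_dx := U.hasWeakDeriv_dx.smul c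
  hasWeakDeriv_dy := U.hasWeakDeriv_dy.smul c
  yfn_ae := by
    filter_upwards [U.yfn_ae, Lp.coeFn_smul c U.fn, Lp.coeFn_smul c U.yfn] with p h1 h3 h4
    rw [h3, h4, Pi.smul_apply, Pi.smul_apply, h1, smul_eq_mul, smul_eq_mul]
    ring
  hasDiagTrace := U.hasDiagTrace.smul c

theorem hasDiagTrace_zero : HasDiagTrace 0 0 0 0 := by
  have h0 : eLpNorm (fun p : ℝ × ℝ => (0 : ℂ) - (0 : L2Plane) p) 2 volume = 0 := by
    rw [← eLpNorm_zero (ε := ℂ) (α := ℝ × ℝ) (μ := volume) (p := 2)]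
    refine eLpNorm_congr_ae ?_
    filter_upwards with p
    simp
  have h1 : eLpNorm (fun p : ℝ => (0 : ℂ) - (0 : L2Line) p) 2 volume = 0 := by
    rw [← eLpNorm_zero (ε := ℂ) (α := ℝ) (μ := volume) (p := 2)]
    refine eLpNorm_congr_ae ?_
    filter_upwards with p
    simp
  have hf (p v : ℝ × ℝ) : fderiv ℝ (0 : ℝ × ℝ → ℂ) p v = 0 := by simp
  refine ⟨fun _ => 0, fun _ => IsTest.zero, ?_, ?_, ?_, ?_⟩
  · simpa only [Pi.zero_apply, h0] using tendsto_const_nhds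
  · simpa only [hf, h0] using tendsto_const_nhds
  · simpa only [hf, h0] using tendsto_const_nhds
  · simpa only [Pi.zero_apply, h1] using tendsto_const_nhds

theorem hasWeakDeriv_zero (v : ℝ × ℝ) : HasWeakDeriv v 0 0 := by
  intro φ _
  have e1 : ∫ p, (0 : L2Plane) p * fderiv ℝ φ p v = 0 := by
    refine integral_eq_zero_of_ae ?_
    filter_upwards with p
    simp
  have e2 : ∫ p, (0 : L2Plane) p * φ p = 0 := by
    refine integral_eq_zero_of_ae ?_
    filter_upwards with p
    simp
  rw [e1, e2, neg_zero]

/-- The zero element of the form domain. -/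
def FormElement.zero : FormElement where
  fn := 0
  dx := 0
  dy := 0
  yfn := 0
  tr := 0
  hasWeakDeriv_dx := hasWeakDeriv_zero _
  hasWeakDeriv_dy := hasWeakDeriv_zero _
  yfn_ae := by
    filter_upwards with p
    simp
  hasDiagTrace := hasDiagTrace_zero

/-- The graph of the self-adjoint operator `H` associated with the form: `u` lies in the domain of
`H` and `H u = w` iff `u` is in the form domain and `form V u = ⟨V, w⟩` for all `V` in the form
domain. -/
def hamiltonianGraph (ω α : ℝ) : Submodule ℂ (L2Plane × L2Plane) where
  carrier := {z | ∃ U : FormElement, U.fn = z.1 ∧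
    ∀ V : FormElement, form ω α V U = inner ℂ V.fn z.2}
  zero_mem' := ⟨FormElement.zero, rfl, fun V => by simp [form, FormElement.zero]⟩
  add_mem' := by
    rintro a b ⟨U, hU, h⟩ ⟨U', hU', h'⟩
    refine ⟨U.add U', by simp [FormElement.add, hU, hU'], fun V => ?_⟩
    rw [Prod.snd_add, inner_add_right, ← h V, ← h' V]
    simp only [form, FormElement.add, inner_add_right]
    ring
  smul_mem' := by
    rintro c a ⟨U, hU, h⟩
    refine ⟨U.smul c, by simp [FormElement.smul, hU], fun V => ?_⟩
    rw [Prod.smul_snd, inner_smul_right, ← h V]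
    simp only [form, FormElement.smul, inner_smul_right]
    ring

/-- The space of all `u` in the domain of `H` with `H u = -E u`. -/
def eigenspace (ω α E : ℝ) : Submodule ℂ L2Plane :=
  (hamiltonianGraph ω α).comap (LinearMap.prod LinearMap.id (-(E : ℂ) • LinearMap.id))

/-- `N` is the number of negative eigenvalues of `H`, counted with multiplicity, and
`-E 0 ≤ -E 1 ≤ … ≤ -E (N - 1) < 0` are these eigenvalues (`E n` is irrelevant for `n ≥ N`). -/
structure IsNegativeSpectrum (ω α : ℝ) (N : ℕ) (E : ℕ → ℝ) : Prop where
  pos : ∀ n < N, 0 < E n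
  antitone : ∀ m n, m ≤ n → n < N → E n ≤ E m
  rank_eq : ∀ e : ℝ, 0 < e → Module.rank ℂ (eigenspace ω α e)
    = (((Finset.range N).filter fun n => E n = e).card : Cardinal)

/-- The integral kernel of `(H₀ + lam)⁻¹`, where `H₀` is the operator without interaction. -/
def greenKernel (ω lam x y x' y' : ℝ) : ℝ :=
  1 / (√2 * Real.pi) * ∫ ν in Set.Ioo (0 : ℝ) 1,
    ν ^ (lam / ω - 1) / (√(1 - ν ^ 2) * √(Real.log (1 / ν))) *
      Real.exp (-(ω / 2) * ((1 - ν) / (1 + ν)) * (y ^ 2 + y' ^ 2)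
        - ω / (2 * Real.log (1 / ν)) * (x - x') ^ 2 - ω * ν / (1 - ν ^ 2) * (y - y') ^ 2)

/-- The potential of the charge `q` on the diagonal. -/
def potential (ω lam : ℝ) (q : L2Line) (p : ℝ × ℝ) : ℂ :=
  ∫ x', (greenKernel ω lam p.1 p.2 x' x' : ℂ) * q x'

/-- The integral operator with kernel `greenKernel (x, x; x', x')`. -/
def kOp (ω lam : ℝ) (q : L2Line) (x : ℝ) : ℂ :=
  ∫ x', (greenKernel ω lam x x x' x' : ℂ) * q x'

/-- The homogeneous equation `q + α K q = 0`. -/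
def SolvesCharge (ω α lam : ℝ) (q : L2Line) : Prop :=
  ∀ᵐ x : ℝ, q x + (α : ℂ) * kOp ω lam q x = 0

end

end ZeroRange

open scoped ENNReal

namespace ZeroRange

noncomputable section


/-! The proof is the Birman–Schwinger principle together with the min-max principle for the operator
`K = K_ω^e` on the line. A function `u` with `H u = -e u` solves `(H₀ + e) u = -α (tr u) δ_diag`.
Hence `u` is the potential of the charge `q = -α tr u`, and taking traces gives `q + α K q = 0`. So
for `α < 0` the eigenspace of `H` at `-e` is isomorphic to the eigenspace of `K` at `c = 1/|α|`
(`chargeEquiv`, `chargeSpace_eq`). For `α ≥ 0` the form is nonnegative, because the lowest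
eigenvalue of the oscillator is exactly compensated by `-ω/2`.

The analytic input is the identity `form_potentialElement`: `F₀(V, Gq) + lam ⟨V, Gq⟩ = ⟨tr V, q⟩` on
the whole form domain. The substitution `ν = exp (-ω τ)` exhibits the Green function as the Laplace
transform of the product of the free heat kernel in `x` and Mehler's kernel in `y`. Schur bounds at
fixed time `τ`, integrable in `τ`, make the potential, its derivatives, its product with `y` and its
trace bounded operators of `q`. The heat equation and the behaviour at time zero give the identity
for test functions, and density gives it in general. The form domain is treated throughout as the
closure `formSpace` of the tuples `(u, ∂ₓu, ∂ᵧu, yu, tr u)` of test functions.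

The operator `K` is symmetric and positive by that identity, and it is compact: for times `τ ≥ s` it
is Hilbert–Schmidt, and the rest is small in norm. By the resolvent identity its `n`-th min-max
level is continuous and strictly decreasing in `e`, and it tends to `0` as `e → ∞`. Each level
therefore equals `c` at most once. The root for the `n`-th level is `E_n`, and multiplicities agree
because the multiplicity of an eigenvalue of `K` is the number of levels equal to it
(`level_eq_iff`). A dilation by `√ω` reduces everything to `ω = 1` with coupling `α/√ω` and energy
`e/ω`.

For `ω = 1` the behaviour at `e → 0` comes from `chargeOp_one_eq`: `K = (2e)^(-1/2) |g⟩⟨g| + R_e`,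
where `g` is the oscillator ground state and `R_e` is bounded uniformly in `e`, compact, and Cauchy
in norm as `e → 0`. The lowest index gives a level equal to `(2e)^(-1/2) + O(1)`, so it always
crosses `c`, and `E_0 ~ α²/2`. The level of index one is bounded, and its supremum determines `α₀`.
Compactness of the remainder leaves only finitely many levels that ever exceed `c`.

Finally the kernel of `K` is strictly positive, and a Perron–Frobenius argument makes its top
eigenvector unique up to a factor; this is the uniqueness of the ground state charge. -/

/-! ### The form domain as a closure of test functions -/

theorem tendsto_eLpNorm_two_of_dominated {β : Type*} [MeasurableSpace β] {μ : Measure β}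
    {F : ℕ → β → ℂ} {f : β → ℂ} {g : β → ℝ} (hF : ∀ n, AEStronglyMeasurable (F n) μ)
    (hf : AEStronglyMeasurable f μ)
    (hg : MemLp g 2 μ) (hb : ∀ n, ∀ᵐ p ∂μ, ‖F n p - f p‖ ≤ g p)
    (hl : ∀ᵐ p ∂μ, Tendsto (fun n => F n p) atTop (𝓝 (f p))) :
    Tendsto (fun n => eLpNorm (fun p => F n p - f p) 2 μ) atTop (𝓝 0) := by
  have key : Tendsto (fun n => ∫⁻ p, ‖F n p - f p‖ₑ ^ (2 : ℝ) ∂μ) atTop (𝓝 0) := by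
    have h0 : (∫⁻ _ : β, (0 : ENNReal) ∂μ) = 0 := by simp
    rw [← h0]
    refine tendsto_lintegral_of_dominated_convergence' (fun p => ‖g p‖ₑ ^ (2 : ℝ))
      (fun n => (((hF n).sub hf).enorm).pow_const _) ?_ ?_ ?_
    · intro n
      filter_upwards [hb n] with p hp
      gcongr
      rw [← ofReal_norm, ← ofReal_norm]
      exact ENNReal.ofReal_le_ofReal (hp.trans (le_abs_self _))
    · have := hg.2
      have h2 := lintegral_rpow_enorm_lt_top_of_eLpNorm_lt_top (p := 2) (by simp) (by simp) this
      simpa using h2.ne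
    · filter_upwards [hl] with p hp
      have h1 : Tendsto (fun n => F n p - f p) atTop (𝓝 0) := by
        simpa using hp.sub_const (f p)
      have h2 := h1.enorm
      rw [enorm_zero] at h2
      have h3 := (ENNReal.continuous_rpow_const (y := (2 : ℝ))).tendsto 0
      simpa [Function.comp_def] using h3.comp h2
  have h4 := (ENNReal.continuous_rpow_const (y := (1 / 2 : ℝ))).tendsto 0
  have h5 := h4.comp key
  simp only [one_div, inv_pos, Nat.ofNat_pos, ENNReal.zero_rpow_of_pos] at h5
  refine h5.congr fun n => ?_
  rw [eLpNorm_eq_lintegral_rpow_enorm_toReal (by simp) (by simp)]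
  simp

/-- Space of tuples `(u, ∂ₓu, ∂ᵧu, yu, tr u)`. -/
abbrev TupleSpace : Type := L2Plane × L2Plane × L2Plane × L2Plane × L2Line

theorem IsTest.mul_real {φ : ℝ × ℝ → ℂ} (h : IsTest φ) {c : ℝ × ℝ → ℝ}
    (hc : ContDiff ℝ ((⊤ : ℕ∞) : WithTop ℕ∞) c) : IsTest (fun p => (c p : ℂ) * φ p) :=
  ⟨(Complex.ofRealCLM.contDiff.comp hc).mul h.smooth, h.compact.mul_left⟩

theorem IsTest.memLp_y {φ : ℝ × ℝ → ℂ} (h : IsTest φ) :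
    MemLp (fun p : ℝ × ℝ => (p.2 : ℂ) * φ p) 2 volume :=
  (h.mul_real (c := fun p => p.2) contDiff_snd).memLp

/-- The tuple of a test function. -/
def testTuple (φ : ℝ × ℝ → ℂ) (h : IsTest φ) : TupleSpace :=
  (h.memLp.toLp _, (h.memLp_fderiv (1, 0)).toLp _, (h.memLp_fderiv (0, 1)).toLp _,
    h.memLp_y.toLp _, h.memLp_diag.toLp _)

/-- The submodule of tuples of test functions. -/
def testSpace : Submodule ℂ TupleSpace where
  carrier := {ξ | ∃ φ, ∃ h : IsTest φ, testTuple φ h = ξ}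
  zero_mem' := by
    refine ⟨0, IsTest.zero, ?_⟩
    have h0 (β : Type) [MeasureSpace β] (f : β → ℂ) (hf : MemLp f 2 volume) (h : f = 0) :
        hf.toLp f = 0 := by subst h; exact MemLp.toLp_zero _
    simp only [testTuple]
    have h := IsTest.zero
    refine Prod.ext (h0 _ _ h.memLp rfl) (Prod.ext (h0 _ _ (h.memLp_fderiv _) ?_)
      (Prod.ext (h0 _ _ (h.memLp_fderiv _) ?_)
      (Prod.ext (h0 _ _ h.memLp_y ?_) (h0 _ _ h.memLp_diag ?_)))) <;> ext p <;> simp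
  add_mem' := by
    rintro _ _ ⟨φ, h, rfl⟩ ⟨ψ, k, rfl⟩
    refine ⟨φ + ψ, h.add k, ?_⟩
    have h0 (β : Type) [MeasureSpace β] (f f' f'' : β → ℂ) (hf : MemLp f 2 volume)
        (hf' : MemLp f' 2 volume) (hf'' : MemLp f'' 2 volume) (e : f'' = f + f') :
        hf''.toLp f'' = hf.toLp f + hf'.toLp f' := by subst e; exact MemLp.toLp_add _ _
    have key (v : ℝ × ℝ) (p : ℝ × ℝ) : fderiv ℝ (φ + ψ) p v
        = fderiv ℝ φ p v + fderiv ℝ ψ p v := by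
      rw [fderiv_add (h.differentiable p) (k.differentiable p)]; rfl
    have hk := h.add k
    refine Prod.ext (h0 _ _ _ _ h.memLp k.memLp hk.memLp rfl)
      (Prod.ext (h0 _ _ _ _ (h.memLp_fderiv _) (k.memLp_fderiv _) (hk.memLp_fderiv _) ?_)
      (Prod.ext (h0 _ _ _ _ (h.memLp_fderiv _) (k.memLp_fderiv _) (hk.memLp_fderiv _) ?_)
      (Prod.ext (h0 _ _ _ _ h.memLp_y k.memLp_y hk.memLp_y ?_)
        (h0 _ _ _ _ h.memLp_diag k.memLp_diag hk.memLp_diag rfl)))) <;> ext p <;> simp [key, mul_add]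
  smul_mem' := by
    rintro c _ ⟨φ, h, rfl⟩
    refine ⟨c • φ, h.smul c, ?_⟩
    have h0 (β : Type) [MeasureSpace β] (f f'' : β → ℂ) (hf : MemLp f 2 volume)
        (hf'' : MemLp f'' 2 volume) (e : f'' = c • f) :
        hf''.toLp f'' = c • hf.toLp f := by subst e; exact MemLp.toLp_const_smul _ _
    have key (v : ℝ × ℝ) (p : ℝ × ℝ) : fderiv ℝ (c • φ) p v
        = c * fderiv ℝ φ p v := by
      rw [fderiv_const_smul (h.differentiable p)]; rfl
    have k := h.smul c
    refine Prod.ext (h0 _ _ _ h.memLp k.memLp rfl)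
      (Prod.ext (h0 _ _ _ (h.memLp_fderiv _) (k.memLp_fderiv _) ?_)
      (Prod.ext (h0 _ _ _ (h.memLp_fderiv _) (k.memLp_fderiv _) ?_)
      (Prod.ext (h0 _ _ _ h.memLp_y k.memLp_y ?_)
        (h0 _ _ _ h.memLp_diag k.memLp_diag rfl)))) <;> ext p <;> simp [key, mul_left_comm]

/-- The closure of the tuples of test functions: the form domain. -/
def formSpace : Submodule ℂ TupleSpace := testSpace.topologicalClosure

/-- The tuple of an element of the form domain. -/
def FormElement.tuple (U : FormElement) : TupleSpace := (U.fn, U.dx, U.dy, U.yfn, U.tr)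

theorem testTuple_mem (φ : ℝ × ℝ → ℂ) (h : IsTest φ) : testTuple φ h ∈ formSpace :=
  Submodule.le_topologicalClosure _ ⟨φ, h, rfl⟩

theorem mem_formSpace_of_tendsto {φ : ℕ → ℝ × ℝ → ℂ} (h : ∀ n, IsTest (φ n)) {ξ : TupleSpace}
    (h0 : Tendsto (fun n => eLpNorm (fun p => φ n p - ξ.1 p) 2 volume) atTop (𝓝 0))
    (h1 : Tendsto (fun n => eLpNorm (fun p => fderiv ℝ (φ n) p (1, 0) - ξ.2.1 p) 2 volume)
      atTop (𝓝 0))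
    (h2 : Tendsto (fun n => eLpNorm (fun p => fderiv ℝ (φ n) p (0, 1) - ξ.2.2.1 p) 2 volume)
      atTop (𝓝 0))
    (h3 : Tendsto (fun n => eLpNorm (fun p => (p.2 : ℂ) * φ n p - ξ.2.2.2.1 p) 2 volume)
      atTop (𝓝 0))
    (h4 : Tendsto (fun n => eLpNorm (fun x : ℝ => φ n (x, x) - ξ.2.2.2.2 x) 2 volume)
      atTop (𝓝 0)) : ξ ∈ formSpace := by
  have key {β : Type} [MeasureSpace β] (f : ℕ → β → ℂ) (hf : ∀ n, MemLp (f n) 2 volume)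
      (g : Lp ℂ 2 (volume : Measure β))
      (h : Tendsto (fun n => eLpNorm (fun p => f n p - g p) 2 volume) atTop (𝓝 0)) :
      Tendsto (fun n => (hf n).toLp (f n)) atTop (𝓝 g) := by
    rw [Lp.tendsto_Lp_iff_tendsto_eLpNorm']
    refine h.congr fun n => eLpNorm_congr_ae ?_
    filter_upwards [(hf n).coeFn_toLp] with p hp
    simp [hp]
  refine mem_closure_of_tendsto (f := fun n => testTuple (φ n) (h n)) (b := atTop) ?_
    (Eventually.of_forall fun n => ⟨φ n, h n, rfl⟩)
  exact (key _ (fun n => (h n).memLp) _ h0).prodMk_nhds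
    ((key _ (fun n => (h n).memLp_fderiv _) _ h1).prodMk_nhds
    ((key _ (fun n => (h n).memLp_fderiv _) _ h2).prodMk_nhds
    ((key _ (fun n => (h n).memLp_y) _ h3).prodMk_nhds (key _ (fun n => (h n).memLp_diag) _ h4))))

theorem exists_tendsto_of_mem_formSpace {ξ : TupleSpace} (hξ : ξ ∈ formSpace) :
    ∃ φ : ℕ → ℝ × ℝ → ℂ, ∃ h : ∀ n, IsTest (φ n),
      Tendsto (fun n => testTuple (φ n) (h n)) atTop (𝓝 ξ) := by
  obtain ⟨η, hη, hl⟩ := mem_closure_iff_seq_limit.1 hξ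
  choose φ h e using hη
  exact ⟨φ, h, by simpa only [e] using hl⟩

/-- Integration by parts for test functions. -/
theorem IsTest.integral_mul_fderiv {φ ψ : ℝ × ℝ → ℂ} (h : IsTest φ) (k : IsTest ψ) (v : ℝ × ℝ) :
    ∫ p, φ p * fderiv ℝ ψ p v = - ∫ p, fderiv ℝ φ p v * ψ p :=
  integral_mul_fderiv_eq_neg_fderiv_mul_of_integrable
    ((h.memLp_fderiv v).integrable_mul k.memLp) (h.memLp.integrable_mul (k.memLp_fderiv v))
    (h.memLp.integrable_mul k.memLp) (fun x _ => h.differentiable x)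
    (fun x _ => k.differentiable x)

/-- Integral of a product as an inner product. -/
theorem integral_mul_eq_inner {β : Type*} [MeasurableSpace β] {μ : Measure β} (u : Lp ℂ 2 μ)
    {φ : β → ℂ} (hφ : MemLp (fun p => starRingEnd ℂ (φ p)) 2 μ) :
    ∫ p, u p * φ p ∂μ = inner ℂ (hφ.toLp _) u := by
  rw [L2.inner_def]
  refine integral_congr_ae ?_
  filter_upwards [hφ.coeFn_toLp] with p hp
  simp [hp]

theorem memLp_conj {β : Type*} [MeasurableSpace β] {μ : Measure β} {φ : β → ℂ}
    (hφ : MemLp φ 2 μ) : MemLp (fun p => starRingEnd ℂ (φ p)) 2 μ :=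
  hφ.star

theorem hasWeakDeriv_of_tendsto {v : ℝ × ℝ} {φ : ℕ → ℝ × ℝ → ℂ} (h : ∀ n, IsTest (φ n))
    {u g : L2Plane} (hu : Tendsto (fun n => (h n).memLp.toLp (φ n)) atTop (𝓝 u))
    (hg : Tendsto (fun n => ((h n).memLp_fderiv v).toLp _) atTop (𝓝 g)) :
    HasWeakDeriv v u g := by
  intro ψ hψ
  rw [integral_mul_eq_inner u (memLp_conj (hψ.memLp_fderiv v)),
    integral_mul_eq_inner g (memLp_conj hψ.memLp)]
  refine tendsto_nhds_unique (tendsto_const_nhds.inner hu) ?_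
  refine (tendsto_const_nhds.inner hg).neg.congr fun n => ?_
  rw [← integral_mul_eq_inner _ (memLp_conj (hψ.memLp_fderiv v)),
    ← integral_mul_eq_inner _ (memLp_conj hψ.memLp)]
  have := (h n).integral_mul_fderiv hψ v
  rw [neg_eq_iff_eq_neg]
  calc _ = ∫ p, fderiv ℝ (φ n) p v * ψ p := by
        refine integral_congr_ae ?_
        filter_upwards [((h n).memLp_fderiv v).coeFn_toLp] with p hp
        rw [hp]
    _ = - ∫ p, φ n p * fderiv ℝ ψ p v := by rw [this, neg_neg]
    _ = _ := by
        congr 1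
        refine integral_congr_ae ?_
        filter_upwards [(h n).memLp.coeFn_toLp] with p hp
        rw [hp]

/-- Weak derivatives survive `L²` limits because they are pairings with fixed test functions. The
relation between `u` and `yu` is pointwise and is recovered along almost everywhere convergent
subsequences. -/
theorem exists_formElement_of_mem {ξ : TupleSpace} (hξ : ξ ∈ formSpace) :
    ∃ U : FormElement, U.tuple = ξ := by
  obtain ⟨φ, h, hl⟩ := exists_tendsto_of_mem_formSpace hξ
  have l0 := (continuous_fst.tendsto ξ).comp hl
  have l1 := ((continuous_fst.comp continuous_snd).tendsto ξ).comp hl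
  have l2 := ((continuous_fst.comp (continuous_snd.comp continuous_snd)).tendsto ξ).comp hl
  have l3 := ((continuous_fst.comp (continuous_snd.comp (continuous_snd.comp
    continuous_snd))).tendsto ξ).comp hl
  have l4 := ((continuous_snd.comp (continuous_snd.comp (continuous_snd.comp
    continuous_snd))).tendsto ξ).comp hl
  have key {β : Type} [MeasureSpace β] (f : ℕ → β → ℂ) (hf : ∀ n, MemLp (f n) 2 volume)
      (g : Lp ℂ 2 (volume : Measure β))
      (h : Tendsto (fun n => (hf n).toLp (f n)) atTop (𝓝 g)) :
      Tendsto (fun n => eLpNorm (fun p => f n p - g p) 2 volume) atTop (𝓝 0) := by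
    rw [Lp.tendsto_Lp_iff_tendsto_eLpNorm'] at h
    refine h.congr fun n => eLpNorm_congr_ae ?_
    filter_upwards [(hf n).coeFn_toLp] with p hp
    simp [hp]
  refine ⟨⟨ξ.1, ξ.2.1, ξ.2.2.1, ξ.2.2.2.1, ξ.2.2.2.2, hasWeakDeriv_of_tendsto h l0 l1,
    hasWeakDeriv_of_tendsto h l0 l2, ?_, φ, h, key _ (fun n => (h n).memLp) _ l0,
    key _ (fun n => (h n).memLp_fderiv _) _ l1, key _ (fun n => (h n).memLp_fderiv _) _ l2,
    key _ (fun n => (h n).memLp_diag) _ l4⟩, rfl⟩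
  -- The second subsequence is extracted from the first, so that both components converge at the
  -- same points.
  have m0 := tendstoInMeasure_of_tendsto_eLpNorm (by simp)
    (fun n => (h n).memLp.1) (Lp.memLp ξ.1).1 (key _ (fun n => (h n).memLp) _ l0)
  obtain ⟨s, hs, hs'⟩ := m0.exists_seq_tendsto_ae
  have m3 := tendstoInMeasure_of_tendsto_eLpNorm (by simp)
    (fun n => (h (s n)).memLp_y.1) (Lp.memLp ξ.2.2.2.1).1
      ((key _ (fun n => (h n).memLp_y) _ l3).comp hs.tendsto_atTop)
  obtain ⟨r, hr, hr'⟩ := m3.exists_seq_tendsto_ae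
  filter_upwards [hs', hr'] with p h1 h2
  exact tendsto_nhds_unique h2 ((h1.comp hr.tendsto_atTop).const_mul _)


/-! ### Cutoffs: every form element is a limit of test functions -/

/-- Dilates `ρ (p / (m + 1))` of one bump function: the factor `1 / (m + 1) ≤ 1` keeps the
derivatives uniformly bounded. Near a given point the dilates are eventually constant, so the
derivatives there vanish eventually. -/
theorem exists_cutoff : ∃ (c : ℕ → ℝ × ℝ → ℝ) (B : ℝ), 0 ≤ B ∧
    (∀ m, ContDiff ℝ ((⊤ : ℕ∞) : WithTop ℕ∞) (c m)) ∧ (∀ m, HasCompactSupport (c m)) ∧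
    (∀ m p, |c m p| ≤ 1) ∧ (∀ m p v, ‖v‖ ≤ 1 → |fderiv ℝ (c m) p v| ≤ B) ∧
    (∀ p, ∀ᶠ m in atTop, c m p = 1) ∧ (∀ p v, ∀ᶠ m in atTop, fderiv ℝ (c m) p v = 0) := by
  let ρ : ContDiffBump (0 : ℝ × ℝ) := ⟨1, 2, one_pos, one_lt_two⟩
  have hρ : ContDiff ℝ ((⊤ : ℕ∞) : WithTop ℕ∞) ρ := ρ.contDiff
  obtain ⟨B, hB⟩ := (ρ.hasCompactSupport.fderiv ℝ).exists_bound_of_continuous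
    (hρ.continuous_fderiv (by simp))
  have hpos (m : ℕ) : (0 : ℝ) < m + 1 := by positivity
  have hsm (m : ℕ) : ContDiff ℝ ((⊤ : ℕ∞) : WithTop ℕ∞)
      (fun p : ℝ × ℝ => ρ (((m : ℝ) + 1)⁻¹ • p)) := hρ.comp (contDiff_const_smul _)
  have h1 (p : ℝ × ℝ) : ∀ᶠ m : ℕ in atTop,
      (fun q : ℝ × ℝ => ρ (((m : ℝ) + 1)⁻¹ • q)) =ᶠ[𝓝 p] fun _ => 1 := by
    filter_upwards [eventually_ge_atTop ⌈‖p‖⌉₊] with m hm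
    have hlt : ‖p‖ < m + 1 := lt_of_le_of_lt (Nat.le_of_ceil_le hm) (by linarith)
    filter_upwards [(continuous_norm.tendsto p).eventually (gt_mem_nhds hlt)] with q hq
    refine ρ.one_of_mem_closedBall ?_
    rw [mem_closedBall_zero_iff, norm_smul, norm_inv, Real.norm_of_nonneg (hpos m).le]
    rw [inv_mul_le_iff₀ (hpos m)]
    simpa [ρ] using hq.le
  refine ⟨fun m p => ρ (((m : ℝ) + 1)⁻¹ • p), B, (norm_nonneg _).trans (hB 0), hsm, fun m => ?_,
    fun m p => ?_, fun m p v hv => ?_, fun p => ?_, fun p v => ?_⟩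
  · exact ρ.hasCompactSupport.comp_smul (inv_ne_zero (hpos m).ne')
  · rw [abs_of_nonneg ρ.nonneg]; exact ρ.le_one
  · rw [fderiv_comp_smul, ← Real.norm_eq_abs]
    refine (ContinuousLinearMap.le_opNorm _ _).trans ?_
    rw [norm_smul]
    have h2 : ‖((m : ℝ) + 1)⁻¹‖ ≤ 1 := by
      rw [norm_inv, Real.norm_of_nonneg (hpos m).le]
      exact inv_le_one_of_one_le₀ (by linarith [Nat.cast_nonneg (α := ℝ) m])
    have h3 := hB (((m : ℝ) + 1)⁻¹ • p)
    have hB0 : 0 ≤ B := (norm_nonneg _).trans h3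
    calc _ ≤ 1 * B * 1 := by gcongr
      _ = B := by ring
  · filter_upwards [h1 p] with m hm using hm.eq_of_nhds
  · filter_upwards [h1 p] with m hm
    rw [hm.fderiv_eq]; simp

theorem fderiv_real_mul {φ : ℝ × ℝ → ℂ} {c : ℝ × ℝ → ℝ} {p : ℝ × ℝ} (hφ : DifferentiableAt ℝ φ p)
    (hc : DifferentiableAt ℝ c p) (v : ℝ × ℝ) :
    fderiv ℝ (fun p => (c p : ℂ) * φ p) p v
      = (c p : ℂ) * fderiv ℝ φ p v + (fderiv ℝ c p v : ℂ) * φ p := by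
  have h1 : HasFDerivAt (fun p => (c p : ℂ)) (Complex.ofRealCLM.comp (fderiv ℝ c p)) p :=
    Complex.ofRealCLM.hasFDerivAt.comp p hc.hasFDerivAt
  have h2 : HasFDerivAt (fun p => (c p : ℂ) * φ p) _ p := h1.mul hφ.hasFDerivAt
  rw [h2.fderiv]
  simp [mul_comm]

/-- The term `d g` is the Leibniz term in which the derivative falls on the cutoff; it disappears by
dominated convergence. -/
theorem tendsto_cutoff_mul {β : Type*} [MeasurableSpace β] {μ : Measure β} (c d : ℕ → β → ℝ)
    (B : ℝ) (mc : ∀ m, Measurable (c m)) (md : ∀ m, Measurable (d m))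
    (hc : ∀ m p, |c m p| ≤ 1) (hd : ∀ m p, |d m p| ≤ B)
    (lc : ∀ p, ∀ᶠ m in atTop, c m p = 1) (ld : ∀ p, ∀ᶠ m in atTop, d m p = 0) (f g : Lp ℂ 2 μ)
    (ζ : ℕ → Lp ℂ 2 μ) (hζ : ∀ m, ∀ᵐ p ∂μ, ζ m p = (c m p : ℂ) * f p + (d m p : ℂ) * g p) :
    Tendsto ζ atTop (𝓝 f) := by
  rw [Lp.tendsto_Lp_iff_tendsto_eLpNorm']
  have := tendsto_eLpNorm_two_of_dominated (μ := μ)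
    (F := fun m p => (c m p : ℂ) * f p + (d m p : ℂ) * g p) (f := f)
    (g := fun p => 2 * ‖f p‖ + B * ‖g p‖) ?_ (Lp.memLp f).1 ?_ ?_ ?_
  · refine this.congr fun m => eLpNorm_congr_ae ?_
    filter_upwards [hζ m] with p hp
    simp [hp]
  · intro m
    exact ((Complex.measurable_ofReal.comp (mc m)).aestronglyMeasurable.mul (Lp.memLp f).1).add
      ((Complex.measurable_ofReal.comp (md m)).aestronglyMeasurable.mul (Lp.memLp g).1)
  · exact ((Lp.memLp f).norm.const_mul 2).add ((Lp.memLp g).norm.const_mul B)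
  · intro m
    filter_upwards with p
    have e : (c m p : ℂ) * f p + (d m p : ℂ) * g p - f p
        = ((c m p - 1 : ℝ) : ℂ) * f p + (d m p : ℂ) * g p := by push_cast; ring
    rw [e]
    refine (norm_add_le _ _).trans ?_
    rw [norm_mul, norm_mul, Complex.norm_real, Complex.norm_real]
    gcongr
    · rw [Real.norm_eq_abs]
      refine (abs_sub _ _).trans ?_
      rw [abs_one]; linarith [hc m p]
    · exact hd m p
  · filter_upwards with p
    refine tendsto_const_nhds.congr' ?_
    filter_upwards [lc p, ld p] with m h1 h2
    simp [h1, h2]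

/-- As the form domain is closed, it is enough to place all truncations in it. -/
theorem mem_formSpace_of_cutoff {c : ℕ → ℝ × ℝ → ℝ} {B : ℝ}
    (hsm : ∀ m, ContDiff ℝ ((⊤ : ℕ∞) : WithTop ℕ∞) (c m))
    (hc : ∀ m p, |c m p| ≤ 1) (hd : ∀ m p v, ‖v‖ ≤ 1 → |fderiv ℝ (c m) p v| ≤ B)
    (lc : ∀ p, ∀ᶠ m in atTop, c m p = 1) (ld : ∀ p v, ∀ᶠ m in atTop, fderiv ℝ (c m) p v = 0)
    {ξ : TupleSpace} {ζ : ℕ → TupleSpace} (hζ : ∀ m, ζ m ∈ formSpace)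
    (h0 : ∀ m, ∀ᵐ p, (ζ m).1 p = (c m p : ℂ) * ξ.1 p)
    (h1 : ∀ m, ∀ᵐ p, (ζ m).2.1 p = (c m p : ℂ) * ξ.2.1 p + (fderiv ℝ (c m) p (1, 0) : ℂ) * ξ.1 p)
    (h2 : ∀ m, ∀ᵐ p, (ζ m).2.2.1 p
      = (c m p : ℂ) * ξ.2.2.1 p + (fderiv ℝ (c m) p (0, 1) : ℂ) * ξ.1 p)
    (h3 : ∀ m, ∀ᵐ p, (ζ m).2.2.2.1 p = (c m p : ℂ) * ξ.2.2.2.1 p)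
    (h4 : ∀ m, ∀ᵐ x, (ζ m).2.2.2.2 x = (c m (x, x) : ℂ) * ξ.2.2.2.2 x) : ξ ∈ formSpace := by
  have mc (m : ℕ) : Measurable (c m) := (hsm m).continuous.measurable
  have md (m : ℕ) (v : ℝ × ℝ) : Measurable (fun p => fderiv ℝ (c m) p v) :=
    (((hsm m).continuous_fderiv (by simp)).clm_apply continuous_const).measurable
  have n1 : ‖((1 : ℝ), (0 : ℝ))‖ ≤ 1 := by simp
  have n2 : ‖((0 : ℝ), (1 : ℝ))‖ ≤ 1 := by simp
  have t0 : Tendsto (fun m => (ζ m).1) atTop (𝓝 ξ.1) :=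
    tendsto_cutoff_mul c (fun _ _ => 0) 0 mc (fun _ => measurable_const) hc (by simp) lc (by simp)
      _ ξ.1 _ (fun m => by filter_upwards [h0 m] with p hp; simp [hp])
  have t1 : Tendsto (fun m => (ζ m).2.1) atTop (𝓝 ξ.2.1) :=
    tendsto_cutoff_mul c (fun m p => fderiv ℝ (c m) p (1, 0)) B mc (fun m => md m _) hc
      (fun m p => hd m p _ n1) lc (fun p => ld p _) _ ξ.1 _ h1
  have t2 : Tendsto (fun m => (ζ m).2.2.1) atTop (𝓝 ξ.2.2.1) :=
    tendsto_cutoff_mul c (fun m p => fderiv ℝ (c m) p (0, 1)) B mc (fun m => md m _) hc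
      (fun m p => hd m p _ n2) lc (fun p => ld p _) _ ξ.1 _ h2
  have t3 : Tendsto (fun m => (ζ m).2.2.2.1) atTop (𝓝 ξ.2.2.2.1) :=
    tendsto_cutoff_mul c (fun _ _ => 0) 0 mc (fun _ => measurable_const) hc (by simp) lc (by simp)
      _ ξ.1 _ (fun m => by filter_upwards [h3 m] with p hp; simp [hp])
  have t4 : Tendsto (fun m => (ζ m).2.2.2.2) atTop (𝓝 ξ.2.2.2.2) :=
    tendsto_cutoff_mul (fun m x => c m (x, x)) (fun _ _ => 0) 0
      (fun m => (mc m).comp (by fun_prop)) (fun _ => measurable_const) (fun m x => hc m _) (by simp)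
      (fun x => lc _) (by simp) _ ξ.2.2.2.2 _
      (fun m => by filter_upwards [h4 m] with p hp; simp [hp])
  exact (Submodule.isClosed_topologicalClosure testSpace).mem_of_tendsto
    (t0.prodMk_nhds (t1.prodMk_nhds (t2.prodMk_nhds (t3.prodMk_nhds t4))))
    (Eventually.of_forall hζ)

/-- A smooth function, square integrable together with its derivatives, its product with `y` and
its restriction to the diagonal, belongs to the form domain. -/
theorem mem_formSpace_of_smooth {f : ℝ × ℝ → ℂ} (hf : ContDiff ℝ ((⊤ : ℕ∞) : WithTop ℕ∞) f)
    {ξ : TupleSpace} (h0 : ∀ᵐ p, ξ.1 p = f p) (h1 : ∀ᵐ p, ξ.2.1 p = fderiv ℝ f p (1, 0))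
    (h2 : ∀ᵐ p, ξ.2.2.1 p = fderiv ℝ f p (0, 1)) (h3 : ∀ᵐ p, ξ.2.2.2.1 p = (p.2 : ℂ) * f p)
    (h4 : ∀ᵐ x, ξ.2.2.2.2 x = f (x, x)) : ξ ∈ formSpace := by
  obtain ⟨c, B, hB, hsm, hsupp, hc, hd, lc, ld⟩ := exists_cutoff
  have hT (m : ℕ) : IsTest (fun p => (c m p : ℂ) * f p) :=
    ⟨(Complex.ofRealCLM.contDiff.comp (hsm m)).mul hf,
      ((hsupp m).comp_left Complex.ofReal_zero).mul_right⟩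
  have hfd := hf.differentiable (by simp)
  have hcd (m : ℕ) := (hsm m).differentiable (by simp)
  refine mem_formSpace_of_cutoff hsm hc hd lc ld
    (ζ := fun m => testTuple _ (hT m)) (fun m => testTuple_mem _ _) ?_ ?_ ?_ ?_ ?_
  · intro m
    filter_upwards [(hT m).memLp.coeFn_toLp, h0] with p hp e
    rw [e]; exact hp
  · intro m
    filter_upwards [((hT m).memLp_fderiv (1, 0)).coeFn_toLp, h0, h1] with p hp e e1
    rw [e, e1, ← fderiv_real_mul (hfd p) (hcd m p)]; exact hp
  · intro m
    filter_upwards [((hT m).memLp_fderiv (0, 1)).coeFn_toLp, h0, h2] with p hp e e1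
    rw [e, e1, ← fderiv_real_mul (hfd p) (hcd m p)]; exact hp
  · intro m
    filter_upwards [(hT m).memLp_y.coeFn_toLp, h3] with p hp e
    rw [e, mul_left_comm]; exact hp
  · intro m
    filter_upwards [(hT m).memLp_diag.coeFn_toLp, h4] with p hp e
    rw [e]; exact hp

theorem tendsto_eLpNorm_comb {β : Type*} [MeasurableSpace β] {μ : Measure β} {c d : β → ℝ}
    {C D : ℝ} (mc : Measurable c) (md : Measurable d)
    (hc : ∀ p, |c p| ≤ C) (hd : ∀ p, |d p| ≤ D) {a b : ℕ → β → ℂ} {f g F : Lp ℂ 2 μ}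
    (ha : ∀ n, MemLp (a n) 2 μ) (hb : ∀ n, MemLp (b n) 2 μ)
    (hF : ∀ᵐ p ∂μ, F p = (c p : ℂ) * f p + (d p : ℂ) * g p)
    (la : Tendsto (fun n => eLpNorm (fun p => a n p - f p) 2 μ) atTop (𝓝 0))
    (lb : Tendsto (fun n => eLpNorm (fun p => b n p - g p) 2 μ) atTop (𝓝 0)) :
    Tendsto (fun n => eLpNorm (fun p => (c p : ℂ) * a n p + (d p : ℂ) * b n p - F p) 2 μ)
      atTop (𝓝 0) := by
  have t := (ENNReal.Tendsto.const_mul (a := ENNReal.ofReal C) la (Or.inr (by simp))).add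
    (ENNReal.Tendsto.const_mul (a := ENNReal.ofReal D) lb (Or.inr (by simp)))
  rw [mul_zero, mul_zero, add_zero] at t
  refine tendsto_of_tendsto_of_tendsto_of_le_of_le tendsto_const_nhds t (fun _ => zero_le)
    fun n => ?_
  have e : eLpNorm (fun p => (c p : ℂ) * a n p + (d p : ℂ) * b n p - F p) 2 μ
      = eLpNorm ((fun p => (c p : ℂ) * (a n p - f p)) + fun p => (d p : ℂ) * (b n p - g p)) 2 μ := by
    refine eLpNorm_congr_ae ?_
    filter_upwards [hF] with p hp
    simp only [hp, Pi.add_apply]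
    ring
  rw [e]
  have m1 := ((ha n).sub (Lp.memLp f)).1
  have m2 := ((hb n).sub (Lp.memLp g)).1
  refine (eLpNorm_add_le
    ((Complex.measurable_ofReal.comp mc).aestronglyMeasurable.mul m1)
    ((Complex.measurable_ofReal.comp md).aestronglyMeasurable.mul m2) (by norm_num)).trans ?_
  gcongr
  · refine eLpNorm_le_mul_eLpNorm_of_ae_le_mul (Eventually.of_forall fun p => ?_) _
    simp only [Pi.mul_apply, Pi.sub_apply, Function.comp_apply, norm_mul, Complex.norm_real]
    gcongr
    exact hc p
  · refine eLpNorm_le_mul_eLpNorm_of_ae_le_mul (Eventually.of_forall fun p => ?_) _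
    simp only [Pi.mul_apply, Pi.sub_apply, Function.comp_apply, norm_mul, Complex.norm_real]
    gcongr
    exact hd p

theorem exists_bound_abs {f : ℝ × ℝ → ℝ} (hf : Continuous f) (h : HasCompactSupport f) :
    ∃ C, ∀ p, |f p| ≤ C := h.exists_bound_of_continuous hf

theorem memLp_real_mul {β : Type*} [MeasurableSpace β] {μ : Measure β} {c : β → ℝ} {C : ℝ}
    (mc : Measurable c) (hc : ∀ p, |c p| ≤ C) {f : β → ℂ} (hf : MemLp f 2 μ) :
    MemLp (fun p => (c p : ℂ) * f p) 2 μ := by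
  refine MemLp.of_le_mul (c := C) hf
    ((Complex.measurable_ofReal.comp mc).aestronglyMeasurable.mul hf.1)
    (Eventually.of_forall fun p => ?_)
  rw [norm_mul, Complex.norm_real]
  gcongr
  exact hc p

/-- The sequence defining the trace converges in `H¹` and along the diagonal, with no control of `y
φ_n`. On the support of a cutoff the factor `y` is bounded, so the truncated sequence converges in
all five components; the cutoff is then removed. -/
theorem FormElement.tuple_mem (V : FormElement) : V.tuple ∈ formSpace := by
  obtain ⟨c, B, hB, hsm, hsupp, hc, hd, lc, ld⟩ := exists_cutoff
  obtain ⟨φ, hφ, l0, l1, l2, l4⟩ := V.hasDiagTrace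
  have mc (m : ℕ) : Measurable (c m) := (hsm m).continuous.measurable
  have cd (m : ℕ) (v : ℝ × ℝ) : Continuous (fun p => fderiv ℝ (c m) p v) :=
    ((hsm m).continuous_fderiv (by simp)).clm_apply continuous_const
  have hdv (m : ℕ) (v : ℝ × ℝ) : ∃ C, ∀ p, |fderiv ℝ (c m) p v| ≤ C :=
    exists_bound_abs (cd m v) ((hsupp m).fderiv_apply ℝ v)
  have hy (m : ℕ) : ∃ C, ∀ p : ℝ × ℝ, |p.2 * c m p| ≤ C :=
    exists_bound_abs (continuous_snd.mul (hsm m).continuous) ((hsupp m).mul_left)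
  have hcd (m : ℕ) := (hsm m).differentiable (by simp)
  have k1 (m : ℕ) (v : ℝ × ℝ) (f : L2Plane) :
      MemLp (fun p => (fderiv ℝ (c m) p v : ℂ) * f p) 2 volume :=
    memLp_real_mul (cd m v).measurable (hdv m v).choose_spec (Lp.memLp f)
  have k0 (m : ℕ) (f : L2Plane) : MemLp (fun p => (c m p : ℂ) * f p) 2 volume :=
    memLp_real_mul (mc m) (hc m) (Lp.memLp f)
  have k4 (m : ℕ) : MemLp (fun x => (c m (x, x) : ℂ) * V.tr x) 2 volume :=
    memLp_real_mul ((mc m).comp (by fun_prop : Measurable fun x : ℝ => (x, x)))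
      (fun x => hc m (x, x)) (Lp.memLp V.tr)
  let ζ (m : ℕ) : TupleSpace := ((k0 m V.fn).toLp _,
    ((k0 m V.dx).add (k1 m (1, 0) V.fn)).toLp _, ((k0 m V.dy).add (k1 m (0, 1) V.fn)).toLp _,
    (k0 m V.yfn).toLp _, (k4 m).toLp _)
  have e0 (m : ℕ) : ∀ᵐ p, (ζ m).1 p = (c m p : ℂ) * V.fn p := (k0 m V.fn).coeFn_toLp
  have e1 (m : ℕ) : ∀ᵐ p, (ζ m).2.1 p
      = (c m p : ℂ) * V.dx p + (fderiv ℝ (c m) p (1, 0) : ℂ) * V.fn p :=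
    ((k0 m V.dx).add (k1 m (1, 0) V.fn)).coeFn_toLp
  have e2 (m : ℕ) : ∀ᵐ p, (ζ m).2.2.1 p
      = (c m p : ℂ) * V.dy p + (fderiv ℝ (c m) p (0, 1) : ℂ) * V.fn p :=
    ((k0 m V.dy).add (k1 m (0, 1) V.fn)).coeFn_toLp
  have e3 (m : ℕ) : ∀ᵐ p, (ζ m).2.2.2.1 p = (c m p : ℂ) * V.yfn p := (k0 m V.yfn).coeFn_toLp
  have e4 (m : ℕ) : ∀ᵐ x, (ζ m).2.2.2.2 x = (c m (x, x) : ℂ) * V.tr x := (k4 m).coeFn_toLp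
  refine mem_formSpace_of_cutoff hsm hc hd lc ld (ζ := ζ) (fun m => ?_) e0 e1 e2 e3 e4
  have z0 {β : Type} (C : ℝ) (h : 0 ≤ C) (p : β) : |(fun _ : β => (0 : ℝ)) p| ≤ C := by simpa
  refine mem_formSpace_of_tendsto (fun n => (hφ n).mul_real (hsm m)) ?_ ?_ ?_ ?_ ?_
  · have := tendsto_eLpNorm_comb (d := fun _ => 0) (mc m) measurable_const (hc m)
      (z0 0 le_rfl) (fun n => (hφ n).memLp) (fun n => (hφ n).memLp) (F := (ζ m).1)
      (by filter_upwards [e0 m] with p hp; simp [hp]) l0 l0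
    simpa using this
  · have := tendsto_eLpNorm_comb (mc m) (cd m (1, 0)).measurable (hc m)
      (hdv m (1, 0)).choose_spec (fun n => (hφ n).memLp_fderiv (1, 0)) (fun n => (hφ n).memLp)
      (e1 m) l1 l0
    refine this.congr fun n => ?_
    simp_rw [fderiv_real_mul ((hφ n).differentiable _) (hcd m _)]
  · have := tendsto_eLpNorm_comb (mc m) (cd m (0, 1)).measurable (hc m)
      (hdv m (0, 1)).choose_spec (fun n => (hφ n).memLp_fderiv (0, 1)) (fun n => (hφ n).memLp)
      (e2 m) l2 l0
    refine this.congr fun n => ?_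
    simp_rw [fderiv_real_mul ((hφ n).differentiable _) (hcd m _)]
  · have := tendsto_eLpNorm_comb (c := fun p => p.2 * c m p) (d := fun _ => 0)
      (measurable_snd.mul (mc m)) measurable_const
      (hy m).choose_spec (z0 0 le_rfl) (fun n => (hφ n).memLp) (fun n => (hφ n).memLp)
      (F := (ζ m).2.2.2.1)
      (by filter_upwards [e3 m, V.yfn_ae] with p hp h; simp [hp, h]; ring) l0 l0
    refine this.congr fun n => ?_
    congr 1; ext p; push_cast; ring
  · have := tendsto_eLpNorm_comb (c := fun x => c m (x, x)) (d := fun _ => 0)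
      ((mc m).comp (by fun_prop : Measurable fun x : ℝ => (x, x))) measurable_const
      (fun x => hc m (x, x)) (z0 0 le_rfl) (fun n => (hφ n).memLp_diag)
      (fun n => (hφ n).memLp_diag) (F := (ζ m).2.2.2.2)
      (by filter_upwards [e4 m] with p hp; simp [hp]) l4 l4
    simpa using this

/-! ### Nonnegativity of the free form and absence of bound states for `α ≥ 0` -/

/-- The form on tuples. -/
def tupleForm (ω α : ℝ) (η ξ : TupleSpace) : ℂ :=
  (1 / 2 : ℂ) * inner ℂ η.2.1 ξ.2.1 + (1 / 2 : ℂ) * inner ℂ η.2.2.1 ξ.2.2.1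
    + ((ω ^ 2 / 2 : ℝ) : ℂ) * inner ℂ η.2.2.2.1 ξ.2.2.2.1 - ((ω / 2 : ℝ) : ℂ) * inner ℂ η.1 ξ.1
    + (α : ℂ) * inner ℂ η.2.2.2.2 ξ.2.2.2.2

theorem form_eq_tupleForm (ω α : ℝ) (V U : FormElement) :
    form ω α V U = tupleForm ω α V.tuple U.tuple := rfl

/-- The inequality of the harmonic oscillator for test functions. -/
theorem oscillator_test {φ : ℝ × ℝ → ℂ} (h : IsTest φ) (ω : ℝ) :
    ω * ‖h.memLp.toLp φ‖ ^ 2 ≤ ‖(h.memLp_fderiv (0, 1)).toLp _‖ ^ 2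
      + ω ^ 2 * ‖h.memLp_y.toLp _‖ ^ 2 := by
  set f := h.memLp.toLp φ
  set g := (h.memLp_fderiv (0, 1)).toLp _
  set k := h.memLp_y.toLp _
  have hconj : IsTest (fun p => starRingEnd ℂ (φ p)) :=
    ⟨Complex.conjCLE.contDiff.comp h.smooth, h.compact.comp_left (map_zero _)⟩
  have hyc := hconj.mul_real (c := fun p => p.2) contDiff_snd
  have e := h.integral_mul_fderiv hyc (0, 1)
  have ec (p : ℝ × ℝ) : fderiv ℝ (fun p => starRingEnd ℂ (φ p)) p (0, 1)
      = starRingEnd ℂ (fderiv ℝ φ p (0, 1)) := by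
    have : HasFDerivAt (fun p => starRingEnd ℂ (φ p))
        ((Complex.conjCLE : ℂ →L[ℝ] ℂ).comp (fderiv ℝ φ p)) p :=
      (Complex.conjCLE : ℂ →L[ℝ] ℂ).hasFDerivAt.comp p (h.differentiable p).hasFDerivAt
    rw [this.fderiv]; simp
  have i1 : inner ℂ g k = ∫ p, φ p * ((p.2 : ℂ) * starRingEnd ℂ (fderiv ℝ φ p (0, 1))) := by
    rw [L2.inner_def]
    refine integral_congr_ae ?_
    filter_upwards [(h.memLp_fderiv (0, 1)).coeFn_toLp, h.memLp_y.coeFn_toLp] with p h1 h2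
    rw [h1, h2]; simp; ring
  have i2 : inner ℂ f f = ∫ p, φ p * starRingEnd ℂ (φ p) := by
    rw [L2.inner_def]
    refine integral_congr_ae ?_
    filter_upwards [h.memLp.coeFn_toLp] with p h1
    rw [h1, Complex.mul_conj, RCLike.inner_apply, Complex.mul_conj]
  have i3 : inner ℂ k g = ∫ p, fderiv ℝ φ p (0, 1) * ((p.2 : ℂ) * starRingEnd ℂ (φ p)) := by
    rw [L2.inner_def]
    refine integral_congr_ae ?_
    filter_upwards [(h.memLp_fderiv (0, 1)).coeFn_toLp, h.memLp_y.coeFn_toLp] with p h1 h2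
    rw [h1, h2]; simp
  -- The commutator `[∂ᵧ, y] = 1`: integrating `φ ∂ᵧ(y φ̄)` by parts gives `2 Re ⟨∂ᵧφ, yφ⟩ = -‖φ‖²`.
  have key : inner ℂ g k + inner ℂ f f = - inner ℂ k g := by
    rw [i1, i2, i3, ← e, ← integral_add]
    · refine integral_congr_ae (Eventually.of_forall fun p => ?_)
      have hs : fderiv ℝ (fun p : ℝ × ℝ => p.2) p (0, 1) = 1 := by
        rw [fderiv_snd]; simp
      simp only
      rw [fderiv_real_mul (hconj.differentiable p) differentiableAt_snd, ec, hs]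
      push_cast; ring
    · have := h.memLp_y.integrable_mul (memLp_conj (h.memLp_fderiv (0, 1)))
      refine this.congr (Eventually.of_forall fun p => ?_)
      simp only [Pi.mul_apply]; ring
    · exact h.memLp.integrable_mul (memLp_conj h.memLp)
  have key2 := congrArg Complex.re key
  have sym : (inner ℂ k g).re = (inner ℂ g k).re := inner_re_symm (𝕜 := ℂ) k g
  have hn : (inner ℂ f f).re = ‖f‖ ^ 2 := by
    rw [inner_self_eq_norm_sq_to_K]; norm_cast
  simp only [Complex.add_re, Complex.neg_re, sym, hn] at key2
  -- The square of the annihilation operator, `‖∂ᵧφ + ω y φ‖² ≥ 0`, is the claim once the cross term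
  -- is known.
  have hsq := sq_nonneg ‖g + (ω : ℂ) • k‖
  rw [@norm_add_sq ℂ, inner_smul_right, norm_smul] at hsq
  simp only [Complex.norm_real, RCLike.re_to_complex, Complex.re_ofReal_mul, mul_pow,
    Real.norm_eq_abs, sq_abs] at hsq
  have ha : (inner ℂ g k).re = - (‖f‖ ^ 2 / 2) := by linarith
  rw [ha] at hsq
  linarith

/-- The lower bound `ω` of `-∂ᵧ² + ω² y²`, carried from test functions to the closure by continuity.
The shift `-ω/2` in the form uses it up exactly. -/
theorem tupleForm_self_nonneg {ω : ℝ} {ξ : TupleSpace} (hξ : ξ ∈ formSpace) :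
    ω * ‖ξ.1‖ ^ 2 ≤ ‖ξ.2.2.1‖ ^ 2 + ω ^ 2 * ‖ξ.2.2.2.1‖ ^ 2 := by
  obtain ⟨φ, h, hl⟩ := exists_tendsto_of_mem_formSpace hξ
  have c1 : Continuous fun ξ : TupleSpace => ω * ‖ξ.1‖ ^ 2 := by fun_prop
  have c2 : Continuous fun ξ : TupleSpace => ‖ξ.2.2.1‖ ^ 2 + ω ^ 2 * ‖ξ.2.2.2.1‖ ^ 2 := by fun_prop
  exact le_of_tendsto_of_tendsto' ((c1.tendsto ξ).comp hl) ((c2.tendsto ξ).comp hl)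
    fun n => oscillator_test (h n) ω

theorem form_self_re (ω α : ℝ) (U : FormElement) : (form ω α U U).re
    = 1 / 2 * ‖U.dx‖ ^ 2 + 1 / 2 * (‖U.dy‖ ^ 2 + ω ^ 2 * ‖U.yfn‖ ^ 2 - ω * ‖U.fn‖ ^ 2)
      + α * ‖U.tr‖ ^ 2 := by
  simp only [form, inner_self_eq_norm_sq_to_K]
  rw [← Complex.ofReal_re (1 / 2 * ‖U.dx‖ ^ 2
    + 1 / 2 * (‖U.dy‖ ^ 2 + ω ^ 2 * ‖U.yfn‖ ^ 2 - ω * ‖U.fn‖ ^ 2) + α * ‖U.tr‖ ^ 2)]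
  congr 1
  push_cast
  simp only [Complex.coe_algebraMap]
  ring

theorem form_self_nonneg (ω : ℝ) {α : ℝ} (hα : 0 ≤ α) (U : FormElement) :
    0 ≤ (form ω α U U).re := by
  rw [form_self_re]
  have := tupleForm_self_nonneg (ω := ω) U.tuple_mem
  simp only [FormElement.tuple] at this
  have : 0 ≤ α * ‖U.tr‖ ^ 2 := by positivity
  nlinarith [sq_nonneg ‖U.dx‖]

theorem mem_eigenspace_iff {ω α e : ℝ} {u : L2Plane} : u ∈ eigenspace ω α e ↔
    ∃ U : FormElement, U.fn = u ∧ ∀ V : FormElement, form ω α V U = -(e : ℂ) * inner ℂ V.fn u := by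
  constructor
  · rintro ⟨U, hU, h⟩
    refine ⟨U, hU, fun V => ?_⟩
    rw [h V, ← inner_smul_right]
    rfl
  · rintro ⟨U, hU, h⟩
    refine ⟨U, hU, fun V => ?_⟩
    rw [h V, ← inner_smul_right]
    rfl

/-- The eigenvalue equation tested with `u` itself gives `0 ≤ -e ‖u‖²`. -/
theorem eigenspace_eq_bot_of_nonneg {ω α : ℝ} (hα : 0 ≤ α) {e : ℝ} (he : 0 < e) :
    eigenspace ω α e = ⊥ := by
  rw [Submodule.eq_bot_iff]
  intro u hu
  obtain ⟨U, hU, h⟩ := mem_eigenspace_iff.1 hu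
  have h1 := congrArg Complex.re (h U)
  have h2 := form_self_nonneg ω hα U
  rw [hU, inner_self_eq_norm_sq_to_K] at h1
  have h3 : (-(e : ℂ) * ((‖u‖ : ℝ) : ℂ) ^ 2).re = - e * ‖u‖ ^ 2 := by
    rw [← Complex.ofReal_re (- e * ‖u‖ ^ 2)]; push_cast; rfl
  replace h1 := h1.trans h3
  have : ‖u‖ ^ 2 ≤ 0 := by nlinarith
  exact norm_eq_zero.1 (by nlinarith [norm_nonneg u])


/-! ### Mehler's heat kernel, its Laplace transform and Gaussian majorants -/

/-- The normalization of the heat kernel. -/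
def heatCoef (ω τ : ℝ) : ℝ :=
  √(ω * Real.exp (ω * τ) / (4 * Real.pi ^ 2 * τ * Real.sinh (ω * τ)))

/-- The exponent of the Mehler kernel. -/
def mehlerExp (ω τ y y' : ℝ) : ℝ :=
  ω / 2 * ((Real.cosh (ω * τ) * (y ^ 2 + y' ^ 2) - 2 * y * y') / Real.sinh (ω * τ))

/-- The integral kernel of `exp (-τ H₀)`. -/
def heat (ω τ : ℝ) (p : ℝ × ℝ) (x' y' : ℝ) : ℝ :=
  heatCoef ω τ * Real.exp (-((p.1 - x') ^ 2 / (2 * τ)) - mehlerExp ω τ p.2 y')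

theorem sinh_mul_pos {ω τ : ℝ} (hω : 0 < ω) (hτ : 0 < τ) : 0 < Real.sinh (ω * τ) :=
  Real.sinh_pos_iff.2 (mul_pos hω hτ)

theorem heatCoef_pos {ω τ : ℝ} (hω : 0 < ω) (hτ : 0 < τ) : 0 < heatCoef ω τ := by
  have := sinh_mul_pos hω hτ
  exact Real.sqrt_pos.2 (by positivity)

theorem heat_pos {ω τ : ℝ} (hω : 0 < ω) (hτ : 0 < τ) (p : ℝ × ℝ) (x' y' : ℝ) :
    0 < heat ω τ p x' y' := mul_pos (heatCoef_pos hω hτ) (Real.exp_pos _)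

/-- The substitution is `ν = exp (-ω τ)`, with Jacobian `ω exp (-ω τ)` and `log (1/ν) = ω τ`. The
factor `exp (ω τ)` under the root of `heatCoef` comes from the shift `-ω/2` of the Hamiltonian. -/
theorem green_integrand {ω lam τ : ℝ} (hω : 0 < ω) (hτ : 0 < τ) (x y x' y' : ℝ) :
    1 / (√2 * Real.pi) * (ω * Real.exp (-(ω * τ)) *
    (Real.exp (-(ω * τ)) ^ (lam / ω - 1) /
      (√(1 - Real.exp (-(ω * τ)) ^ 2) * √(Real.log (1 / Real.exp (-(ω * τ))))) *
      Real.exp (-(ω / 2) * ((1 - Real.exp (-(ω * τ))) / (1 + Real.exp (-(ω * τ)))) * (y ^ 2 + y' ^ 2)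
        - ω / (2 * Real.log (1 / Real.exp (-(ω * τ)))) * (x - x') ^ 2
        - ω * Real.exp (-(ω * τ)) / (1 - Real.exp (-(ω * τ)) ^ 2) * (y - y') ^ 2)))
    = Real.exp (-(lam * τ)) * heat ω τ (x, y) x' y' := by
  have hlog : Real.log (1 / Real.exp (-(ω * τ))) = ω * τ := by
    rw [one_div, ← Real.exp_neg, neg_neg, Real.log_exp]
  rw [hlog]
  have hE : 1 < Real.exp (ω * τ) := Real.one_lt_exp_iff.2 (mul_pos hω hτ)
  have hpow : Real.exp (-(ω * τ)) * Real.exp (-(ω * τ)) ^ (lam / ω - 1)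
      = Real.exp (-(lam * τ)) := by
    rw [← Real.exp_mul, ← Real.exp_add]
    congr 1
    field_simp
    ring
  have hs := sinh_mul_pos hω hτ
  have hexp : -(ω / 2) * ((1 - Real.exp (-(ω * τ))) / (1 + Real.exp (-(ω * τ)))) * (y ^ 2 + y' ^ 2)
        - ω / (2 * (ω * τ)) * (x - x') ^ 2
        - ω * Real.exp (-(ω * τ)) / (1 - Real.exp (-(ω * τ)) ^ 2) * (y - y') ^ 2
      = -((x - x') ^ 2 / (2 * τ)) - mehlerExp ω τ y y' := by
    rw [mehlerExp, Real.sinh_eq, Real.cosh_eq, Real.exp_neg]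
    set E := Real.exp (ω * τ)
    have h0 : E ≠ 0 := by positivity
    have h1 : E - E⁻¹ ≠ 0 := by
      have : E⁻¹ < 1 := inv_lt_one_of_one_lt₀ hE
      linarith
    have h2 : E ^ 2 - 1 ≠ 0 := by nlinarith
    have h3 : E + 1 ≠ 0 := by positivity
    have h4 : 1 + E⁻¹ ≠ 0 := by positivity
    have h5 : 1 - E⁻¹ ^ 2 ≠ 0 := by
      have : 1 - E⁻¹ ^ 2 = (E ^ 2 - 1) / E ^ 2 := by field_simp
      rw [this]; positivity
    have e1 : (1 - E⁻¹) / (1 + E⁻¹) = (E - 1) ^ 2 / (E ^ 2 - 1) := by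
      rw [div_eq_div_iff h4 h2]; field_simp; ring
    have e2 : ω * E⁻¹ / (1 - E⁻¹ ^ 2) = ω * E / (E ^ 2 - 1) := by
      rw [div_eq_div_iff h5 h2]; field_simp
    have e3 : ((E + E⁻¹) / 2 * (y ^ 2 + y' ^ 2) - 2 * y * y') / ((E - E⁻¹) / 2)
        = ((E ^ 2 + 1) * (y ^ 2 + y' ^ 2) - 4 * E * y * y') / (E ^ 2 - 1) := by
      rw [div_eq_div_iff (by positivity) h2]; field_simp; ring
    rw [e1, e2, e3]
    field_simp
    ring
  have hcoef : 1 / (√2 * Real.pi) * (ω / (√(1 - Real.exp (-(ω * τ)) ^ 2) * √(ω * τ)))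
      = heatCoef ω τ := by
    have hν : Real.exp (-(ω * τ)) < 1 := Real.exp_lt_one_iff.2 (by nlinarith)
    have hν2 : 0 < 1 - Real.exp (-(ω * τ)) ^ 2 := by nlinarith [Real.exp_pos (-(ω * τ))]
    rw [heatCoef, eq_comm, Real.sqrt_eq_iff_mul_self_eq_of_pos (by positivity)]
    have : ∀ a b c : ℝ, 0 < a → 0 < b → 0 < c → 1 / (√a * Real.pi) * (ω / (√b * √c))
        * (1 / (√a * Real.pi) * (ω / (√b * √c))) = ω ^ 2 / (a * Real.pi ^ 2 * b * c) := by
      intro a b c ha hb hc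
      have e1 := Real.mul_self_sqrt ha.le
      have e2 := Real.mul_self_sqrt hb.le
      have e3 := Real.mul_self_sqrt hc.le
      have : 1 / (√a * Real.pi) * (ω / (√b * √c)) * (1 / (√a * Real.pi) * (ω / (√b * √c)))
        = ω ^ 2 / ((√a * √a) * Real.pi ^ 2 * (√b * √b) * (√c * √c)) := by
        field_simp
      rw [this, e1, e2, e3]
    rw [this _ _ _ two_pos hν2 (mul_pos hω hτ), Real.sinh_eq, Real.exp_neg]
    rw [Real.exp_neg] at hν2
    set E := Real.exp (ω * τ)
    have h0 : E ≠ 0 := by positivity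
    have h2 : E ^ 2 - 1 ≠ 0 := by nlinarith
    have h5 : 1 - E⁻¹ ^ 2 = (E ^ 2 - 1) / E ^ 2 := by field_simp
    have h6 : (E - E⁻¹) / 2 = (E ^ 2 - 1) / (2 * E) := by field_simp
    rw [h5, h6]
    field_simp
    ring
  rw [hexp, heat, ← hcoef, ← hpow]
  ring

/-- This lets every estimate be made on the heat kernel at a fixed time and then integrated. -/
theorem greenKernel_eq {ω : ℝ} (hω : 0 < ω) (lam x y x' y' : ℝ) : greenKernel ω lam x y x' y'
    = ∫ τ in Set.Ioi (0 : ℝ), Real.exp (-(lam * τ)) * heat ω τ (x, y) x' y' := by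
  have himg : (fun τ => Real.exp (-(ω * τ))) '' Set.Ioi 0 = Set.Ioo 0 1 := by
    ext ν
    constructor
    · rintro ⟨τ, hτ, rfl⟩
      exact ⟨Real.exp_pos _, Real.exp_lt_one_iff.2 (by have := mul_pos hω hτ; linarith)⟩
    · rintro ⟨h0, h1⟩
      refine ⟨-Real.log ν / ω, ?_, ?_⟩
      · exact div_pos (by have := Real.log_neg h0 h1; linarith) hω
      · simp only
        rw [mul_div_cancel₀ _ hω.ne', neg_neg, Real.exp_log h0]
  have hinj : Set.InjOn (fun τ => Real.exp (-(ω * τ))) (Set.Ioi 0) := by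
    intro a _ b _ h
    have := Real.exp_injective h
    have h2 : ω * a = ω * b := by linarith
    exact mul_left_cancel₀ hω.ne' h2
  have hder : ∀ τ ∈ Set.Ioi (0 : ℝ), HasDerivWithinAt (fun τ => Real.exp (-(ω * τ)))
      (Real.exp (-(ω * τ)) * (-(ω * 1))) (Set.Ioi 0) τ := fun τ _ =>
    (((hasDerivAt_id τ).const_mul ω).neg.exp).hasDerivWithinAt
  rw [greenKernel, ← himg,
    integral_image_eq_integral_abs_deriv_smul measurableSet_Ioi hder hinj, ← integral_const_mul]
  refine setIntegral_congr_fun measurableSet_Ioi fun τ hτ => ?_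
  rw [← green_integrand hω hτ x y x' y']
  rw [abs_of_nonpos (by have := Real.exp_pos (-(ω * τ)); nlinarith), smul_eq_mul]
  ring_nf

/-- Completing the square by `cosh² = sinh² + 1`: in `y` the kernel is a Gaussian centred at the
drifted point `y' / cosh (ω τ)`. -/
theorem mehlerExp_eq_square {ω τ : ℝ} (hω : 0 < ω) (hτ : 0 < τ) (y y' : ℝ) : mehlerExp ω τ y y'
    = ω * Real.cosh (ω * τ) / (2 * Real.sinh (ω * τ)) * (y - y' / Real.cosh (ω * τ)) ^ 2
      + ω * Real.sinh (ω * τ) / (2 * Real.cosh (ω * τ)) * y' ^ 2 := by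
  have hs := sinh_mul_pos hω hτ
  have hc := Real.cosh_pos (ω * τ)
  have h := Real.cosh_sq (ω * τ)
  rw [mehlerExp]
  field_simp
  linear_combination y' ^ 2 * h

/-- From `2 y y' ≤ y² + y'²`; the coefficient is `tanh (ω τ / 2)`. The bound gives decay in both
variables with an explicit rate. -/
theorem mehlerExp_ge_tanh {ω τ : ℝ} (hω : 0 < ω) (hτ : 0 < τ) (y y' : ℝ) :
    ω / 2 * ((Real.cosh (ω * τ) - 1) / Real.sinh (ω * τ)) * (y ^ 2 + y' ^ 2)
      ≤ mehlerExp ω τ y y' := by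
  have hs := sinh_mul_pos hω hτ
  rw [mehlerExp, mul_assoc]
  gcongr
  rw [div_mul_eq_mul_div]
  gcongr
  have h0 := sq_nonneg (y - y')
  nlinarith

/-- A Gaussian majorant of the heat kernel. -/
def heatMaj (ω τ : ℝ) (p : ℝ × ℝ) (x' y' : ℝ) : ℝ :=
  heatCoef ω τ * (Real.exp (-(1 / (4 * τ)) * (p.1 - x') ^ 2) *
    Real.exp (-(ω * Real.cosh (ω * τ) / (4 * Real.sinh (ω * τ)))
      * (p.2 - y' / Real.cosh (ω * τ)) ^ 2))

theorem abs_mul_exp_le (z : ℝ) : |z| * Real.exp (-(z ^ 2 / 4)) ≤ 1 := by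
  have h := Real.add_one_le_exp (z ^ 2 / 4)
  have h2 : |z| ≤ Real.exp (z ^ 2 / 4) := by
    have := sq_abs z
    nlinarith [sq_nonneg (|z| / 2 - 1)]
  rw [Real.exp_neg, ← div_eq_mul_inv]
  exact (div_le_one (Real.exp_pos _)).2 h2

theorem abs_mul_exp_le_of_sq {a u : ℝ} (ha : 0 < a) :
    |u| * Real.exp (-(a * u ^ 2 / 4)) ≤ (√a)⁻¹ := by
  have h := abs_mul_exp_le (√a * u)
  rw [abs_mul, abs_of_nonneg (Real.sqrt_nonneg a), mul_pow, Real.sq_sqrt ha.le] at h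
  rw [← one_div, le_div_iff₀ (Real.sqrt_pos.2 ha)]
  linarith

theorem heatMaj_pos {ω τ : ℝ} (hω : 0 < ω) (hτ : 0 < τ) (p : ℝ × ℝ) (x' y' : ℝ) :
    0 < heatMaj ω τ p x' y' :=
  mul_pos (heatCoef_pos hω hτ) (mul_pos (Real.exp_pos _) (Real.exp_pos _))

theorem heatMaj_ge {ω τ : ℝ} (hω : 0 < ω) (hτ : 0 < τ) (p : ℝ × ℝ) (x' y' : ℝ) :
    heatCoef ω τ * Real.exp (-((p.1 - x') ^ 2 / (4 * τ)) - mehlerExp ω τ p.2 y' / 2)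
      ≤ heatMaj ω τ p x' y' := by
  rw [heatMaj, ← Real.exp_add]
  have := heatCoef_pos hω hτ
  gcongr
  have hs := sinh_mul_pos hω hτ
  have hc := Real.cosh_pos (ω * τ)
  rw [mehlerExp_eq_square hω hτ]
  have : 0 ≤ ω * Real.sinh (ω * τ) / (2 * Real.cosh (ω * τ)) * y' ^ 2 := by positivity
  have e1 : -(1 / (4 * τ)) * (p.1 - x') ^ 2 = -((p.1 - x') ^ 2 / (4 * τ)) := by ring
  have e2 : -(ω * Real.cosh (ω * τ) / (4 * Real.sinh (ω * τ)))
      * (p.2 - y' / Real.cosh (ω * τ)) ^ 2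
      = -(ω * Real.cosh (ω * τ) / (2 * Real.sinh (ω * τ))
      * (p.2 - y' / Real.cosh (ω * τ)) ^ 2) / 2 := by ring
  rw [e1, e2]
  linarith

/-- The exponent is halved: one half absorbs a polynomial factor, as in `abs_mul_heat_le`, and the
other half is still dominated by the Gaussian `heatMaj`. -/
theorem heat_split {ω τ : ℝ} (p : ℝ × ℝ) (x' y' : ℝ) : heat ω τ p x' y'
    = Real.exp (-((p.1 - x') ^ 2 / (4 * τ)) - mehlerExp ω τ p.2 y' / 2) *
      (heatCoef ω τ * Real.exp (-((p.1 - x') ^ 2 / (4 * τ)) - mehlerExp ω τ p.2 y' / 2)) := by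
  rw [heat, mul_left_comm, ← Real.exp_add]
  congr 2
  ring

theorem mehlerExp_nonneg {ω τ : ℝ} (hω : 0 < ω) (hτ : 0 < τ) (y y' : ℝ) :
    0 ≤ mehlerExp ω τ y y' := by
  have hs := sinh_mul_pos hω hτ
  have hc := Real.cosh_pos (ω * τ)
  rw [mehlerExp_eq_square hω hτ]
  positivity

/-- Moments against the heat kernel are controlled by the majorant. -/
theorem abs_mul_heat_le {ω τ : ℝ} (hω : 0 < ω) (hτ : 0 < τ) {p : ℝ × ℝ} {x' y' u D : ℝ}
    (h : |u| * Real.exp (-((p.1 - x') ^ 2 / (4 * τ)) - mehlerExp ω τ p.2 y' / 2) ≤ D) :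
    |u| * heat ω τ p x' y' ≤ D * heatMaj ω τ p x' y' := by
  rw [heat_split, ← mul_assoc]
  have hD : 0 ≤ D := le_trans (by positivity) h
  have := heatMaj_ge hω hτ p x' y'
  have h3 := heatCoef_pos hω hτ
  gcongr

theorem heat_le_heatMaj {ω τ : ℝ} (hω : 0 < ω) (hτ : 0 < τ) (p : ℝ × ℝ) (x' y' : ℝ) :
    heat ω τ p x' y' ≤ heatMaj ω τ p x' y' := by
  have := abs_mul_heat_le (p := p) (x' := x') (y' := y') (u := 1) (D := 1) hω hτ ?_
  · simpa using this
  · rw [abs_one, one_mul, Real.exp_le_one_iff]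
    have := mehlerExp_nonneg hω hτ p.2 y'
    have h2 : 0 ≤ (p.1 - x') ^ 2 / (4 * τ) := by positivity
    linarith

theorem abs_x_mul_heat_le {ω τ : ℝ} (hω : 0 < ω) (hτ : 0 < τ) (p : ℝ × ℝ) (x' y' : ℝ) :
    |p.1 - x'| * heat ω τ p x' y' ≤ √τ * heatMaj ω τ p x' y' := by
  refine abs_mul_heat_le hω hτ ?_
  have h := abs_mul_exp_le_of_sq (u := p.1 - x') (inv_pos.2 hτ)
  rw [Real.sqrt_inv, inv_inv] at h
  refine le_trans ?_ h
  gcongr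
  have := mehlerExp_nonneg hω hτ p.2 y'
  have e : τ⁻¹ * (p.1 - x') ^ 2 / 4 = (p.1 - x') ^ 2 / (4 * τ) := by field_simp
  rw [e]; linarith

theorem abs_w_mul_heat_le {ω τ : ℝ} (hω : 0 < ω) (hτ : 0 < τ) (p : ℝ × ℝ) (x' y' : ℝ) :
    |p.2 - y' / Real.cosh (ω * τ)| * heat ω τ p x' y'
      ≤ (√(ω * Real.cosh (ω * τ) / Real.sinh (ω * τ)))⁻¹ * heatMaj ω τ p x' y' := by
  have hs := sinh_mul_pos hω hτ
  have hc := Real.cosh_pos (ω * τ)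
  refine abs_mul_heat_le hω hτ ?_
  have h := abs_mul_exp_le_of_sq (u := p.2 - y' / Real.cosh (ω * τ))
    (a := ω * Real.cosh (ω * τ) / Real.sinh (ω * τ)) (by positivity)
  refine le_trans ?_ h
  gcongr
  rw [mehlerExp_eq_square hω hτ]
  have : 0 ≤ ω * Real.sinh (ω * τ) / (2 * Real.cosh (ω * τ)) * y' ^ 2 := by positivity
  have h2 : 0 ≤ (p.1 - x') ^ 2 / (4 * τ) := by positivity
  have e : ω * Real.cosh (ω * τ) / Real.sinh (ω * τ) * (p.2 - y' / Real.cosh (ω * τ)) ^ 2 / 4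
    = ω * Real.cosh (ω * τ) / (2 * Real.sinh (ω * τ)) * (p.2 - y' / Real.cosh (ω * τ)) ^ 2 / 2 := by
    ring
  rw [e]; linarith

theorem cosh_sub_one_pos {ω τ : ℝ} (hω : 0 < ω) (hτ : 0 < τ) : 0 < Real.cosh (ω * τ) - 1 :=
  sub_pos.2 (Real.one_lt_cosh.2 (mul_pos hω hτ).ne')

theorem abs_y_mul_heat_le {ω τ : ℝ} (hω : 0 < ω) (hτ : 0 < τ) (p : ℝ × ℝ) (x' y' : ℝ) :
    |p.2| * heat ω τ p x' y'
      ≤ (√(ω * (Real.cosh (ω * τ) - 1) / Real.sinh (ω * τ)))⁻¹ * heatMaj ω τ p x' y' := by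
  have hs := sinh_mul_pos hω hτ
  have hc := cosh_sub_one_pos hω hτ
  refine abs_mul_heat_le hω hτ ?_
  have h := abs_mul_exp_le_of_sq (u := p.2)
    (a := ω * (Real.cosh (ω * τ) - 1) / Real.sinh (ω * τ)) (by positivity)
  refine le_trans ?_ h
  gcongr
  have h1 := mehlerExp_ge_tanh hω hτ p.2 y'
  have h2 : 0 ≤ (p.1 - x') ^ 2 / (4 * τ) := by positivity
  have h3 : 0 ≤ ω / 2 * ((Real.cosh (ω * τ) - 1) / Real.sinh (ω * τ)) * y' ^ 2 := by positivity
  have e : ω * (Real.cosh (ω * τ) - 1) / Real.sinh (ω * τ) * p.2 ^ 2 / 4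
    = (ω / 2 * ((Real.cosh (ω * τ) - 1) / Real.sinh (ω * τ)) * p.2 ^ 2) / 2 := by
    ring
  rw [e]; linarith

theorem exp_le_two_mul_cosh (a : ℝ) : Real.exp a ≤ 2 * Real.cosh a := by
  rw [Real.cosh_eq]; have := Real.exp_pos (-a); linarith

theorem integrable_gauss_shift {b : ℝ} (hb : 0 < b) (a : ℝ) :
    Integrable fun x : ℝ => Real.exp (-b * (x - a) ^ 2) :=
  (integrable_exp_neg_mul_sq hb).comp_sub_right a

theorem integral_gauss_shift (b a : ℝ) :
    ∫ x : ℝ, Real.exp (-b * (x - a) ^ 2) = √(Real.pi / b) := by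
  rw [integral_sub_right_eq_self (fun x : ℝ => Real.exp (-b * x ^ 2)) a, integral_gaussian]

theorem integrable_heatMaj {ω τ : ℝ} (hω : 0 < ω) (hτ : 0 < τ) (x' y' : ℝ) :
    Integrable fun p => heatMaj ω τ p x' y' := by
  have hs := sinh_mul_pos hω hτ
  have hc := Real.cosh_pos (ω * τ)
  exact ((integrable_gauss_shift (by positivity) x').mul_prod
    (integrable_gauss_shift (by positivity) (y' / Real.cosh (ω * τ)))).const_mul _

/-- The integral equals `√(4 exp θ / cosh θ)` with `θ = ω τ`, and `exp θ ≤ 2 cosh θ`. -/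
theorem integral_heatMaj_le {ω τ : ℝ} (hω : 0 < ω) (hτ : 0 < τ) (x' y' : ℝ) :
    ∫ p, heatMaj ω τ p x' y' ≤ 4 := by
  have hs := sinh_mul_pos hω hτ
  have hc := Real.cosh_pos (ω * τ)
  simp only [heatMaj]
  rw [integral_const_mul, Measure.volume_eq_prod,
    integral_prod_mul (fun x : ℝ => Real.exp (-(1 / (4 * τ)) * (x - x') ^ 2))
      (fun y : ℝ => Real.exp (-(ω * Real.cosh (ω * τ) / (4 * Real.sinh (ω * τ)))
      * (y - y' / Real.cosh (ω * τ)) ^ 2)), integral_gauss_shift, integral_gauss_shift, heatCoef,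
    ← Real.sqrt_mul (by positivity), ← Real.sqrt_mul (by positivity)]
  rw [Real.sqrt_le_left (by norm_num)]
  have e : ω * Real.exp (ω * τ) / (4 * Real.pi ^ 2 * τ * Real.sinh (ω * τ)) *
      (Real.pi / (1 / (4 * τ)) * (Real.pi / (ω * Real.cosh (ω * τ) / (4 * Real.sinh (ω * τ)))))
      = 4 * (Real.exp (ω * τ) / Real.cosh (ω * τ)) := by
    field_simp
  rw [e]
  have := (div_le_iff₀ hc).2 (exp_le_two_mul_cosh (ω * τ))
  linarith

theorem integrable_heatMaj_row {ω τ : ℝ} (hω : 0 < ω) (hτ : 0 < τ) (p : ℝ × ℝ) :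
    Integrable fun x' => heatMaj ω τ p x' x' := by
  have hs := sinh_mul_pos hω hτ
  have hc := Real.cosh_pos (ω * τ)
  have h := (integrable_gauss_shift (b := 1 / (4 * τ)) (by positivity) p.1).const_mul
    (heatCoef ω τ)
  refine h.mono' (by unfold heatMaj; fun_prop) (Eventually.of_forall fun x' => ?_)
  rw [Real.norm_of_nonneg (heatMaj_pos hω hτ _ _ _).le, heatMaj]
  have := heatCoef_pos hω hτ
  gcongr
  rw [← sub_sq_comm x' p.1]
  refine mul_le_of_le_one_right (Real.exp_pos _).le (Real.exp_le_one_iff.2 ?_)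
  have : 0 ≤ (ω * Real.cosh (ω * τ) / (4 * Real.sinh (ω * τ)))
      * (p.2 - x' / Real.cosh (ω * τ)) ^ 2 := by positivity
  linarith

/-- Sources lie on the diagonal, so only a line is integrated and the `y`-Gaussian is simply
dropped. The cost is a factor `τ^(-1/2)` at small times, which the integral over the plane does not
have. -/
theorem integral_heatMaj_row_le {ω τ : ℝ} (hω : 0 < ω) (hτ : 0 < τ) (p : ℝ × ℝ) :
    ∫ x', heatMaj ω τ p x' x' ≤ √(ω * (1 + 1 / (ω * τ))) := by
  have hs := sinh_mul_pos hω hτ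
  have hc := Real.cosh_pos (ω * τ)
  have hp := heatCoef_pos hω hτ
  have h := (integrable_gauss_shift (b := 1 / (4 * τ)) (by positivity) p.1).const_mul
    (heatCoef ω τ)
  refine (integral_mono (integrable_heatMaj_row hω hτ p) h fun x' => ?_).trans ?_
  · simp only [heatMaj]
    gcongr
    rw [← sub_sq_comm x' p.1]
    refine mul_le_of_le_one_right (Real.exp_pos _).le (Real.exp_le_one_iff.2 ?_)
    have : 0 ≤ (ω * Real.cosh (ω * τ) / (4 * Real.sinh (ω * τ)))
        * (p.2 - x' / Real.cosh (ω * τ)) ^ 2 := by positivity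
    linarith
  · rw [integral_const_mul, integral_gauss_shift, heatCoef, ← Real.sqrt_mul (by positivity)]
    refine Real.sqrt_le_sqrt ?_
    have e : ω * Real.exp (ω * τ) / (4 * Real.pi ^ 2 * τ * Real.sinh (ω * τ)) *
      (Real.pi / (1 / (4 * τ))) = ω * (Real.exp (ω * τ) / (Real.pi * Real.sinh (ω * τ))) := by
      field_simp
    rw [e]
    gcongr
    rw [div_le_iff₀ (by positivity)]
    have h1 : ω * τ + 1 ≤ Real.exp (ω * τ) := Real.add_one_le_exp _
    have hωτ := mul_pos hω hτ
    have h2 : Real.exp (-(ω * τ)) ≤ 1 := Real.exp_le_one_iff.2 (by linarith)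
    have h3 : Real.exp (ω * τ) ≤ (1 + 1 / (ω * τ)) * (2 * Real.sinh (ω * τ)) := by
      rw [Real.sinh_eq]
      have : (1 + 1 / (ω * τ)) * (2 * ((Real.exp (ω * τ) - Real.exp (-(ω * τ))) / 2))
        = Real.exp (ω * τ) + ((Real.exp (ω * τ) - (ω * τ + 1) * Real.exp (-(ω * τ))) / (ω * τ)) := by
        field_simp; ring
      rw [this]
      have : 0 ≤ (Real.exp (ω * τ) - (ω * τ + 1) * Real.exp (-(ω * τ))) / (ω * τ) := by
        apply div_nonneg _ hωτ.le
        nlinarith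
      linarith
    refine h3.trans ?_
    gcongr
    linarith [Real.pi_gt_three]


/-! ### Derivatives of the heat kernel and the heat equation -/

theorem IsTest.fderiv {φ : ℝ × ℝ → ℂ} (h : IsTest φ) (v : ℝ × ℝ) :
    IsTest (fun p => fderiv ℝ φ p v) :=
  ⟨(h.smooth.fderiv_right (m := ((⊤ : ℕ∞) : WithTop ℕ∞)) (by simp)).clm_apply contDiff_const,
    h.compact.fderiv_apply ℝ v⟩

/-- The free Hamiltonian applied to a smooth function. -/
def freeHam (ω : ℝ) (φ : ℝ × ℝ → ℂ) (p : ℝ × ℝ) : ℂ :=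
  -(1 / 2 : ℂ) * fderiv ℝ (fun q => fderiv ℝ φ q (1, 0)) p (1, 0)
    - (1 / 2 : ℂ) * fderiv ℝ (fun q => fderiv ℝ φ q (0, 1)) p (0, 1)
    + ((ω ^ 2 * p.2 ^ 2 / 2 - ω / 2 : ℝ) : ℂ) * φ p

theorem IsTest.freeHam {φ : ℝ × ℝ → ℂ} (h : IsTest φ) (ω : ℝ) : IsTest (freeHam ω φ) := by
  have h1 := ((h.fderiv (1, 0)).fderiv (1, 0)).smul (-(1 / 2 : ℂ))
  have h2 := ((h.fderiv (0, 1)).fderiv (0, 1)).smul (-(1 / 2 : ℂ))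
  have h3 := h.mul_real (c := fun p => ω ^ 2 * p.2 ^ 2 / 2 - ω / 2) (by fun_prop)
  have h4 := (h1.add h2).add h3
  convert h4 using 1
  ext p
  simp [ZeroRange.freeHam]
  ring

theorem hasDerivAt_fst_of_differentiable {f : ℝ × ℝ → ℂ} {p : ℝ × ℝ}
    (hf : DifferentiableAt ℝ f p) :
    HasDerivAt (fun x => f (x, p.2)) (fderiv ℝ f p (1, 0)) p.1 := by
  have h1 : HasDerivAt (fun x : ℝ => (x, p.2)) ((1 : ℝ), (0 : ℝ)) p.1 :=
    (hasDerivAt_id _).prodMk (hasDerivAt_const _ _)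
  exact HasFDerivAt.comp_hasDerivAt (f := fun x : ℝ => (x, p.2)) (l := f) p.1
    (hf.hasFDerivAt) h1

theorem hasDerivAt_snd_of_differentiable {f : ℝ × ℝ → ℂ} {p : ℝ × ℝ}
    (hf : DifferentiableAt ℝ f p) :
    HasDerivAt (fun y => f (p.1, y)) (fderiv ℝ f p (0, 1)) p.2 := by
  have h1 : HasDerivAt (fun y : ℝ => (p.1, y)) ((0 : ℝ), (1 : ℝ)) p.2 :=
    (hasDerivAt_const _ _).prodMk (hasDerivAt_id _)
  exact HasFDerivAt.comp_hasDerivAt (f := fun y : ℝ => (p.1, y)) (l := f) p.2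
    (hf.hasFDerivAt) h1

theorem contDiff_heat (ω τ x' y' : ℝ) : ContDiff ℝ ((⊤ : ℕ∞) : WithTop ℕ∞)
    (fun p => (heat ω τ p x' y' : ℂ)) := by
  have h : ContDiff ℝ ((⊤ : ℕ∞) : WithTop ℕ∞) (fun p => heat ω τ p x' y') := by
    unfold heat mehlerExp
    fun_prop
  exact Complex.ofRealCLM.contDiff.comp h

theorem hasDerivAt_heat_x (ω τ x y x' y' : ℝ) : HasDerivAt (fun x => heat ω τ (x, y) x' y')
    (-((x - x') / τ) * heat ω τ (x, y) x' y') x := by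
  have h1 : HasDerivAt (fun x : ℝ => -((x - x') ^ 2 / (2 * τ)) - mehlerExp ω τ y y')
      (-((2 * (x - x') ^ 1 * 1) / (2 * τ))) x := by
    have := ((((hasDerivAt_id x).sub_const x').pow 2).div_const (2 * τ)).neg.sub_const
      (mehlerExp ω τ y y')
    simpa using this
  refine (h1.exp.const_mul (heatCoef ω τ)).congr_deriv ?_
  simp only [heat, pow_one]
  by_cases hτ : τ = 0
  · simp [hτ]
  · field_simp

theorem hasDerivAt_heat_y (ω τ x y x' y' : ℝ) : HasDerivAt (fun y => heat ω τ (x, y) x' y')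
    (-(ω * (Real.cosh (ω * τ) * y - y') / Real.sinh (ω * τ)) * heat ω τ (x, y) x' y') y := by
  have h0 : HasDerivAt (fun y : ℝ => Real.cosh (ω * τ) * (y ^ 2 + y' ^ 2) - 2 * y * y')
      (Real.cosh (ω * τ) * (2 * y) - 2 * y') y := by
    have a := (((hasDerivAt_id y).pow 2).add_const (y' ^ 2)).const_mul (Real.cosh (ω * τ))
    have b := ((hasDerivAt_id y).const_mul 2).mul_const y'
    refine (a.sub b).congr_deriv ?_
    simp
  have h1 : HasDerivAt (fun y : ℝ => -((x - x') ^ 2 / (2 * τ)) - mehlerExp ω τ y y')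
      (-(ω / 2 * ((Real.cosh (ω * τ) * (2 * y) - 2 * y') / Real.sinh (ω * τ)))) y := by
    have := ((h0.div_const (Real.sinh (ω * τ))).const_mul (ω / 2)).const_sub
      (-((x - x') ^ 2 / (2 * τ)))
    simpa [mehlerExp] using this
  refine (h1.exp.const_mul (heatCoef ω τ)).congr_deriv ?_
  simp only [heat]
  ring

theorem fderiv_heat_x (ω τ : ℝ) (p : ℝ × ℝ) (x' y' : ℝ) :
    fderiv ℝ (fun p => (heat ω τ p x' y' : ℂ)) p (1, 0)
      = ((-((p.1 - x') / τ) * heat ω τ p x' y' : ℝ) : ℂ) :=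
  (hasDerivAt_fst_of_differentiable
    ((contDiff_heat ω τ x' y').differentiable (by simp) p)).unique
    (hasDerivAt_heat_x ω τ p.1 p.2 x' y').ofReal_comp

theorem fderiv_heat_y (ω τ : ℝ) (p : ℝ × ℝ) (x' y' : ℝ) :
    fderiv ℝ (fun p => (heat ω τ p x' y' : ℂ)) p (0, 1)
      = ((-(ω * (Real.cosh (ω * τ) * p.2 - y') / Real.sinh (ω * τ)) * heat ω τ p x' y' : ℝ) : ℂ) :=
  (hasDerivAt_snd_of_differentiable
    ((contDiff_heat ω τ x' y').differentiable (by simp) p)).unique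
    (hasDerivAt_heat_y ω τ p.1 p.2 x' y').ofReal_comp

theorem fderiv_heat_xx (ω τ : ℝ) (p : ℝ × ℝ) (x' y' : ℝ) :
    fderiv ℝ (fun q => fderiv ℝ (fun p => (heat ω τ p x' y' : ℂ)) q (1, 0)) p (1, 0)
      = (((((p.1 - x') / τ) ^ 2 - 1 / τ) * heat ω τ p x' y' : ℝ) : ℂ) := by
  have hd : ContDiff ℝ ((⊤ : ℕ∞) : WithTop ℕ∞)
      (fun q => fderiv ℝ (fun p => (heat ω τ p x' y' : ℂ)) q (1, 0)) :=
    ((contDiff_heat ω τ x' y').fderiv_right (by simp)).clm_apply contDiff_const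
  refine (hasDerivAt_fst_of_differentiable (hd.differentiable (by simp) p)).unique ?_
  simp only [fderiv_heat_x]
  refine HasDerivAt.ofReal_comp ?_
  have h := ((((hasDerivAt_id p.1).sub_const x').div_const τ).neg).mul
    (hasDerivAt_heat_x ω τ p.1 p.2 x' y')
  refine h.congr_deriv ?_
  simp
  ring

theorem fderiv_heat_yy (ω τ : ℝ) (p : ℝ × ℝ) (x' y' : ℝ) :
    fderiv ℝ (fun q => fderiv ℝ (fun p => (heat ω τ p x' y' : ℂ)) q (0, 1)) p (0, 1)
      = ((((ω * (Real.cosh (ω * τ) * p.2 - y') / Real.sinh (ω * τ)) ^ 2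
        - ω * Real.cosh (ω * τ) / Real.sinh (ω * τ)) * heat ω τ p x' y' : ℝ) : ℂ) := by
  have hd : ContDiff ℝ ((⊤ : ℕ∞) : WithTop ℕ∞)
      (fun q => fderiv ℝ (fun p => (heat ω τ p x' y' : ℂ)) q (0, 1)) :=
    ((contDiff_heat ω τ x' y').fderiv_right (by simp)).clm_apply contDiff_const
  refine (hasDerivAt_snd_of_differentiable (hd.differentiable (by simp) p)).unique ?_
  simp only [fderiv_heat_y]
  refine HasDerivAt.ofReal_comp ?_
  have h := ((((((hasDerivAt_id p.2).const_mul (Real.cosh (ω * τ))).sub_const y').const_mul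
    ω).div_const (Real.sinh (ω * τ))).neg).mul (hasDerivAt_heat_y ω τ p.1 p.2 x' y')
  refine h.congr_deriv ?_
  simp
  ring

/-- The time derivative of the heat kernel. -/
def heatDot (ω τ : ℝ) (p : ℝ × ℝ) (x' y' : ℝ) : ℝ :=
  (ω / 2 - 1 / (2 * τ) - ω * Real.cosh (ω * τ) / (2 * Real.sinh (ω * τ))
    + (p.1 - x') ^ 2 / (2 * τ ^ 2)
    + ω ^ 2 / 2 * ((p.2 ^ 2 + y' ^ 2 - 2 * Real.cosh (ω * τ) * p.2 * y') / Real.sinh (ω * τ) ^ 2))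
    * heat ω τ p x' y'

theorem hasDerivAt_heatCoef {ω τ : ℝ} (hω : 0 < ω) (hτ : 0 < τ) : HasDerivAt (heatCoef ω)
    ((ω / 2 - 1 / (2 * τ) - ω * Real.cosh (ω * τ) / (2 * Real.sinh (ω * τ))) * heatCoef ω τ) τ := by
  have hs := sinh_mul_pos hω hτ
  have hl : HasDerivAt (fun τ : ℝ => ω * τ) ω τ := by
    simpa using (hasDerivAt_id τ).const_mul ω
  have hnum := (hl.exp).const_mul ω
  have hden : HasDerivAt (fun τ => 4 * Real.pi ^ 2 * τ * Real.sinh (ω * τ))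
      (4 * Real.pi ^ 2 * Real.sinh (ω * τ) + 4 * Real.pi ^ 2 * τ * (Real.cosh (ω * τ) * ω)) τ := by
    refine (((hasDerivAt_id τ).const_mul (4 * Real.pi ^ 2)).mul hl.sinh).congr_deriv ?_
    simp
  have hB := hnum.div hden (by positivity)
  have hpos : 0 < ω * Real.exp (ω * τ) / (4 * Real.pi ^ 2 * τ * Real.sinh (ω * τ)) := by positivity
  refine (hB.sqrt hpos.ne').congr_deriv ?_
  have hcp := heatCoef_pos hω hτ
  have hsq : heatCoef ω τ * heatCoef ω τ
      = ω * Real.exp (ω * τ) / (4 * Real.pi ^ 2 * τ * Real.sinh (ω * τ)) :=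
    Real.mul_self_sqrt hpos.le
  change _ / (2 * heatCoef ω τ) = _
  rw [div_eq_iff (by positivity)]
  have : (ω / 2 - 1 / (2 * τ) - ω * Real.cosh (ω * τ) / (2 * Real.sinh (ω * τ))) * heatCoef ω τ
      * (2 * heatCoef ω τ) = 2 * (ω / 2 - 1 / (2 * τ)
        - ω * Real.cosh (ω * τ) / (2 * Real.sinh (ω * τ))) * (heatCoef ω τ * heatCoef ω τ) := by ring
  rw [this, hsq]
  field_simp
  ring

theorem hasDerivAt_heat_time {ω τ : ℝ} (hω : 0 < ω) (hτ : 0 < τ) (p : ℝ × ℝ) (x' y' : ℝ) :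
    HasDerivAt (fun τ => heat ω τ p x' y') (heatDot ω τ p x' y') τ := by
  have hs := sinh_mul_pos hω hτ
  have hl : HasDerivAt (fun τ : ℝ => ω * τ) ω τ := by
    simpa using (hasDerivAt_id τ).const_mul ω
  have h1 : HasDerivAt (fun τ : ℝ => (p.1 - x') ^ 2 / (2 * τ))
      ((0 * (2 * τ) - (p.1 - x') ^ 2 * 2) / (2 * τ) ^ 2) τ := by
    have hd : HasDerivAt (fun τ : ℝ => 2 * τ) 2 τ := by
      simpa using (hasDerivAt_id τ).const_mul 2
    exact (hasDerivAt_const τ ((p.1 - x') ^ 2)).div hd (by positivity)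
  have h2 := ((((hl.cosh).mul_const (p.2 ^ 2 + y' ^ 2)).sub_const (2 * p.2 * y')).div hl.sinh
    hs.ne').const_mul (ω / 2)
  have h3 := (h1.neg.sub h2).exp
  refine ((hasDerivAt_heatCoef hω hτ).mul h3).congr_deriv ?_
  simp only [heatDot, heat, mehlerExp, Pi.neg_apply, Pi.sub_apply, Pi.div_apply]
  have hc := Real.cosh_sq (ω * τ)
  set X := Real.exp (-((p.1 - x') ^ 2 / (2 * τ)) - ω / 2 *
    ((Real.cosh (ω * τ) * (p.2 ^ 2 + y' ^ 2) - 2 * p.2 * y') / Real.sinh (ω * τ)))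
  have key : (-((0 * (2 * τ) - (p.1 - x') ^ 2 * 2) / (2 * τ) ^ 2) - ω / 2 *
      ((Real.sinh (ω * τ) * ω * (p.2 ^ 2 + y' ^ 2) * Real.sinh (ω * τ)
        - (Real.cosh (ω * τ) * (p.2 ^ 2 + y' ^ 2) - 2 * p.2 * y') * (Real.cosh (ω * τ) * ω))
        / Real.sinh (ω * τ) ^ 2))
      = (p.1 - x') ^ 2 / (2 * τ ^ 2)
    + ω ^ 2 / 2 * ((p.2 ^ 2 + y' ^ 2 - 2 * Real.cosh (ω * τ) * p.2 * y')
      / Real.sinh (ω * τ) ^ 2) := by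
    clear h3 h2
    generalize Real.cosh (ω * τ) = c at hc ⊢
    generalize Real.sinh (ω * τ) = s at hc hs ⊢
    field_simp
    linear_combination (ω ^ 2 * τ ^ 2 * (p.2 ^ 2 + y' ^ 2)) * hc
  linear_combination (heatCoef ω τ * X) * key

/-- Both sides are the kernel times a polynomial of degree two in `x - x'`, `y`, `y'`; only the
coefficient of `y²` needs `cosh² = sinh² + 1`. -/
theorem heat_equation {ω τ : ℝ} (hω : 0 < ω) (hτ : 0 < τ) (p : ℝ × ℝ) (x' y' : ℝ) :
    (heatDot ω τ p x' y' : ℂ) = - freeHam ω (fun p => (heat ω τ p x' y' : ℂ)) p := by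
  rw [freeHam, fderiv_heat_xx, fderiv_heat_yy, heatDot]
  have hs := sinh_mul_pos hω hτ
  have hc := Real.cosh_sq (ω * τ)
  have key : (ω / 2 - 1 / (2 * τ) - ω * Real.cosh (ω * τ) / (2 * Real.sinh (ω * τ))
    + (p.1 - x') ^ 2 / (2 * τ ^ 2)
    + ω ^ 2 / 2 * ((p.2 ^ 2 + y' ^ 2 - 2 * Real.cosh (ω * τ) * p.2 * y') / Real.sinh (ω * τ) ^ 2))
    = 1 / 2 * (((p.1 - x') / τ) ^ 2 - 1 / τ)
      + 1 / 2 * ((ω * (Real.cosh (ω * τ) * p.2 - y') / Real.sinh (ω * τ)) ^ 2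
        - ω * Real.cosh (ω * τ) / Real.sinh (ω * τ)) - (ω ^ 2 * p.2 ^ 2 / 2 - ω / 2) := by
    field_simp
    linear_combination (-(ω ^ 2 * τ ^ 2 * p.2 ^ 2)) * hc
  rw [key]
  push_cast
  ring


/-! ### The Laplace transform of the heat kernel as a fundamental solution -/

theorem IsTest.integrable_mul {φ f : ℝ × ℝ → ℂ} (h : IsTest φ) (hf : Continuous f) :
    Integrable fun p => φ p * f p :=
  (h.smooth.continuous.mul hf).integrable_of_hasCompactSupport h.compact.mul_right

theorem IsTest.integral_mul_fderiv_smooth {φ f : ℝ × ℝ → ℂ} (h : IsTest φ)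
    (hf : ContDiff ℝ ((⊤ : ℕ∞) : WithTop ℕ∞) f) (v : ℝ × ℝ) :
    ∫ p, φ p * _root_.fderiv ℝ f p v = - ∫ p, _root_.fderiv ℝ φ p v * f p := by
  have hc : Continuous fun p => _root_.fderiv ℝ f p v :=
    (hf.continuous_fderiv (by simp)).clm_apply continuous_const
  exact integral_mul_fderiv_eq_neg_fderiv_mul_of_integrable
    ((h.fderiv v).integrable_mul hf.continuous) (h.integrable_mul hc)
    (h.integrable_mul hf.continuous) (fun x _ => h.differentiable x)
    (fun x _ => hf.differentiable (by simp) x)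

/-- The free Hamiltonian is symmetric. -/
theorem IsTest.integral_mul_freeHam {φ f : ℝ × ℝ → ℂ} (h : IsTest φ) (ω : ℝ)
    (hf : ContDiff ℝ ((⊤ : ℕ∞) : WithTop ℕ∞) f) :
    ∫ p, φ p * ZeroRange.freeHam ω f p = ∫ p, ZeroRange.freeHam ω φ p * f p := by
  have hfv (v : ℝ × ℝ) : ContDiff ℝ ((⊤ : ℕ∞) : WithTop ℕ∞) (fun q => _root_.fderiv ℝ f q v) :=
    (hf.fderiv_right (by simp)).clm_apply contDiff_const
  have dd (v : ℝ × ℝ) : ∫ p, φ p * _root_.fderiv ℝ (fun q => _root_.fderiv ℝ f q v) p v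
      = ∫ p, _root_.fderiv ℝ (fun q => _root_.fderiv ℝ φ q v) p v * f p := by
    rw [h.integral_mul_fderiv_smooth (hfv v) v, (h.fderiv v).integral_mul_fderiv_smooth hf v,
      neg_neg]
  have i1 (v : ℝ × ℝ) : Integrable fun p =>
      φ p * _root_.fderiv ℝ (fun q => _root_.fderiv ℝ f q v) p v :=
    h.integrable_mul (((hfv v).continuous_fderiv (by simp)).clm_apply continuous_const)
  have i2 (v : ℝ × ℝ) : Integrable fun p =>
      _root_.fderiv ℝ (fun q => _root_.fderiv ℝ φ q v) p v * f p :=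
    ((h.fderiv v).fderiv v).integrable_mul hf.continuous
  have i3 : Integrable fun p => ((ω ^ 2 * p.2 ^ 2 / 2 - ω / 2 : ℝ) : ℂ) * φ p * f p :=
    (h.mul_real (c := fun p => ω ^ 2 * p.2 ^ 2 / 2 - ω / 2) (by fun_prop)).integrable_mul
      hf.continuous
  have e1 : ∀ p, φ p * ZeroRange.freeHam ω f p
      = -(1 / 2 : ℂ) * (φ p * _root_.fderiv ℝ (fun q => _root_.fderiv ℝ f q (1, 0)) p (1, 0))
      + -(1 / 2 : ℂ) * (φ p * _root_.fderiv ℝ (fun q => _root_.fderiv ℝ f q (0, 1)) p (0, 1))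
      + ((ω ^ 2 * p.2 ^ 2 / 2 - ω / 2 : ℝ) : ℂ) * φ p * f p := fun p => by
    rw [ZeroRange.freeHam]; ring
  have e2 : ∀ p, ZeroRange.freeHam ω φ p * f p
      = -(1 / 2 : ℂ) * (_root_.fderiv ℝ (fun q => _root_.fderiv ℝ φ q (1, 0)) p (1, 0) * f p)
      + -(1 / 2 : ℂ) * (_root_.fderiv ℝ (fun q => _root_.fderiv ℝ φ q (0, 1)) p (0, 1) * f p)
      + ((ω ^ 2 * p.2 ^ 2 / 2 - ω / 2 : ℝ) : ℂ) * φ p * f p := fun p => by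
    rw [ZeroRange.freeHam]; ring
  have add3 (A B C : ℝ × ℝ → ℂ) (hA : Integrable A) (hB : Integrable B) (hC : Integrable C) :
      ∫ p, (A p + B p + C p) = (∫ p, A p) + (∫ p, B p) + ∫ p, C p := by
    rw [integral_add (f := fun p => A p + B p) (hA.add hB) hC, integral_add hA hB]
  simp_rw [e1, e2]
  rw [add3 _ _ _ ((i1 _).const_mul _) ((i1 _).const_mul _) i3,
    add3 _ _ _ ((i2 _).const_mul _) ((i2 _).const_mul _) i3]
  simp only [integral_const_mul, dd]

theorem continuousOn_heatDot {ω : ℝ} (hω : 0 < ω) (x' y' : ℝ) :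
    ContinuousOn (fun z : ℝ × (ℝ × ℝ) => heatDot ω z.1 z.2 x' y')
      (Set.Ioi 0 ×ˢ Set.univ) := by
  rintro z ⟨hz, -⟩
  have hs := sinh_mul_pos hω hz
  have hz' : 0 < z.1 := hz
  have h1 : 4 * Real.pi ^ 2 * z.1 * Real.sinh (ω * z.1) ≠ 0 := by positivity
  have h2 : 2 * z.1 ≠ 0 := by positivity
  have h3 : 2 * z.1 ^ 2 ≠ 0 := by positivity
  have h4 : 2 * Real.sinh (ω * z.1) ≠ 0 := by positivity
  have h5 : Real.sinh (ω * z.1) ^ 2 ≠ 0 := by positivity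
  refine ContinuousAt.continuousWithinAt ?_
  unfold heatDot heat mehlerExp heatCoef
  fun_prop (disch := first | exact h1 | exact h2 | exact hs.ne' | exact h3 | exact h4 | exact h5)

theorem continuous_heat (ω τ x' y' : ℝ) : Continuous fun p => heat ω τ p x' y' := by
  unfold heat mehlerExp; fun_prop

/-- The time derivative of the kernel is bounded on a compact time interval times the support of
`φ`, which allows differentiation under the integral. The heat equation and the symmetry of the free
Hamiltonian then move the operator onto `φ`. -/
theorem hasDerivAt_integral_heat {ω : ℝ} (hω : 0 < ω) {φ : ℝ × ℝ → ℂ} (h : IsTest φ) (x' y' : ℝ)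
    {τ : ℝ} (hτ : 0 < τ) :
    HasDerivAt (fun τ => ∫ p, φ p * (heat ω τ p x' y' : ℂ))
      (- ∫ p, freeHam ω φ p * (heat ω τ p x' y' : ℂ)) τ := by
  have hsub : Set.Icc (τ / 2) (2 * τ) ×ˢ tsupport φ ⊆ Set.Ioi (0 : ℝ) ×ˢ Set.univ := by
    rintro z ⟨hz, -⟩
    exact ⟨lt_of_lt_of_le (by positivity : (0 : ℝ) < τ / 2) hz.1, trivial⟩
  obtain ⟨C, hC⟩ := (isCompact_Icc.prod h.compact).exists_bound_of_continuousOn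
    ((continuousOn_heatDot hω x' y').mono hsub)
  have key := hasDerivAt_integral_of_dominated_loc_of_deriv_le (μ := (volume : Measure (ℝ × ℝ)))
    (F := fun τ p => φ p * (heat ω τ p x' y' : ℂ))
    (F' := fun τ p => φ p * (heatDot ω τ p x' y' : ℂ)) (x₀ := τ)
    (s := Set.Icc (τ / 2) (2 * τ)) (bound := fun p => ‖φ p‖ * C)
    (Icc_mem_nhds (by linarith) (by linarith)) ?_ ?_ ?_ ?_ ?_ ?_
  · refine key.2.congr_deriv ?_
    simp_rw [heat_equation hω hτ]
    rw [← h.integral_mul_freeHam ω (contDiff_heat ω τ x' y'), ← integral_neg]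
    simp only [mul_neg]
  · refine Eventually.of_forall fun t => ?_
    exact (h.integrable_mul (Complex.continuous_ofReal.comp (continuous_heat ω t x' y'))).1
  · exact h.integrable_mul (Complex.continuous_ofReal.comp (continuous_heat ω τ x' y'))
  · have : Continuous fun p => heatDot ω τ p x' y' := by
      have := continuousOn_heatDot hω x' y'
      refine this.comp_continuous (f := fun p => (τ, p)) (by fun_prop) fun p => ⟨hτ, trivial⟩
    exact (h.integrable_mul (Complex.continuous_ofReal.comp this)).1
  · refine Eventually.of_forall fun p t ht => ?_
    rw [norm_mul, Complex.norm_real]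
    by_cases hp : p ∈ tsupport φ
    · gcongr
      exact hC (t, p) ⟨ht, hp⟩
    · simp [image_eq_zero_of_notMem_tsupport hp]
  · exact (h.smooth.continuous.norm.integrable_of_hasCompactSupport h.compact.norm).mul_const C
  · refine Eventually.of_forall fun p t ht => ?_
    have ht0 : 0 < t := lt_of_lt_of_le (by positivity : (0 : ℝ) < τ / 2) ht.1
    exact (hasDerivAt_heat_time hω ht0 p x' y').ofReal_comp.const_mul _

theorem integrable_heat {ω τ : ℝ} (hω : 0 < ω) (hτ : 0 < τ) (x' y' : ℝ) :
    Integrable fun p => heat ω τ p x' y' :=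
  (integrable_heatMaj hω hτ x' y').mono' (continuous_heat ω τ x' y').aestronglyMeasurable
    (Eventually.of_forall fun p => by
      rw [Real.norm_of_nonneg (heat_pos hω hτ _ _ _).le]; exact heat_le_heatMaj hω hτ p x' y')

theorem integral_heat {ω τ : ℝ} (hω : 0 < ω) (hτ : 0 < τ) (x' y' : ℝ) :
    ∫ p, heat ω τ p x' y' = √(Real.exp (ω * τ) / Real.cosh (ω * τ))
      * Real.exp (-(ω * Real.sinh (ω * τ) / (2 * Real.cosh (ω * τ)) * y' ^ 2)) := by
  have hs := sinh_mul_pos hω hτ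
  have hc := Real.cosh_pos (ω * τ)
  have e (p : ℝ × ℝ) : heat ω τ p x' y'
      = heatCoef ω τ * Real.exp (-(ω * Real.sinh (ω * τ) / (2 * Real.cosh (ω * τ)) * y' ^ 2))
        * (Real.exp (-(1 / (2 * τ)) * (p.1 - x') ^ 2) *
        Real.exp (-(ω * Real.cosh (ω * τ) / (2 * Real.sinh (ω * τ)))
          * (p.2 - y' / Real.cosh (ω * τ)) ^ 2)) := by
    rw [heat, mehlerExp_eq_square hω hτ, mul_assoc, ← Real.exp_add, ← Real.exp_add]
    congr 2
    ring
  simp_rw [e]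
  rw [integral_const_mul, Measure.volume_eq_prod,
    integral_prod_mul (fun x : ℝ => Real.exp (-(1 / (2 * τ)) * (x - x') ^ 2))
      (fun y : ℝ => Real.exp (-(ω * Real.cosh (ω * τ) / (2 * Real.sinh (ω * τ)))
      * (y - y' / Real.cosh (ω * τ)) ^ 2)), integral_gauss_shift, integral_gauss_shift,
    mul_right_comm, heatCoef, ← Real.sqrt_mul (by positivity), ← Real.sqrt_mul (by positivity)]
  congr 2
  field_simp
  ring

/-- The heat semigroup is strongly continuous at time zero. -/
theorem tendsto_integral_heat {ω : ℝ} (hω : 0 < ω) {φ : ℝ × ℝ → ℂ} (h : IsTest φ) (x' y' : ℝ) :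
    Tendsto (fun τ => ∫ p, φ p * (heat ω τ p x' y' : ℂ)) (𝓝[>] 0) (𝓝 (φ (x', y'))) := by
  obtain ⟨L, hL⟩ := (h.smooth.of_le (m := 1) (by exact_mod_cast le_top)
    ).lipschitzWith_of_hasCompactSupport h.compact one_ne_zero
  have c1 : ContinuousAt (fun τ : ℝ => √(Real.exp (ω * τ) / Real.cosh (ω * τ))
      * Real.exp (-(ω * Real.sinh (ω * τ) / (2 * Real.cosh (ω * τ)) * y' ^ 2))) 0 := by
    have h1 : Real.cosh (ω * 0) ≠ 0 := (Real.cosh_pos _).ne'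
    have h2 : 2 * Real.cosh (ω * 0) ≠ 0 := mul_ne_zero two_ne_zero h1
    fun_prop (disch := first | exact h1 | exact h2)
  have m1 : Tendsto (fun τ : ℝ => √(Real.exp (ω * τ) / Real.cosh (ω * τ))
      * Real.exp (-(ω * Real.sinh (ω * τ) / (2 * Real.cosh (ω * τ)) * y' ^ 2))) (𝓝[>] 0)
      (𝓝 1) := by
    have := c1.tendsto.mono_left (nhdsWithin_le_nhds (s := Set.Ioi 0))
    simpa using this
  -- Lipschitz constant of `φ` times the mean distance from `(x', y')` under the kernel: `√τ` in
  -- `x`, the width around the drifted centre in `y`, and the drift `|y'| |1 - 1 / cosh (ω τ)|`. The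
  -- `4` is the bound for the mass of `heatMaj`.
  let D : ℝ → ℝ := fun τ => L * (4 * (√τ + √(Real.sinh (ω * τ) / (ω * Real.cosh (ω * τ)))
    + |y'| * |1 - 1 / Real.cosh (ω * τ)|))
  have dlim : Tendsto D (𝓝[>] 0) (𝓝 0) := by
    have : ContinuousAt D 0 := by
      have h1 : Real.cosh (ω * 0) ≠ 0 := (Real.cosh_pos _).ne'
      have h2 : ω * Real.cosh (ω * 0) ≠ 0 := mul_ne_zero hω.ne' h1
      simp only [D]
      fun_prop (disch := first | exact h1 | exact h2)
    have := this.tendsto.mono_left (nhdsWithin_le_nhds (s := Set.Ioi 0))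
    simpa [D] using this
  -- The kernel is not normalized, so the comparison is with `φ (x', y')` times its total mass,
  -- which tends to `1`.
  have bound : ∀ τ : ℝ, 0 < τ → ‖(∫ p, φ p * (heat ω τ p x' y' : ℂ))
      - φ (x', y') * ((√(Real.exp (ω * τ) / Real.cosh (ω * τ))
      * Real.exp (-(ω * Real.sinh (ω * τ) / (2 * Real.cosh (ω * τ)) * y' ^ 2)) : ℝ) : ℂ)‖ ≤ D τ := by
    intro τ hτ
    have hs := sinh_mul_pos hω hτ
    have hc := Real.cosh_pos (ω * τ)
    have hi : Integrable fun p => φ p * (heat ω τ p x' y' : ℂ) :=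
      h.integrable_mul (Complex.continuous_ofReal.comp (continuous_heat ω τ x' y'))
    have hi' : Integrable fun p => φ (x', y') * (heat ω τ p x' y' : ℂ) :=
      (integrable_heat hω hτ x' y').ofReal.const_mul _
    rw [← integral_heat hω hτ x' y', ← integral_complex_ofReal, ← integral_const_mul,
      ← integral_sub hi hi']
    have hb (p : ℝ × ℝ) : ‖φ p * (heat ω τ p x' y' : ℂ) - φ (x', y') * (heat ω τ p x' y' : ℂ)‖
        ≤ L * (√τ + √(Real.sinh (ω * τ) / (ω * Real.cosh (ω * τ)))
          + |y'| * |1 - 1 / Real.cosh (ω * τ)|) * heatMaj ω τ p x' y' := by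
      rw [← sub_mul, norm_mul, Complex.norm_real, Real.norm_of_nonneg (heat_pos hω hτ _ _ _).le]
      have h1 : ‖φ p - φ (x', y')‖ ≤ L * (|p.1 - x'| + |p.2 - y' / Real.cosh (ω * τ)|
          + |y'| * |1 - 1 / Real.cosh (ω * τ)|) := by
        have := hL.dist_le_mul p (x', y')
        rw [dist_eq_norm, Prod.dist_eq] at this
        refine this.trans ?_
        gcongr
        simp only [Real.dist_eq]
        have h2 : |p.2 - y'| ≤ |p.2 - y' / Real.cosh (ω * τ)|
            + |y'| * |1 - 1 / Real.cosh (ω * τ)| := by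
          have : p.2 - y' = (p.2 - y' / Real.cosh (ω * τ)) - y' * (1 - 1 / Real.cosh (ω * τ)) := by
            ring
          rw [this, ← abs_mul]
          exact abs_sub _ _
        have h3 := abs_nonneg (p.1 - x')
        have h4 := abs_nonneg (p.2 - y')
        refine max_le ?_ ?_ <;> nlinarith
      have b1 := abs_x_mul_heat_le hω hτ p x' y'
      have b2 := abs_w_mul_heat_le hω hτ p x' y'
      rw [← Real.sqrt_inv, inv_div] at b2
      have b3 := heat_le_heatMaj hω hτ p x' y'
      have hh := (heat_pos hω hτ p x' y').le
      calc _ ≤ L * (|p.1 - x'| + |p.2 - y' / Real.cosh (ω * τ)|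
          + |y'| * |1 - 1 / Real.cosh (ω * τ)|) * heat ω τ p x' y' := by gcongr
        _ = L * (|p.1 - x'| * heat ω τ p x' y' + |p.2 - y' / Real.cosh (ω * τ)| * heat ω τ p x' y'
          + |y'| * |1 - 1 / Real.cosh (ω * τ)| * heat ω τ p x' y') := by ring
        _ ≤ L * (√τ * heatMaj ω τ p x' y'
          + √(Real.sinh (ω * τ) / (ω * Real.cosh (ω * τ))) * heatMaj ω τ p x' y'
          + |y'| * |1 - 1 / Real.cosh (ω * τ)| * heatMaj ω τ p x' y') := by gcongr
        _ = _ := by ring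
    refine (norm_integral_le_of_norm_le ((integrable_heatMaj hω hτ x' y').const_mul _)
      (Eventually.of_forall hb)).trans ?_
    rw [integral_const_mul]
    have := integral_heatMaj_le hω hτ x' y'
    have hL0 : (0 : ℝ) ≤ L := L.2
    simp only [D]
    calc _ ≤ L * (√τ + √(Real.sinh (ω * τ) / (ω * Real.cosh (ω * τ)))
          + |y'| * |1 - 1 / Real.cosh (ω * τ)|) * 4 := by gcongr
      _ = _ := by ring
  have l2 := squeeze_zero_norm' (f := fun τ => (∫ p, φ p * (heat ω τ p x' y' : ℂ))
      - φ (x', y') * ((√(Real.exp (ω * τ) / Real.cosh (ω * τ))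
      * Real.exp (-(ω * Real.sinh (ω * τ) / (2 * Real.cosh (ω * τ)) * y' ^ 2)) : ℝ) : ℂ))
    (a := D) (eventually_nhdsWithin_of_forall bound) dlim
  have l3 : Tendsto (fun τ => φ (x', y') * ((√(Real.exp (ω * τ) / Real.cosh (ω * τ))
      * Real.exp (-(ω * Real.sinh (ω * τ) / (2 * Real.cosh (ω * τ)) * y' ^ 2)) : ℝ) : ℂ))
      (𝓝[>] 0) (𝓝 (φ (x', y') * ((1 : ℝ) : ℂ))) :=
    ((Complex.continuous_ofReal.tendsto _).comp m1).const_mul _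
  have l4 := l2.add l3
  simp only [sub_add_cancel, zero_add, Complex.ofReal_one, mul_one] at l4
  exact l4

theorem IsTest.exists_bound {φ : ℝ × ℝ → ℂ} (h : IsTest φ) : ∃ C, ∀ p, ‖φ p‖ ≤ C :=
  h.compact.exists_bound_of_continuous h.smooth.continuous

theorem measurable_heat (ω : ℝ) :
    Measurable (fun z : ℝ × (ℝ × ℝ) × ℝ × ℝ => heat ω z.1 z.2.1 z.2.2.1 z.2.2.2) := by
  unfold heat mehlerExp heatCoef
  fun_prop

theorem norm_integral_heat_le {ω : ℝ} (hω : 0 < ω) {φ : ℝ × ℝ → ℂ} {C : ℝ}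
    (hC : ∀ p, ‖φ p‖ ≤ C) (x' y' : ℝ) {τ : ℝ} (hτ : 0 < τ) :
    ‖∫ p, φ p * (heat ω τ p x' y' : ℂ)‖ ≤ C * 4 := by
  refine (norm_integral_le_of_norm_le ((integrable_heatMaj hω hτ x' y').const_mul C)
    (Eventually.of_forall fun p => ?_)).trans ?_
  · rw [norm_mul, Complex.norm_real, Real.norm_of_nonneg (heat_pos hω hτ _ _ _).le]
    have := heat_le_heatMaj hω hτ p x' y'
    have := heat_pos hω hτ p x' y'
    have := (norm_nonneg _).trans (hC p)
    gcongr
    exact hC p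
  · rw [integral_const_mul]
    have := (norm_nonneg _).trans (hC 0)
    gcongr
    exact integral_heatMaj_le hω hτ x' y'

theorem integrable_exp_mul_heat {ω lam : ℝ} (hω : 0 < ω) (hl : 0 < lam) {φ : ℝ × ℝ → ℂ}
    (h : IsTest φ) (x' y' : ℝ) :
    Integrable (fun z : ℝ × ℝ × ℝ => φ z.2 * ((Real.exp (-(lam * z.1)) * heat ω z.1 z.2 x' y' : ℝ) : ℂ))
      ((volume.restrict (Set.Ioi 0)).prod volume) := by
  obtain ⟨C, hC⟩ := h.exists_bound
  have hm : Measurable (fun z : ℝ × ℝ × ℝ =>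
      φ z.2 * ((Real.exp (-(lam * z.1)) * heat ω z.1 z.2 x' y' : ℝ) : ℂ)) := by
    have h1 : Measurable fun z : ℝ × ℝ × ℝ => heat ω z.1 z.2 x' y' :=
      (measurable_heat ω).comp (f := fun z : ℝ × ℝ × ℝ => (z.1, z.2, x', y')) (by fun_prop)
    have h2 := h.smooth.continuous.measurable
    fun_prop
  rw [integrable_prod_iff hm.aestronglyMeasurable]
  have hexp : IntegrableOn (fun τ => Real.exp (-(lam * τ))) (Set.Ioi 0) := by
    simpa [neg_mul] using exp_neg_integrableOn_Ioi 0 hl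
  refine ⟨?_, ?_⟩
  · filter_upwards [ae_restrict_mem measurableSet_Ioi] with τ hτ
    exact h.integrable_mul (f := fun p => ((Real.exp (-(lam * τ)) * heat ω τ p x' y' : ℝ) : ℂ))
      (Complex.continuous_ofReal.comp (continuous_const.mul (continuous_heat ω τ x' y')))
  · refine (hexp.mul_const (C * 4)).mono' hm.norm.aestronglyMeasurable.integral_prod_right' ?_
    filter_upwards [ae_restrict_mem measurableSet_Ioi] with τ hτ
    rw [Real.norm_of_nonneg (integral_nonneg fun _ => norm_nonneg _)]
    have hC0 := (norm_nonneg _).trans (hC 0)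
    calc _ ≤ ∫ p, Real.exp (-(lam * τ)) * (C * heatMaj ω τ p x' y') := by
          refine integral_mono_of_nonneg (Eventually.of_forall fun _ => norm_nonneg _)
            (((integrable_heatMaj hω hτ x' y').const_mul C).const_mul _)
            (Eventually.of_forall fun p => ?_)
          simp only [norm_mul, Complex.norm_real]
          rw [Real.norm_of_nonneg (heat_pos hω hτ _ _ _).le, Real.norm_of_nonneg (Real.exp_pos _).le,
            mul_left_comm]
          have := heat_le_heatMaj hω hτ p x' y'
          have := heat_pos hω hτ p x' y'
          gcongr
          exact hC p
      _ ≤ _ := by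
          rw [integral_const_mul, integral_const_mul]
          gcongr
          exact integral_heatMaj_le hω hτ _ _

/-- The Laplace transform of the heat kernel is a fundamental solution. -/
theorem integral_integral_freeHam_mul_heat {ω lam : ℝ} (hω : 0 < ω) (hl : 0 < lam)
    {φ : ℝ × ℝ → ℂ} (h : IsTest φ) (x' y' : ℝ) :
    ∫ τ in Set.Ioi 0, (∫ p, (freeHam ω φ p + lam * φ p)
      * ((Real.exp (-(lam * τ)) * heat ω τ p x' y' : ℝ) : ℂ)) = φ (x', y') := by
  have hD : IsTest (fun p => freeHam ω φ p + lam * φ p) := (h.freeHam ω).add (h.smul (lam : ℂ))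
  have hint := integrable_exp_mul_heat hω hl hD x' y'
  set Φ : ℝ → ℂ := fun τ => ∫ p, φ p * (heat ω τ p x' y' : ℂ) with hΦ
  have hi (τ : ℝ) {ψ : ℝ × ℝ → ℂ} (hψ : IsTest ψ) :
      Integrable fun p => ψ p * (heat ω τ p x' y' : ℂ) :=
    hψ.integrable_mul (Complex.continuous_ofReal.comp (continuous_heat ω τ x' y'))
  have e2 (τ : ℝ) : ∫ p, (freeHam ω φ p + lam * φ p)
        * ((Real.exp (-(lam * τ)) * heat ω τ p x' y' : ℝ) : ℂ)
      = -((Real.exp (-(lam * τ)) * (-lam) : ℝ) * Φ τ + (Real.exp (-(lam * τ)) : ℝ) *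
        (- ∫ p, freeHam ω φ p * (heat ω τ p x' y' : ℂ))) := by
    have : ∀ p, (freeHam ω φ p + lam * φ p) * ((Real.exp (-(lam * τ)) * heat ω τ p x' y' : ℝ) : ℂ)
        = (Real.exp (-(lam * τ)) : ℝ) * (freeHam ω φ p * (heat ω τ p x' y' : ℂ))
          + ((Real.exp (-(lam * τ)) : ℝ) * lam) * (φ p * (heat ω τ p x' y' : ℂ)) := fun p => by
      push_cast; ring
    simp_rw [this]
    rw [integral_add ((hi τ (h.freeHam ω)).const_mul _) ((hi τ h).const_mul _),
      integral_const_mul, integral_const_mul, hΦ]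
    push_cast
    ring
  obtain ⟨C, hC⟩ := h.exists_bound
  -- The integrand is `-f'` for `f τ = exp (-lam τ) ∫ φ heat`. The value of `f` at `0` is set to the
  -- limit `φ (x', y')`, so that the fundamental theorem applies on the closed half line.
  let f : ℝ → ℂ := fun τ => if τ ≤ 0 then φ (x', y') else (Real.exp (-(lam * τ)) : ℝ) * Φ τ
  have hder : ∀ τ ∈ Set.Ioi (0 : ℝ), HasDerivAt f ((Real.exp (-(lam * τ)) * (-lam) : ℝ) * Φ τ
      + (Real.exp (-(lam * τ)) : ℝ) * (- ∫ p, freeHam ω φ p * (heat ω τ p x' y' : ℂ))) τ := by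
    intro τ hτ
    have hd1 : HasDerivAt (fun τ => Real.exp (-(lam * τ))) (Real.exp (-(lam * τ)) * (-lam)) τ := by
      simpa using (((hasDerivAt_id τ).const_mul lam).neg.exp)
    refine (hd1.ofReal_comp.mul (hasDerivAt_integral_heat hω h x' y' hτ)).congr_of_eventuallyEq ?_
    filter_upwards [Ioi_mem_nhds hτ] with t ht
    simp only [f, if_neg (not_le.2 (Set.mem_Ioi.1 ht))]
    rfl
  have hcont : ContinuousWithinAt f (Set.Ici 0) 0 := by
    have h1 : Tendsto (fun τ : ℝ => ((Real.exp (-(lam * τ)) : ℝ) : ℂ)) (𝓝[>] 0) (𝓝 1) := by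
      have : Continuous fun τ : ℝ => ((Real.exp (-(lam * τ)) : ℝ) : ℂ) := by fun_prop
      have := (this.tendsto 0).mono_left (nhdsWithin_le_nhds (s := Set.Ioi 0))
      simpa using this
    have h2 := h1.mul (tendsto_integral_heat hω h x' y')
    rw [one_mul] at h2
    have h3 : ContinuousWithinAt f (Set.Ioi 0) 0 := by
      have hf0 : f 0 = φ (x', y') := by simp [f]
      rw [ContinuousWithinAt, hf0]
      refine h2.congr' ?_
      filter_upwards [self_mem_nhdsWithin] with t ht
      simp only [f, if_neg (not_le.2 (Set.mem_Ioi.1 ht)), hΦ]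
    exact continuousWithinAt_Ioi_iff_Ici.1 h3
  have hinf : Tendsto f atTop (𝓝 0) := by
    have h1 : Tendsto (fun τ : ℝ => Real.exp (-(lam * τ)) * (C * 4)) atTop (𝓝 0) := by
      have := (Real.tendsto_exp_neg_atTop_nhds_zero.comp
        (tendsto_id.const_mul_atTop hl)).mul_const (C * 4)
      simpa using this
    refine squeeze_zero_norm' ?_ h1
    filter_upwards [eventually_gt_atTop 0] with t ht
    simp only [f, if_neg (not_le.2 ht), norm_mul, Complex.norm_real]
    rw [Real.norm_of_nonneg (Real.exp_pos _).le]
    gcongr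
    exact norm_integral_heat_le hω hC x' y' ht
  have hfin := integral_Ioi_of_hasDerivAt_of_tendsto hcont hder ?_ hinf
  · simp_rw [e2]
    rw [integral_neg, hfin]
    simp [f]
  · have := hint.integral_prod_left
    simp only [e2] at this
    refine this.neg.congr (Eventually.of_forall fun τ => ?_)
    simp only [Pi.neg_apply, neg_neg]


/-! ### Schur test for kernels integrated over time -/

theorem lintegral_mul_sq_le {β : Type*} [MeasurableSpace β] {μ : Measure β} {f g : β → ℝ≥0∞}
    (hf : AEMeasurable f μ) (hg : AEMeasurable g μ) :
    (∫⁻ x, f x * g x ∂μ) ^ 2 ≤ (∫⁻ x, f x ^ 2 ∂μ) * ∫⁻ x, g x ^ 2 ∂μ := by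
  have h := ENNReal.lintegral_mul_le_Lp_mul_Lq μ Real.HolderConjugate.two_two hf hg
  simp only [Pi.mul_apply] at h
  have h2 := pow_le_pow_left₀ zero_le h 2
  refine h2.trans (le_of_eq ?_)
  rw [mul_pow, ← ENNReal.rpow_natCast, ← ENNReal.rpow_mul, ← ENNReal.rpow_natCast,
    ← ENNReal.rpow_mul]
  norm_num

/-- Cauchy–Schwarz for `f = c^(1/2) · c^(-1/2) f`. With `c` the norm bound of the time slices it
does the work of Minkowski's integral inequality. -/
theorem lintegral_sq_le_weighted {β : Type*} [MeasurableSpace β] {μ : Measure β} {f c : β → ℝ≥0∞}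
    (hf : AEMeasurable f μ) (hc : AEMeasurable c μ) (h0 : ∀ᵐ x ∂μ, c x ≠ 0)
    (h1 : ∀ᵐ x ∂μ, c x ≠ ∞) :
    (∫⁻ x, f x ∂μ) ^ 2 ≤ (∫⁻ x, c x ∂μ) * ∫⁻ x, (c x)⁻¹ * f x ^ 2 ∂μ := by
  have h := lintegral_mul_sq_le (μ := μ) (f := fun x => c x ^ (1 / 2 : ℝ))
    (g := fun x => (c x ^ (1 / 2 : ℝ))⁻¹ * f x) (hc.pow_const _) ((hc.pow_const _).inv.mul hf)
  have half (t : ℝ≥0∞) : (t ^ (1 / 2 : ℝ)) ^ 2 = t := by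
    rw [← ENNReal.rpow_natCast, ← ENNReal.rpow_mul]; norm_num
  simp only [mul_pow, half, ← ENNReal.inv_pow] at h
  refine le_trans (le_of_eq ?_) h
  congr 1
  refine lintegral_congr_ae ?_
  filter_upwards [h0, h1] with x hx0 hx1
  rw [← mul_assoc, ENNReal.mul_inv_cancel, one_mul]
  · simpa using hx0
  · simp [hx1]

theorem lintegral_sq_le_kernel {β : Type*} [MeasurableSpace β] {μ : Measure β} {k g : β → ℝ≥0∞}
    (hk : AEMeasurable k μ) (hg : AEMeasurable g μ) :
    (∫⁻ x, k x * g x ∂μ) ^ 2 ≤ (∫⁻ x, k x ∂μ) * ∫⁻ x, k x * g x ^ 2 ∂μ := by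
  have h := lintegral_mul_sq_le (μ := μ) (f := fun x => k x ^ (1 / 2 : ℝ))
    (g := fun x => k x ^ (1 / 2 : ℝ) * g x) (hk.pow_const _) ((hk.pow_const _).mul hg)
  have half (t : ℝ≥0∞) : (t ^ (1 / 2 : ℝ)) ^ 2 = t := by
    rw [← ENNReal.rpow_natCast, ← ENNReal.rpow_mul]; norm_num
  simp only [mul_pow, half, ← mul_assoc, ← sq] at h
  exact h

/-- The Schur test. -/
theorem lintegral_schur {P β : Type*} [MeasurableSpace P] [MeasurableSpace β] {μ : Measure P}
    {ν : Measure β} [SFinite μ] [SFinite ν] {k : P → β → ℝ≥0∞} (hk : Measurable (Function.uncurry k))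
    {g : β → ℝ≥0∞} (hg : Measurable g) {A B : ℝ≥0∞} (hA : ∀ p, ∫⁻ x, k p x ∂ν ≤ A)
    (hB : ∀ x, ∫⁻ p, k p x ∂μ ≤ B) :
    ∫⁻ p, (∫⁻ x, k p x * g x ∂ν) ^ 2 ∂μ ≤ A * B * ∫⁻ x, g x ^ 2 ∂ν := by
  calc ∫⁻ p, (∫⁻ x, k p x * g x ∂ν) ^ 2 ∂μ
      ≤ ∫⁻ p, A * ∫⁻ x, k p x * g x ^ 2 ∂ν ∂μ := by
        refine lintegral_mono fun p => ?_
        refine (lintegral_sq_le_kernel (hk.of_uncurry_left).aemeasurable hg.aemeasurable).trans ?_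
        gcongr
        exact hA p
    _ = A * ∫⁻ p, ∫⁻ x, k p x * g x ^ 2 ∂ν ∂μ := by
        refine lintegral_const_mul _ ?_
        exact (hk.mul ((hg.comp measurable_snd).pow_const 2)).lintegral_prod_right'
    _ = A * ∫⁻ x, ∫⁻ p, k p x * g x ^ 2 ∂μ ∂ν := by
        rw [lintegral_lintegral_swap]
        exact (hk.mul ((hg.comp measurable_snd).pow_const 2)).aemeasurable
    _ = A * ∫⁻ x, (∫⁻ p, k p x ∂μ) * g x ^ 2 ∂ν := by
        congr 1
        refine lintegral_congr fun x => ?_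
        rw [lintegral_mul_const _ hk.of_uncurry_right]
    _ ≤ A * ∫⁻ x, B * g x ^ 2 ∂ν := by
        gcongr with x
        exact hB x
    _ = A * B * ∫⁻ x, g x ^ 2 ∂ν := by
        rw [lintegral_const_mul _ (hg.pow_const 2), mul_assoc]

/-- The measure `dτ dx'` on `(0, ∞) × ℝ`. -/
abbrev timeLine : Measure (ℝ × ℝ) := (volume.restrict (Set.Ioi (0 : ℝ))).prod volume

/-- A family of kernels satisfying Schur bounds which are integrable in time. -/
structure SchurFamily {P : Type*} [MeasurableSpace P] (μ : Measure P) (a : ℝ → P → ℝ → ℝ)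
    (C : ℝ → ℝ) : Prop where
  meas : Measurable fun w : P × ℝ × ℝ => a w.2.1 w.1 w.2.2
  pos : ∀ τ, 0 < τ → 0 < C τ
  int : IntegrableOn C (Set.Ioi 0)
  bound : ∀ τ, 0 < τ → ∃ A B : ℝ, 0 ≤ A ∧ 0 ≤ B ∧
    (∀ p, ∫⁻ x', ‖a τ p x'‖ₑ ≤ ENNReal.ofReal A) ∧
    (∀ x', ∫⁻ p, ‖a τ p x'‖ₑ ∂μ ≤ ENNReal.ofReal B) ∧ A * B ≤ C τ ^ 2

namespace SchurFamily

variable {P : Type*} [MeasurableSpace P] {μ : Measure P} {a : ℝ → P → ℝ → ℝ}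
  {C : ℝ → ℝ}

theorem measurable_integrand (h : SchurFamily μ a C) (q : L2Line) :
    StronglyMeasurable fun w : P × ℝ × ℝ => (a w.2.1 w.1 w.2.2 : ℂ) * q w.2.2 :=
  ((Complex.measurable_ofReal.comp h.meas).mul ((Lp.stronglyMeasurable q).measurable.comp
    (measurable_snd.comp measurable_snd))).stronglyMeasurable

theorem lintegral_sq_eq {β : Type*} [MeasurableSpace β] {ν : Measure β} (f : Lp ℂ 2 ν) :
    ∫⁻ x, ‖f x‖ₑ ^ 2 ∂ν = ‖f‖ₑ ^ 2 := by
  rw [Lp.enorm_def, eLpNorm_eq_lintegral_rpow_enorm_toReal (by simp) (by simp),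
    ← ENNReal.rpow_natCast, ← ENNReal.rpow_mul]
  norm_num

theorem enorm_int (h : SchurFamily μ a C) :
    ∫⁻ τ in Set.Ioi 0, ENNReal.ofReal (C τ) = ENNReal.ofReal (∫ τ in Set.Ioi 0, C τ) := by
  rw [ofReal_integral_eq_lintegral_ofReal h.int]
  filter_upwards [ae_restrict_mem measurableSet_Ioi] with τ hτ using (h.pos τ hτ).le

variable [SFinite μ]

/-- The slice at time `τ` has norm at most `C τ` by Schur's test. Cauchy–Schwarz in time with weight
`C` gives one factor `∫ C`; the weight `1 / C` against `C²` gives the other. -/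
theorem lintegral_le (h : SchurFamily μ a C) {g : ℝ → ℝ≥0∞} (hg : Measurable g) :
    ∫⁻ p, (∫⁻ z, ‖a z.1 p z.2‖ₑ * g z.2 ∂timeLine) ^ 2 ∂μ
      ≤ (∫⁻ τ in Set.Ioi 0, ENNReal.ofReal (C τ)) ^ 2 * ∫⁻ x, g x ^ 2 := by
  have hm : Measurable fun w : P × ℝ × ℝ => ‖a w.2.1 w.1 w.2.2‖ₑ * g w.2.2 :=
    h.meas.enorm.mul (hg.comp (measurable_snd.comp measurable_snd))
  have hmF : Measurable fun w : P × ℝ => ∫⁻ x', ‖a w.2 w.1 x'‖ₑ * g x' := by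
    have : Measurable fun w : (P × ℝ) × ℝ => ‖a w.1.2 w.1.1 w.2‖ₑ * g w.2 :=
      hm.comp (f := fun w : (P × ℝ) × ℝ => (w.1.1, w.1.2, w.2)) (by fun_prop)
    exact this.lintegral_prod_right'
  have hC : AEMeasurable (fun τ => ENNReal.ofReal (C τ)) (volume.restrict (Set.Ioi 0)) :=
    h.int.aemeasurable.ennreal_ofReal
  -- `C` is only almost everywhere measurable; a measurable version is needed to pull weights
  -- through the integrals.
  obtain ⟨C', hC'm, hC'e⟩ := hC
  set M := ∫⁻ τ in Set.Ioi 0, ENNReal.ofReal (C τ) with hM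
  have hM' : M = ∫⁻ τ in Set.Ioi 0, C' τ := lintegral_congr_ae hC'e
  have hpos : ∀ᵐ τ ∂(volume.restrict (Set.Ioi (0 : ℝ))), C' τ ≠ 0 := by
    filter_upwards [ae_restrict_mem measurableSet_Ioi, hC'e] with τ hτ e
    rw [← e]; simpa using h.pos τ hτ
  have hfin : ∀ᵐ τ ∂(volume.restrict (Set.Ioi (0 : ℝ))), C' τ ≠ ∞ := by
    filter_upwards [hC'e] with τ e
    rw [← e]; simp
  calc _ = ∫⁻ p, (∫⁻ τ in Set.Ioi 0, ∫⁻ x', ‖a τ p x'‖ₑ * g x') ^ 2 ∂μ := by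
        refine lintegral_congr fun p => ?_
        rw [lintegral_prod]
        exact (hm.comp (f := fun z : ℝ × ℝ => (p, z)) (by fun_prop)).aemeasurable
    _ ≤ ∫⁻ p, M * (∫⁻ τ in Set.Ioi 0, (C' τ)⁻¹ * (∫⁻ x', ‖a τ p x'‖ₑ * g x') ^ 2) ∂μ := by
        refine lintegral_mono fun p => ?_
        rw [hM']
        exact lintegral_sq_le_weighted
          (hmF.comp (f := fun τ : ℝ => (p, τ)) (by fun_prop)).aemeasurable
          hC'm.aemeasurable hpos hfin
    _ = M * ∫⁻ p, (∫⁻ τ in Set.Ioi 0, (C' τ)⁻¹ * (∫⁻ x', ‖a τ p x'‖ₑ * g x') ^ 2) ∂μ := by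
        refine lintegral_const_mul _ ?_
        exact (((hC'm.comp measurable_snd).inv).mul (hmF.pow_const 2)).lintegral_prod_right'
    _ = M * ∫⁻ τ in Set.Ioi 0, ∫⁻ p, (C' τ)⁻¹ * (∫⁻ x', ‖a τ p x'‖ₑ * g x') ^ 2 ∂μ := by
        rw [lintegral_lintegral_swap]
        exact (((hC'm.comp measurable_snd).inv).mul (hmF.pow_const 2)).aemeasurable
    _ = M * ∫⁻ τ in Set.Ioi 0, (C' τ)⁻¹ * ∫⁻ p, (∫⁻ x', ‖a τ p x'‖ₑ * g x') ^ 2 ∂μ := by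
        congr 1
        refine lintegral_congr fun τ => ?_
        rw [lintegral_const_mul]
        exact (hmF.comp (f := fun p => (p, τ)) (by fun_prop)).pow_const 2
    _ ≤ M * ∫⁻ τ in Set.Ioi 0, C' τ * ∫⁻ x, g x ^ 2 := by
        gcongr M * ?_
        refine lintegral_mono_ae ?_
        filter_upwards [ae_restrict_mem measurableSet_Ioi, hC'e, hpos, hfin] with τ hτ e e0 e1
        obtain ⟨A, B, hA0, hB0, hA, hB, hAB⟩ := h.bound τ hτ
        have hs := lintegral_schur (μ := μ) (ν := volume) (k := fun p x' => ‖a τ p x'‖ₑ)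
          ((h.meas.comp (f := fun w : P × ℝ => (w.1, τ, w.2)) (by fun_prop)).enorm) hg hA hB
        have hAB' : ENNReal.ofReal A * ENNReal.ofReal B ≤ C' τ ^ 2 := by
          rw [← e, ← ENNReal.ofReal_mul hA0, ← ENNReal.ofReal_pow (h.pos τ hτ).le]
          exact ENNReal.ofReal_le_ofReal hAB
        calc _ ≤ (C' τ)⁻¹ * (C' τ ^ 2 * ∫⁻ x, g x ^ 2) := by
              gcongr
              exact hs.trans (by gcongr)
          _ = _ := by
              rw [sq (C' τ), ← mul_assoc, ← mul_assoc, ENNReal.inv_mul_cancel e0 e1, one_mul]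
    _ = _ := by
        rw [lintegral_mul_const _ hC'm, ← hM', sq, mul_assoc]

/-- The function `p ↦ ∫ a q`. -/
def fn (_ : SchurFamily μ a C) (q : L2Line) (p : P) : ℂ :=
  ∫ z, (a z.1 p z.2 : ℂ) * q z.2 ∂timeLine

theorem lintegral_fn_le (h : SchurFamily μ a C) (q : L2Line) :
    ∫⁻ p, (∫⁻ z, ‖(a z.1 p z.2 : ℂ) * q z.2‖ₑ ∂timeLine) ^ 2 ∂μ
      ≤ (ENNReal.ofReal (∫ τ in Set.Ioi 0, C τ) * ‖q‖ₑ) ^ 2 := by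
  have := h.lintegral_le (g := fun x => ‖q x‖ₑ) (Lp.stronglyMeasurable q).measurable.enorm
  rw [h.enorm_int, lintegral_sq_eq, ← mul_pow] at this
  refine le_trans (le_of_eq ?_) this
  simp only [enorm_mul]
  have e (r : ℝ) : ‖(r : ℂ)‖ₑ = ‖r‖ₑ := by
    rw [← ofReal_norm, ← ofReal_norm, Complex.norm_real]
  simp only [e]

theorem memLp_fn (h : SchurFamily μ a C) (q : L2Line) : MemLp (h.fn q) 2 μ ∧
    eLpNorm (h.fn q) 2 μ ≤ ENNReal.ofReal (∫ τ in Set.Ioi 0, C τ) * ‖q‖ₑ := by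
  have hm : AEStronglyMeasurable (h.fn q) μ :=
    ((h.measurable_integrand q).integral_prod_right' (ν := timeLine)).aestronglyMeasurable
  have hb : eLpNorm (h.fn q) 2 μ ≤ ENNReal.ofReal (∫ τ in Set.Ioi 0, C τ) * ‖q‖ₑ := by
    rw [eLpNorm_eq_lintegral_rpow_enorm_toReal (by simp) (by simp)]
    have h1 : ∫⁻ p, ‖h.fn q p‖ₑ ^ (2 : ℝ) ∂μ
        ≤ (ENNReal.ofReal (∫ τ in Set.Ioi 0, C τ) * ‖q‖ₑ) ^ (2 : ℝ) := by
      rw [ENNReal.rpow_two]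
      refine le_trans (lintegral_mono fun p => ?_) (h.lintegral_fn_le q)
      rw [ENNReal.rpow_two]
      gcongr
      exact enorm_integral_le_lintegral_enorm _
    have h2 := ENNReal.rpow_le_rpow h1 (z := 1 / 2) (by norm_num)
    rw [← ENNReal.rpow_mul] at h2
    norm_num at h2 ⊢
    exact h2
  exact ⟨⟨hm, hb.trans_lt (ENNReal.mul_lt_top ENNReal.ofReal_lt_top enorm_lt_top)⟩, hb⟩

theorem ae_integrable (h : SchurFamily μ a C) (q : L2Line) :
    ∀ᵐ p ∂μ, Integrable (fun z => (a z.1 p z.2 : ℂ) * q z.2) timeLine := by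
  have hlt := (h.lintegral_fn_le q).trans_lt (ENNReal.pow_lt_top
    (ENNReal.mul_lt_top ENNReal.ofReal_lt_top enorm_lt_top))
  have hm := (h.measurable_integrand q).measurable
  have := ae_lt_top ((hm.enorm.lintegral_prod_right' (ν := timeLine)).pow_const 2) hlt.ne
  filter_upwards [this] with p hp
  refine ⟨(hm.comp (f := fun z : ℝ × ℝ => (p, z)) (by fun_prop)).aestronglyMeasurable, ?_⟩
  by_contra hcon
  rw [HasFiniteIntegral, not_lt, top_le_iff] at hcon
  simp only [hcon] at hp
  simp at hp

/-- The operator with kernel `∫ a dτ`. -/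
def op (h : SchurFamily μ a C) : L2Line →L[ℂ] Lp ℂ 2 μ :=
  LinearMap.mkContinuous
    { toFun := fun q => (h.memLp_fn q).1.toLp _
      map_add' := fun q r => by
        rw [← MemLp.toLp_add, MemLp.toLp_eq_toLp_iff]
        filter_upwards [h.ae_integrable q, h.ae_integrable r] with p h1 h2
        simp only [fn, Pi.add_apply]
        rw [← integral_add h1 h2]
        refine integral_congr_ae ?_
        have := Measure.quasiMeasurePreserving_snd.ae (μa := timeLine) (Lp.coeFn_add q r)
        filter_upwards [this] with z hz
        rw [hz, Pi.add_apply, mul_add]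
      map_smul' := fun c q => by
        rw [RingHom.id_apply, ← MemLp.toLp_const_smul, MemLp.toLp_eq_toLp_iff]
        filter_upwards with p
        simp only [fn, Pi.smul_apply, smul_eq_mul]
        rw [← integral_const_mul]
        refine integral_congr_ae ?_
        have := Measure.quasiMeasurePreserving_snd.ae (μa := timeLine) (Lp.coeFn_smul c q)
        filter_upwards [this] with z hz
        rw [hz, Pi.smul_apply, smul_eq_mul]
        ring }
    (∫ τ in Set.Ioi 0, C τ) fun q => by
      have h1 := (h.memLp_fn q).2
      have h0 : 0 ≤ ∫ τ in Set.Ioi 0, C τ :=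
        setIntegral_nonneg measurableSet_Ioi fun τ hτ => (h.pos τ hτ).le
      change ‖(h.memLp_fn q).1.toLp _‖ ≤ _
      rw [Lp.norm_toLp]
      refine (ENNReal.toReal_mono (ENNReal.mul_ne_top ENNReal.ofReal_ne_top enorm_ne_top) h1).trans
        (le_of_eq ?_)
      rw [ENNReal.toReal_mul, ENNReal.toReal_ofReal h0, toReal_enorm]

theorem op_ae (h : SchurFamily μ a C) (q : L2Line) :
    ∀ᵐ p ∂μ, h.op q p = ∫ z, (a z.1 p z.2 : ℂ) * q z.2 ∂timeLine :=
  (h.memLp_fn q).1.coeFn_toLp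

theorem norm_op_le (h : SchurFamily μ a C) : ‖h.op‖ ≤ ∫ τ in Set.Ioi 0, C τ :=
  LinearMap.mkContinuous_norm_le _
    (setIntegral_nonneg measurableSet_Ioi fun τ hτ => (h.pos τ hτ).le) _

/-- `lintegral_fn_le` bounds the integral with absolute values inside, so Cauchy–Schwarz against `η`
gives absolute convergence in all variables. -/
theorem integrable_triple (h : SchurFamily μ a C) (η : Lp ℂ 2 μ) (q : L2Line) :
    Integrable (fun w : P × ℝ × ℝ => starRingEnd ℂ (η w.1) * ((a w.2.1 w.1 w.2.2 : ℂ) * q w.2.2))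
      (μ.prod timeLine) := by
  have hmη : Measurable η := (Lp.stronglyMeasurable η).measurable
  have hm : Measurable (fun w : P × ℝ × ℝ =>
      starRingEnd ℂ (η w.1) * ((a w.2.1 w.1 w.2.2 : ℂ) * q w.2.2)) :=
    ((Complex.continuous_conj.measurable.comp hmη).comp measurable_fst).mul
      (h.measurable_integrand q).measurable
  refine ⟨hm.aestronglyMeasurable, ?_⟩
  have hmi := (h.measurable_integrand q).measurable.enorm
  rw [HasFiniteIntegral, lintegral_prod _ hm.enorm.aemeasurable]
  have e (p : P) : ∫⁻ z, ‖starRingEnd ℂ (η p) * ((a z.1 p z.2 : ℂ) * q z.2)‖ₑ ∂timeLine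
      = ‖η p‖ₑ * ∫⁻ z, ‖(a z.1 p z.2 : ℂ) * q z.2‖ₑ ∂timeLine := by
    rw [← lintegral_const_mul]
    · refine lintegral_congr fun z => ?_
      rw [enorm_mul, RCLike.enorm_conj]
    · exact hmi.comp (f := fun z : ℝ × ℝ => (p, z)) (by fun_prop)
  simp only [e]
  have hcs := lintegral_mul_sq_le (μ := μ) (f := fun p => ‖η p‖ₑ)
    (g := fun p => ∫⁻ z, ‖(a z.1 p z.2 : ℂ) * q z.2‖ₑ ∂timeLine)
    hmη.enorm.aemeasurable (hmi.lintegral_prod_right' (ν := timeLine)).aemeasurable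
  have hlt := (h.lintegral_fn_le q).trans_lt (ENNReal.pow_lt_top
    (ENNReal.mul_lt_top ENNReal.ofReal_lt_top enorm_lt_top))
  rw [lintegral_sq_eq] at hcs
  have := hcs.trans_lt (ENNReal.mul_lt_top (ENNReal.pow_lt_top enorm_lt_top) hlt)
  by_contra hcon
  rw [not_lt, top_le_iff] at hcon
  rw [hcon] at this
  simp at this

/-- By Fubini a pairing with the operator is an integral, over time and charge, of pairings with
single kernels. Identities for one heat kernel thus pass to potentials. -/
theorem inner_op (h : SchurFamily μ a C) (η : Lp ℂ 2 μ) (q : L2Line) :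
    inner ℂ η (h.op q)
      = ∫ z, (∫ p, starRingEnd ℂ (η p) * (a z.1 p z.2 : ℂ) ∂μ) * q z.2 ∂timeLine := by
  have hsw := integral_integral_swap (f := fun (p : P) (z : ℝ × ℝ) =>
    starRingEnd ℂ (η p) * ((a z.1 p z.2 : ℂ) * q z.2)) (h.integrable_triple η q)
  rw [L2.inner_def]
  calc _ = ∫ p, (∫ z, starRingEnd ℂ (η p) * ((a z.1 p z.2 : ℂ) * q z.2) ∂timeLine) ∂μ := by
        refine integral_congr_ae ?_
        filter_upwards [h.op_ae q] with p hp
        rw [hp, integral_const_mul, RCLike.inner_apply, mul_comm]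
    _ = _ := by
        rw [hsw]
        refine integral_congr_ae (Eventually.of_forall fun z => ?_)
        simp only
        rw [← integral_mul_const]
        refine integral_congr_ae (Eventually.of_forall fun p => ?_)
        simp only
        ring

theorem integrable_inner (h : SchurFamily μ a C) (η : Lp ℂ 2 μ) (q : L2Line) :
    Integrable (fun z => (∫ p, starRingEnd ℂ (η p) * (a z.1 p z.2 : ℂ) ∂μ) * q z.2) timeLine := by
  refine (h.integrable_triple η q).integral_prod_right.congr (Eventually.of_forall fun z => ?_)
  simp only
  rw [← integral_mul_const]
  refine integral_congr_ae (Eventually.of_forall fun p => ?_)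
  simp only
  ring

end SchurFamily

/-! ### Schur bounds for the potential, its derivatives, its product with `y` and its trace -/

theorem integrableOn_exp_mul_rpow {lam s : ℝ} (hl : 0 < lam) (hs : -1 < s) :
    IntegrableOn (fun τ : ℝ => Real.exp (-(lam * τ)) * τ ^ s) (Set.Ioi 0) := by
  have := integrableOn_rpow_mul_exp_neg_mul_rpow (p := 1) (s := s) (b := lam) hs one_pos hl
  refine this.congr_fun (fun τ _ => ?_) measurableSet_Ioi
  simp only [Real.rpow_one]
  rw [mul_comm, neg_mul]

theorem integrableOn_exp_mul {lam : ℝ} (hl : 0 < lam) :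
    IntegrableOn (fun τ : ℝ => Real.exp (-(lam * τ))) (Set.Ioi 0) := by
  simpa [neg_mul] using exp_neg_integrableOn_Ioi 0 hl

theorem integrableOn_weight {lam : ℝ} (hl : 0 < lam) (M : ℝ) {s : ℝ} (hs0 : 0 ≤ s) (hs1 : s < 1) :
    IntegrableOn (fun τ : ℝ => M * (Real.exp (-(lam * τ)) * (1 + 1 / τ) ^ s)) (Set.Ioi 0) := by
  have h1 : IntegrableOn (fun τ : ℝ => Real.exp (-(lam * τ)) + Real.exp (-(lam * τ)) * τ ^ (-s))
      (Set.Ioi 0) := (integrableOn_exp_mul hl).add (integrableOn_exp_mul_rpow hl (by linarith))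
  refine (h1.mono' (by fun_prop) ?_).const_mul M
  filter_upwards [ae_restrict_mem measurableSet_Ioi] with τ hτ
  have hτ' : (0 : ℝ) < τ := hτ
  rw [Real.norm_of_nonneg (by positivity)]
  have := Real.rpow_add_le_add_rpow (a := 1) (b := 1 / τ) (by norm_num) (by positivity) hs0 hs1.le
  rw [Real.one_rpow, one_div, Real.inv_rpow hτ'.le, ← Real.rpow_neg hτ'.le] at this
  rw [one_div]
  calc _ ≤ Real.exp (-(lam * τ)) * (1 + τ ^ (-s)) := by gcongr
    _ = _ := by ring

theorem lintegral_enorm_le_of_abs_le {β : Type*} [MeasurableSpace β] {μ : Measure β} {f g : β → ℝ}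
    {c : ℝ} (hg : Integrable g μ) (hg0 : ∀ x, 0 ≤ g x) (h : ∀ x, |f x| ≤ g x)
    (hc : ∫ x, g x ∂μ ≤ c) : ∫⁻ x, ‖f x‖ₑ ∂μ ≤ ENNReal.ofReal c := by
  calc ∫⁻ x, ‖f x‖ₑ ∂μ ≤ ∫⁻ x, ENNReal.ofReal (g x) ∂μ := by
        refine lintegral_mono fun x => ?_
        rw [← ofReal_norm]
        exact ENNReal.ofReal_le_ofReal (h x)
    _ = ENNReal.ofReal (∫ x, g x ∂μ) :=
        (ofReal_integral_eq_lintegral_ofReal hg (Eventually.of_forall hg0)).symm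
    _ ≤ _ := ENNReal.ofReal_le_ofReal hc

/-- Rows cost `τ^(-1/2)`, columns are bounded, so Schur's test costs `τ^(-1/4)`. A factor `D` of
size `τ^(-1/2)`, as produced by a derivative, leads to `τ^(-3/4)`, which is still integrable at
zero. -/
theorem schurFamily_of_le {ω lam K : ℝ} (hω : 0 < ω) (hl : 0 < lam) (hK : 0 < K)
    {a : ℝ → ℝ × ℝ → ℝ → ℝ} {D : ℝ → ℝ}
    (hm : Measurable fun w : (ℝ × ℝ) × ℝ × ℝ => a w.2.1 w.1 w.2.2)
    (hD0 : ∀ τ, 0 < τ → 0 ≤ D τ) (hD : ∀ τ, 0 < τ → D τ ^ 2 ≤ K * (1 + 1 / τ))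
    (ha : ∀ τ, 0 < τ → ∀ p x', |a τ p x'| ≤ Real.exp (-(lam * τ)) * D τ * heatMaj ω τ p x' x') :
    SchurFamily volume a (fun τ => √(4 * K * √(1 + ω)) *
      (Real.exp (-(lam * τ)) * (1 + 1 / τ) ^ (3 / 4 : ℝ))) := by
  refine ⟨hm, fun τ hτ => by positivity,
    integrableOn_weight hl _ (by norm_num) (by norm_num), fun τ hτ => ?_⟩
  have hD' := hD0 τ hτ
  refine ⟨Real.exp (-(lam * τ)) * D τ * √(ω * (1 + 1 / (ω * τ))),
    Real.exp (-(lam * τ)) * D τ * 4, by positivity, by positivity, fun p => ?_, fun x' => ?_, ?_⟩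
  · refine lintegral_enorm_le_of_abs_le ((integrable_heatMaj_row hω hτ p).const_mul _)
      (fun x' => ?_) (ha τ hτ p) ?_
    · have := (heatMaj_pos hω hτ p x' x').le
      positivity
    · rw [integral_const_mul]
      gcongr
      exact integral_heatMaj_row_le hω hτ p
  · refine lintegral_enorm_le_of_abs_le ((integrable_heatMaj hω hτ x' x').const_mul _)
      (fun p => ?_) (fun p => ha τ hτ p x') ?_
    · have := (heatMaj_pos hω hτ p x' x').le
      positivity
    · rw [integral_const_mul]
      gcongr
      exact integral_heatMaj_le hω hτ x' x'
  · have hu : 0 < 1 + 1 / τ := by positivity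
    rw [mul_pow, Real.sq_sqrt (by positivity), mul_pow]
    have e1 : ((1 + 1 / τ) ^ (3 / 4 : ℝ)) ^ 2 = (1 + 1 / τ) * √(1 + 1 / τ) := by
      rw [← Real.rpow_natCast, ← Real.rpow_mul hu.le, Real.sqrt_eq_rpow,
        ← Real.rpow_one_add' hu.le (by norm_num)]
      norm_num
    have e2 : √(ω * (1 + 1 / (ω * τ))) ≤ √(1 + ω) * √(1 + 1 / τ) := by
      rw [← Real.sqrt_mul (by positivity)]
      refine Real.sqrt_le_sqrt ?_
      have : ω * (1 + 1 / (ω * τ)) = ω + 1 / τ := by field_simp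
      rw [this]
      have : 0 < 1 / τ := by positivity
      nlinarith
    rw [e1]
    have h1 := hD τ hτ
    calc _ = 4 * Real.exp (-(lam * τ)) ^ 2 * (D τ ^ 2) * √(ω * (1 + 1 / (ω * τ))) := by ring
      _ ≤ 4 * Real.exp (-(lam * τ)) ^ 2 * (K * (1 + 1 / τ)) * (√(1 + ω) * √(1 + 1 / τ)) := by
          gcongr
      _ = _ := by ring

/-- The constant in the bounds of the kernels. -/
def kernelConst (ω : ℝ) : ℝ := 1 + ω + 1 / ω + 2 / ω ^ 2

theorem kernelConst_pos {ω : ℝ} (hω : 0 < ω) : 0 < kernelConst ω := by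
  unfold kernelConst; positivity

theorem coth_le {θ : ℝ} (hθ : 0 < θ) : Real.cosh θ / Real.sinh θ ≤ 1 + 1 / θ := by
  have hs := Real.sinh_pos_iff.2 hθ
  have h1 := Real.self_le_sinh_iff.2 hθ.le
  have h2 := Real.cosh_sub_sinh θ
  have h3 : Real.exp (-θ) ≤ 1 := Real.exp_le_one_iff.2 (by linarith)
  rw [div_le_iff₀ hs]
  have : 1 ≤ Real.sinh θ / θ := (one_le_div hθ).2 h1
  have e : (1 + 1 / θ) * Real.sinh θ = Real.sinh θ + Real.sinh θ / θ := by ring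
  rw [e]; linarith

/-- The quotient is `coth (θ/2) = coth θ + 1 / sinh θ`. -/
theorem sinh_div_cosh_sub_one_le {θ : ℝ} (hθ : 0 < θ) :
    Real.sinh θ / (Real.cosh θ - 1) ≤ 1 + 2 / θ := by
  have hs := Real.sinh_pos_iff.2 hθ
  have hc : 0 < Real.cosh θ - 1 := sub_pos.2 (Real.one_lt_cosh.2 hθ.ne')
  have h1 := Real.self_le_sinh_iff.2 hθ.le
  have h2 := coth_le hθ
  have e : Real.sinh θ / (Real.cosh θ - 1) = Real.cosh θ / Real.sinh θ + 1 / Real.sinh θ := by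
    rw [div_eq_iff hc.ne']
    field_simp
    linear_combination -(Real.cosh_sq θ)
  have h3 : 1 / Real.sinh θ ≤ 1 / θ := one_div_le_one_div_of_le hθ h1
  rw [e]
  calc _ ≤ (1 + 1 / θ) + 1 / θ := by gcongr
    _ = _ := by ring

/-- The resolvent kernels on the plane. -/
def kerFn (ω lam τ : ℝ) (p : ℝ × ℝ) (z : ℝ) : ℝ := Real.exp (-(lam * τ)) * heat ω τ p z z

/-- The `x`-derivative of the resolvent kernel. -/
def kerDx (ω lam τ : ℝ) (p : ℝ × ℝ) (z : ℝ) : ℝ :=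
  Real.exp (-(lam * τ)) * (-((p.1 - z) / τ) * heat ω τ p z z)

/-- The `y`-derivative of the resolvent kernel. -/
def kerDy (ω lam τ : ℝ) (p : ℝ × ℝ) (z : ℝ) : ℝ :=
  Real.exp (-(lam * τ)) *
    (-(ω * (Real.cosh (ω * τ) * p.2 - z) / Real.sinh (ω * τ)) * heat ω τ p z z)

/-- The product of `y` and the resolvent kernel. -/
def kerY (ω lam τ : ℝ) (p : ℝ × ℝ) (z : ℝ) : ℝ :=
  Real.exp (-(lam * τ)) * (p.2 * heat ω τ p z z)

/-- The resolvent kernel on the diagonal. -/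
def kerDiag (ω lam τ : ℝ) (x x' : ℝ) : ℝ := Real.exp (-(lam * τ)) * heat ω τ (x, x) x' x'

theorem measurable_heat' (ω : ℝ) :
    Measurable fun w : (ℝ × ℝ) × ℝ × ℝ => heat ω w.2.1 w.1 w.2.2 w.2.2 :=
  (measurable_heat ω).comp (f := fun w : (ℝ × ℝ) × ℝ × ℝ => (w.2.1, w.1, w.2.2, w.2.2))
    (by fun_prop)

theorem abs_kerFn_le {ω : ℝ} (hω : 0 < ω) (lam : ℝ) {τ : ℝ} (hτ : 0 < τ) (p : ℝ × ℝ) (x' : ℝ) :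
    |kerFn ω lam τ p x'| ≤ Real.exp (-(lam * τ)) * 1 * heatMaj ω τ p x' x' := by
  rw [kerFn, abs_mul, abs_of_pos (Real.exp_pos _), abs_of_pos (heat_pos hω hτ _ _ _), mul_assoc,
    one_mul]
  gcongr
  exact heat_le_heatMaj hω hτ p x' x'

theorem abs_kerDx_le {ω : ℝ} (hω : 0 < ω) (lam : ℝ) {τ : ℝ} (hτ : 0 < τ) (p : ℝ × ℝ) (x' : ℝ) :
    |kerDx ω lam τ p x'| ≤ Real.exp (-(lam * τ)) * (√τ / τ) * heatMaj ω τ p x' x' := by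
  rw [kerDx, abs_mul, abs_of_pos (Real.exp_pos _), mul_assoc, abs_mul,
    abs_of_pos (heat_pos hω hτ _ _ _), abs_neg, abs_div, abs_of_pos hτ]
  refine mul_le_mul_of_nonneg_left ?_ (Real.exp_pos _).le
  have := abs_x_mul_heat_le hω hτ p x' x'
  rw [div_mul_eq_mul_div, div_mul_eq_mul_div]
  gcongr

theorem abs_kerDy_le {ω : ℝ} (hω : 0 < ω) (lam : ℝ) {τ : ℝ} (hτ : 0 < τ) (p : ℝ × ℝ) (x' : ℝ) :
    |kerDy ω lam τ p x'| ≤ Real.exp (-(lam * τ)) * √(ω * Real.cosh (ω * τ) / Real.sinh (ω * τ))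
      * heatMaj ω τ p x' x' := by
  have hs := sinh_mul_pos hω hτ
  have hc := Real.cosh_pos (ω * τ)
  rw [kerDy, abs_mul, abs_of_pos (Real.exp_pos _), mul_assoc, abs_mul,
    abs_of_pos (heat_pos hω hτ _ _ _), abs_neg]
  refine mul_le_mul_of_nonneg_left ?_ (Real.exp_pos _).le
  have := abs_w_mul_heat_le hω hτ p x' x'
  have e : ω * (Real.cosh (ω * τ) * p.2 - x') / Real.sinh (ω * τ)
      = ω * Real.cosh (ω * τ) / Real.sinh (ω * τ) * (p.2 - x' / Real.cosh (ω * τ)) := by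
    field_simp
  set b := ω * Real.cosh (ω * τ) / Real.sinh (ω * τ)
  have hb : 0 < b := by positivity
  rw [e, abs_mul, abs_of_pos hb]
  calc _ = b * (|p.2 - x' / Real.cosh (ω * τ)| * heat ω τ p x' x') := by ring
    _ ≤ b * ((√b)⁻¹ * heatMaj ω τ p x' x') := by gcongr
    _ = √b * heatMaj ω τ p x' x' := by
        rw [← mul_assoc, ← div_eq_mul_inv, Real.div_sqrt]

theorem abs_kerY_le {ω : ℝ} (hω : 0 < ω) (lam : ℝ) {τ : ℝ} (hτ : 0 < τ) (p : ℝ × ℝ) (x' : ℝ) :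
    |kerY ω lam τ p x'| ≤ Real.exp (-(lam * τ))
      * (√(ω * (Real.cosh (ω * τ) - 1) / Real.sinh (ω * τ)))⁻¹ * heatMaj ω τ p x' x' := by
  rw [kerY, abs_mul, abs_of_pos (Real.exp_pos _), mul_assoc, abs_mul,
    abs_of_pos (heat_pos hω hτ _ _ _)]
  refine mul_le_mul_of_nonneg_left ?_ (Real.exp_pos _).le
  exact abs_y_mul_heat_le hω hτ p x' x'

/-- In this and the next three cases `D²` is `1`, `1/τ`, at most `ω + 1/τ`, and at most `1/ω + 2/(ω²
τ)`. `kernelConst` is the sum of the coefficients that occur. -/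
theorem schurFamily_kerFn {ω lam : ℝ} (hω : 0 < ω) (hl : 0 < lam) :
    SchurFamily volume (kerFn ω lam) (fun τ => √(4 * kernelConst ω * √(1 + ω)) *
      (Real.exp (-(lam * τ)) * (1 + 1 / τ) ^ (3 / 4 : ℝ))) := by
  have hm := measurable_heat' ω
  refine schurFamily_of_le hω hl (kernelConst_pos hω) (by unfold kerFn; fun_prop)
    (D := fun _ => 1) (fun _ _ => zero_le_one) (fun τ hτ => ?_) (fun τ hτ => abs_kerFn_le hω lam hτ)
  unfold kernelConst
  have : 0 < 1 / τ := by positivity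
  have : 0 < 1 / ω := by positivity
  have : 0 < 2 / ω ^ 2 := by positivity
  nlinarith

theorem schurFamily_kerDx {ω lam : ℝ} (hω : 0 < ω) (hl : 0 < lam) :
    SchurFamily volume (kerDx ω lam) (fun τ => √(4 * kernelConst ω * √(1 + ω)) *
      (Real.exp (-(lam * τ)) * (1 + 1 / τ) ^ (3 / 4 : ℝ))) := by
  have hm := measurable_heat' ω
  refine schurFamily_of_le hω hl (kernelConst_pos hω) (by unfold kerDx; fun_prop)
    (D := fun τ => √τ / τ) (fun τ hτ => by positivity) (fun τ hτ => ?_)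
    (fun τ hτ => abs_kerDx_le hω lam hτ)
  have e : (√τ / τ) ^ 2 = 1 / τ := by
    rw [div_pow, Real.sq_sqrt hτ.le]; field_simp
  rw [e]
  unfold kernelConst
  have : 0 < 1 / τ := by positivity
  have : 0 < 1 / ω := by positivity
  have : 0 < 2 / ω ^ 2 := by positivity
  nlinarith

theorem schurFamily_kerDy {ω lam : ℝ} (hω : 0 < ω) (hl : 0 < lam) :
    SchurFamily volume (kerDy ω lam) (fun τ => √(4 * kernelConst ω * √(1 + ω)) *
      (Real.exp (-(lam * τ)) * (1 + 1 / τ) ^ (3 / 4 : ℝ))) := by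
  have hm := measurable_heat' ω
  refine schurFamily_of_le hω hl (kernelConst_pos hω) (by unfold kerDy; fun_prop)
    (D := fun τ => √(ω * Real.cosh (ω * τ) / Real.sinh (ω * τ))) (fun τ hτ => by positivity)
    (fun τ hτ => ?_) (fun τ hτ => abs_kerDy_le hω lam hτ)
  have hs := sinh_mul_pos hω hτ
  have hc := Real.cosh_pos (ω * τ)
  rw [Real.sq_sqrt (by positivity), mul_div_assoc]
  have h1 := coth_le (mul_pos hω hτ)
  calc _ ≤ ω * (1 + 1 / (ω * τ)) := by gcongr
    _ = ω + 1 / τ := by field_simp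
    _ ≤ _ := by
      unfold kernelConst
      have : 0 < 1 / τ := by positivity
      have : 0 < 1 / ω := by positivity
      have : 0 < 2 / ω ^ 2 := by positivity
      nlinarith

theorem schurFamily_kerY {ω lam : ℝ} (hω : 0 < ω) (hl : 0 < lam) :
    SchurFamily volume (kerY ω lam) (fun τ => √(4 * kernelConst ω * √(1 + ω)) *
      (Real.exp (-(lam * τ)) * (1 + 1 / τ) ^ (3 / 4 : ℝ))) := by
  have hm := measurable_heat' ω
  refine schurFamily_of_le hω hl (kernelConst_pos hω) (by unfold kerY; fun_prop)
    (D := fun τ => (√(ω * (Real.cosh (ω * τ) - 1) / Real.sinh (ω * τ)))⁻¹)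
    (fun τ hτ => by positivity) (fun τ hτ => ?_) (fun τ hτ => abs_kerY_le hω lam hτ)
  have hs := sinh_mul_pos hω hτ
  have hc := cosh_sub_one_pos hω hτ
  have h1 := sinh_div_cosh_sub_one_le (mul_pos hω hτ)
  rw [inv_pow, Real.sq_sqrt (by positivity), inv_div]
  have e : Real.sinh (ω * τ) / (ω * (Real.cosh (ω * τ) - 1))
      = 1 / ω * (Real.sinh (ω * τ) / (Real.cosh (ω * τ) - 1)) := by field_simp
  rw [e]
  calc _ ≤ 1 / ω * (1 + 2 / (ω * τ)) := by gcongr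
    _ = 1 / ω + 2 / ω ^ 2 * (1 / τ) := by field_simp
    _ ≤ _ := by
      unfold kernelConst
      have : 0 < 1 / τ := by positivity
      have : 0 < 1 / ω := by positivity
      have : 0 < 2 / ω ^ 2 := by positivity
      nlinarith

theorem heat_diag_symm (ω τ x x' : ℝ) : heat ω τ (x, x) x' x' = heat ω τ (x', x') x x := by
  simp only [heat, mehlerExp]
  ring_nf

theorem integrable_heat_diag {ω τ : ℝ} (hω : 0 < ω) (hτ : 0 < τ) (x : ℝ) :
    Integrable fun x' => heat ω τ (x, x) x' x' := by
  refine (integrable_heatMaj_row hω hτ (x, x)).mono'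
    (by unfold heat mehlerExp; fun_prop) (Eventually.of_forall fun x' => ?_)
  rw [Real.norm_of_nonneg (heat_pos hω hτ _ _ _).le]; exact heat_le_heatMaj hω hτ _ _ _

theorem integral_heat_diag_le {ω τ : ℝ} (hω : 0 < ω) (hτ : 0 < τ) (x : ℝ) :
    ∫ x', heat ω τ (x, x) x' x' ≤ √(ω * (1 + 1 / (ω * τ))) :=
  (integral_mono (integrable_heat_diag hω hτ x) (integrable_heatMaj_row hω hτ (x, x))
    fun _ => heat_le_heatMaj hω hτ _ _ _).trans (integral_heatMaj_row_le hω hτ (x, x))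

/-- The heat kernel restricted to the diagonal is symmetric, so the row bound is also the column
bound; its singularity `τ^(-1/2)` is integrable at zero. -/
theorem schurFamily_diag_of_le {ω : ℝ} (hω : 0 < ω) {a : ℝ → ℝ → ℝ → ℝ} {c C : ℝ → ℝ}
    (hm : Measurable fun w : ℝ × ℝ × ℝ => a w.2.1 w.1 w.2.2)
    (hc : ∀ τ, 0 < τ → 0 ≤ c τ)
    (ha : ∀ τ, 0 < τ → ∀ x x', |a τ x x'| ≤ c τ * heat ω τ (x, x) x' x')
    (hpos : ∀ τ, 0 < τ → 0 < C τ) (hint : IntegrableOn C (Set.Ioi 0))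
    (hcC : ∀ τ, 0 < τ → c τ * √(ω * (1 + 1 / (ω * τ))) ≤ C τ) : SchurFamily volume a C := by
  refine ⟨hm, hpos, hint, fun τ hτ => ?_⟩
  have hc0 := hc τ hτ
  have h0 (x x' : ℝ) : 0 ≤ c τ * heat ω τ (x, x) x' x' :=
    mul_nonneg hc0 (heat_pos hω hτ _ _ _).le
  have hrow (x : ℝ) : ∫ x', c τ * heat ω τ (x, x) x' x' ≤ c τ * √(ω * (1 + 1 / (ω * τ))) := by
    rw [integral_const_mul]
    gcongr
    exact integral_heat_diag_le hω hτ x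
  refine ⟨c τ * √(ω * (1 + 1 / (ω * τ))), c τ * √(ω * (1 + 1 / (ω * τ))), by positivity,
    by positivity, fun x => ?_, fun x' => ?_, ?_⟩
  · exact lintegral_enorm_le_of_abs_le ((integrable_heat_diag hω hτ x).const_mul _) (h0 x)
      (ha τ hτ x) (hrow x)
  · refine lintegral_enorm_le_of_abs_le ((integrable_heat_diag hω hτ x').const_mul _) (h0 x')
      (fun x => ?_) (hrow x')
    rw [heat_diag_symm]
    exact ha τ hτ x x'
  · rw [← sq]
    gcongr
    exact hcC τ hτ

theorem measurable_heat_diag (ω : ℝ) :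
    Measurable fun w : ℝ × ℝ × ℝ => heat ω w.2.1 (w.1, w.1) w.2.2 w.2.2 :=
  (measurable_heat ω).comp (f := fun w : ℝ × ℝ × ℝ => (w.2.1, (w.1, w.1), w.2.2, w.2.2))
    (by fun_prop)

/-- The time weight of the diagonal kernel. -/
def diagWeight (ω lam τ : ℝ) : ℝ := Real.exp (-(lam * τ)) * √(ω * (1 + 1 / (ω * τ)))

theorem diagWeight_pos {ω lam τ : ℝ} (hω : 0 < ω) (hτ : 0 < τ) : 0 < diagWeight ω lam τ := by
  unfold diagWeight; positivity

theorem integrableOn_diagWeight {ω lam : ℝ} (hω : 0 < ω) (hl : 0 < lam) :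
    IntegrableOn (diagWeight ω lam) (Set.Ioi 0) := by
  refine (integrableOn_weight hl (√(1 + ω)) (s := 1 / 2) (by norm_num) (by norm_num)).mono'
    (by unfold diagWeight; fun_prop) ?_
  filter_upwards [ae_restrict_mem measurableSet_Ioi] with τ hτ
  have hτ' : (0 : ℝ) < τ := hτ
  rw [Real.norm_of_nonneg (diagWeight_pos hω hτ).le, diagWeight, mul_left_comm]
  gcongr
  rw [← Real.sqrt_eq_rpow, ← Real.sqrt_mul (by positivity)]
  refine Real.sqrt_le_sqrt ?_
  have : ω * (1 + 1 / (ω * τ)) = ω + 1 / τ := by field_simp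
  rw [this]
  have : 0 < 1 / τ := by positivity
  nlinarith

theorem schurFamily_kerDiag {ω lam : ℝ} (hω : 0 < ω) (hl : 0 < lam) :
    SchurFamily volume (kerDiag ω lam) (diagWeight ω lam) := by
  have hm := measurable_heat_diag ω
  refine schurFamily_diag_of_le hω (c := fun τ => Real.exp (-(lam * τ)))
    (by unfold kerDiag; fun_prop) (fun τ _ => (Real.exp_pos _).le) (fun τ hτ x x' => ?_)
    (fun τ hτ => diagWeight_pos hω hτ) (integrableOn_diagWeight hω hl) (fun τ _ => le_rfl)
  rw [kerDiag, abs_of_pos (mul_pos (Real.exp_pos _) (heat_pos hω hτ _ _ _))]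


/-! ### The potential of a charge belongs to the form domain -/

theorem exists_dual_of_notMem {F : Type*} [NormedAddCommGroup F] [NormedSpace ℂ F]
    {W : Submodule ℂ F} (hW : IsClosed (W : Set F)) {x : F} (hx : x ∉ W) :
    ∃ f : F →L[ℂ] ℂ, (∀ w ∈ W, f w = 0) ∧ f x ≠ 0 := by
  have : IsClosed (W : Set F) := hW
  have hne : ‖(W.mkQ x : F ⧸ W)‖ ≠ 0 := by
    rw [norm_ne_zero_iff, Submodule.mkQ_apply, Ne, Submodule.Quotient.mk_eq_zero]
    exact hx
  obtain ⟨g, -, hg⟩ := exists_dual_vector ℂ (W.mkQ x) hne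
  refine ⟨g.comp W.mkQL, fun w hw => ?_, ?_⟩
  · have : W.mkQL w = 0 := (Submodule.Quotient.mk_eq_zero W).2 hw
    rw [ContinuousLinearMap.comp_apply, this, map_zero]
  · change g (W.mkQ x) ≠ 0
    rw [hg]
    exact Complex.ofReal_ne_zero.2 hne

theorem exists_dual_tuple (f : TupleSpace →L[ℂ] ℂ) : ∃ η : TupleSpace, ∀ ξ : TupleSpace,
    f ξ = inner ℂ η.1 ξ.1 + inner ℂ η.2.1 ξ.2.1 + inner ℂ η.2.2.1 ξ.2.2.1
      + inner ℂ η.2.2.2.1 ξ.2.2.2.1 + inner ℂ η.2.2.2.2 ξ.2.2.2.2 := by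
  have key {G : Type} [NormedAddCommGroup G] [InnerProductSpace ℂ G] [CompleteSpace G]
      (i : G →L[ℂ] TupleSpace) : ∃ η : G, ∀ x, f (i x) = inner ℂ η x :=
    ⟨(InnerProductSpace.toDual ℂ G).symm (f.comp i),
      fun x => (InnerProductSpace.toDual_symm_apply (y := f.comp i)).symm⟩
  obtain ⟨η0, h0⟩ := key (ContinuousLinearMap.inl ℂ L2Plane (L2Plane × L2Plane × L2Plane × L2Line))
  obtain ⟨η1, h1⟩ := key ((ContinuousLinearMap.inr ℂ L2Plane
    (L2Plane × L2Plane × L2Plane × L2Line)).comp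
    (ContinuousLinearMap.inl ℂ L2Plane (L2Plane × L2Plane × L2Line)))
  obtain ⟨η2, h2⟩ := key ((ContinuousLinearMap.inr ℂ L2Plane
    (L2Plane × L2Plane × L2Plane × L2Line)).comp
    ((ContinuousLinearMap.inr ℂ L2Plane (L2Plane × L2Plane × L2Line)).comp
      (ContinuousLinearMap.inl ℂ L2Plane (L2Plane × L2Line))))
  obtain ⟨η3, h3⟩ := key ((ContinuousLinearMap.inr ℂ L2Plane
    (L2Plane × L2Plane × L2Plane × L2Line)).comp
    ((ContinuousLinearMap.inr ℂ L2Plane (L2Plane × L2Plane × L2Line)).comp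
      ((ContinuousLinearMap.inr ℂ L2Plane (L2Plane × L2Line)).comp
        (ContinuousLinearMap.inl ℂ L2Plane L2Line))))
  obtain ⟨η4, h4⟩ := key ((ContinuousLinearMap.inr ℂ L2Plane
    (L2Plane × L2Plane × L2Plane × L2Line)).comp
    ((ContinuousLinearMap.inr ℂ L2Plane (L2Plane × L2Plane × L2Line)).comp
      ((ContinuousLinearMap.inr ℂ L2Plane (L2Plane × L2Line)).comp
        (ContinuousLinearMap.inr ℂ L2Plane L2Line))))
  refine ⟨(η0, η1, η2, η3, η4), fun ξ => ?_⟩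
  simp only
  rw [← h0, ← h1, ← h2, ← h3, ← h4, ← map_add, ← map_add, ← map_add, ← map_add]
  congr 1
  simp

theorem heatMaj_le_heatCoef {ω τ : ℝ} (hω : 0 < ω) (hτ : 0 < τ) (p : ℝ × ℝ) (x' y' : ℝ) :
    heatMaj ω τ p x' y' ≤ heatCoef ω τ := by
  have hs := sinh_mul_pos hω hτ
  have hc := Real.cosh_pos (ω * τ)
  rw [heatMaj, ← Real.exp_add]
  refine mul_le_of_le_one_right (heatCoef_pos hω hτ).le (Real.exp_le_one_iff.2 ?_)
  have h1 : 0 ≤ 1 / (4 * τ) * (p.1 - x') ^ 2 := by positivity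
  have h2 : 0 ≤ ω * Real.cosh (ω * τ) / (4 * Real.sinh (ω * τ))
      * (p.2 - y' / Real.cosh (ω * τ)) ^ 2 := by positivity
  linarith

theorem heat_le_heatCoef {ω τ : ℝ} (hω : 0 < ω) (hτ : 0 < τ) (p : ℝ × ℝ) (x' y' : ℝ) :
    heat ω τ p x' y' ≤ heatCoef ω τ :=
  (heat_le_heatMaj hω hτ p x' y').trans (heatMaj_le_heatCoef hω hτ p x' y')

theorem memLp_two_of_abs_le {β : Type*} [MeasurableSpace β] {μ : Measure β} {f g : β → ℝ} {c D : ℝ}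
    (hf : Measurable f) (hg : Integrable g μ) (hg0 : ∀ p, 0 ≤ g p) (hgc : ∀ p, g p ≤ c)
    (h : ∀ p, |f p| ≤ D * g p) : MemLp (fun p => (f p : ℂ)) 2 μ := by
  have hm : AEStronglyMeasurable (fun p => (f p : ℂ)) μ :=
    (Complex.measurable_ofReal.comp hf).aestronglyMeasurable
  refine (memLp_two_iff_integrable_sq_norm hm).2 ?_
  refine (hg.const_mul (D ^ 2 * c)).mono' (hm.norm.pow 2) (Eventually.of_forall fun p => ?_)
  rw [Complex.norm_real, Real.norm_eq_abs (f p), Real.norm_of_nonneg (sq_nonneg _)]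
  calc |f p| ^ 2 ≤ (D * g p) ^ 2 := by
        gcongr
        exact h p
    _ = D ^ 2 * (g p * g p) := by ring
    _ ≤ D ^ 2 * (c * g p) := by
        gcongr
        · exact hg0 p
        · exact hgc p
    _ = _ := by ring

theorem memLp_slice {ω τ : ℝ} (hω : 0 < ω) (hτ : 0 < τ) {f : ℝ × ℝ → ℝ} {x' D : ℝ}
    (hf : Measurable f) (h : ∀ p, |f p| ≤ D * heatMaj ω τ p x' x') :
    MemLp (fun p => (f p : ℂ)) 2 volume :=
  memLp_two_of_abs_le hf (integrable_heatMaj hω hτ x' x') (fun p => (heatMaj_pos hω hτ p x' x').le)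
    (fun p => heatMaj_le_heatCoef hω hτ p x' x') h

theorem memLp_kerDiag {ω τ : ℝ} (hω : 0 < ω) (lam : ℝ) (hτ : 0 < τ) (x' : ℝ) :
    MemLp (fun x => (kerDiag ω lam τ x x' : ℂ)) 2 volume := by
  refine memLp_two_of_abs_le (D := Real.exp (-(lam * τ))) ?_ (integrable_heat_diag hω hτ x')
    (fun x => (heat_pos hω hτ _ _ _).le) (fun x => heat_le_heatCoef hω hτ _ _ _) fun x => ?_
  · unfold kerDiag heat mehlerExp
    fun_prop
  · rw [kerDiag, abs_of_pos (mul_pos (Real.exp_pos _) (heat_pos hω hτ _ _ _)), heat_diag_symm]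

/-- At a fixed time and for a fixed source point the kernel is smooth with Gaussian decay; these
functions are the building blocks of all potentials. -/
theorem exists_slice_mem_formSpace {ω τ : ℝ} (hω : 0 < ω) (lam : ℝ) (hτ : 0 < τ) (x' : ℝ) :
    ∃ ξ ∈ formSpace, (∀ᵐ p, ξ.1 p = (kerFn ω lam τ p x' : ℂ)) ∧
      (∀ᵐ p, ξ.2.1 p = (kerDx ω lam τ p x' : ℂ)) ∧ (∀ᵐ p, ξ.2.2.1 p = (kerDy ω lam τ p x' : ℂ)) ∧
      (∀ᵐ p, ξ.2.2.2.1 p = (kerY ω lam τ p x' : ℂ)) ∧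
      (∀ᵐ x, ξ.2.2.2.2 x = (kerDiag ω lam τ x x' : ℂ)) := by
  have hc := (continuous_heat ω τ x' x').measurable
  have m0 : MemLp (fun p => (kerFn ω lam τ p x' : ℂ)) 2 volume :=
    memLp_slice hω hτ (by unfold kerFn; fun_prop) fun p => abs_kerFn_le hω lam hτ p x'
  have m1 : MemLp (fun p => (kerDx ω lam τ p x' : ℂ)) 2 volume :=
    memLp_slice hω hτ (by unfold kerDx; fun_prop) fun p => abs_kerDx_le hω lam hτ p x'
  have m2 : MemLp (fun p => (kerDy ω lam τ p x' : ℂ)) 2 volume :=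
    memLp_slice hω hτ (by unfold kerDy; fun_prop) fun p => abs_kerDy_le hω lam hτ p x'
  have m3 : MemLp (fun p => (kerY ω lam τ p x' : ℂ)) 2 volume :=
    memLp_slice hω hτ (by unfold kerY; fun_prop) fun p => abs_kerY_le hω lam hτ p x'
  have m4 := memLp_kerDiag hω lam hτ x'
  refine ⟨(m0.toLp _, m1.toLp _, m2.toLp _, m3.toLp _, m4.toLp _), ?_, m0.coeFn_toLp,
    m1.coeFn_toLp, m2.coeFn_toLp, m3.coeFn_toLp, m4.coeFn_toLp⟩
  have hsm := contDiff_heat ω τ x' x'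
  have hd := hsm.differentiable (by simp)
  have hfd (p v : ℝ × ℝ) : fderiv ℝ (fun p => (Real.exp (-(lam * τ)) : ℂ) * (heat ω τ p x' x' : ℂ)) p v
      = (Real.exp (-(lam * τ)) : ℂ) * fderiv ℝ (fun p => (heat ω τ p x' x' : ℂ)) p v := by
    rw [fderiv_const_mul (hd p)]; rfl
  refine mem_formSpace_of_smooth (f := fun p => (Real.exp (-(lam * τ)) : ℂ) * (heat ω τ p x' x' : ℂ))
    (contDiff_const.mul hsm) ?_ ?_ ?_ ?_ ?_
  · filter_upwards [m0.coeFn_toLp] with p hp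
    rw [hp, kerFn, Complex.ofReal_mul]
  · filter_upwards [m1.coeFn_toLp] with p hp
    rw [hp, hfd, fderiv_heat_x, kerDx, Complex.ofReal_mul]
  · filter_upwards [m2.coeFn_toLp] with p hp
    rw [hp, hfd, fderiv_heat_y, kerDy, Complex.ofReal_mul]
  · filter_upwards [m3.coeFn_toLp] with p hp
    rw [hp, kerY]
    push_cast
    ring
  · filter_upwards [m4.coeFn_toLp] with p hp
    rw [hp, kerDiag, Complex.ofReal_mul]

section
variable {ω lam : ℝ} (hω : 0 < ω) (hl : 0 < lam)

/-- The tuple of the potential of the charge `q`. -/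
def potentialTuple : L2Line →L[ℂ] TupleSpace :=
  (schurFamily_kerFn hω hl).op.prod ((schurFamily_kerDx hω hl).op.prod
    ((schurFamily_kerDy hω hl).op.prod ((schurFamily_kerY hω hl).op.prod
      (schurFamily_kerDiag hω hl).op)))

theorem ae_timeLine_pos : ∀ᵐ z : ℝ × ℝ ∂timeLine, 0 < z.1 :=
  Measure.quasiMeasurePreserving_fst.ae
    (ae_restrict_mem measurableSet_Ioi : ∀ᵐ τ ∂volume.restrict (Set.Ioi (0 : ℝ)), 0 < τ)

/-- Hahn–Banach: a continuous functional that vanishes on the closed form domain vanishes on every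
slice. By `SchurFamily.inner_op` its value on the potential is an integral of its values on slices.
-/
theorem potentialTuple_mem (q : L2Line) : potentialTuple hω hl q ∈ formSpace := by
  by_contra hcon
  obtain ⟨f, hf0, hf⟩ := exists_dual_of_notMem testSpace.isClosed_topologicalClosure hcon
  obtain ⟨η, hη⟩ := exists_dual_tuple f
  refine hf ?_
  rw [hη]
  simp only [potentialTuple, ContinuousLinearMap.prod_apply]
  rw [SchurFamily.inner_op, SchurFamily.inner_op, SchurFamily.inner_op, SchurFamily.inner_op,
    SchurFamily.inner_op]
  have i0 := (schurFamily_kerFn hω hl).integrable_inner η.1 q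
  have i1 := (schurFamily_kerDx hω hl).integrable_inner η.2.1 q
  have i2 := (schurFamily_kerDy hω hl).integrable_inner η.2.2.1 q
  have i3 := (schurFamily_kerY hω hl).integrable_inner η.2.2.2.1 q
  have i4 := (schurFamily_kerDiag hω hl).integrable_inner η.2.2.2.2 q
  rw [← integral_add' i0 i1, ← integral_add' (i0.add i1) i2, ← integral_add' ((i0.add i1).add i2) i3,
    ← integral_add' (((i0.add i1).add i2).add i3) i4]
  refine integral_eq_zero_of_ae ?_
  filter_upwards [ae_timeLine_pos] with z hz
  obtain ⟨ξ, hξ, e0, e1, e2, e3, e4⟩ := exists_slice_mem_formSpace hω lam hz z.2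
  have h0 := hf0 ξ hξ
  have key {β : Type} [MeasurableSpace β] {μ : Measure β} (a b : Lp ℂ 2 μ) (g : β → ℂ)
      (hg : ∀ᵐ p ∂μ, b p = g p) : inner ℂ a b = ∫ p, starRingEnd ℂ (a p) * g p ∂μ := by
    rw [L2.inner_def]
    refine integral_congr_ae ?_
    filter_upwards [hg] with p hp
    rw [RCLike.inner_apply, hp, mul_comm]
  rw [hη, key _ _ _ e0, key _ _ _ e1, key _ _ _ e2, key _ _ _ e3, key _ _ _ e4] at h0
  simp only [Pi.add_apply, Pi.zero_apply]
  rw [← add_mul, ← add_mul, ← add_mul, ← add_mul, h0, zero_mul]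

/-- The potential of the charge `q` as an element of the form domain. -/
def potentialElement (q : L2Line) : FormElement :=
  (exists_formElement_of_mem (potentialTuple_mem hω hl q)).choose

theorem potentialElement_tuple (q : L2Line) :
    (potentialElement hω hl q).tuple = potentialTuple hω hl q :=
  (exists_formElement_of_mem (potentialTuple_mem hω hl q)).choose_spec

end

/-- Fubini with the time integral done first; for the resolvent kernels this brings back
`greenKernel`. -/
theorem SchurFamily.op_ae_kernel {P : Type*} [MeasurableSpace P] {μ : Measure P} [SFinite μ]
    {a : ℝ → P → ℝ → ℝ} {C : ℝ → ℝ} (h : SchurFamily μ a C) (q : L2Line) :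
    ∀ᵐ p ∂μ, h.op q p = ∫ x', ((∫ τ in Set.Ioi 0, a τ p x' : ℝ) : ℂ) * q x' := by
  filter_upwards [h.op_ae q, h.ae_integrable q] with p h1 h2
  rw [h1, integral_prod_symm _ h2]
  refine integral_congr_ae (Eventually.of_forall fun x' => ?_)
  simp only
  rw [integral_mul_const, integral_complex_ofReal]

section
variable {ω lam : ℝ} (hω : 0 < ω) (hl : 0 < lam)

/-- The bounded operator given by the integral kernel on the diagonal. -/
def chargeOp : L2Line →L[ℂ] L2Line := (schurFamily_kerDiag hω hl).op

theorem chargeOp_ae (q : L2Line) : ∀ᵐ x, chargeOp hω hl q x = kOp ω lam q x := by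
  filter_upwards [(schurFamily_kerDiag hω hl).op_ae_kernel q] with x hx
  rw [chargeOp, hx, kOp]
  simp only [greenKernel_eq hω, kerDiag]

theorem potentialElement_fn (q : L2Line) :
    (potentialElement hω hl q).fn = (schurFamily_kerFn hω hl).op q :=
  congrArg Prod.fst (potentialElement_tuple hω hl q)

theorem potentialElement_tr (q : L2Line) :
    (potentialElement hω hl q).tr = chargeOp hω hl q :=
  congrArg (fun ξ : TupleSpace => ξ.2.2.2.2) (potentialElement_tuple hω hl q)

theorem potentialElement_ae (q : L2Line) :
    ∀ᵐ p, (potentialElement hω hl q).fn p = potential ω lam q p := by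
  rw [potentialElement_fn]
  filter_upwards [(schurFamily_kerFn hω hl).op_ae_kernel q] with p hp
  rw [hp, potential]
  simp only [greenKernel_eq hω, kerFn]

end

/-! ### The resolvent equation with a charge on the diagonal -/

theorem IsTest.conj {φ : ℝ × ℝ → ℂ} (h : IsTest φ) : IsTest (fun p => starRingEnd ℂ (φ p)) :=
  ⟨Complex.conjCLE.contDiff.comp h.smooth, h.compact.comp_left (map_zero _)⟩

theorem fderiv_conj_apply {φ : ℝ × ℝ → ℂ} (h : Differentiable ℝ φ) (p v : ℝ × ℝ) :
    fderiv ℝ (fun p => starRingEnd ℂ (φ p)) p v = starRingEnd ℂ (fderiv ℝ φ p v) := by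
  have := (Complex.conjCLE.toContinuousLinearMap.hasFDerivAt.comp p (h p).hasFDerivAt).fderiv
  change fderiv ℝ (fun p => starRingEnd ℂ (φ p)) p = _ at this
  rw [this]
  rfl

/-- The weak derivatives are tested with the derivatives of `ψ`, which puts the whole second order
operator on `ψ`. -/
theorem FormElement.integral_freeHam (U : FormElement) (ω : ℝ) {ψ : ℝ × ℝ → ℂ} (h : IsTest ψ) :
    (1 / 2 : ℂ) * (∫ p, U.dx p * fderiv ℝ ψ p (1, 0))
      + (1 / 2 : ℂ) * (∫ p, U.dy p * fderiv ℝ ψ p (0, 1))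
      + ((ω ^ 2 / 2 : ℝ) : ℂ) * (∫ p, U.yfn p * ((p.2 : ℂ) * ψ p))
      - ((ω / 2 : ℝ) : ℂ) * ∫ p, U.fn p * ψ p = ∫ p, U.fn p * freeHam ω ψ p := by
  have h1 := U.hasWeakDeriv_dx _ (h.fderiv (1, 0))
  have h2 := U.hasWeakDeriv_dy _ (h.fderiv (0, 1))
  have h3 : ∫ p, U.yfn p * ((p.2 : ℂ) * ψ p) = ∫ p, U.fn p * ((p.2 ^ 2 : ℝ) * ψ p) := by
    refine integral_congr_ae ?_
    filter_upwards [U.yfn_ae] with p hp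
    rw [hp]; push_cast; ring
  rw [neg_eq_iff_eq_neg.symm] at h1 h2
  rw [← h1, ← h2, h3]
  have i {χ : ℝ × ℝ → ℂ} (hχ : IsTest χ) : Integrable (fun p => U.fn p * χ p) volume :=
    (Lp.memLp U.fn).integrable_mul hχ.memLp
  have i1 := (i ((h.fderiv (1, 0)).fderiv (1, 0))).const_mul (-(1 / 2 : ℂ))
  have i2 := (i ((h.fderiv (0, 1)).fderiv (0, 1))).const_mul (-(1 / 2 : ℂ))
  have i3 := (i (h.mul_real (c := fun p => p.2 ^ 2) (by fun_prop))).const_mul ((ω ^ 2 / 2 : ℝ) : ℂ)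
  have i4 := (i h).const_mul (-((ω / 2 : ℝ) : ℂ))
  have e : (fun p => U.fn p * freeHam ω ψ p) = (((fun p => -(1 / 2 : ℂ) *
      (U.fn p * fderiv ℝ (fun q => fderiv ℝ ψ q (1, 0)) p (1, 0))) + fun p => -(1 / 2 : ℂ) *
      (U.fn p * fderiv ℝ (fun q => fderiv ℝ ψ q (0, 1)) p (0, 1))) + fun p => ((ω ^ 2 / 2 : ℝ) : ℂ) *
      (U.fn p * ((p.2 ^ 2 : ℝ) * ψ p))) + fun p => -((ω / 2 : ℝ) : ℂ) * (U.fn p * ψ p) := by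
    funext p
    simp only [Pi.add_apply, freeHam]
    push_cast
    ring
  rw [e, integral_add' ((i1.add i2).add i3) i4, integral_add' (i1.add i2) i3, integral_add' i1 i2,
    integral_const_mul, integral_const_mul, integral_const_mul, integral_const_mul]
  ring

theorem inner_toLp_conj {β : Type*} [MeasurableSpace β] {μ : Measure β} (u : Lp ℂ 2 μ)
    {φ : β → ℂ} (hφ : MemLp φ 2 μ) {ψ : β → ℂ} (e : ∀ p, starRingEnd ℂ (φ p) = ψ p) :
    inner ℂ (hφ.toLp φ) u = ∫ p, u p * ψ p ∂μ := by
  rw [L2.inner_def]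
  refine integral_congr_ae ?_
  filter_upwards [hφ.coeFn_toLp] with p hp
  rw [RCLike.inner_apply, hp, ← e]

theorem FormElement.tupleForm_test (U : FormElement) (ω : ℝ) {φ : ℝ × ℝ → ℂ} (h : IsTest φ) :
    tupleForm ω 0 (testTuple φ h) U.tuple
      = ∫ p, U.fn p * freeHam ω (fun p => starRingEnd ℂ (φ p)) p := by
  rw [← U.integral_freeHam ω h.conj]
  have hd := h.smooth.differentiable (by simp)
  simp only [tupleForm, testTuple, FormElement.tuple, Complex.ofReal_zero, zero_mul, add_zero]
  rw [inner_toLp_conj U.dx _ fun p => (fderiv_conj_apply hd p (1, 0)).symm,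
    inner_toLp_conj U.dy _ fun p => (fderiv_conj_apply hd p (0, 1)).symm,
    inner_toLp_conj U.fn _ fun p => rfl,
    inner_toLp_conj U.yfn h.memLp_y (ψ := fun p => (p.2 : ℂ) * starRingEnd ℂ (φ p)) fun p => by simp]

section
variable {ω lam : ℝ} (hω : 0 < ω) (hl : 0 < lam)

/-- The distributional equation `(H₀ + lam) G q = q δ_diag`: the operator falls on the test
function, Fubini isolates a single source point `(x', x')`, and the fundamental solution evaluates
the test function there. -/
theorem potentialElement_test (q : L2Line) {φ : ℝ × ℝ → ℂ} (h : IsTest φ) :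
    tupleForm ω 0 (testTuple φ h) (potentialElement hω hl q).tuple
      + lam * inner ℂ (h.memLp.toLp φ) (potentialElement hω hl q).fn
      = inner ℂ (h.memLp_diag.toLp _) q := by
  set U := potentialElement hω hl q with hU
  have hD : IsTest (fun p => freeHam ω (fun p => starRingEnd ℂ (φ p)) p
      + lam * starRingEnd ℂ (φ p)) := (h.conj.freeHam ω).add (h.conj.smul (lam : ℂ))
  have i {χ : ℝ × ℝ → ℂ} (hχ : IsTest χ) : Integrable (fun p => U.fn p * χ p) volume :=
    (Lp.memLp U.fn).integrable_mul hχ.memLp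
  rw [U.tupleForm_test, inner_toLp_conj U.fn h.memLp (fun p => rfl), ← integral_const_mul,
    ← integral_add (i (h.conj.freeHam ω)) ((i h.conj).const_mul _)]
  have hin (z : ℝ × ℝ) : ∫ p, starRingEnd ℂ (hD.conj.memLp.toLp _ p) * (kerFn ω lam z.1 p z.2 : ℂ)
      = ∫ p, (freeHam ω (fun p => starRingEnd ℂ (φ p)) p + lam * starRingEnd ℂ (φ p))
          * (kerFn ω lam z.1 p z.2 : ℂ) := by
    refine integral_congr_ae ?_
    filter_upwards [hD.conj.memLp.coeFn_toLp] with p hp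
    rw [hp, Complex.conj_conj]
  calc _ = ∫ p, U.fn p * (freeHam ω (fun p => starRingEnd ℂ (φ p)) p
      + lam * starRingEnd ℂ (φ p)) := by
        refine integral_congr_ae (Eventually.of_forall fun p => ?_)
        simp only; ring
    _ = inner ℂ (hD.conj.memLp.toLp _) ((schurFamily_kerFn hω hl).op q) := by
        rw [inner_toLp_conj _ hD.conj.memLp (fun p => Complex.conj_conj _), ← potentialElement_fn]
    _ = ∫ z, (∫ p, (freeHam ω (fun p => starRingEnd ℂ (φ p)) p + lam * starRingEnd ℂ (φ p))
          * (kerFn ω lam z.1 p z.2 : ℂ)) * q z.2 ∂timeLine := by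
        rw [SchurFamily.inner_op]
        simp only [hin]
    _ = ∫ x', starRingEnd ℂ (φ (x', x')) * q x' := by
        rw [integral_prod_symm]
        · refine integral_congr_ae (Eventually.of_forall fun x' => ?_)
          simp only
          rw [integral_mul_const]
          simp only [kerFn]
          rw [integral_integral_freeHam_mul_heat hω hl h.conj]
        · have := (schurFamily_kerFn hω hl).integrable_inner (hD.conj.memLp.toLp _) q
          simpa only [hin] using this
    _ = inner ℂ (h.memLp_diag.toLp _) q := by
        rw [inner_toLp_conj q h.memLp_diag (fun p => rfl)]
        simp only [mul_comm]

/-- Both sides are continuous in the tuple of `V`, and test functions are dense in the form domain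
by `FormElement.tuple_mem`. -/
theorem form_potentialElement (q : L2Line) (V : FormElement) :
    form ω 0 V (potentialElement hω hl q) + lam * inner ℂ V.fn (potentialElement hω hl q).fn
      = inner ℂ V.tr q := by
  generalize hU : potentialElement hω hl q = U
  have hc : IsClosed {η : TupleSpace | tupleForm ω 0 η U.tuple + lam * inner ℂ η.1 U.fn
      = inner ℂ η.2.2.2.2 q} := by
    refine isClosed_eq ?_ ?_
    · unfold tupleForm
      fun_prop
    · fun_prop
  have hsub : (testSpace : Set TupleSpace) ⊆ {η : TupleSpace | tupleForm ω 0 η U.tuple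
      + lam * inner ℂ η.1 U.fn = inner ℂ η.2.2.2.2 q} := by
    rintro _ ⟨φ, h, rfl⟩
    have := potentialElement_test hω hl q h
    rw [hU] at this
    exact this
  have hmem : V.tuple ∈ closure (testSpace : Set TupleSpace) := V.tuple_mem
  have := closure_minimal hsub hc hmem
  rw [form_eq_tupleForm]
  exact this

end

/-! ### The Birman–Schwinger correspondence -/

theorem form_conj (ω α : ℝ) (U V : FormElement) :
    starRingEnd ℂ (form ω α V U) = form ω α U V := by
  have h2 : starRingEnd ℂ (1 / 2 : ℂ) = 1 / 2 := by
    simpa using Complex.conj_ofReal (1 / 2)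
  simp only [form, map_add, map_sub, map_mul, inner_conj_symm, Complex.conj_ofReal, h2]

theorem form_eq_add_trace (ω α : ℝ) (V U : FormElement) :
    form ω α V U = form ω 0 V U + α * inner ℂ V.tr U.tr := by
  simp [form]

/-- Difference in the form domain. -/
def FormElement.sub (U V : FormElement) : FormElement := U.add (V.smul (-1))

theorem FormElement.sub_fn (U V : FormElement) : (U.sub V).fn = U.fn - V.fn := by
  simp [FormElement.sub, FormElement.add, FormElement.smul, sub_eq_add_neg]

theorem FormElement.sub_tr (U V : FormElement) : (U.sub V).tr = U.tr - V.tr := by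
  simp [FormElement.sub, FormElement.add, FormElement.smul, sub_eq_add_neg]

theorem form_sub_right (ω α : ℝ) (V U W : FormElement) :
    form ω α V (U.sub W) = form ω α V U - form ω α V W := by
  simp only [form, FormElement.sub, FormElement.add, FormElement.smul, inner_add_right,
    inner_smul_right]
  ring

section
variable {ω lam : ℝ} (hω : 0 < ω) (hl : 0 < lam)

/-- The resolvent equation has no nontrivial homogeneous solution. -/
theorem FormElement.eq_zero_of_resolvent {ω lam : ℝ} (hω : 0 < ω) (hl : 0 < lam) (Z : FormElement)
    (h : ∀ V : FormElement, form ω 0 V Z + lam * inner ℂ V.fn Z.fn = 0) : Z.fn = 0 ∧ Z.tr = 0 := by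
  constructor
  · have h1 := congrArg Complex.re (h Z)
    have h2 := form_self_nonneg ω le_rfl Z
    rw [inner_self_eq_norm_sq_to_K, Complex.add_re] at h1
    have h3 : ((lam : ℂ) * ((‖Z.fn‖ : ℂ)) ^ 2).re = lam * ‖Z.fn‖ ^ 2 := by
      norm_cast
    simp only [Complex.coe_algebraMap, Complex.zero_re] at h1
    rw [h3] at h1
    have h4 : lam * ‖Z.fn‖ ^ 2 ≤ 0 := by linarith
    have h5 : ‖Z.fn‖ ^ 2 = 0 := by
      have := sq_nonneg ‖Z.fn‖
      nlinarith
    simpa using h5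
  -- The trace is a separate datum of a form element, so it has to be shown to vanish as well:
  -- testing with the potential of the charge `Z.tr` produces `‖Z.tr‖²`.
  · have h1 := h (potentialElement hω hl Z.tr)
    have h2 := form_potentialElement hω hl Z.tr Z
    have h3 := congrArg (starRingEnd ℂ) h1
    rw [map_add, map_mul, form_conj, inner_conj_symm, Complex.conj_ofReal, h2, map_zero] at h3
    exact inner_self_eq_zero.1 h3

/-- If the potential vanishes, the charge is orthogonal to all traces. -/
theorem inner_tr_eq_zero_of_potential {r : L2Line} (hr : (potentialElement hω hl r).fn = 0)
    (V : FormElement) : inner ℂ V.tr r = 0 := by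
  have hc : IsClosed {η : TupleSpace | inner ℂ η.2.2.2.2 r = 0} :=
    isClosed_eq (by fun_prop) continuous_const
  have hsub : (testSpace : Set TupleSpace) ⊆ {η : TupleSpace | inner ℂ η.2.2.2.2 r = 0} := by
    rintro _ ⟨φ, h, rfl⟩
    have h1 := potentialElement_test hω hl r h
    rw [FormElement.tupleForm_test, hr, inner_zero_right, mul_zero, add_zero] at h1
    have h2 : ∫ p, (0 : L2Plane) p * freeHam ω (fun p => starRingEnd ℂ (φ p)) p = 0 := by
      refine integral_eq_zero_of_ae ?_
      filter_upwards with p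
      simp
    rw [h2] at h1
    exact h1.symm
  have hmem : V.tuple ∈ closure (testSpace : Set TupleSpace) := V.tuple_mem
  exact closure_minimal hsub hc hmem

/-- The charge `r` is orthogonal to every trace `K s`. With `s = K r` and the symmetry of the form
this reads `‖K r‖² = 0`. -/
theorem chargeOp_eq_zero_of_potential {r : L2Line} (hr : (potentialElement hω hl r).fn = 0) :
    chargeOp hω hl r = 0 := by
  have h1 (s : L2Line) : inner ℂ (chargeOp hω hl s) r = 0 := by
    rw [← potentialElement_tr]
    exact inner_tr_eq_zero_of_potential hω hl hr _
  have h2 := form_potentialElement hω hl r (potentialElement hω hl (chargeOp hω hl r))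
  have h3 := form_potentialElement hω hl (chargeOp hω hl r) (potentialElement hω hl r)
  have h4 := congrArg (starRingEnd ℂ) h2
  rw [map_add, map_mul, form_conj, inner_conj_symm, Complex.conj_ofReal, h3,
    potentialElement_tr, potentialElement_tr, h1, map_zero] at h4
  exact inner_self_eq_zero.1 h4

/-- `⟨r, K q⟩` is the form of the potentials. -/
theorem inner_chargeOp (r q : L2Line) : inner ℂ (chargeOp hω hl r) q
    = form ω 0 (potentialElement hω hl r) (potentialElement hω hl q)
      + lam * inner ℂ (potentialElement hω hl r).fn (potentialElement hω hl q).fn := by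
  rw [form_potentialElement, potentialElement_tr]

theorem chargeOp_symm (r q : L2Line) :
    inner ℂ (chargeOp hω hl r) q = inner ℂ r (chargeOp hω hl q) := by
  rw [← inner_conj_symm r, inner_chargeOp, inner_chargeOp, map_add, map_mul, form_conj,
    inner_conj_symm, Complex.conj_ofReal]

theorem chargeOp_nonneg (q : L2Line) : 0 ≤ (inner ℂ (chargeOp hω hl q) q).re := by
  rw [inner_chargeOp, inner_self_eq_norm_sq_to_K]
  have h2 := form_self_nonneg ω le_rfl (potentialElement hω hl q)
  have h3 : ((lam : ℂ) * ((‖(potentialElement hω hl q).fn‖ : ℂ)) ^ 2).re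
      = lam * ‖(potentialElement hω hl q).fn‖ ^ 2 := by
    norm_cast
  simp only [Complex.coe_algebraMap, Complex.add_re]
  rw [h3]
  positivity

theorem potentialElement_sub_fn (q r : L2Line) : (potentialElement hω hl (q - r)).fn
    = (potentialElement hω hl q).fn - (potentialElement hω hl r).fn := by
  simp only [potentialElement_fn, map_sub]

theorem solvesCharge_iff {α : ℝ} (q : L2Line) :
    SolvesCharge ω α lam q ↔ q + (α : ℂ) • chargeOp hω hl q = 0 := by
  rw [Lp.ext_iff, SolvesCharge]
  constructor
  · intro h
    filter_upwards [h, chargeOp_ae hω hl q, Lp.coeFn_add q ((α : ℂ) • chargeOp hω hl q),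
      Lp.coeFn_smul (α : ℂ) (chargeOp hω hl q), Lp.coeFn_zero ℂ 2 (volume : Measure ℝ)]
      with x h1 h2 h3 h4 h5
    rw [h3, Pi.add_apply, h4, h5, Pi.smul_apply, h2, smul_eq_mul, h1, Pi.zero_apply]
  · intro h
    filter_upwards [h, chargeOp_ae hω hl q, Lp.coeFn_add q ((α : ℂ) • chargeOp hω hl q),
      Lp.coeFn_smul (α : ℂ) (chargeOp hω hl q), Lp.coeFn_zero ℂ 2 (volume : Measure ℝ)]
      with x h1 h2 h3 h4 h5
    rw [h3, Pi.add_apply, h4, h5, Pi.smul_apply, h2, smul_eq_mul, Pi.zero_apply] at h1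
    exact h1

/-- The interaction contributes `α tr (G q) = α K q = -q`, which cancels the source in
`form_potentialElement`. -/
theorem potentialElement_mem_eigenspace {α : ℝ} {q : L2Line}
    (hq : q + (α : ℂ) • chargeOp hω hl q = 0) :
    (potentialElement hω hl q).fn ∈ eigenspace ω α lam := by
  refine mem_eigenspace_iff.2 ⟨_, rfl, fun V => ?_⟩
  have h1 := form_potentialElement hω hl q V
  have h2 : inner ℂ V.tr (q + (α : ℂ) • chargeOp hω hl q) = 0 := by rw [hq, inner_zero_right]
  rw [inner_add_right, inner_smul_right] at h2
  rw [form_eq_add_trace, potentialElement_tr]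
  linear_combination h1 + h2

/-- The charge is `q = -α tr u`. Then `u - G q` solves the homogeneous resolvent equation, so it
vanishes together with its trace, and the trace of `u = G q` is the charge equation. -/
theorem exists_charge_of_mem_eigenspace {α : ℝ} {u : L2Plane} (hu : u ∈ eigenspace ω α lam) :
    ∃ q : L2Line, (potentialElement hω hl q).fn = u ∧ q + (α : ℂ) • chargeOp hω hl q = 0 := by
  obtain ⟨U, rfl, hU⟩ := mem_eigenspace_iff.1 hu
  set q := -(α : ℂ) • U.tr with hq
  have hZ (V : FormElement) : form ω 0 V (U.sub (potentialElement hω hl q))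
      + lam * inner ℂ V.fn (U.sub (potentialElement hω hl q)).fn = 0 := by
    have h1 := form_potentialElement hω hl q V
    have h2 := hU V
    rw [form_eq_add_trace] at h2
    rw [hq, inner_smul_right] at h1
    rw [form_sub_right, FormElement.sub_fn, inner_sub_right]
    linear_combination h2 - h1
  obtain ⟨z1, z2⟩ := FormElement.eq_zero_of_resolvent hω hl _ hZ
  rw [FormElement.sub_fn, sub_eq_zero] at z1
  rw [FormElement.sub_tr, sub_eq_zero] at z2
  refine ⟨q, z1.symm, ?_⟩
  rw [← potentialElement_tr, ← z2, hq]
  module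

/-- Equal potentials have `K q = K r`, and the charge equation recovers `q = -α K q`. -/
theorem charge_unique {α : ℝ} {q r : L2Line} (hq : q + (α : ℂ) • chargeOp hω hl q = 0)
    (hr : r + (α : ℂ) • chargeOp hω hl r = 0)
    (h : (potentialElement hω hl q).fn = (potentialElement hω hl r).fn) : q = r := by
  have h0 : (potentialElement hω hl (q - r)).fn = 0 := by
    rw [potentialElement_sub_fn, h, sub_self]
  have h1 := chargeOp_eq_zero_of_potential hω hl h0
  rw [map_sub, sub_eq_zero] at h1
  rw [eq_neg_of_add_eq_zero_left hq, eq_neg_of_add_eq_zero_left hr, h1]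

theorem eq_potentialElement_iff (u : L2Plane) (q : L2Line) :
    (∀ᵐ p, u p = potential ω lam q p) ↔ (potentialElement hω hl q).fn = u := by
  rw [Lp.ext_iff]
  constructor
  · intro h
    filter_upwards [h, potentialElement_ae hω hl q] with p h1 h2
    rw [h1, h2]
  · intro h
    filter_upwards [h, potentialElement_ae hω hl q] with p h1 h2
    rw [← h1, h2]

theorem existsUnique_charge {ω lam : ℝ} (hω : 0 < ω) (hl : 0 < lam) {α : ℝ} {u : L2Plane} (hu : u ∈ eigenspace ω α lam) :
    ∃! q : L2Line, (∀ᵐ p : ℝ × ℝ, u p = potential ω lam q p) ∧ SolvesCharge ω α lam q := by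
  obtain ⟨q, h1, h2⟩ := exists_charge_of_mem_eigenspace hω hl hu
  refine ⟨q, ⟨(eq_potentialElement_iff hω hl u q).2 h1, (solvesCharge_iff hω hl q).2 h2⟩, ?_⟩
  rintro r ⟨h3, h4⟩
  exact charge_unique hω hl ((solvesCharge_iff hω hl r).1 h4) h2
    (((eq_potentialElement_iff hω hl u r).1 h3).trans h1.symm)

theorem exists_eigenvector_of_charge {ω lam : ℝ} (hω : 0 < ω) (hl : 0 < lam) {α : ℝ} {q : L2Line} (hq : SolvesCharge ω α lam q) :
    ∃ u ∈ eigenspace ω α lam, ∀ᵐ p : ℝ × ℝ, u p = potential ω lam q p :=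
  ⟨_, potentialElement_mem_eigenspace hω hl ((solvesCharge_iff hω hl q).1 hq),
    potentialElement_ae hω hl q⟩

/-- The space of solutions of the charge equation. -/
def chargeSpace (α : ℝ) : Submodule ℂ L2Line :=
  LinearMap.ker (LinearMap.id + (α : ℂ) • (chargeOp hω hl : L2Line →ₗ[ℂ] L2Line))

theorem mem_chargeSpace {α : ℝ} {q : L2Line} :
    q ∈ chargeSpace hω hl α ↔ q + (α : ℂ) • chargeOp hω hl q = 0 := by
  rw [chargeSpace, LinearMap.mem_ker]
  rfl

/-- Eigenvectors correspond to solutions of the charge equation. -/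
def chargeEquiv (α : ℝ) : chargeSpace hω hl α ≃ₗ[ℂ] eigenspace ω α lam :=
  LinearEquiv.ofBijective
    (LinearMap.codRestrict _ (((schurFamily_kerFn hω hl).op : L2Line →ₗ[ℂ] L2Plane).domRestrict _)
      fun q => by
        have := potentialElement_mem_eigenspace hω hl ((mem_chargeSpace hω hl).1 q.2)
        rw [potentialElement_fn] at this
        exact this) (by
    constructor
    · intro q r h
      have h' := congrArg Subtype.val h
      refine Subtype.ext (charge_unique hω hl ((mem_chargeSpace hω hl).1 q.2)
        ((mem_chargeSpace hω hl).1 r.2) ?_)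
      rw [potentialElement_fn, potentialElement_fn]
      exact h'
    · rintro ⟨u, hu⟩
      obtain ⟨q, h1, h2⟩ := exists_charge_of_mem_eigenspace hω hl hu
      refine ⟨⟨q, (mem_chargeSpace hω hl).2 h2⟩, Subtype.ext ?_⟩
      rw [potentialElement_fn] at h1
      exact h1)

end

/-- The resolvent identity on the diagonal. -/
theorem inner_chargeOp_sub {ω lam lam' : ℝ} (hω : 0 < ω) (hl : 0 < lam) (hl' : 0 < lam')
    (r q : L2Line) : inner ℂ r (chargeOp hω hl q - chargeOp hω hl' q)
      = (lam' - lam : ℝ) * inner ℂ (potentialElement hω hl r).fn (potentialElement hω hl' q).fn := by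
  have h1 := form_potentialElement hω hl r (potentialElement hω hl' q)
  have h2 := form_potentialElement hω hl' q (potentialElement hω hl r)
  have h3 := congrArg (starRingEnd ℂ) h1
  rw [map_add, map_mul, form_conj, inner_conj_symm, inner_conj_symm, Complex.conj_ofReal,
    potentialElement_tr] at h3
  rw [potentialElement_tr, chargeOp_symm] at h2
  rw [inner_sub_right, ← h2, ← h3]
  push_cast
  ring


/-! ### Min-max levels of a bounded operator and the spectral subspaces of a compact one -/

section MinMax

variable {H : Type*} [NormedAddCommGroup H] [InnerProductSpace ℂ H]

/-- The real quadratic form of an operator. -/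
def quad (T : H →L[ℂ] H) (x : H) : ℝ := (inner ℂ (T x) x).re

theorem abs_quad_le (T : H →L[ℂ] H) (x : H) : |quad T x| ≤ ‖T‖ * ‖x‖ ^ 2 := by
  calc |quad T x| ≤ ‖inner ℂ (T x) x‖ := Complex.abs_re_le_norm _
    _ ≤ ‖T x‖ * ‖x‖ := norm_inner_le_norm _ _
    _ ≤ ‖T‖ * ‖x‖ * ‖x‖ := by gcongr; exact T.le_opNorm x
    _ = _ := by ring

theorem quad_sub (T S : H →L[ℂ] H) (x : H) : quad (T - S) x = quad T x - quad S x := by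
  simp [quad]

theorem continuous_quad (T : H →L[ℂ] H) : Continuous (quad T) := by
  unfold quad
  fun_prop

theorem quad_smul (T : H →L[ℂ] H) (c : ℝ) (x : H) : quad T ((c : ℂ) • x) = c ^ 2 * quad T x := by
  rw [quad, map_smul, inner_smul_left, inner_smul_right, Complex.conj_ofReal, quad, ← mul_assoc,
    ← Complex.ofReal_mul, Complex.re_ofReal_mul]
  ring

/-- The levels attained by the form of `T` on subspaces of dimension larger than `n`. -/
def levelSet (n : ℕ) (T : H →L[ℂ] H) : Set ℝ :=
  {r | 0 ≤ r ∧ ∃ W : Submodule ℂ H, n + 1 ≤ Module.finrank ℂ W ∧ ∀ x ∈ W, r * ‖x‖ ^ 2 ≤ quad T x}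

/-- The `n`-th eigenvalue from above of a positive compact operator, by the min-max principle. -/
def level (n : ℕ) (T : H →L[ℂ] H) : ℝ := sSup (levelSet n T)

/-- `finrank` is `0` on infinite-dimensional spaces, so only finite-dimensional subspaces are
admitted in `levelSet`. -/
theorem exists_ne_zero_of_finrank {W : Submodule ℂ H} {n : ℕ} (h : n + 1 ≤ Module.finrank ℂ W) :
    ∃ x ∈ W, x ≠ 0 := by
  have : 0 < Module.finrank ℂ W := by omega
  have := Module.nontrivial_of_finrank_pos this
  obtain ⟨x, hx⟩ := exists_ne (0 : W)
  exact ⟨x, x.2, fun h => hx (Subtype.ext h)⟩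

theorem le_of_mem_levelSet {n : ℕ} {T : H →L[ℂ] H} {r : ℝ} (h : r ∈ levelSet n T) : r ≤ ‖T‖ := by
  obtain ⟨-, W, hW, hr⟩ := h
  obtain ⟨x, hx, hx0⟩ := exists_ne_zero_of_finrank hW
  have h1 := (hr x hx).trans ((le_abs_self _).trans (abs_quad_le T x))
  exact le_of_mul_le_mul_right h1 (by positivity)

theorem bddAbove_levelSet (n : ℕ) (T : H →L[ℂ] H) : BddAbove (levelSet n T) :=
  ⟨‖T‖, fun _ h => le_of_mem_levelSet h⟩

/-- Holds also if no subspace is admissible, since `sSup ∅ = 0`. For the same reason upper bounds of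
a level require a nonnegative bound. -/
theorem level_nonneg (n : ℕ) (T : H →L[ℂ] H) : 0 ≤ level n T :=
  Real.sSup_nonneg fun _ h => h.1

theorem level_le_norm (n : ℕ) (T : H →L[ℂ] H) : level n T ≤ ‖T‖ :=
  Real.sSup_le (fun _ h => le_of_mem_levelSet h) (norm_nonneg _)

theorem le_level {n : ℕ} {T : H →L[ℂ] H} {r : ℝ} (h : r ∈ levelSet n T) : r ≤ level n T :=
  le_csSup (bddAbove_levelSet n T) h

theorem level_anti (T : H →L[ℂ] H) {m n : ℕ} (h : m ≤ n) : level n T ≤ level m T := by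
  refine Real.sSup_le (fun r hr => le_level ?_) (level_nonneg _ _)
  obtain ⟨h0, W, hW, hr⟩ := hr
  exact ⟨h0, W, by omega, hr⟩

theorem level_mono {n : ℕ} {S T : H →L[ℂ] H} (h : ∀ x, quad S x ≤ quad T x) :
    level n S ≤ level n T := by
  refine Real.sSup_le (fun r hr => le_level ?_) (level_nonneg _ _)
  obtain ⟨h0, W, hW, hr⟩ := hr
  exact ⟨h0, W, hW, fun x hx => (hr x hx).trans (h x)⟩

/-- Weyl's inequality: the same subspace serves for `S` with the value lowered by `‖T - S‖`. If the
lowered value is negative it is not in `levelSet`, but then the bound is trivial. -/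
theorem level_le_add (n : ℕ) (T S : H →L[ℂ] H) : level n T ≤ level n S + ‖T - S‖ := by
  have hS := level_nonneg n S
  refine Real.sSup_le (fun r hr => ?_) (by positivity)
  obtain ⟨h0, W, hW, hr⟩ := hr
  rcases le_total r ‖T - S‖ with h | h
  · linarith
  · suffices r - ‖T - S‖ ≤ level n S by linarith
    refine le_level ⟨by linarith, W, hW, fun x hx => ?_⟩
    have h1 := (le_abs_self _).trans (abs_quad_le (T - S) x)
    rw [quad_sub] at h1
    have h2 := hr x hx
    linarith

theorem abs_level_sub_le (n : ℕ) (T S : H →L[ℂ] H) : |level n T - level n S| ≤ ‖T - S‖ := by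
  have h1 := level_le_add n T S
  have h2 := level_le_add n S T
  rw [norm_sub_rev] at h2
  rw [abs_le]
  constructor <;> linarith

theorem quad_le_level_zero {T : H →L[ℂ] H} (hT : ∀ x, 0 ≤ quad T x) (x : H) :
    quad T x ≤ level 0 T * ‖x‖ ^ 2 := by
  rcases eq_or_ne x 0 with rfl | hx
  · simp [quad]
  have hn : 0 < ‖x‖ ^ 2 := by positivity
  rw [← div_le_iff₀ hn]
  refine le_level ⟨div_nonneg (hT x) hn.le, Submodule.span ℂ {x}, ?_, fun y hy => ?_⟩
  · rw [finrank_span_singleton hx]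
  · obtain ⟨c, rfl⟩ := Submodule.mem_span_singleton.1 hy
    have e : quad T (c • x) = ‖c‖ ^ 2 * quad T x := by
      rw [quad, map_smul, inner_smul_left, inner_smul_right, ← mul_assoc, Complex.conj_mul', quad,
        ← Complex.ofReal_pow, Complex.re_ofReal_mul]
    rw [e, norm_smul]
    apply le_of_eq
    field_simp

/-- The orthogonal projection to `M` is injective on `W`. -/
theorem finiteDimensional_of_inf_orthogonal {W M : Submodule ℂ H} [FiniteDimensional ℂ M]
    (h : ∀ x ∈ W, x ∈ Mᗮ → x = 0) :
    FiniteDimensional ℂ W ∧ Module.finrank ℂ W ≤ Module.finrank ℂ M := by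
  let f : W →ₗ[ℂ] M := (M.orthogonalProjectionOnto : H →ₗ[ℂ] M).comp W.subtype
  have hf : Function.Injective f := by
    rw [injective_iff_map_eq_zero]
    intro x hx
    refine Subtype.ext (h x x.2 ?_)
    exact (Submodule.orthogonalProjectionOnto_eq_zero_iff).1 hx
  have : FiniteDimensional ℂ W := FiniteDimensional.of_injective f hf
  exact ⟨this, LinearMap.finrank_le_finrank_of_injective hf⟩

/-- A subspace of dimension larger than `n` contains a nonzero vector orthogonal to `M`, where the
form is at most `c`. -/
theorem level_le_of_orthogonal {n : ℕ} {T : H →L[ℂ] H} {M : Submodule ℂ H}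
    [FiniteDimensional ℂ M] (hM : Module.finrank ℂ M ≤ n) {c : ℝ} (hc : 0 ≤ c)
    (h : ∀ x ∈ Mᗮ, quad T x ≤ c * ‖x‖ ^ 2) : level n T ≤ c := by
  refine Real.sSup_le (fun r hr => ?_) hc
  obtain ⟨h0, W, hW, hr⟩ := hr
  by_contra hcon
  have hfin := finiteDimensional_of_inf_orthogonal (W := W) (M := M) fun x hx hxM => by
    by_contra hx0
    have h1 := (hr x hx).trans (h x hxM)
    exact hcon (le_of_mul_le_mul_right h1 (by positivity))
  omega

/-- `M` is spanned by a finite `ε`-net of the image of the unit ball. For a unit vector `u ⟂ M` and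
a net point `y` near `T u`, `⟨T u, u⟩ = ⟨T u - y, u⟩` is at most `ε`. -/
theorem exists_orthogonal_quad_le {T : H →L[ℂ] H} (hT : IsCompactOperator T) {ε : ℝ} (hε : 0 < ε) :
    ∃ M : Submodule ℂ H, FiniteDimensional ℂ M ∧ ∀ x ∈ Mᗮ, quad T x ≤ ε * ‖x‖ ^ 2 := by
  have hc : IsCompact (closure (T '' Metric.closedBall 0 1)) :=
    hT.isCompact_closure_image_closedBall 1
  obtain ⟨t, -, htf, ht⟩ := Metric.finite_approx_of_totallyBounded hc.totallyBounded ε hε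
  refine ⟨Submodule.span ℂ t, FiniteDimensional.span_of_finite ℂ htf, fun x hx => ?_⟩
  have key (u : H) (hu : u ∈ (Submodule.span ℂ t)ᗮ) (hn : ‖u‖ = 1) : quad T u ≤ ε := by
    have h1 : T u ∈ closure (T '' Metric.closedBall 0 1) :=
      subset_closure ⟨u, by simp [hn], rfl⟩
    obtain ⟨y, hy, hd⟩ := Set.mem_iUnion₂.1 (ht h1)
    rw [Metric.mem_ball, dist_eq_norm] at hd
    have h2 : inner ℂ y u = 0 := hu y (Submodule.subset_span hy)
    have h3 : quad T u = (inner ℂ (T u - y) u).re := by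
      rw [quad, inner_sub_left, h2, sub_zero]
    rw [h3]
    calc _ ≤ ‖inner ℂ (T u - y) u‖ := (le_abs_self _).trans (Complex.abs_re_le_norm _)
      _ ≤ ‖T u - y‖ * ‖u‖ := norm_inner_le_norm _ _
      _ ≤ ε := by rw [hn, mul_one]; exact hd.le
  rcases eq_or_ne x 0 with rfl | hx0
  · simp [quad]
  have hxn : ‖x‖ ≠ 0 := norm_ne_zero_iff.2 hx0
  have h1 := key ((‖x‖⁻¹ : ℝ) • x) ?_ ?_
  · have h2 := quad_smul T ‖x‖⁻¹ x
    rw [Complex.coe_smul] at h2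
    rw [h2] at h1
    have : 0 < ‖x‖ ^ 2 := by positivity
    calc quad T x = ‖x‖⁻¹ ^ 2 * quad T x * ‖x‖ ^ 2 := by field_simp
      _ ≤ _ := by gcongr
  · rw [← Complex.coe_smul]
    exact Submodule.smul_mem _ _ hx
  · rw [norm_smul, norm_inv, norm_norm, inv_mul_cancel₀ hxn]

/-- The span of the eigenvectors with eigenvalue in `s`. -/
def specSub (T : H →L[ℂ] H) (s : Set ℂ) : Submodule ℂ H :=
  ⨆ ν : s, Module.End.eigenspace (T : H →ₗ[ℂ] H) ν

theorem specSub_mono (T : H →L[ℂ] H) {s t : Set ℂ} (h : s ⊆ t) : specSub T s ≤ specSub T t :=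
  iSup_le fun ν => le_iSup (fun ν : t => Module.End.eigenspace (T : H →ₗ[ℂ] H) ν) ⟨ν, h ν.2⟩

theorem eigenspace_le_specSub (T : H →L[ℂ] H) {s : Set ℂ} {ν : ℂ} (h : ν ∈ s) :
    Module.End.eigenspace (T : H →ₗ[ℂ] H) ν ≤ specSub T s :=
  le_iSup (fun ν : s => Module.End.eigenspace (T : H →ₗ[ℂ] H) ν) ⟨ν, h⟩

/-- Pythagoras: eigenspaces of a symmetric operator are orthogonal, so norm and form become weighted
sums with common nonnegative weights. -/
theorem exists_sum_of_mem_specSub {T : H →L[ℂ] H} (hT : (T : H →ₗ[ℂ] H).IsSymmetric) {s : Set ℂ}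
    {x : H} (hx : x ∈ specSub T s) : ∃ (F : Finset s) (w : s → ℝ), (∀ i, 0 ≤ w i) ∧
      ‖x‖ ^ 2 = ∑ i ∈ F, w i ∧ quad T x = ∑ i ∈ F, (i : ℂ).re * w i := by
  obtain ⟨f, hf, rfl⟩ := (Submodule.mem_iSup_iff_exists_finsupp _ _).1 hx
  have ho := (hT.orthogonalFamily_eigenspaces).comp (Subtype.coe_injective (p := fun ν => ν ∈ s))
  let l : ∀ i : s, Module.End.eigenspace (T : H →ₗ[ℂ] H) i := fun i => ⟨f i, hf i⟩
  have e1 : (f.sum fun _ x => x) = ∑ i ∈ f.support, ((l i : Module.End.eigenspace _ _) : H) := rfl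
  have e2 : T (f.sum fun _ x => x) = ∑ i ∈ f.support,
      (((i : ℂ) • l i : Module.End.eigenspace _ _) : H) := by
    rw [e1, map_sum]
    refine Finset.sum_congr rfl fun i _ => ?_
    exact Module.End.mem_eigenspace_iff.1 (hf i)
  refine ⟨f.support, fun i => ‖l i‖ ^ 2, fun i => by positivity, ?_, ?_⟩
  · rw [e1]
    exact ho.norm_sum l f.support
  · rw [quad, e2, e1]
    have := ho.inner_sum (fun i => (i : ℂ) • l i) l f.support
    refine (congrArg Complex.re this).trans ?_
    rw [Complex.re_sum]
    refine Finset.sum_congr rfl fun i _ => ?_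
    rw [inner_smul_left, inner_self_eq_norm_sq_to_K]
    simp only [Complex.coe_algebraMap]
    rw [← Complex.ofReal_pow, Complex.re_mul_ofReal, Complex.conj_re]

theorem quad_ge_of_mem_specSub {T : H →L[ℂ] H} (hT : (T : H →ₗ[ℂ] H).IsSymmetric) {s : Set ℂ}
    {r : ℝ} (hs : ∀ ν ∈ s, r ≤ ν.re) {x : H} (hx : x ∈ specSub T s) : r * ‖x‖ ^ 2 ≤ quad T x := by
  obtain ⟨F, w, hw, h1, h2⟩ := exists_sum_of_mem_specSub hT hx
  rw [h1, h2, Finset.mul_sum]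
  exact Finset.sum_le_sum fun i _ => mul_le_mul_of_nonneg_right (hs i i.2) (hw i)

theorem quad_le_of_mem_specSub {T : H →L[ℂ] H} (hT : (T : H →ₗ[ℂ] H).IsSymmetric) {s : Set ℂ}
    {r : ℝ} (hs : ∀ ν ∈ s, ν.re ≤ r) {x : H} (hx : x ∈ specSub T s) : quad T x ≤ r * ‖x‖ ^ 2 := by
  obtain ⟨F, w, hw, h1, h2⟩ := exists_sum_of_mem_specSub hT hx
  rw [h1, h2, Finset.mul_sum]
  exact Finset.sum_le_sum fun i _ => mul_le_mul_of_nonneg_right (hs i i.2) (hw i)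

theorem specSub_isOrtho {T : H →L[ℂ] H} (hT : (T : H →ₗ[ℂ] H).IsSymmetric) {s t : Set ℂ}
    (h : Disjoint s t) : specSub T s ⟂ specSub T t := by
  rw [specSub, specSub, Submodule.isOrtho_iSup_left]
  intro i
  rw [Submodule.isOrtho_iSup_right]
  intro j
  exact hT.orthogonalFamily_eigenspaces.isOrtho (h.ne_of_mem i.2 j.2)

theorem finiteDimensional_specSub {T : H →L[ℂ] H} (hc : IsCompactOperator T)
    (hT : (T : H →ₗ[ℂ] H).IsSymmetric) {s : Set ℂ} {r : ℝ} (hr : 0 < r) (hs : ∀ ν ∈ s, r ≤ ν.re) :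
    FiniteDimensional ℂ (specSub T s) := by
  obtain ⟨M, hM, hq⟩ := exists_orthogonal_quad_le hc (half_pos hr)
  refine (finiteDimensional_of_inf_orthogonal (M := M) fun x hx hxM => ?_).1
  have h1 := (quad_ge_of_mem_specSub hT hs hx).trans (hq x hxM)
  by_contra hx0
  have : 0 < ‖x‖ ^ 2 := by positivity
  nlinarith

variable [CompleteSpace H]

/-- The spectral theorem: the eigenspaces are total, so a vector orthogonal to those with eigenvalue
in `s` is a limit of sums from the others. -/
theorem mem_closure_specSub {T : H →L[ℂ] H} (hc : IsCompactOperator T)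
    (hT : (T : H →ₗ[ℂ] H).IsSymmetric) {s : Set ℂ} {x : H} (hx : x ∈ (specSub T s)ᗮ) :
    x ∈ (specSub T sᶜ).topologicalClosure := by
  set C := (specSub T sᶜ).topologicalClosure
  have hCc : IsClosed (C : Set H) := Submodule.isClosed_topologicalClosure _
  have : CompleteSpace C := hCc.completeSpace_coe
  obtain ⟨a, ha, b, hb, rfl⟩ := C.exists_add_mem_mem_orthogonal x
  have ha' : a ∈ (specSub T s)ᗮ := by
    have : C ≤ (specSub T s)ᗮ := by
      refine Submodule.topologicalClosure_minimal _ ?_ (Submodule.isClosed_orthogonal _)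
      exact (specSub_isOrtho hT disjoint_compl_left)
    exact this ha
  have hb1 : b ∈ (specSub T s)ᗮ := by
    have := Submodule.sub_mem _ hx ha'
    simpa using this
  have hb2 : b ∈ (specSub T sᶜ)ᗮ :=
    Submodule.orthogonal_le (Submodule.le_topologicalClosure _) hb
  have hbot := ContinuousLinearMap.orthogonalComplement_iSup_eigenspaces_eq_bot hc hT
  have hb0 : b ∈ (⨆ ν, Module.End.eigenspace (T : H →ₗ[ℂ] H) ν)ᗮ := by
    rw [← Submodule.iInf_orthogonal, Submodule.mem_iInf]
    intro ν
    by_cases hν : ν ∈ s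
    · exact Submodule.orthogonal_le (eigenspace_le_specSub T hν) hb1
    · exact Submodule.orthogonal_le (eigenspace_le_specSub T (s := sᶜ) hν) hb2
  rw [hbot, Submodule.mem_bot] at hb0
  rw [hb0, add_zero]
  exact ha

theorem quad_le_of_mem_orthogonal {T : H →L[ℂ] H} (hc : IsCompactOperator T)
    (hT : (T : H →ₗ[ℂ] H).IsSymmetric) {s : Set ℂ} {r : ℝ} (hs : ∀ ν ∉ s, ν.re ≤ r) {x : H}
    (hx : x ∈ (specSub T s)ᗮ) : quad T x ≤ r * ‖x‖ ^ 2 := by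
  have hcl : IsClosed {x | quad T x ≤ r * ‖x‖ ^ 2} :=
    isClosed_le (continuous_quad T) (by fun_prop)
  have hx' : x ∈ closure (specSub T sᶜ : Set H) := mem_closure_specSub hc hT hx
  exact closure_minimal (fun y hy => quad_le_of_mem_specSub hT (fun ν hν => hs ν hν) hy) hcl hx'

end MinMax

/-! ### Multiplicities counted by levels -/

section Counting

variable {H : Type*} [NormedAddCommGroup H] [InnerProductSpace ℂ H]
  {T : H →L[ℂ] H}

/-- The span of the eigenvectors with eigenvalue larger than `r`. -/
def specGt (T : H →L[ℂ] H) (r : ℝ) : Submodule ℂ H := specSub T {ν | r < ν.re}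

/-- The span of the eigenvectors with eigenvalue at least `r`. -/
def specGe (T : H →L[ℂ] H) (r : ℝ) : Submodule ℂ H := specSub T {ν | r ≤ ν.re}

theorem exists_minimal_nat {β : Type*} (f : β → ℕ) {s : Set β} (hs : s.Nonempty) :
    ∃ a ∈ s, ∀ b ∈ s, f a ≤ f b := by
  obtain ⟨a, ha, h⟩ := (measure f).wf.has_min s hs
  exact ⟨a, ha, fun b hb => not_lt.1 (h b hb)⟩

/-- The lower half of the min-max principle, with `specGe` as trial space; the upper half in
`level_le_of_finrank_specGt_le` uses the orthogonal complement of `specGt`. -/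
theorem le_level_of_lt_finrank_specGe (hT : (T : H →ₗ[ℂ] H).IsSymmetric) {r : ℝ} (hr : 0 ≤ r)
    {n : ℕ} (h : n < Module.finrank ℂ (specGe T r)) : r ≤ level n T :=
  le_level ⟨hr, specGe T r, h, fun _ hx => quad_ge_of_mem_specSub hT (fun _ hν => hν) hx⟩

theorem level_le_of_finrank_specGt_le [CompleteSpace H] (hc : IsCompactOperator T)
    (hT : (T : H →ₗ[ℂ] H).IsSymmetric) {r : ℝ} (hr : 0 < r)
    {n : ℕ} (h : Module.finrank ℂ (specGt T r) ≤ n) : level n T ≤ r := by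
  have : FiniteDimensional ℂ (specGt T r) :=
    finiteDimensional_specSub hc hT hr fun _ hν => le_of_lt hν
  exact level_le_of_orthogonal h hr.le fun x hx =>
    quad_le_of_mem_orthogonal hc hT (fun ν hν => not_lt.1 hν) hx

/-- Eigenvalues above a positive number do not accumulate at it. A threshold above `r` with the
largest spectral subspace already captures everything, because lowering it further cannot enlarge
that subspace. -/
theorem exists_specGe_eq_specGt (hc : IsCompactOperator T)
    (hT : (T : H →ₗ[ℂ] H).IsSymmetric) {r : ℝ} (hr : 0 < r) :
    ∃ r' > r, specGt T r ≤ specGe T r' := by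
  have hfin : FiniteDimensional ℂ (specGt T r) :=
    finiteDimensional_specSub hc hT hr fun _ hν => le_of_lt hν
  have hle {a : ℝ} (ha : r < a) : specGe T a ≤ specGt T r :=
    specSub_mono T fun ν (hν : a ≤ ν.re) => lt_of_lt_of_le ha hν
  -- The largest dimension is found by minimizing the codimension in `specGt T r`, a natural number.
  obtain ⟨a, ha, hmin⟩ := exists_minimal_nat
    (fun a => Module.finrank ℂ (specGt T r) - Module.finrank ℂ (specGe T a))
    (s := Set.Ioi r) ⟨r + 1, by simp⟩
  refine ⟨a, ha, iSup_le fun ν => ?_⟩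
  have hν : r < (ν : ℂ).re := ν.2
  have hb : r < min a (ν : ℂ).re := lt_min ha hν
  have h1 := hmin _ hb
  have f1 := Submodule.finrank_mono (hle ha)
  have f2 := Submodule.finrank_mono (hle hb)
  have hba : specGe T a ≤ specGe T (min a (ν : ℂ).re) :=
    specSub_mono T fun z (hz : a ≤ z.re) => (min_le_left _ _).trans hz
  have : FiniteDimensional ℂ (specGe T (min a (ν : ℂ).re)) :=
    Submodule.finiteDimensional_of_le (hle hb)
  have he := Submodule.eq_of_le_of_finrank_le hba (by omega)
  rw [he]
  exact eigenspace_le_specSub T (s := {z | min a (ν : ℂ).re ≤ z.re}) (min_le_right a (ν : ℂ).re)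

theorem lt_level_of_lt_finrank_specGt (hc : IsCompactOperator T)
    (hT : (T : H →ₗ[ℂ] H).IsSymmetric) {r : ℝ} (hr : 0 < r)
    {n : ℕ} (h : n < Module.finrank ℂ (specGt T r)) : r < level n T := by
  obtain ⟨r', hr', hle⟩ := exists_specGe_eq_specGt hc hT hr
  have : FiniteDimensional ℂ (specGe T r') :=
    finiteDimensional_specSub hc hT (hr.trans hr') fun _ hν => hν
  exact lt_of_lt_of_le hr' (le_level_of_lt_finrank_specGe hT (hr.trans hr').le
    (h.trans_le (Submodule.finrank_mono hle)))

/-- No accumulation from below. The threshold `a < r` has the smallest spectral subspace. If an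
eigenvalue lay strictly between `a` and `r`, raising `a` to it would not change this subspace, and
the eigenspace would be orthogonal to itself. -/
theorem exists_specGt_le_specGe (hc : IsCompactOperator T)
    (hT : (T : H →ₗ[ℂ] H).IsSymmetric) {r : ℝ} (hr : 0 < r) :
    ∃ r', 0 < r' ∧ r' < r ∧ specGt T r' ≤ specGe T r := by
  obtain ⟨a, ha, hmin⟩ := exists_minimal_nat (fun a => Module.finrank ℂ (specGt T a))
    (s := Set.Ioo 0 r) ⟨r / 2, by constructor <;> linarith⟩
  have hfin : FiniteDimensional ℂ (specGt T a) :=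
    finiteDimensional_specSub hc hT ha.1 fun _ hν => le_of_lt hν
  refine ⟨a, ha.1, ha.2, iSup_le fun ν => ?_⟩
  have hν : a < (ν : ℂ).re := ν.2
  rcases le_or_gt r (ν : ℂ).re with h | h
  · exact eigenspace_le_specSub T h
  · have h1 := hmin _ ⟨ha.1.trans hν, h⟩
    have hle : specGt T (ν : ℂ).re ≤ specGt T a :=
      specSub_mono T fun z (hz : (ν : ℂ).re < z.re) => hν.trans hz
    have he := Submodule.eq_of_le_of_finrank_le hle h1
    have h2 : Module.End.eigenspace (T : H →ₗ[ℂ] H) ν ≤ specGt T (ν : ℂ).re := by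
      rw [he]; exact eigenspace_le_specSub T hν
    have h3 : specSub T {(ν : ℂ)} ⟂ specGt T (ν : ℂ).re :=
      specSub_isOrtho hT (by simp)
    have h4 := h3.mono (eigenspace_le_specSub T (Set.mem_singleton _)) h2
    rw [Submodule.isOrtho_self] at h4
    rw [h4]
    exact bot_le

theorem level_lt_of_finrank_specGe_le [CompleteSpace H] (hc : IsCompactOperator T)
    (hT : (T : H →ₗ[ℂ] H).IsSymmetric) {r : ℝ} (hr : 0 < r)
    {n : ℕ} (h : Module.finrank ℂ (specGe T r) ≤ n) : level n T < r := by
  obtain ⟨r', h0, hr', hle⟩ := exists_specGt_le_specGe hc hT hr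
  have : FiniteDimensional ℂ (specGe T r) := finiteDimensional_specSub hc hT hr fun _ hν => hν
  exact lt_of_le_of_lt (level_le_of_finrank_specGt_le hc hT h0
    ((Submodule.finrank_mono hle).trans h)) hr'

/-- The spectral sets are cut out by real parts; since eigenvalues of a symmetric operator are real,
the only one with real part `r` is `r`. -/
theorem finrank_specGe (hc : IsCompactOperator T)
    (hT : (T : H →ₗ[ℂ] H).IsSymmetric) {r : ℝ} (hr : 0 < r) :
    Module.finrank ℂ (specGe T r) = Module.finrank ℂ (specGt T r)
      + Module.finrank ℂ (Module.End.eigenspace (T : H →ₗ[ℂ] H) (r : ℂ)) := by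
  have hsup : specGt T r ⊔ Module.End.eigenspace (T : H →ₗ[ℂ] H) (r : ℂ) = specGe T r := by
    refine le_antisymm (sup_le (specSub_mono T fun ν (hν : r < ν.re) => hν.le)
      (eigenspace_le_specSub T (by simp))) (iSup_le fun ν => ?_)
    have hν : r ≤ (ν : ℂ).re := ν.2
    rcases hν.lt_or_eq with h | h
    · exact (eigenspace_le_specSub T h).trans le_sup_left
    · by_cases he : Module.End.eigenspace (T : H →ₗ[ℂ] H) (ν : ℂ) = ⊥
      · rw [he]; exact bot_le
      · have h1 := hT.conj_eigenvalue_eq_self (μ := (ν : ℂ)) he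
        have h2 : (ν : ℂ) = (r : ℂ) := by
          rw [← Complex.conj_eq_iff_re.1 h1, ← h]
        rw [h2]
        exact le_sup_right
  have f1 : FiniteDimensional ℂ (specGe T r) := finiteDimensional_specSub hc hT hr fun _ hν => hν
  have f2 : FiniteDimensional ℂ (specGt T r) :=
    finiteDimensional_specSub hc hT hr fun _ hν => le_of_lt hν
  have f3 : FiniteDimensional ℂ (Module.End.eigenspace (T : H →ₗ[ℂ] H) (r : ℂ)) :=
    Submodule.finiteDimensional_of_le (le_sup_right.trans hsup.le)
  have hinf : specGt T r ⊓ Module.End.eigenspace (T : H →ₗ[ℂ] H) (r : ℂ) = ⊥ := by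
    have h3 : specGt T r ⟂ specSub T {(r : ℂ)} := specSub_isOrtho hT (by simp)
    exact (h3.mono_right (eigenspace_le_specSub T (Set.mem_singleton _))).disjoint.eq_bot
  have := Submodule.finrank_sup_add_finrank_inf_eq (specGt T r)
    (Module.End.eigenspace (T : H →ₗ[ℂ] H) (r : ℂ))
  rw [hsup, hinf, finrank_bot, add_zero] at this
  exact this

/-- The multiplicity of an eigenvalue is the number of levels equal to it. -/
theorem level_eq_iff [CompleteSpace H] (hc : IsCompactOperator T) (hT : (T : H →ₗ[ℂ] H).IsSymmetric) {r : ℝ}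
    (hr : 0 < r) (n : ℕ) : level n T = r ↔ n ∈ Finset.Ico (Module.finrank ℂ (specGt T r))
      (Module.finrank ℂ (specGt T r)
        + Module.finrank ℂ (Module.End.eigenspace (T : H →ₗ[ℂ] H) (r : ℂ))) := by
  rw [← finrank_specGe hc hT hr, Finset.mem_Ico]
  constructor
  · intro h
    constructor
    · by_contra hcon
      exact absurd h (lt_level_of_lt_finrank_specGt hc hT hr (not_le.1 hcon)).ne'
    · by_contra hcon
      exact absurd h (level_lt_of_finrank_specGe_le hc hT hr (not_lt.1 hcon)).ne
  · rintro ⟨h1, h2⟩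
    exact le_antisymm (level_le_of_finrank_specGt_le hc hT hr h1)
      (le_level_of_lt_finrank_specGe hT hr.le h2)

/-- The unit sphere of the finite-dimensional `W` is compact, so the form attains a minimum there,
and the inequality stays strict. -/
theorem lt_level_of_forall_lt {s : ℝ} (hs : 0 ≤ s) {n : ℕ} {W : Submodule ℂ H}
    (hn : n + 1 ≤ Module.finrank ℂ W) (h : ∀ x ∈ W, ‖x‖ = 1 → s < quad T x) : s < level n T := by
  have hfin : FiniteDimensional ℂ W := FiniteDimensional.of_finrank_pos (by omega)
  have hcomp : IsCompact (Metric.sphere (0 : W) 1) := isCompact_sphere 0 1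
  have hnt : Nontrivial W := Module.nontrivial_of_finrank_pos (R := ℂ) (by omega)
  have hne : (Metric.sphere (0 : W) 1).Nonempty := by
    obtain ⟨x, hx⟩ := exists_norm_eq W (c := 1) zero_le_one
    exact ⟨x, by simp [hx]⟩
  obtain ⟨u, hu, hmin⟩ := hcomp.exists_isMinOn hne
    ((continuous_quad T).comp continuous_subtype_val).continuousOn
  have hu1 : ‖(u : H)‖ = 1 := by simpa using hu
  have hlt : s < quad T u := h u u.2 hu1
  refine hlt.trans_le (le_level ⟨(hs.trans_lt hlt).le, W, hn, fun x hx => ?_⟩)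
  rcases eq_or_ne x 0 with rfl | hx0
  · simp [quad]
  have hxn : ‖x‖ ≠ 0 := norm_ne_zero_iff.2 hx0
  have hmem : ((‖x‖⁻¹ : ℝ) : ℂ) • x ∈ W := W.smul_mem _ hx
  have h1 := hmin (a := (⟨_, hmem⟩ : W)) (by
    rw [mem_sphere_zero_iff_norm]
    change ‖((‖x‖⁻¹ : ℝ) : ℂ) • x‖ = 1
    rw [norm_smul, Complex.norm_real, norm_inv, norm_norm, inv_mul_cancel₀ hxn])
  simp only [Function.comp, Set.mem_ofPred_eq] at h1
  rw [quad_smul] at h1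
  calc quad T u * ‖x‖ ^ 2 ≤ ‖x‖⁻¹ ^ 2 * quad T x * ‖x‖ ^ 2 := by gcongr
    _ = _ := by field_simp

/-- The level of `S` is realised on the subspace `specGe S (level n S)`, of dimension larger than
`n`, where the form of `S` is positive and hence strictly below that of `T`. -/
theorem level_lt_level [CompleteSpace H] {S : H →L[ℂ] H} (hc : IsCompactOperator S)
    (hS : (S : H →ₗ[ℂ] H).IsSymmetric) {n : ℕ} (hpos : 0 < level n S)
    (h : ∀ x, 0 < quad S x → quad S x < quad T x) : level n S < level n T := by
  have hn : n < Module.finrank ℂ (specGe S (level n S)) := by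
    by_contra hcon
    exact lt_irrefl _ (level_lt_of_finrank_specGe_le hc hS hpos (not_lt.1 hcon))
  refine lt_level_of_forall_lt hpos.le hn fun x hx hx1 => ?_
  have h1 : level n S * ‖x‖ ^ 2 ≤ quad S x := quad_ge_of_mem_specSub hS (fun _ hν => hν) hx
  rw [hx1, one_pow, mul_one] at h1
  exact h1.trans_lt (h x (hpos.trans_le h1))

end Counting

/-! ### Hilbert–Schmidt operators are compact -/

theorem isCompactOperator_smulRight {F G : Type*} [NormedAddCommGroup F] [NormedSpace ℂ F]
    [NormedAddCommGroup G] [NormedSpace ℂ G] (f : F →L[ℂ] ℂ) (y : G) :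
    IsCompactOperator (f.smulRight y) :=
  (isCompactOperator_of_locallyCompactSpace_dom f).clm_comp (ContinuousLinearMap.toSpanSingleton ℂ y)

theorem isCompactOperator_sum {F G ι : Type*} [NormedAddCommGroup F] [NormedSpace ℂ F]
    [NormedAddCommGroup G] [NormedSpace ℂ G] (s : Finset ι) {f : ι → F →L[ℂ] G}
    (h : ∀ i ∈ s, IsCompactOperator (f i)) : IsCompactOperator (∑ i ∈ s, f i : F →L[ℂ] G) := by
  classical
  induction s using Finset.induction_on with
  | empty => simpa using isCompactOperator_zero
  | insert i s hi ih =>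
    rw [Finset.sum_insert hi]
    exact (h i (Finset.mem_insert_self _ _)).add (ih fun j hj => h j (Finset.mem_insert_of_mem hj))

theorem isCompactOperator_of_forall_norm_le {F G : Type*} [NormedAddCommGroup F] [NormedSpace ℂ F]
    [NormedAddCommGroup G] [NormedSpace ℂ G] [CompleteSpace G] (T : F →L[ℂ] G)
    (h : ∀ ε > 0, ∃ S : F →L[ℂ] G, IsCompactOperator S ∧ ‖T - S‖ ≤ ε) : IsCompactOperator T := by
  choose S hS hn using fun n : ℕ => h (1 / ((n : ℝ) + 1)) (by positivity)
  refine isCompactOperator_of_tendsto (F := S) (l := atTop) ?_ (Eventually.of_forall hS)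
  rw [tendsto_iff_norm_sub_tendsto_zero]
  refine squeeze_zero (fun _ => norm_nonneg _) (fun n => ?_) tendsto_one_div_add_atTop_nhds_zero_nat
  rw [norm_sub_rev]
  exact hn n

/-- Operators with square summable images of an orthonormal basis are compact. -/
theorem isCompactOperator_of_summable {F : Type*} [NormedAddCommGroup F]
    [InnerProductSpace ℂ F] [CompleteSpace F] {ι : Type*} (b : HilbertBasis ι ℂ F) (T : F →L[ℂ] F)
    (hs : Summable fun i => ‖T (b i)‖ ^ 2) : IsCompactOperator T := by
  classical
  refine isCompactOperator_of_forall_norm_le T fun ε hε => ?_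
  obtain ⟨s, hs'⟩ := summable_iff_vanishing_norm.1 hs (ε ^ 2) (by positivity)
  refine ⟨∑ i ∈ s, (innerSL ℂ (b i)).smulRight (T (b i)),
    isCompactOperator_sum s fun i _ => isCompactOperator_smulRight _ _, ?_⟩
  refine ContinuousLinearMap.opNorm_le_bound _ hε.le fun x => ?_
  have h1 : HasSum (fun i => inner ℂ (b i) x • T (b i)) (T x) := by
    have := (b.hasSum_repr x).mapL T
    simpa only [map_smul, b.repr_apply_apply] using this
  have h2 := h1.sub (hasSum_sum_of_ne_finset_zero (s := s)
    (f := fun i => if i ∈ s then inner ℂ (b i) x • T (b i) else 0) fun i hi => by simp [hi])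
  have e : ∑ i ∈ s, (if i ∈ s then inner ℂ (b i) x • T (b i) else 0)
      = (∑ i ∈ s, (innerSL ℂ (b i)).smulRight (T (b i))) x := by
    rw [sum_apply]
    refine Finset.sum_congr rfl fun i hi => ?_
    simp [hi]
  rw [e] at h2
  refine le_of_tendsto (h2.norm) (Eventually.of_forall fun t => ?_)
  have e2 : ∑ i ∈ t, (inner ℂ (b i) x • T (b i)
      - (if i ∈ s then inner ℂ (b i) x • T (b i) else 0))
      = ∑ i ∈ t \ s, inner ℂ (b i) x • T (b i) := by
    rw [← Finset.filter_notMem_eq_sdiff, Finset.sum_filter]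
    refine Finset.sum_congr rfl fun i _ => ?_
    by_cases hi : i ∈ s <;> simp [hi]
  rw [e2]
  have h3 := hs' (t \ s) Finset.sdiff_disjoint
  rw [Real.norm_of_nonneg (Finset.sum_nonneg fun _ _ => by positivity)] at h3
  -- The tail is estimated by Cauchy–Schwarz: Bessel's inequality for the coefficients, smallness of
  -- the square sum for the images.
  have h4 := b.orthonormal.sum_inner_products_le x (s := t \ s)
  calc ‖∑ i ∈ t \ s, inner ℂ (b i) x • T (b i)‖
      ≤ ∑ i ∈ t \ s, ‖inner ℂ (b i) x‖ * ‖T (b i)‖ := by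
        refine (norm_sum_le _ _).trans (le_of_eq ?_)
        simp only [norm_smul]
    _ ≤ √(∑ i ∈ t \ s, ‖inner ℂ (b i) x‖ ^ 2) * √(∑ i ∈ t \ s, ‖T (b i)‖ ^ 2) :=
        Real.sum_mul_le_sqrt_mul_sqrt _ _ _
    _ ≤ √(‖x‖ ^ 2) * √(ε ^ 2) := by gcongr
    _ = ε * ‖x‖ := by
        rw [Real.sqrt_sq (norm_nonneg _), Real.sqrt_sq hε.le, mul_comm]

theorem norm_sq_eq_integral {β : Type*} [MeasurableSpace β] {μ : Measure β} (f : Lp ℂ 2 μ) :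
    ‖f‖ ^ 2 = ∫ x, ‖f x‖ ^ 2 ∂μ := by
  have h := inner_self_eq_norm_sq_to_K (𝕜 := ℂ) f
  rw [L2.inner_def] at h
  have e : ∫ x, inner ℂ (f x) (f x) ∂μ = ((∫ x, ‖f x‖ ^ 2 ∂μ : ℝ) : ℂ) := by
    rw [← integral_complex_ofReal]
    refine integral_congr_ae (Eventually.of_forall fun x => ?_)
    simp only
    rw [inner_self_eq_norm_sq_to_K]
    simp
  rw [e] at h
  simp only [Complex.coe_algebraMap] at h
  exact_mod_cast h.symm

theorem integrable_norm_sq {β : Type*} [MeasurableSpace β] {μ : Measure β} (f : Lp ℂ 2 μ) :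
    Integrable (fun x => ‖f x‖ ^ 2) μ :=
  (memLp_two_iff_integrable_sq_norm (Lp.aestronglyMeasurable f)).1 (Lp.memLp f)

/-- Hilbert–Schmidt operators are compact. -/
theorem isCompactOperator_of_rows {T : L2Line →L[ℂ] L2Line} {g : ℝ → L2Line} {G : ℝ → ℝ}
    (hT : ∀ q, ∀ᵐ x, T q x = inner ℂ (g x) q) (hG : Integrable G) (hb : ∀ x, ‖g x‖ ^ 2 ≤ G x) :
    IsCompactOperator T := by
  obtain ⟨w, b, -⟩ := exists_hilbertBasis ℂ L2Line
  refine isCompactOperator_of_summable b T (summable_of_sum_le (c := ∫ x, G x)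
    (fun _ => by positivity) fun F => ?_)
  simp only [norm_sq_eq_integral (T _)]
  -- The sum over the basis is taken under the integral, where Bessel's inequality for `g x` bounds
  -- it pointwise by `G x`.
  rw [← integral_finsetSum _ fun i _ => integrable_norm_sq _]
  refine integral_mono_ae (integrable_finsetSum _ fun i _ => integrable_norm_sq _) hG ?_
  have hall : ∀ᵐ x, ∀ i ∈ F, T (b i) x = inner ℂ (g x) (b i) :=
    (Filter.eventually_all_finset F).2 fun i _ => hT (b i)
  filter_upwards [hall] with x hx
  refine le_trans (le_of_eq ?_) ((b.orthonormal.sum_inner_products_le (g x) (s := F)).trans (hb x))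
  refine Finset.sum_congr rfl fun i hi => ?_
  rw [hx i hi, norm_inner_symm]

/-- After integration in time the kernel is dominated by a product of Gaussians, hence square
integrable. -/
theorem SchurFamily.isCompactOperator_op {a : ℝ → ℝ → ℝ → ℝ} {C : ℝ → ℝ}
    (h : SchurFamily volume a C) {β : ℝ → ℝ} {c : ℝ} (hc : 0 < c) (hβ : IntegrableOn β (Set.Ioi 0))
    (hb : ∀ τ, 0 < τ → ∀ x x', |a τ x x'| ≤ β τ * (Real.exp (-c * x ^ 2) * Real.exp (-c * x' ^ 2))) :
    IsCompactOperator h.op := by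
  set M := ∫ τ in Set.Ioi 0, β τ with hM
  have hk (x x' : ℝ) : |∫ τ in Set.Ioi 0, a τ x x'|
      ≤ M * (Real.exp (-c * x ^ 2) * Real.exp (-c * x' ^ 2)) := by
    rw [hM, ← integral_mul_const]
    refine norm_integral_le_of_norm_le (G := ℝ) (hβ.mul_const _) ?_
    filter_upwards [ae_restrict_mem measurableSet_Ioi] with τ hτ
    exact hb τ hτ x x'
  have hmeas (x : ℝ) : Measurable fun x' => ∫ τ in Set.Ioi 0, a τ x x' := by
    have : StronglyMeasurable fun z : ℝ × ℝ => a z.2 x z.1 :=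
      (h.meas.comp (f := fun z : ℝ × ℝ => (x, z.2, z.1)) (by fun_prop)).stronglyMeasurable
    exact (this.integral_prod_right' (ν := volume.restrict (Set.Ioi 0))).measurable
  have hgi : Integrable fun x' : ℝ => Real.exp (-c * x' ^ 2) := integrable_exp_neg_mul_sq hc
  have hL (x : ℝ) : MemLp (fun x' => ((∫ τ in Set.Ioi 0, a τ x x' : ℝ) : ℂ)) 2 volume :=
    memLp_two_of_abs_le (c := 1) (D := M * Real.exp (-c * x ^ 2)) (hmeas x) hgi
      (fun _ => (Real.exp_pos _).le)
      (fun x' => Real.exp_le_one_iff.2 (by nlinarith [sq_nonneg x', mul_nonneg hc.le (sq_nonneg x')]))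
      (fun x' => by rw [mul_assoc]; exact hk x x')
  have hgi2 : Integrable fun x' : ℝ => Real.exp (-(2 * c) * x' ^ 2) :=
    integrable_exp_neg_mul_sq (by positivity)
  refine isCompactOperator_of_rows (g := fun x => (hL x).toLp _)
    (G := fun x => M ^ 2 * (∫ x' : ℝ, Real.exp (-(2 * c) * x' ^ 2)) * Real.exp (-(2 * c) * x ^ 2))
    (fun q => ?_) (hgi2.const_mul _) fun x => ?_
  · filter_upwards [h.op_ae_kernel q] with x hx
    rw [hx, inner_toLp_conj q (hL x) (fun x' => Complex.conj_ofReal _)]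
    simp only [mul_comm]
  · rw [norm_sq_eq_integral]
    have e : ∫ x', ‖(hL x).toLp _ x'‖ ^ 2 = ∫ x', |∫ τ in Set.Ioi 0, a τ x x'| ^ 2 := by
      refine integral_congr_ae ?_
      filter_upwards [(hL x).coeFn_toLp] with x' hx'
      rw [hx', Complex.norm_real, Real.norm_eq_abs]
    rw [e]
    calc ∫ x', |∫ τ in Set.Ioi 0, a τ x x'| ^ 2
        ≤ ∫ x', M ^ 2 * Real.exp (-(2 * c) * x ^ 2) * Real.exp (-(2 * c) * x' ^ 2) := by
          refine integral_mono_of_nonneg (Eventually.of_forall fun _ => by positivity)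
            (hgi2.const_mul _) (Eventually.of_forall fun x' => ?_)
          simp only
          calc _ ≤ (M * (Real.exp (-c * x ^ 2) * Real.exp (-c * x' ^ 2))) ^ 2 := by
                gcongr; exact hk x x'
            _ = M ^ 2 * (Real.exp (-c * x ^ 2) ^ 2) * (Real.exp (-c * x' ^ 2) ^ 2) := by ring
            _ = _ := by
                rw [← Real.exp_nat_mul, ← Real.exp_nat_mul]
                push_cast
                ring_nf
      _ = _ := by
          rw [integral_const_mul]
          ring

theorem SchurFamily.op_eq_add {P : Type*} [MeasurableSpace P] {μ : Measure P} [SFinite μ]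
    {a a₁ a₂ : ℝ → P → ℝ → ℝ} {C C₁ C₂ : ℝ → ℝ} (h : SchurFamily μ a C) (h₁ : SchurFamily μ a₁ C₁)
    (h₂ : SchurFamily μ a₂ C₂) (e : ∀ τ, 0 < τ → ∀ p x', a τ p x' = a₁ τ p x' + a₂ τ p x') :
    h.op = h₁.op + h₂.op := by
  ext1 q
  rw [add_apply, Lp.ext_iff]
  filter_upwards [Lp.coeFn_add (h₁.op q) (h₂.op q), h.op_ae q, h₁.op_ae q, h₂.op_ae q,
    h₁.ae_integrable q, h₂.ae_integrable q] with p e0 e1 e2 e3 i1 i2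
  rw [e0, Pi.add_apply, e1, e2, e3, ← integral_add i1 i2]
  refine integral_congr_ae ?_
  filter_upwards [ae_timeLine_pos] with z hz
  rw [e z.1 hz]
  push_cast
  ring


/-! ### Compactness of the charge operator -/

theorem heatCoef_le {ω s τ : ℝ} (hω : 0 < ω) (hs : 0 < s) (h : s ≤ τ) :
    heatCoef ω τ ≤ √(ω / (4 * Real.pi ^ 2 * s) * (2 * (1 + 1 / (ω * s)))) := by
  have hτ := hs.trans_le h
  have hsh := sinh_mul_pos hω hτ
  refine Real.sqrt_le_sqrt ?_
  have h1 : Real.exp (ω * τ) / Real.sinh (ω * τ) ≤ 2 * (1 + 1 / (ω * s)) := by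
    calc _ ≤ 2 * Real.cosh (ω * τ) / Real.sinh (ω * τ) := by
          gcongr; exact exp_le_two_mul_cosh _
      _ = 2 * (Real.cosh (ω * τ) / Real.sinh (ω * τ)) := by ring
      _ ≤ 2 * (1 + 1 / (ω * τ)) := by gcongr; exact coth_le (mul_pos hω hτ)
      _ ≤ _ := by gcongr
  calc _ = ω / (4 * Real.pi ^ 2 * τ) * (Real.exp (ω * τ) / Real.sinh (ω * τ)) := by
        field_simp
    _ ≤ _ := by gcongr

/-- On the diagonal the oscillator confines `x` itself: `mehlerExp_ge_tanh` gives Gaussian decay in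
`x` and `x'`, at a rate bounded below for `τ ≥ s`. -/
theorem heat_diag_le {ω s τ : ℝ} (hω : 0 < ω) (hs : 0 < s) (h : s ≤ τ) (x x' : ℝ) :
    heat ω τ (x, x) x' x' ≤ √(ω / (4 * Real.pi ^ 2 * s) * (2 * (1 + 1 / (ω * s))))
      * (Real.exp (-(ω / 2 * (1 + 2 / (ω * s))⁻¹) * x ^ 2)
        * Real.exp (-(ω / 2 * (1 + 2 / (ω * s))⁻¹) * x' ^ 2)) := by
  have hτ := hs.trans_le h
  have hsh := sinh_mul_pos hω hτ
  have hc := cosh_sub_one_pos hω hτ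
  rw [heat, ← Real.exp_add]
  refine mul_le_mul (heatCoef_le hω hs h) (Real.exp_le_exp.2 ?_) (Real.exp_pos _).le
    (Real.sqrt_nonneg _)
  have h1 := mehlerExp_ge_tanh hω hτ x x'
  have h2 : (1 + 2 / (ω * s))⁻¹ ≤ (Real.cosh (ω * τ) - 1) / Real.sinh (ω * τ) := by
    rw [← inv_div (Real.sinh (ω * τ))]
    refine inv_anti₀ (by positivity) ((sinh_div_cosh_sub_one_le (mul_pos hω hτ)).trans ?_)
    gcongr
  have h3 : ω / 2 * (1 + 2 / (ω * s))⁻¹ * (x ^ 2 + x' ^ 2)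
      ≤ ω / 2 * ((Real.cosh (ω * τ) - 1) / Real.sinh (ω * τ)) * (x ^ 2 + x' ^ 2) := by gcongr
  have h4 : 0 ≤ (x - x') ^ 2 / (2 * τ) := by positivity
  simp only
  linarith

/-- The diagonal kernel for times larger than `s`. -/
def kerLate (ω lam s τ x x' : ℝ) : ℝ := if s < τ then kerDiag ω lam τ x x' else 0

/-- The diagonal kernel for times up to `s`. -/
def kerEarly (ω lam s τ x x' : ℝ) : ℝ := if s < τ then 0 else kerDiag ω lam τ x x'

theorem measurable_kerDiag (ω lam : ℝ) :
    Measurable fun w : ℝ × ℝ × ℝ => kerDiag ω lam w.2.1 w.1 w.2.2 := by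
  have hm := measurable_heat_diag ω
  unfold kerDiag
  fun_prop

theorem abs_kerDiag {ω lam τ : ℝ} (hω : 0 < ω) (hτ : 0 < τ) (x x' : ℝ) :
    |kerDiag ω lam τ x x'| = Real.exp (-(lam * τ)) * heat ω τ (x, x) x' x' := by
  rw [kerDiag, abs_of_pos (mul_pos (Real.exp_pos _) (heat_pos hω hτ _ _ _))]

theorem schurFamily_kerLate {ω lam : ℝ} (hω : 0 < ω) (hl : 0 < lam) (s : ℝ) :
    SchurFamily volume (kerLate ω lam s) (diagWeight ω lam) := by
  refine schurFamily_diag_of_le hω (c := fun τ => Real.exp (-(lam * τ)))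
    ?_ (fun τ _ => (Real.exp_pos _).le) (fun τ hτ x x' => ?_)
    (fun τ hτ => diagWeight_pos hω hτ) (integrableOn_diagWeight hω hl) (fun τ _ => le_rfl)
  · exact Measurable.ite (measurableSet_lt measurable_const (by fun_prop))
      (measurable_kerDiag ω lam) measurable_const
  · rw [kerLate]
    split_ifs
    · rw [abs_kerDiag hω hτ]
    · rw [abs_zero]
      exact mul_nonneg (Real.exp_pos _).le (heat_pos hω hτ _ _ _).le

/-- A Schur weight has to be strictly positive, so late times, where the kernel vanishes, get the
factor `s` instead of `0`; the integral of the weight still tends to `0` as `s → 0`. -/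
theorem schurFamily_kerEarly {ω lam s : ℝ} (hω : 0 < ω) (hl : 0 < lam) (hs : 0 < s) (hs1 : s ≤ 1) :
    SchurFamily volume (kerEarly ω lam s)
      (fun τ => (if s < τ then s else 1) * diagWeight ω lam τ) := by
  have hif (τ : ℝ) : 0 < (if s < τ then s else 1) ∧ (if s < τ then s else (1 : ℝ)) ≤ 1 := by
    split_ifs
    · exact ⟨hs, hs1⟩
    · exact ⟨one_pos, le_rfl⟩
  refine schurFamily_diag_of_le hω (c := fun τ => if s < τ then 0 else Real.exp (-(lam * τ)))
    ?_ (fun τ _ => ?_) (fun τ hτ x x' => ?_)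
    (fun τ hτ => mul_pos (hif τ).1 (diagWeight_pos hω hτ)) ?_ (fun τ hτ => ?_)
  · exact Measurable.ite (measurableSet_lt measurable_const (by fun_prop))
      measurable_const (measurable_kerDiag ω lam)
  · split_ifs
    · exact le_rfl
    · exact (Real.exp_pos _).le
  · rw [kerEarly]
    split_ifs
    · simp
    · rw [abs_kerDiag hω hτ]
  · refine (integrableOn_diagWeight (lam := lam) hω hl).mono'
      ((Measurable.ite (measurableSet_lt measurable_const measurable_id) measurable_const
        measurable_const).aestronglyMeasurable.mul (integrableOn_diagWeight hω hl).1) ?_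
    filter_upwards [ae_restrict_mem measurableSet_Ioi] with τ hτ
    have h0 := diagWeight_pos (lam := lam) hω hτ
    rw [Real.norm_of_nonneg (mul_pos (hif τ).1 h0).le]
    exact mul_le_of_le_one_left h0.le (hif τ).2
  · have h0 := diagWeight_pos (lam := lam) hω hτ
    split_ifs
    · rw [zero_mul]; positivity
    · rw [one_mul, diagWeight]

theorem tendsto_integral_early {ω lam : ℝ} (hω : 0 < ω) (hl : 0 < lam) :
    Tendsto (fun n : ℕ => ∫ τ in Set.Ioi 0, (if 1 / ((n : ℝ) + 1) < τ then 1 / ((n : ℝ) + 1) else 1)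
      * diagWeight ω lam τ) atTop (𝓝 0) := by
  rw [show 𝓝 (0 : ℝ) = 𝓝 (∫ τ in Set.Ioi (0 : ℝ), (0 : ℝ)) by simp]
  have hs (n : ℕ) : 0 < 1 / ((n : ℝ) + 1) ∧ 1 / ((n : ℝ) + 1) ≤ 1 := by
    refine ⟨by positivity, ?_⟩
    rw [div_le_one (by positivity)]
    have : (0 : ℝ) ≤ n := by positivity
    linarith
  have l0 := tendsto_one_div_add_atTop_nhds_zero_nat (𝕜 := ℝ)
  refine tendsto_integral_of_dominated_convergence (diagWeight ω lam)
    (fun n => ((schurFamily_kerEarly hω hl (hs n).1 (hs n).2).int).1)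
    (integrableOn_diagWeight hω hl) (fun n => ?_) ?_
  · filter_upwards [ae_restrict_mem measurableSet_Ioi] with τ hτ
    have h0 := diagWeight_pos (lam := lam) hω hτ
    rw [norm_mul, Real.norm_of_nonneg h0.le]
    refine mul_le_of_le_one_left h0.le ?_
    split_ifs
    · rw [Real.norm_of_nonneg (hs n).1.le]; exact (hs n).2
    · simp
  · filter_upwards [ae_restrict_mem measurableSet_Ioi] with τ hτ
    have h1 : Tendsto (fun n : ℕ => 1 / ((n : ℝ) + 1) * diagWeight ω lam τ) atTop (𝓝 0) := by
      simpa using l0.mul_const (diagWeight ω lam τ)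
    refine h1.congr' ?_
    filter_upwards [l0.eventually_lt_const hτ] with n hn
    rw [if_pos hn]

theorem isCompactOperator_kerLate {ω lam s : ℝ} (hω : 0 < ω) (hl : 0 < lam) (hs : 0 < s) :
    IsCompactOperator (schurFamily_kerLate hω hl s).op := by
  refine (schurFamily_kerLate hω hl s).isCompactOperator_op
    (c := ω / 2 * (1 + 2 / (ω * s))⁻¹)
    (β := fun τ => Real.exp (-(lam * τ)) * √(ω / (4 * Real.pi ^ 2 * s) * (2 * (1 + 1 / (ω * s)))))
    (by positivity) ((integrableOn_exp_mul hl).mul_const _) fun τ hτ x x' => ?_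
  rw [kerLate]
  split_ifs with h
  · rw [abs_kerDiag hω hτ, mul_assoc]
    exact mul_le_mul_of_nonneg_left (heat_diag_le hω hs h.le x x') (Real.exp_pos _).le
  · rw [abs_zero]; positivity

/-- Norm limit of the parts with times larger than `s`, which are Hilbert–Schmidt. -/
theorem isCompactOperator_chargeOp {ω lam : ℝ} (hω : 0 < ω) (hl : 0 < lam) :
    IsCompactOperator (chargeOp hω hl) := by
  refine isCompactOperator_of_forall_norm_le _ fun ε hε => ?_
  obtain ⟨n, hn⟩ := ((tendsto_integral_early hω hl).eventually_lt_const hε).exists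
  have hs : 0 < 1 / ((n : ℝ) + 1) ∧ 1 / ((n : ℝ) + 1) ≤ 1 := by
    refine ⟨by positivity, ?_⟩
    rw [div_le_one (by positivity)]
    have : (0 : ℝ) ≤ n := by positivity
    linarith
  set s := 1 / ((n : ℝ) + 1)
  refine ⟨_, isCompactOperator_kerLate hω hl hs.1, ?_⟩
  have e := (schurFamily_kerDiag hω hl).op_eq_add (schurFamily_kerLate hω hl s)
    (schurFamily_kerEarly hω hl hs.1 hs.2) fun τ _ x x' => by
      rw [kerLate, kerEarly]; split_ifs <;> simp
  rw [chargeOp, e, add_sub_cancel_left]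
  exact ((schurFamily_kerEarly hω hl hs.1 hs.2).norm_op_le).trans hn.le


/-! ### Large time behaviour of the heat kernel on the diagonal for `ω = 1` -/

/-- The kernel of the projection to the ground state of the oscillator, times the free kernel on
the diagonal. -/
def kerRank (τ x x' : ℝ) : ℝ :=
  (√(2 * Real.pi * τ))⁻¹ * (√Real.pi)⁻¹ * (Real.exp (-(1 / 2) * x ^ 2) * Real.exp (-(1 / 2) * x' ^ 2))

theorem kerRank_pos {τ : ℝ} (hτ : 0 < τ) (x x' : ℝ) : 0 < kerRank τ x x' := by
  have := Real.pi_pos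
  unfold kerRank; positivity

theorem exp_tail_le {τ : ℝ} (hτ : 4 ≤ τ) : Real.exp (-τ) / (1 - Real.exp (-τ)) ≤ 1 / τ ∧
    Real.exp (-τ) < 1 := by
  have h1 : Real.exp (-τ) < 1 := Real.exp_lt_one_iff.2 (by linarith)
  refine ⟨?_, h1⟩
  rw [div_le_div_iff₀ (by linarith) (by linarith), one_mul]
  have h2 : Real.exp (-τ) * (1 + τ) ≤ 1 := by
    rw [Real.exp_neg, inv_mul_le_iff₀ (Real.exp_pos _), mul_one]
    have := Real.add_one_le_exp τ
    linarith
  nlinarith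

/-- Everything is written in `ν = exp (-τ)`, which is small for large times; the correction factor
is then close to `1` on bounded sets. -/
theorem heat_eq_kerRank_mul {τ : ℝ} (hτ : 0 < τ) (x x' : ℝ) : heat 1 τ (x, x) x' x'
    = kerRank τ x x' * ((√(1 - Real.exp (-τ) ^ 2))⁻¹ *
      Real.exp ((2 * Real.exp (-τ) * (x * x') - Real.exp (-τ) ^ 2 * (x ^ 2 + x' ^ 2))
        / (1 - Real.exp (-τ) ^ 2) - (x - x') ^ 2 / (2 * τ))) := by
  have hpi := Real.pi_pos
  set ν := Real.exp (-τ) with hν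
  have hν0 : 0 < ν := Real.exp_pos _
  have hν1 : ν < 1 := Real.exp_lt_one_iff.2 (by linarith)
  have h1 : 0 < 1 - ν ^ 2 := by nlinarith
  have he : Real.exp τ = ν⁻¹ := by rw [hν, Real.exp_neg, inv_inv]
  have hsinh : Real.sinh τ = (1 - ν ^ 2) / (2 * ν) := by
    rw [Real.sinh_eq, he, ← hν]; field_simp
  have hcosh : Real.cosh τ = (1 + ν ^ 2) / (2 * ν) := by
    rw [Real.cosh_eq, he, ← hν]; field_simp
  have hcoef : heatCoef 1 τ = (√(2 * Real.pi * τ))⁻¹ * (√Real.pi)⁻¹ * (√(1 - ν ^ 2))⁻¹ := by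
    rw [heatCoef, one_mul, one_mul, hsinh, he, ← Real.sqrt_inv, ← Real.sqrt_inv, ← Real.sqrt_inv,
      ← Real.sqrt_mul (by positivity), ← Real.sqrt_mul (by positivity)]
    congr 1
    field_simp
    norm_num
  have hexp : -((x - x') ^ 2 / (2 * τ)) - mehlerExp 1 τ x x' = -(1 / 2) * x ^ 2 + -(1 / 2) * x' ^ 2
      + ((2 * ν * (x * x') - ν ^ 2 * (x ^ 2 + x' ^ 2)) / (1 - ν ^ 2) - (x - x') ^ 2 / (2 * τ)) := by
    rw [mehlerExp, one_mul, hsinh, hcosh]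
    field_simp
    ring
  rw [heat]
  simp only
  rw [hexp, hcoef, kerRank, Real.exp_add, Real.exp_add]
  ring

theorem abs_exp_sub_one_le {z w : ℝ} (hw : 0 ≤ w) (h : z ≤ w) :
    |Real.exp z - 1| ≤ |z| * Real.exp w := by
  rcases le_total z 0 with hz | hz
  · have h1 := Real.add_one_le_exp z
    have h2 : Real.exp z ≤ 1 := Real.exp_le_one_iff.2 hz
    have h3 : 1 ≤ Real.exp w := Real.one_le_exp hw
    rw [abs_of_nonpos (by linarith), abs_of_nonpos hz]
    nlinarith
  · have h1 := Real.add_one_le_exp (-z)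
    have h2 : 1 ≤ Real.exp z := Real.one_le_exp hz
    have h3 : Real.exp z ≤ Real.exp w := Real.exp_le_exp.2 h
    rw [abs_of_nonneg (by linarith), abs_of_nonneg hz]
    have h4 : Real.exp z * Real.exp (-z) = 1 := by rw [← Real.exp_add]; simp
    nlinarith [Real.exp_pos z]

/-- With `S = x² + x'²` the relative error is at most `(1 + 2S)/τ · exp (S/4)`, where `τ ≥ 4` gives
`S/τ ≤ S/4`. Out of the decay `exp (-S/2)` of `kerRank`, `S/4` pays for this exponential and `S/8`
for `1 + 2S ≤ 16 exp (S/8)`; `S/8` is left. The gain `1/τ` makes the remainder integrable at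
infinity. -/
theorem abs_heat_sub_kerRank_le {τ : ℝ} (hτ : 4 ≤ τ) (x x' : ℝ) :
    |heat 1 τ (x, x) x' x' - kerRank τ x x'| ≤ (√(2 * Real.pi * τ))⁻¹ * (√Real.pi)⁻¹ * (16 / τ)
      * (Real.exp (-(1 / 8) * x ^ 2) * Real.exp (-(1 / 8) * x' ^ 2)) := by
  have hτ0 : 0 < τ := by linarith
  have hpi := Real.pi_pos
  rw [heat_eq_kerRank_mul hτ0]
  obtain ⟨t1, t2⟩ := exp_tail_le hτ
  set ν := Real.exp (-τ) with hν
  have hν0 : 0 < ν := Real.exp_pos _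
  have h1 : 0 < 1 - ν ^ 2 := by nlinarith
  have h1' : 0 < 1 - ν := by linarith
  set S := x ^ 2 + x' ^ 2 with hS
  have hS0 : 0 ≤ S := by positivity
  set A := (2 * ν * (x * x') - ν ^ 2 * S) / (1 - ν ^ 2) with hA
  have hAabs : |A| ≤ S / τ := by
    have e : |2 * ν * (x * x') - ν ^ 2 * S| ≤ ν * (1 + ν) * S := by
      rw [abs_le]
      constructor
      · nlinarith [sq_nonneg (x + x'), mul_nonneg hν0.le (sq_nonneg (x + x'))]
      · nlinarith [sq_nonneg (x - x'), mul_nonneg hν0.le (sq_nonneg (x - x')), sq_nonneg ν,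
          mul_nonneg (sq_nonneg ν) hS0]
    rw [hA, abs_div, abs_of_pos h1]
    calc _ ≤ ν * (1 + ν) * S / (1 - ν ^ 2) := by gcongr
      _ = ν / (1 - ν) * S := by
          rw [show 1 - ν ^ 2 = (1 - ν) * (1 + ν) by ring]
          field_simp
      _ ≤ 1 / τ * S := by gcongr
      _ = _ := by ring
  have hA4 : A ≤ S / 4 := (le_abs_self A).trans (hAabs.trans (by gcongr))
  set z := A - (x - x') ^ 2 / (2 * τ) with hz
  have hdz : (x - x') ^ 2 / (2 * τ) ≤ S / τ := by
    rw [div_le_div_iff₀ (by positivity) hτ0]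
    nlinarith [sq_nonneg (x + x'), mul_nonneg hτ0.le (sq_nonneg (x + x'))]
  have hdz0 : 0 ≤ (x - x') ^ 2 / (2 * τ) := by positivity
  have hz4 : z ≤ S / 4 := by linarith
  have hzabs : |z| ≤ 2 * S / τ := by
    calc |z| ≤ |A| + |(x - x') ^ 2 / (2 * τ)| := abs_sub _ _
      _ ≤ S / τ + S / τ := by
          rw [abs_of_nonneg hdz0]; linarith
      _ = _ := by ring
  have hc1 : 1 ≤ (√(1 - ν ^ 2))⁻¹ := by
    rw [one_le_inv₀ (Real.sqrt_pos.2 h1)]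
    exact Real.sqrt_le_one.2 (by nlinarith)
  have hc2 : (√(1 - ν ^ 2))⁻¹ - 1 ≤ 1 / τ := by
    have h3 : 1 - ν ^ 2 ≤ √(1 - ν ^ 2) := by
      rw [Real.le_sqrt' h1]
      nlinarith [sq_nonneg ν]
    have h4 : (√(1 - ν ^ 2))⁻¹ ≤ (1 - ν ^ 2)⁻¹ := inv_anti₀ h1 h3
    have h5 : (1 - ν ^ 2)⁻¹ - 1 ≤ ν / (1 - ν) := by
      rw [sub_le_iff_le_add, ← sub_le_iff_le_add', inv_eq_one_div]
      rw [sub_le_iff_le_add', div_le_iff₀ h1, show 1 - ν ^ 2 = (1 - ν) * (1 + ν) by ring]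
      have : (ν / (1 - ν) + 1) * ((1 - ν) * (1 + ν)) = 1 + ν := by field_simp; ring
      nlinarith
    linarith
  have hmain : |(√(1 - ν ^ 2))⁻¹ * Real.exp z - 1| ≤ (1 + 2 * S) / τ * Real.exp (S / 4) := by
    have h3 := abs_exp_sub_one_le (by positivity) hz4
    have h4 : Real.exp z ≤ Real.exp (S / 4) := Real.exp_le_exp.2 hz4
    calc _ = |((√(1 - ν ^ 2))⁻¹ - 1) * Real.exp z + (Real.exp z - 1)| := by ring_nf
      _ ≤ |((√(1 - ν ^ 2))⁻¹ - 1) * Real.exp z| + |Real.exp z - 1| := abs_add_le _ _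
      _ ≤ 1 / τ * Real.exp (S / 4) + 2 * S / τ * Real.exp (S / 4) := by
          refine add_le_add ?_ (h3.trans (by gcongr))
          rw [abs_mul, abs_of_nonneg (by linarith), abs_of_pos (Real.exp_pos _)]
          gcongr
      _ = _ := by ring
  have hS16 : 1 + 2 * S ≤ 16 * Real.exp (S / 8) := by
    have := Real.add_one_le_exp (S / 8)
    linarith
  have e1 : kerRank τ x x' = (√(2 * Real.pi * τ))⁻¹ * (√Real.pi)⁻¹ * Real.exp (-(S / 2)) := by
    rw [kerRank, ← Real.exp_add, hS]; congr 2; ring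
  have e2 : Real.exp (-(1 / 8) * x ^ 2) * Real.exp (-(1 / 8) * x' ^ 2) = Real.exp (-(S / 8)) := by
    rw [← Real.exp_add, hS]; congr 1; ring
  rw [← mul_sub_one, abs_mul, abs_of_pos (kerRank_pos hτ0 x x'), e2, e1]
  calc _ ≤ (√(2 * Real.pi * τ))⁻¹ * (√Real.pi)⁻¹ * Real.exp (-(S / 2))
      * ((16 * Real.exp (S / 8)) / τ * Real.exp (S / 4)) := by
        gcongr
        exact hmain.trans (by gcongr)
    _ = (√(2 * Real.pi * τ))⁻¹ * (√Real.pi)⁻¹ * (16 / τ)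
      * (Real.exp (-(S / 2)) * Real.exp (S / 8) * Real.exp (S / 4)) := by ring
    _ = _ := by
        rw [← Real.exp_add, ← Real.exp_add]
        congr 2
        ring

/-- The integrable weight of the remainder. -/
def remWeight (τ : ℝ) : ℝ :=
  if τ < 4 then 4 * τ ^ (-(1 / 2) : ℝ) else 32 * τ ^ (-(3 / 2) : ℝ)

theorem remWeight_pos {τ : ℝ} (hτ : 0 < τ) : 0 < remWeight τ := by
  unfold remWeight; split_ifs <;> positivity

theorem integrableOn_remWeight : IntegrableOn remWeight (Set.Ioi 0) := by
  have h : Set.Ioi (0 : ℝ) = Set.Ioo 0 4 ∪ Set.Ici 4 := by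
    ext τ; simp only [Set.mem_Ioi, Set.mem_union, Set.mem_Ioo, Set.mem_Ici]
    constructor
    · intro h
      rcases lt_or_ge τ 4 with h' | h'
      · exact Or.inl ⟨h, h'⟩
      · exact Or.inr h'
    · rintro (h | h) <;> linarith
  rw [h]
  refine IntegrableOn.union ?_ ?_
  · have h1 : IntegrableOn (fun τ : ℝ => 4 * τ ^ (-(1 / 2) : ℝ)) (Set.Ioo 0 4) :=
      ((intervalIntegral.integrableOn_Ioo_rpow_iff (by norm_num)).2 (by norm_num)).const_mul 4
    refine h1.congr_fun (fun τ hτ => ?_) measurableSet_Ioo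
    rw [remWeight, if_pos hτ.2]
  · have h1 : IntegrableOn (fun τ : ℝ => 32 * τ ^ (-(3 / 2) : ℝ)) (Set.Ici 4) :=
      ((integrableOn_Ici_iff_integrableOn_Ioi).2
        (integrableOn_Ioi_rpow_of_lt (by norm_num) (by norm_num))).const_mul 32
    refine h1.congr_fun (fun τ hτ => ?_) measurableSet_Ici
    rw [remWeight, if_neg (not_lt.2 hτ)]

theorem integral_gauss_const {b : ℝ} (c x : ℝ) :
    ∫ x' : ℝ, c * (Real.exp (-b * x ^ 2) * Real.exp (-b * x' ^ 2))
      = c * Real.exp (-b * x ^ 2) * √(Real.pi / b) := by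
  rw [integral_const_mul, integral_const_mul, integral_gaussian]
  ring

theorem integrable_kerRank (τ x : ℝ) : Integrable fun x' => kerRank τ x x' :=
  ((integrable_exp_neg_mul_sq (by norm_num : (0 : ℝ) < 1 / 2)).const_mul _).const_mul _

theorem exp_neg_mul_sq_le_one {b : ℝ} (hb : 0 ≤ b) (x : ℝ) : Real.exp (-b * x ^ 2) ≤ 1 :=
  Real.exp_le_one_iff.2 (by nlinarith [mul_nonneg hb (sq_nonneg x)])

theorem integral_kerRank_le {τ : ℝ} (hτ : 0 < τ) (x : ℝ) :
    ∫ x', kerRank τ x x' ≤ τ ^ (-(1 / 2) : ℝ) := by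
  have hpi := Real.pi_pos
  have hpi3 := Real.pi_gt_three
  simp only [kerRank]
  rw [integral_gauss_const]
  calc _ ≤ (√(2 * Real.pi * τ))⁻¹ * (√Real.pi)⁻¹ * 1 * √(Real.pi / (1 / 2)) := by
        gcongr
        exact exp_neg_mul_sq_le_one (by norm_num) x
    _ = (√τ)⁻¹ * (√Real.pi)⁻¹ := by
        rw [show Real.pi / (1 / 2) = 2 * Real.pi by ring, Real.sqrt_mul (by positivity)]
        have : √(2 * Real.pi) ≠ 0 := by positivity
        field_simp
    _ ≤ (√τ)⁻¹ * 1 := by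
        gcongr
        exact inv_le_one_of_one_le₀ (Real.one_le_sqrt.2 (by linarith))
    _ = _ := by rw [mul_one, Real.sqrt_eq_rpow, Real.rpow_neg hτ.le]

theorem kerRank_symm (τ x x' : ℝ) : kerRank τ x x' = kerRank τ x' x := by
  unfold kerRank; ring

/-- An integrable bound of the remainder in the second variable. -/
theorem exists_bound_rem {τ : ℝ} (hτ : 0 < τ) : ∃ g : ℝ → ℝ → ℝ, (∀ x, Integrable (g x)) ∧
    (∀ x x', 0 ≤ g x x') ∧ (∀ x x', |heat 1 τ (x, x) x' x' - kerRank τ x x'| ≤ g x x') ∧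
    ∀ x, ∫ x', g x x' ≤ remWeight τ := by
  have hpi := Real.pi_pos
  have hpi3 := Real.pi_gt_three
  rcases lt_or_ge τ 4 with h | h
  · refine ⟨fun x x' => heat 1 τ (x, x) x' x' + kerRank τ x x',
      fun x => (integrable_heat_diag one_pos hτ x).add (integrable_kerRank τ x),
      fun x x' => add_nonneg (heat_pos one_pos hτ _ _ _).le (kerRank_pos hτ _ _).le,
      fun x x' => ?_, fun x => ?_⟩
    · refine (abs_sub _ _).trans (le_of_eq ?_)
      rw [abs_of_pos (heat_pos one_pos hτ _ _ _), abs_of_pos (kerRank_pos hτ _ _)]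
    · rw [integral_add (integrable_heat_diag one_pos hτ x) (integrable_kerRank τ x), remWeight,
        if_pos h]
      have h1 := integral_heat_diag_le one_pos hτ x
      have h2 := integral_kerRank_le hτ x
      -- For `τ < 4` one has `τ + 1 ≤ 9`. Together with the bound `τ^(-1/2)` for `kerRank` this
      -- gives the constant `4` of `remWeight`.
      have h3 : √(1 * (1 + 1 / (1 * τ))) ≤ 3 * τ ^ (-(1 / 2) : ℝ) := by
        rw [Real.rpow_neg hτ.le, ← Real.sqrt_eq_rpow, one_mul, one_mul]
        refine Real.sqrt_le_iff.2 ⟨by positivity, ?_⟩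
        rw [mul_pow, inv_pow, Real.sq_sqrt hτ.le]
        have : 1 + 1 / τ = (τ + 1) * τ⁻¹ := by field_simp
        rw [this]
        gcongr
        linarith
      linarith
  · refine ⟨fun x x' => (√(2 * Real.pi * τ))⁻¹ * (√Real.pi)⁻¹ * (16 / τ)
      * (Real.exp (-(1 / 8) * x ^ 2) * Real.exp (-(1 / 8) * x' ^ 2)),
      fun x => ((integrable_exp_neg_mul_sq (by norm_num : (0 : ℝ) < 1 / 8)).const_mul _).const_mul _,
      fun x x' => by positivity, fun x x' => abs_heat_sub_kerRank_le h x x', fun x => ?_⟩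
    rw [integral_gauss_const, remWeight, if_neg (not_lt.2 h)]
    -- Since `√(8π) / √(2πτ) = 2 / √τ`, the constant `16` becomes the `32` of `remWeight`.
    calc _ ≤ (√(2 * Real.pi * τ))⁻¹ * (√Real.pi)⁻¹ * (16 / τ) * 1 * √(Real.pi / (1 / 8)) := by
          gcongr
          exact exp_neg_mul_sq_le_one (by norm_num) x
      _ = 32 * ((√τ)⁻¹ * τ⁻¹) * (√Real.pi)⁻¹ := by
          rw [show Real.pi / (1 / 8) = (2 * 2) * (2 * Real.pi) by ring, Real.sqrt_mul (by norm_num) (2 * Real.pi),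
            Real.sqrt_mul_self (by norm_num), Real.sqrt_mul (x := 2 * Real.pi) (by positivity) τ]
          have : √(2 * Real.pi) ≠ 0 := by positivity
          field_simp
          norm_num
      _ ≤ 32 * ((√τ)⁻¹ * τ⁻¹) * 1 := by
          gcongr
          exact inv_le_one_of_one_le₀ (Real.one_le_sqrt.2 (by linarith))
      _ = _ := by
          rw [mul_one, Real.sqrt_eq_rpow, ← Real.rpow_neg hτ.le, ← Real.rpow_neg_one,
            ← Real.rpow_add hτ]
          norm_num


/-! ### Splitting the charge operator into a singular rank one part and a bounded remainder -/

/-- The remainder of the heat kernel on the diagonal. -/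
def remKer (τ x x' : ℝ) : ℝ := heat 1 τ (x, x) x' x' - kerRank τ x x'

theorem measurable_kerRank :
    Measurable fun w : ℝ × ℝ × ℝ => kerRank w.2.1 w.1 w.2.2 := by
  unfold kerRank; fun_prop

theorem remKer_symm (τ x x' : ℝ) : remKer τ x x' = remKer τ x' x := by
  rw [remKer, remKer, heat_diag_symm, kerRank_symm]

theorem schurFamily_rem {b c : ℝ → ℝ} (hb : Measurable b)
    (hint : IntegrableOn (fun τ => c τ * remWeight τ) (Set.Ioi 0)) (hc : ∀ τ, 0 < τ → 0 < c τ)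
    (hbc : ∀ τ, 0 < τ → |b τ| ≤ c τ) :
    SchurFamily volume (fun τ x x' => b τ * remKer τ x x') (fun τ => c τ * remWeight τ) := by
  have hm1 := measurable_heat_diag 1
  have hm2 := measurable_kerRank
  refine ⟨by unfold remKer; fun_prop, fun τ hτ => mul_pos (hc τ hτ) (remWeight_pos hτ), hint,
    fun τ hτ => ?_⟩
  obtain ⟨g, g1, g2, g3, g4⟩ := exists_bound_rem hτ
  have hw := remWeight_pos hτ
  have hc0 := hc τ hτ
  have key (x : ℝ) : ∫⁻ x', ‖b τ * remKer τ x x'‖ₑ ≤ ENNReal.ofReal (c τ * remWeight τ) := by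
    refine lintegral_enorm_le_of_abs_le ((g1 x).const_mul (c τ))
      (fun x' => mul_nonneg hc0.le (g2 x x')) (fun x' => ?_) ?_
    · rw [abs_mul]
      exact mul_le_mul (hbc τ hτ) (g3 x x') (abs_nonneg _) hc0.le
    · rw [integral_const_mul]
      exact mul_le_mul_of_nonneg_left (g4 x) hc0.le
  refine ⟨c τ * remWeight τ, c τ * remWeight τ, by positivity, by positivity, key, fun x' => ?_,
    le_of_eq (by ring)⟩
  simp only [remKer_symm τ _ x']
  exact key x'

/-- Without the exponential the weight `τ^(-1/2)` is not integrable at infinity: this is the part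
that is singular as `lam → 0`. -/
theorem schurFamily_rank {lam : ℝ} (hl : 0 < lam) :
    SchurFamily volume (fun τ x x' => Real.exp (-(lam * τ)) * kerRank τ x x')
      (fun τ => Real.exp (-(lam * τ)) * τ ^ (-(1 / 2) : ℝ)) := by
  have hm2 := measurable_kerRank
  refine ⟨by fun_prop, fun τ hτ => by positivity, integrableOn_exp_mul_rpow hl (by norm_num),
    fun τ hτ => ?_⟩
  have key (x : ℝ) : ∫⁻ x', ‖Real.exp (-(lam * τ)) * kerRank τ x x'‖ₑ
      ≤ ENNReal.ofReal (Real.exp (-(lam * τ)) * τ ^ (-(1 / 2) : ℝ)) := by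
    have h0 (x' : ℝ) : 0 ≤ Real.exp (-(lam * τ)) * kerRank τ x x' :=
      mul_nonneg (Real.exp_pos _).le (kerRank_pos hτ _ _).le
    refine lintegral_enorm_le_of_abs_le ((integrable_kerRank τ x).const_mul _) h0
      (fun x' => (abs_of_nonneg (h0 x')).le) ?_
    rw [integral_const_mul]
    exact mul_le_mul_of_nonneg_left (integral_kerRank_le hτ x) (Real.exp_pos _).le
  refine ⟨_, _, by positivity, by positivity, key, fun x' => ?_, le_of_eq (sq _).symm⟩
  simp only [kerRank_symm τ _ x']
  exact key x'

theorem schurFamily_remExp {lam : ℝ} (hl : 0 < lam) :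
    SchurFamily volume (fun τ x x' => Real.exp (-(lam * τ)) * remKer τ x x')
      (fun τ => 1 * remWeight τ) :=
  schurFamily_rem (c := fun _ => 1) (by fun_prop) (by simpa using integrableOn_remWeight)
    (fun _ _ => one_pos) fun τ hτ => by
      rw [abs_of_pos (Real.exp_pos _)]
      exact Real.exp_le_one_iff.2 (by have := mul_pos hl hτ; linarith)

/-- The remainder operator. -/
def remOp {lam : ℝ} (hl : 0 < lam) : L2Line →L[ℂ] L2Line := (schurFamily_remExp hl).op

/-- A bound of the remainder operators. -/
def remBound : ℝ := ∫ τ in Set.Ioi 0, remWeight τ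

theorem remBound_nonneg : 0 ≤ remBound :=
  setIntegral_nonneg measurableSet_Ioi fun _ hτ => (remWeight_pos hτ).le

theorem norm_remOp_le {lam : ℝ} (hl : 0 < lam) : ‖remOp hl‖ ≤ remBound := by
  refine (schurFamily_remExp hl).norm_op_le.trans (le_of_eq ?_)
  simp [remBound]

/-- `exp (-lam τ) - exp (-lam' τ) ≤ 1 - exp (-lam' τ)` makes the bound independent of the smaller
parameter. The remainders are thus Cauchy in norm as the parameter tends to zero. -/
theorem norm_remOp_sub_le {lam lam' : ℝ} (hl : 0 < lam) (hl' : 0 < lam') (h : lam ≤ lam') :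
    ‖remOp hl - remOp hl'‖ ≤ ∫ τ in Set.Ioi 0, (1 - Real.exp (-(lam' * τ))) * remWeight τ := by
  have hpos (τ : ℝ) (hτ : 0 < τ) : 0 < 1 - Real.exp (-(lam' * τ)) :=
    sub_pos.2 (Real.exp_lt_one_iff.2 (by have := mul_pos hl' hτ; linarith))
  have hint : IntegrableOn (fun τ => (1 - Real.exp (-(lam' * τ))) * remWeight τ) (Set.Ioi 0) := by
    refine integrableOn_remWeight.mono' ((by fun_prop : Measurable fun τ : ℝ =>
      1 - Real.exp (-(lam' * τ))).aestronglyMeasurable.mul integrableOn_remWeight.1) ?_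
    filter_upwards [ae_restrict_mem measurableSet_Ioi] with τ hτ
    have h0 := remWeight_pos hτ
    rw [Real.norm_of_nonneg (mul_pos (hpos τ hτ) h0).le]
    exact mul_le_of_le_one_left h0.le (by have := Real.exp_pos (-(lam' * τ)); linarith)
  have hd : SchurFamily volume
      (fun τ x x' => (Real.exp (-(lam * τ)) - Real.exp (-(lam' * τ))) * remKer τ x x')
      (fun τ => (1 - Real.exp (-(lam' * τ))) * remWeight τ) :=
    schurFamily_rem (by fun_prop) hint hpos fun τ hτ => by
      have hτ' : 0 < τ := hτ
      have h1 : Real.exp (-(lam' * τ)) ≤ Real.exp (-(lam * τ)) := by gcongr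
      have h2 : Real.exp (-(lam * τ)) ≤ 1 := Real.exp_le_one_iff.2 (by
        have := mul_pos hl hτ; linarith)
      rw [abs_of_nonneg (by linarith)]
      linarith
  have e := (schurFamily_remExp hl).op_eq_add (schurFamily_remExp hl') hd
    fun τ _ x x' => by ring
  rw [remOp, remOp, e, add_sub_cancel_left]
  exact hd.norm_op_le

theorem tendsto_remOp_bound : Tendsto
    (fun n : ℕ => ∫ τ in Set.Ioi 0, (1 - Real.exp (-(1 / ((n : ℝ) + 1) * τ))) * remWeight τ)
    atTop (𝓝 0) := by
  rw [show 𝓝 (0 : ℝ) = 𝓝 (∫ τ in Set.Ioi (0 : ℝ), (0 : ℝ)) by simp]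
  have l0 := tendsto_one_div_add_atTop_nhds_zero_nat (𝕜 := ℝ)
  refine tendsto_integral_of_dominated_convergence remWeight (fun n => ?_)
    integrableOn_remWeight (fun n => ?_) ?_
  · exact (by fun_prop : Measurable fun τ : ℝ =>
      1 - Real.exp (-(1 / ((n : ℝ) + 1) * τ))).aestronglyMeasurable.mul integrableOn_remWeight.1
  · filter_upwards [ae_restrict_mem measurableSet_Ioi] with τ hτ
    have hτ' : 0 < τ := hτ
    have h0 := remWeight_pos hτ
    have h1 : Real.exp (-(1 / ((n : ℝ) + 1) * τ)) ≤ 1 := Real.exp_le_one_iff.2 (by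
      have : 0 < 1 / ((n : ℝ) + 1) * τ := by positivity
      linarith)
    rw [Real.norm_of_nonneg (mul_nonneg (by linarith) h0.le)]
    exact mul_le_of_le_one_left h0.le (by
      have := Real.exp_pos (-(1 / ((n : ℝ) + 1) * τ)); linarith)
  · filter_upwards with τ
    have h1 : Continuous fun s : ℝ => (1 - Real.exp (-(s * τ))) * remWeight τ := by fun_prop
    have h2 := (h1.tendsto 0).comp l0
    simpa [Function.comp_def] using h2

theorem memLp_groundState :
    MemLp (fun x : ℝ => ((Real.pi ^ (-(1 / 4) : ℝ) * Real.exp (-(1 / 2) * x ^ 2) : ℝ) : ℂ)) 2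
      volume :=
  memLp_two_of_abs_le (c := 1) (D := Real.pi ^ (-(1 / 4) : ℝ)) (by fun_prop)
    (integrable_exp_neg_mul_sq (by norm_num : (0 : ℝ) < 1 / 2)) (fun _ => (Real.exp_pos _).le)
    (fun x => exp_neg_mul_sq_le_one (by norm_num) x) fun x => by
      have := Real.pi_pos
      rw [abs_of_pos (by positivity)]

/-- The ground state of the oscillator. -/
def groundState : L2Line := memLp_groundState.toLp _

theorem groundState_ae : ∀ᵐ x : ℝ, groundState x
    = ((Real.pi ^ (-(1 / 4) : ℝ) * Real.exp (-(1 / 2) * x ^ 2) : ℝ) : ℂ) :=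
  memLp_groundState.coeFn_toLp

theorem norm_groundState : ‖groundState‖ = 1 := by
  have hpi := Real.pi_pos
  have h : ‖groundState‖ ^ 2 = 1 := by
    rw [norm_sq_eq_integral]
    calc _ = ∫ x : ℝ, (√Real.pi)⁻¹ * Real.exp (-1 * x ^ 2) := by
          refine integral_congr_ae ?_
          filter_upwards [groundState_ae] with x hx
          rw [hx, Complex.norm_real, Real.norm_of_nonneg (by positivity), mul_pow,
            ← Real.rpow_natCast, ← Real.rpow_mul hpi.le, ← Real.exp_nat_mul, Real.sqrt_eq_rpow,
            ← Real.rpow_neg hpi.le]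
          congr 2
          · norm_num
          · push_cast; ring
      _ = 1 := by
          rw [integral_const_mul, integral_gaussian, div_one, inv_mul_cancel₀ (by positivity)]
  have h0 := norm_nonneg groundState
  nlinarith

/-- The Laplace transform of `τ^(-1/2)` is `Γ(1/2) lam^(-1/2)`, which is the source of `(2
lam)^(-1/2)`. -/
theorem integral_kerRank_time {lam : ℝ} (hl : 0 < lam) (x x' : ℝ) :
    ∫ τ in Set.Ioi 0, Real.exp (-(lam * τ)) * kerRank τ x x'
      = (√(2 * lam))⁻¹ * ((Real.pi ^ (-(1 / 4) : ℝ) * Real.exp (-(1 / 2) * x ^ 2))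
        * (Real.pi ^ (-(1 / 4) : ℝ) * Real.exp (-(1 / 2) * x' ^ 2))) := by
  have hpi := Real.pi_pos
  have h := Real.integral_rpow_mul_exp_neg_mul_Ioi (a := 1 / 2) (r := lam) (by norm_num) hl
  have e : ∀ τ ∈ Set.Ioi (0 : ℝ), Real.exp (-(lam * τ)) * kerRank τ x x'
      = (√(2 * Real.pi))⁻¹ * (√Real.pi)⁻¹ * (Real.exp (-(1 / 2) * x ^ 2)
        * Real.exp (-(1 / 2) * x' ^ 2)) * (τ ^ (1 / 2 - 1 : ℝ) * Real.exp (-(lam * τ))) := by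
    intro τ hτ
    have hτ' : 0 < τ := hτ
    rw [kerRank, Real.sqrt_mul (by positivity) τ, show (1 / 2 - 1 : ℝ) = -(1 / 2) by norm_num,
      Real.rpow_neg hτ'.le, ← Real.sqrt_eq_rpow, mul_inv]
    ring
  rw [setIntegral_congr_fun measurableSet_Ioi e, integral_const_mul, h, Real.Gamma_one_half_eq,
    ← Real.sqrt_eq_rpow, Real.sqrt_div zero_le_one, Real.sqrt_one, Real.sqrt_mul (by norm_num),
    Real.sqrt_mul (by norm_num)]
  have e4 : Real.pi ^ (-(1 / 4) : ℝ) * Real.pi ^ (-(1 / 4) : ℝ) = (√Real.pi)⁻¹ := by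
    rw [← Real.rpow_add hpi, Real.sqrt_eq_rpow, ← Real.rpow_neg hpi.le]
    norm_num
  calc _ = (√2)⁻¹ * (√lam)⁻¹ * ((√Real.pi)⁻¹ * (Real.exp (-(1 / 2) * x ^ 2)
        * Real.exp (-(1 / 2) * x' ^ 2))) * ((√Real.pi)⁻¹ * √Real.pi) := by
        rw [mul_inv]; ring
    _ = _ := by
        rw [inv_mul_cancel₀ (by positivity), mul_one, ← e4, mul_inv]
        ring

theorem rank_op_apply {lam : ℝ} (hl : 0 < lam) (q : L2Line) : (schurFamily_rank hl).op q
    = (((√(2 * lam))⁻¹ : ℝ) : ℂ) • (inner ℂ groundState q • groundState) := by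
  rw [smul_smul, Lp.ext_iff]
  filter_upwards [(schurFamily_rank hl).op_ae_kernel q, groundState_ae,
    Lp.coeFn_smul ((((√(2 * lam))⁻¹ : ℝ) : ℂ) * inner ℂ groundState q) groundState] with x h1 h2 h3
  rw [h1, h3, Pi.smul_apply, h2, smul_eq_mul, groundState,
    inner_toLp_conj q memLp_groundState (fun x' => Complex.conj_ofReal _), ← integral_const_mul,
    ← integral_mul_const]
  refine integral_congr_ae (Eventually.of_forall fun x' => ?_)
  simp only [integral_kerRank_time hl]
  push_cast
  ring

/-- All of the divergence at `lam → 0` sits in the rank one term; `norm_remOp_le` bounds the other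
term uniformly. -/
theorem chargeOp_one_eq {lam : ℝ} (hl : 0 < lam) (q : L2Line) : chargeOp one_pos hl q
    = (((√(2 * lam))⁻¹ : ℝ) : ℂ) • (inner ℂ groundState q • groundState) + remOp hl q := by
  have e := (schurFamily_kerDiag one_pos hl).op_eq_add (schurFamily_rank hl) (schurFamily_remExp hl)
    fun τ _ x x' => by rw [kerDiag, remKer]; ring
  rw [chargeOp, e, add_apply, rank_op_apply hl]
  rfl

theorem quad_chargeOp_eq {lam : ℝ} (hl : 0 < lam) (q : L2Line) : quad (chargeOp one_pos hl) q
    = (√(2 * lam))⁻¹ * ‖inner ℂ groundState q‖ ^ 2 + quad (remOp hl) q := by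
  rw [quad, chargeOp_one_eq, inner_add_left, inner_smul_left, inner_smul_left, Complex.conj_ofReal,
    Complex.conj_mul', Complex.add_re, ← Complex.ofReal_pow, ← Complex.ofReal_mul,
    Complex.ofReal_re, quad]


/-! ### The levels as functions of the spectral parameter -/

theorem chargeOp_isSymmetric {ω lam : ℝ} (hω : 0 < ω) (hl : 0 < lam) :
    (chargeOp hω hl : L2Line →ₗ[ℂ] L2Line).IsSymmetric := fun r q => chargeOp_symm hω hl r q

/-- Let `U`, `U'` be the two potentials of `q`. The resolvent identity gives `(lam' - lam) Re ⟨U,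
U'⟩` on the right. Subtracting the two resolvent equations tested with `U - U'` shows `(lam' - lam)
Re ⟨U - U', U'⟩ ≥ 0`. -/
theorem quad_chargeOp_sub_ge {ω lam lam' : ℝ} (hω : 0 < ω) (hl : 0 < lam) (hl' : 0 < lam')
    (q : L2Line) : (lam' - lam) * ‖(potentialElement hω hl' q).fn‖ ^ 2
      ≤ quad (chargeOp hω hl) q - quad (chargeOp hω hl') q := by
  set U := potentialElement hω hl q
  set U' := potentialElement hω hl' q
  have e : quad (chargeOp hω hl) q - quad (chargeOp hω hl') q
      = (lam' - lam) * (inner ℂ U.fn U'.fn).re := by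
    have h1 := congrArg Complex.re (inner_chargeOp_sub hω hl hl' q q)
    rw [inner_sub_right, ← chargeOp_symm, ← chargeOp_symm, Complex.sub_re,
      Complex.re_ofReal_mul] at h1
    exact h1
  have h1 := form_potentialElement hω hl q (U.sub U')
  have h2 := form_potentialElement hω hl' q (U.sub U')
  have h3 : form ω 0 (U.sub U') (U.sub U') + lam * inner ℂ (U.sub U').fn (U.sub U').fn
      = (lam' - lam : ℝ) * inner ℂ (U.sub U').fn U'.fn := by
    rw [form_sub_right, FormElement.sub_fn] at *
    rw [inner_sub_right (U.fn - U'.fn)]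
    push_cast
    linear_combination h1 - h2
  have h4 := congrArg Complex.re h3
  have h5 := form_self_nonneg ω le_rfl (U.sub U')
  have h6 : ((lam : ℂ) * inner ℂ (U.sub U').fn (U.sub U').fn).re
      = lam * ‖(U.sub U').fn‖ ^ 2 := by
    rw [inner_self_eq_norm_sq_to_K]
    simp only [Complex.coe_algebraMap]
    norm_cast
  have h7 : (inner ℂ U'.fn U'.fn).re = ‖U'.fn‖ ^ 2 := by
    rw [inner_self_eq_norm_sq_to_K]
    simp only [Complex.coe_algebraMap]
    norm_cast
  rw [Complex.add_re, h6, Complex.re_ofReal_mul, FormElement.sub_fn, inner_sub_left,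
    Complex.sub_re, h7] at h4
  have h8 : 0 ≤ lam * ‖U.fn - U'.fn‖ ^ 2 := by positivity
  rw [e]
  nlinarith

theorem quad_chargeOp_nonneg {ω lam : ℝ} (hω : 0 < ω) (hl : 0 < lam) (q : L2Line) :
    0 ≤ quad (chargeOp hω hl) q := chargeOp_nonneg hω hl q

theorem quad_chargeOp_anti {ω lam lam' : ℝ} (hω : 0 < ω) (hl : 0 < lam) (hl' : 0 < lam')
    (h : lam ≤ lam') (q : L2Line) : quad (chargeOp hω hl') q ≤ quad (chargeOp hω hl) q := by
  have h1 := quad_chargeOp_sub_ge hω hl hl' q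
  have h2 : 0 ≤ (lam' - lam) * ‖(potentialElement hω hl' q).fn‖ ^ 2 :=
    mul_nonneg (by linarith) (by positivity)
  linarith

theorem quad_chargeOp_strictAnti {ω lam lam' : ℝ} (hω : 0 < ω) (hl : 0 < lam) (hl' : 0 < lam')
    (h : lam < lam') (q : L2Line) (hq : 0 < quad (chargeOp hω hl') q) :
    quad (chargeOp hω hl') q < quad (chargeOp hω hl) q := by
  have h1 := quad_chargeOp_sub_ge hω hl hl' q
  have hne : (potentialElement hω hl' q).fn ≠ 0 := fun h0 => by
    rw [quad, chargeOp_eq_zero_of_potential hω hl' h0, inner_zero_left] at hq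
    exact lt_irrefl _ hq
  have h2 : 0 < (lam' - lam) * ‖(potentialElement hω hl' q).fn‖ ^ 2 :=
    mul_pos (by linarith) (by positivity)
  linarith

/-- The levels of the charge operator for `ω = 1`. -/
def chargeLevel (n : ℕ) (lam : ℝ) : ℝ :=
  if h : 0 < lam then level n (chargeOp one_pos h) else 0

theorem chargeLevel_eq (n : ℕ) {lam : ℝ} (hl : 0 < lam) :
    chargeLevel n lam = level n (chargeOp one_pos hl) := dif_pos hl

theorem chargeLevel_antitone_index {lam : ℝ} (hl : 0 < lam) {m n : ℕ} (h : m ≤ n) :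
    chargeLevel n lam ≤ chargeLevel m lam := by
  rw [chargeLevel_eq n hl, chargeLevel_eq m hl]
  exact level_anti _ h

theorem chargeLevel_anti (n : ℕ) {lam lam' : ℝ} (hl : 0 < lam) (h : lam ≤ lam') :
    chargeLevel n lam' ≤ chargeLevel n lam := by
  rw [chargeLevel_eq n hl, chargeLevel_eq n (hl.trans_le h)]
  exact level_mono (quad_chargeOp_anti one_pos hl _ h)

theorem chargeLevel_strictAnti {n : ℕ} {lam lam' : ℝ} (hl : 0 < lam) (h : lam < lam')
    (hp : 0 < chargeLevel n lam') : chargeLevel n lam' < chargeLevel n lam := by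
  rw [chargeLevel_eq n (hl.trans h)] at *
  rw [chargeLevel_eq n hl]
  exact level_lt_level (isCompactOperator_chargeOp one_pos _) (chargeOp_isSymmetric one_pos _) hp
    (quad_chargeOp_strictAnti one_pos hl _ h)

/-- The resolvent identity, with the norm of the potential map bounded by `I` for all parameters
above `lam₀`; then `M = I²`. -/
theorem norm_chargeOp_sub_le {ω lam₀ : ℝ} (hω : 0 < ω) (h₀ : 0 < lam₀) : ∃ M : ℝ, 0 ≤ M ∧
    ∀ lam lam' (hl : 0 < lam) (hl' : 0 < lam'), lam₀ ≤ lam → lam₀ ≤ lam' →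
      ‖chargeOp hω hl - chargeOp hω hl'‖ ≤ M * |lam' - lam| := by
  let I := ∫ τ in Set.Ioi 0, √(4 * kernelConst ω * √(1 + ω)) *
      (Real.exp (-(lam₀ * τ)) * (1 + 1 / τ) ^ (3 / 4 : ℝ))
  have hI0 : 0 ≤ I := setIntegral_nonneg measurableSet_Ioi fun τ hτ =>
    ((schurFamily_kerFn hω h₀).pos τ hτ).le
  have hI (lam : ℝ) (hl : 0 < lam) (h : lam₀ ≤ lam) : ‖(schurFamily_kerFn hω hl).op‖ ≤ I := by
    refine (schurFamily_kerFn hω hl).norm_op_le.trans (setIntegral_mono_on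
      (schurFamily_kerFn hω hl).int (schurFamily_kerFn hω h₀).int measurableSet_Ioi fun τ hτ => ?_)
    have hτ' : 0 < τ := hτ
    gcongr
  refine ⟨I * I, by positivity, fun lam lam' hl hl' h h' => ?_⟩
  refine ContinuousLinearMap.opNorm_le_bound _ (by positivity) fun q => ?_
  set r := chargeOp hω hl q - chargeOp hω hl' q with hr
  have h1 := inner_chargeOp_sub hω hl hl' r q
  rw [potentialElement_fn, potentialElement_fn, ← hr, inner_self_eq_norm_sq_to_K] at h1
  have h2 := congrArg norm h1
  rw [norm_mul, Complex.norm_real, Real.norm_eq_abs] at h2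
  have h3 : ‖((‖r‖ : ℂ)) ^ 2‖ = ‖r‖ ^ 2 := by simp
  simp only [Complex.coe_algebraMap] at h2
  rw [h3] at h2
  have h4 : ‖r‖ ^ 2 ≤ |lam' - lam| * ((I * ‖r‖) * (I * ‖q‖)) := by
    rw [h2]
    gcongr
    refine (norm_inner_le_norm _ _).trans ?_
    gcongr
    · exact ((schurFamily_kerFn hω hl).op.le_opNorm r).trans (by gcongr; exact hI lam hl h)
    · exact ((schurFamily_kerFn hω hl').op.le_opNorm q).trans (by gcongr; exact hI lam' hl' h')
  change ‖r‖ ≤ _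
  rcases (norm_nonneg r).eq_or_lt with h5 | h5
  · rw [← h5]; positivity
  · refine le_of_mul_le_mul_right ?_ h5
    calc ‖r‖ * ‖r‖ = ‖r‖ ^ 2 := by ring
      _ ≤ _ := h4
      _ = _ := by ring

theorem continuousOn_chargeLevel (n : ℕ) : ContinuousOn (chargeLevel n) (Set.Ioi 0) := by
  intro lam hlam
  have hl : 0 < lam := hlam
  obtain ⟨M, hM0, hM⟩ := norm_chargeOp_sub_le (ω := 1) one_pos (half_pos hl)
  refine ContinuousAt.continuousWithinAt ?_
  have hn : ∀ᶠ x in 𝓝 lam, lam / 2 < x := eventually_gt_nhds (by linarith)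
  rw [ContinuousAt, tendsto_iff_norm_sub_tendsto_zero]
  have hb : Tendsto (fun x : ℝ => M * |lam - x|) (𝓝 lam) (𝓝 0) := by
    have : Continuous fun x : ℝ => M * |lam - x| := by fun_prop
    simpa using this.tendsto lam
  refine squeeze_zero' (Eventually.of_forall fun _ => norm_nonneg _) ?_ hb
  filter_upwards [hn] with x hx
  have hx0 : 0 < x := by linarith
  rw [chargeLevel_eq n hx0, chargeLevel_eq n hl, Real.norm_eq_abs]
  exact (abs_level_sub_le n _ _).trans (hM x lam hx0 hl hx.le (by linarith))

/-- The Schur bound of the whole operator tends to zero as the parameter tends to infinity. -/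
theorem exists_chargeLevel_lt {c : ℝ} (hc : 0 < c) (n : ℕ) : ∃ lam > 0, chargeLevel n lam < c := by
  have ht : Tendsto (fun m : ℕ => ∫ τ in Set.Ioi 0, diagWeight 1 ((m : ℝ) + 1) τ) atTop (𝓝 0) := by
    rw [show 𝓝 (0 : ℝ) = 𝓝 (∫ τ in Set.Ioi (0 : ℝ), (0 : ℝ)) by simp]
    refine tendsto_integral_of_dominated_convergence (diagWeight 1 1)
      (fun m => (integrableOn_diagWeight one_pos (by positivity)).1)
      (integrableOn_diagWeight one_pos one_pos) (fun m => ?_) ?_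
    · filter_upwards [ae_restrict_mem measurableSet_Ioi] with τ hτ
      have hτ' : 0 < τ := hτ
      rw [Real.norm_of_nonneg (diagWeight_pos one_pos hτ).le]
      unfold diagWeight
      gcongr
      have : (0 : ℝ) ≤ m := by positivity
      linarith
    · filter_upwards [ae_restrict_mem measurableSet_Ioi] with τ hτ
      have hτ' : 0 < τ := hτ
      unfold diagWeight
      rw [show (0 : ℝ) = 0 * √(1 * (1 + 1 / (1 * τ))) by simp]
      refine Tendsto.mul_const _ (Real.tendsto_exp_atBot.comp (tendsto_neg_atTop_atBot.comp ?_))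
      exact (tendsto_atTop_add_const_right _ _ tendsto_natCast_atTop_atTop).atTop_mul_const hτ'
  obtain ⟨m, hm⟩ := (ht.eventually_lt_const hc).exists
  have hp : 0 < (m : ℝ) + 1 := by positivity
  refine ⟨m + 1, hp, ?_⟩
  rw [chargeLevel_eq n hp]
  exact ((level_le_norm n _).trans (schurFamily_kerDiag one_pos hp).norm_op_le).trans_lt hm

theorem abs_quad_remOp_le {lam : ℝ} (hl : 0 < lam) (q : L2Line) :
    |quad (remOp hl) q| ≤ remBound * ‖q‖ ^ 2 :=
  (abs_quad_le _ q).trans (by gcongr; exact norm_remOp_le hl)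

/-- The lower bound is the Rayleigh quotient of `groundState`; the upper bound is `|⟨g, x⟩| ≤ ‖x‖`,
with the remainder estimated by its norm. -/
theorem abs_chargeLevel_zero_sub_le {lam : ℝ} (hl : 0 < lam) :
    |chargeLevel 0 lam - (√(2 * lam))⁻¹| ≤ remBound := by
  rw [chargeLevel_eq 0 hl, abs_le]
  have h0 := remBound_nonneg
  constructor
  · have h1 := quad_le_level_zero (quad_chargeOp_nonneg one_pos hl) groundState
    have h2 := (abs_le.1 (abs_quad_remOp_le hl groundState)).1
    rw [quad_chargeOp_eq hl, inner_self_eq_norm_sq_to_K, norm_groundState] at h1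
    rw [norm_groundState] at h2
    simp only [Complex.coe_algebraMap, Complex.ofReal_one, one_pow, norm_one, mul_one] at h1 h2
    linarith
  · suffices level 0 (chargeOp one_pos hl) ≤ (√(2 * lam))⁻¹ + remBound by linarith
    refine level_le_of_orthogonal (M := ⊥) (by simp) (by positivity) fun x _ => ?_
    have h2 := (abs_le.1 (abs_quad_remOp_le hl x)).2
    have h3 : ‖inner ℂ groundState x‖ ≤ ‖x‖ := by
      have := norm_inner_le_norm (𝕜 := ℂ) groundState x
      rwa [norm_groundState, one_mul] at this
    rw [quad_chargeOp_eq hl, add_mul]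
    gcongr

/-- On the complement of `groundState` the singular term vanishes. The bound is uniform in the
parameter, so weak coupling admits no second bound state. -/
theorem chargeLevel_one_le {lam : ℝ} (hl : 0 < lam) : chargeLevel 1 lam ≤ remBound := by
  rw [chargeLevel_eq 1 hl]
  refine level_le_of_orthogonal (M := Submodule.span ℂ {groundState}) ?_ remBound_nonneg
    fun x hx => ?_
  · exact finrank_span_le_card {groundState} |>.trans (by simp)
  · have h1 : inner ℂ groundState x = 0 := hx _ (Submodule.mem_span_singleton_self _)
    rw [quad_chargeOp_eq hl, h1]
    have h2 := (abs_le.1 (abs_quad_remOp_le hl x)).2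
    simpa using h2

theorem isCompactOperator_remOp {lam : ℝ} (hl : 0 < lam) : IsCompactOperator (remOp hl) := by
  have e : remOp hl = chargeOp one_pos hl - (((√(2 * lam))⁻¹ : ℝ) : ℂ) •
      (innerSL ℂ groundState).smulRight groundState := by
    ext1 q
    rw [sub_apply, chargeOp_one_eq hl]
    simp
  rw [e]
  exact (isCompactOperator_chargeOp one_pos hl).sub
    ((isCompactOperator_smulRight _ _).smul _)

/-- Finiteness of the number of bound states. For one small parameter `l` the compact remainder is
at most `c/2` off a finite-dimensional `M`; for smaller parameters the remainder changes by at most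
`c/2`. Off `M` and `groundState` the form is thus at most `c`, and parameters above `l` follow by
monotonicity. -/
theorem exists_forall_chargeLevel_le {c : ℝ} (hc : 0 < c) :
    ∃ n, ∀ lam > 0, chargeLevel n lam ≤ c := by
  obtain ⟨m, hm⟩ := (tendsto_remOp_bound.eventually_lt_const (half_pos hc)).exists
  have hp : 0 < 1 / ((m : ℝ) + 1) := by positivity
  set l := 1 / ((m : ℝ) + 1)
  obtain ⟨M, hM, hq⟩ := exists_orthogonal_quad_le (isCompactOperator_remOp hp) (half_pos hc)
  have hle (lam : ℝ) (hl : 0 < lam) (h : lam ≤ l) :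
      chargeLevel (Module.finrank ℂ ↥(M ⊔ Submodule.span ℂ {groundState})) lam ≤ c := by
    rw [chargeLevel_eq _ hl]
    refine level_le_of_orthogonal (M := M ⊔ Submodule.span ℂ {groundState}) le_rfl hc.le
      fun x hx => ?_
    have h1 : inner ℂ groundState x = 0 :=
      hx _ (Submodule.mem_sup_right (Submodule.mem_span_singleton_self _))
    have h2 := hq x (Submodule.orthogonal_le le_sup_left hx)
    have h3 := (le_abs_self _).trans (abs_quad_le (remOp hl - remOp hp) x)
    rw [quad_sub] at h3
    have h4 := (norm_remOp_sub_le hl hp h).trans hm.le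
    have h5 : ‖remOp hl - remOp hp‖ * ‖x‖ ^ 2 ≤ c / 2 * ‖x‖ ^ 2 := by gcongr
    rw [quad_chargeOp_eq hl, h1]
    simp only [norm_zero, ne_eq, OfNat.ofNat_ne_zero, not_false_eq_true, zero_pow, mul_zero,
      zero_add]
    linarith
  refine ⟨Module.finrank ℂ ↥(M ⊔ Submodule.span ℂ {groundState}), fun lam hl => ?_⟩
  rcases le_total lam l with h | h
  · exact hle lam hl h
  · exact (chargeLevel_anti _ hp h).trans (hle l hp le_rfl)


/-! ### Strict positivity of all levels -/

theorem exists_isTest_diag {g : ℝ → ℝ} (hg : ContDiff ℝ ((⊤ : ℕ∞) : WithTop ℕ∞) g)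
    (hs : HasCompactSupport g) :
    ∃ φ : ℝ × ℝ → ℂ, IsTest φ ∧ ∀ x, φ (x, x) = (g x : ℂ) := by
  obtain ⟨R, hR0, hR⟩ := hs.isCompact.isBounded.subset_closedBall_lt 0 (0 : ℝ)
  let χ : ContDiffBump (0 : ℝ) := ⟨R, R + 1, hR0, by linarith⟩
  refine ⟨fun p => ((g p.1 * χ p.2 : ℝ) : ℂ), ⟨?_, ?_⟩, fun x => ?_⟩
  · refine Complex.ofRealCLM.contDiff.comp ?_
    exact (hg.comp contDiff_fst).mul (χ.contDiff.comp contDiff_snd)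
  · refine HasCompactSupport.intro (hs.isCompact.prod χ.hasCompactSupport.isCompact) fun p hp => ?_
    rw [Set.mem_prod, not_and_or] at hp
    rcases hp with hp | hp
    · rw [image_eq_zero_of_notMem_tsupport hp, zero_mul, Complex.ofReal_zero]
    · rw [image_eq_zero_of_notMem_tsupport hp, mul_zero, Complex.ofReal_zero]
  · by_cases hx : x ∈ tsupport g
    · simp only [χ.one_of_mem_closedBall (hR hx), mul_one]
    · simp [image_eq_zero_of_notMem_tsupport hx]

/-- The traces of form elements are total in `L²`. -/
theorem eq_zero_of_inner_tr {r : L2Line} (h : ∀ V : FormElement, inner ℂ V.tr r = 0) : r = 0 := by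
  rw [Lp.eq_zero_iff_ae_eq_zero]
  refine ae_eq_zero_of_integral_contDiff_smul_eq_zero
    ((Lp.memLp r).locallyIntegrable (by norm_num)) fun g hg hs => ?_
  obtain ⟨φ, hφ, hd⟩ := exists_isTest_diag hg hs
  obtain ⟨V, hV⟩ := exists_formElement_of_mem (testTuple_mem φ hφ)
  have h1 := h V
  rw [show V.tr = hφ.memLp_diag.toLp from congrArg (fun z => z.2.2.2.2) hV, L2.inner_def] at h1
  rw [← h1]
  refine integral_congr_ae ?_
  filter_upwards [hφ.memLp_diag.coeFn_toLp] with x hx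
  rw [hx, hd, RCLike.inner_apply, Complex.conj_ofReal, mul_comm, Complex.real_smul]

/-- The form of `K` at `q` dominates `lam ‖G q‖²`. If it vanishes then so does the potential, and
`q` is orthogonal to all traces, which are total. -/
theorem quad_chargeOp_pos {ω lam : ℝ} (hω : 0 < ω) (hl : 0 < lam) {q : L2Line} (hq : q ≠ 0) :
    0 < quad (chargeOp hω hl) q := by
  refine (quad_chargeOp_nonneg hω hl q).lt_of_ne' fun h0 => hq ?_
  refine eq_zero_of_inner_tr fun V => inner_tr_eq_zero_of_potential hω hl ?_ V
  rw [quad, inner_chargeOp, inner_self_eq_norm_sq_to_K] at h0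
  have h2 := form_self_nonneg ω le_rfl (potentialElement hω hl q)
  have h3 : ((lam : ℂ) * ((‖(potentialElement hω hl q).fn‖ : ℂ)) ^ 2).re
      = lam * ‖(potentialElement hω hl q).fn‖ ^ 2 := by
    norm_cast
  simp only [Complex.coe_algebraMap, Complex.add_re] at h0
  rw [h3] at h0
  by_contra hne
  have h4 : 0 < lam * ‖(potentialElement hω hl q).fn‖ ^ 2 := by positivity
  linarith

theorem exists_submodule_finrank_eq (n : ℕ) :
    ∃ W : Submodule ℂ L2Line, Module.finrank ℂ W = n := by
  let v : Fin n → L2Line := fun i => indicatorConstLp 2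
    (measurableSet_Ioo : MeasurableSet (Set.Ioo (i : ℝ) (i + 1))) measure_Ioo_lt_top.ne (1 : ℂ)
  have hv : LinearIndependent ℂ v := by
    refine linearIndependent_of_ne_zero_of_inner_eq_zero (𝕜 := ℂ) (fun i h => ?_) fun i j hij => ?_
    · have h1 := congrArg norm h
      rw [norm_indicatorConstLp (by norm_num) (by norm_num)] at h1
      simp [Measure.real] at h1
    · change inner ℂ (v i) (v j) = 0
      simp only [v]
      rw [L2.inner_indicatorConstLp_one_indicatorConstLp_one _ _ measure_Ioo_lt_top.ne
        measure_Ioo_lt_top.ne]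
      have : Set.Ioo (i : ℝ) (i + 1) ∩ Set.Ioo (j : ℝ) (j + 1) = ∅ := by
        refine Set.eq_empty_of_forall_notMem fun x hx => hij (Fin.ext ?_)
        have h1 : (i : ℝ) < (j + 1 : ℕ) := by push_cast; linarith [hx.1.1, hx.2.2]
        have h2 : (j : ℝ) < (i + 1 : ℕ) := by push_cast; linarith [hx.1.2, hx.2.1]
        have h1' := Nat.cast_lt.1 h1
        have h2' := Nat.cast_lt.1 h2
        omega
      rw [this]
      simp
  exact ⟨Submodule.span ℂ (Set.range v), by rw [finrank_span_eq_card hv, Fintype.card_fin]⟩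

theorem chargeLevel_pos (n : ℕ) {lam : ℝ} (hl : 0 < lam) : 0 < chargeLevel n lam := by
  obtain ⟨W, hW⟩ := exists_submodule_finrank_eq (n + 1)
  rw [chargeLevel_eq n hl]
  refine lt_level_of_forall_lt le_rfl hW.ge fun x _ hx => quad_chargeOp_pos one_pos hl ?_
  rintro rfl
  simp at hx


/-! ### Crossing points of the levels, their number and the weak coupling limit -/

/-- The number of levels which exceed `c` for some spectral parameter. -/
def numLevels (c : ℝ) : ℕ := sInf {n | ∀ lam > 0, chargeLevel n lam ≤ c}

/-- Levels decrease with the index, so the indices of levels that stay below `c` form an upper set,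
nonempty by `exists_forall_chargeLevel_le`. -/
theorem lt_numLevels_iff {c : ℝ} (hc : 0 < c) {n : ℕ} :
    n < numLevels c ↔ ∃ lam > 0, c < chargeLevel n lam := by
  have hmem : numLevels c ∈ {n | ∀ lam > 0, chargeLevel n lam ≤ c} :=
    Nat.sInf_mem (exists_forall_chargeLevel_le hc)
  constructor
  · intro h
    have := Nat.notMem_of_lt_sInf h
    simpa using this
  · rintro ⟨lam, hl, h⟩
    by_contra hcon
    have h1 := chargeLevel_antitone_index hl (not_lt.1 hcon)
    exact absurd (h.trans_le (h1.trans (hmem lam hl))) (lt_irrefl _)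

/-- Intermediate value theorem between a parameter where the level exceeds `c` and a large one where
it is below. -/
theorem exists_chargeLevel_eq {c : ℝ} (hc : 0 < c) {n : ℕ} (h : n < numLevels c) :
    ∃ e > 0, chargeLevel n e = c := by
  obtain ⟨a, ha, hca⟩ := (lt_numLevels_iff hc).1 h
  obtain ⟨b, hb, hcb⟩ := exists_chargeLevel_lt hc n
  have hab : a ≤ b := by
    by_contra hcon
    have := chargeLevel_anti n hb (not_le.1 hcon).le
    linarith
  obtain ⟨e, he, hec⟩ := intermediate_value_Icc' hab
    ((continuousOn_chargeLevel n).mono fun x hx => ha.trans_le hx.1) ⟨hcb.le, hca.le⟩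
  exact ⟨e, ha.trans_le he.1, hec⟩

/-- The spectral parameter at which the `n`-th level equals `c`. -/
def levelRoot (n : ℕ) (c : ℝ) : ℝ :=
  Classical.epsilon fun e => 0 < e ∧ chargeLevel n e = c

theorem levelRoot_spec {c : ℝ} (hc : 0 < c) {n : ℕ} (h : n < numLevels c) :
    0 < levelRoot n c ∧ chargeLevel n (levelRoot n c) = c :=
  Classical.epsilon_spec (exists_chargeLevel_eq hc h)

theorem chargeLevel_injOn (n : ℕ) : Set.InjOn (chargeLevel n) (Set.Ioi 0) := by
  intro a ha b hb h
  by_contra hne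
  rcases lt_or_gt_of_ne hne with h1 | h1
  · exact absurd h (chargeLevel_strictAnti ha h1 (chargeLevel_pos n hb)).ne'
  · exact absurd h (chargeLevel_strictAnti hb h1 (chargeLevel_pos n ha)).ne

/-- If the level equals `c` at `e`, it exceeds `c` at `e / 2` by strict monotonicity, so the index
is counted although `numLevels` asks for a strict excess. -/
theorem levelRoot_eq_iff {c : ℝ} (hc : 0 < c) {n : ℕ} {e : ℝ} (he : 0 < e) :
    (n < numLevels c ∧ levelRoot n c = e) ↔ chargeLevel n e = c := by
  constructor
  · rintro ⟨h, rfl⟩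
    exact (levelRoot_spec hc h).2
  · intro h
    have h1 : n < numLevels c := (lt_numLevels_iff hc).2 ⟨e / 2, half_pos he, by
      rw [← h]
      exact chargeLevel_strictAnti (half_pos he) (half_lt_self he) (chargeLevel_pos n he)⟩
    have h2 := levelRoot_spec hc h1
    exact ⟨h1, chargeLevel_injOn n h2.1 he (h2.2.trans h.symm)⟩

/-- A lower curve crosses the height `c` earlier. -/
theorem levelRoot_antitone {c : ℝ} (hc : 0 < c) {m n : ℕ} (hmn : m ≤ n) (hn : n < numLevels c) :
    levelRoot n c ≤ levelRoot m c := by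
  obtain ⟨n0, n1⟩ := levelRoot_spec hc hn
  obtain ⟨m0, m1⟩ := levelRoot_spec hc (hmn.trans_lt hn)
  by_contra hcon
  have h1 := chargeLevel_strictAnti (n := m) m0 (not_le.1 hcon) (chargeLevel_pos m n0)
  have h2 := chargeLevel_antitone_index n0 hmn
  linarith

theorem chargeSpace_eq {ω lam α : ℝ} (hω : 0 < ω) (hl : 0 < lam) (hα : α < 0) :
    chargeSpace hω hl α = Module.End.eigenspace (chargeOp hω hl : L2Line →ₗ[ℂ] L2Line)
      (((-α)⁻¹ : ℝ) : ℂ) := by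
  have h0 : (α : ℂ) ≠ 0 := Complex.ofReal_ne_zero.2 hα.ne
  ext q
  rw [mem_chargeSpace, Module.End.mem_eigenspace_iff]
  change _ ↔ chargeOp hω hl q = _
  push_cast
  rw [inv_neg, neg_smul]
  constructor
  · intro h
    rw [add_eq_zero_iff_eq_neg] at h
    nth_rewrite 2 [h]
    rw [smul_neg, neg_neg, inv_smul_smul₀ h0]
  · intro h
    rw [h, smul_neg, smul_inv_smul₀ h0, add_neg_cancel]

/-- The indices whose root is `e` are those whose level at `e` equals `1/|α|`. By `level_eq_iff`
they form an interval whose length is the multiplicity. -/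
theorem rank_chargeSpace_one {α e : ℝ} (hα : α < 0) (he : 0 < e) :
    Module.rank ℂ (chargeSpace one_pos he α) = (((Finset.range (numLevels (-α)⁻¹)).filter
      fun n => levelRoot n (-α)⁻¹ = e).card : Cardinal) := by
  have hc : 0 < (-α)⁻¹ := inv_pos.2 (neg_pos.2 hα)
  have hK := isCompactOperator_chargeOp one_pos he
  have hS := chargeOp_isSymmetric one_pos he
  have hfin : FiniteDimensional ℂ (specGe (chargeOp one_pos he) (-α)⁻¹) :=
    finiteDimensional_specSub hK hS hc fun _ hν => hν
  have hfin' : FiniteDimensional ℂ (Module.End.eigenspace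
      (chargeOp one_pos he : L2Line →ₗ[ℂ] L2Line) (((-α)⁻¹ : ℝ) : ℂ)) :=
    Submodule.finiteDimensional_of_le (S₂ := specGe (chargeOp one_pos he) (-α)⁻¹)
      (eigenspace_le_specSub _ (by simp))
  rw [chargeSpace_eq one_pos he hα, ← Module.finrank_eq_rank]
  congr 1
  have e1 : (Finset.range (numLevels (-α)⁻¹)).filter (fun n => levelRoot n (-α)⁻¹ = e)
      = Finset.Ico (Module.finrank ℂ (specGt (chargeOp one_pos he) (-α)⁻¹))
        (Module.finrank ℂ (specGt (chargeOp one_pos he) (-α)⁻¹) + Module.finrank ℂ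
          (Module.End.eigenspace (chargeOp one_pos he : L2Line →ₗ[ℂ] L2Line)
            (((-α)⁻¹ : ℝ) : ℂ))) := by
    ext n
    rw [Finset.mem_filter, Finset.mem_range, levelRoot_eq_iff hc he, chargeLevel_eq n he,
      level_eq_iff hK hS hc]
  rw [e1, Nat.card_Ico, Nat.add_sub_cancel_left]

theorem numLevels_pos {c : ℝ} (hc : 0 < c) : 0 < numLevels c := by
  have h0 := remBound_nonneg
  have hs : 0 < c + remBound + 1 := by linarith
  -- At this parameter `(2 lam)^(-1/2) = c + remBound + 1`, which leaves room for the remainder.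
  have hl : 0 < ((c + remBound + 1)⁻¹) ^ 2 / 2 := by positivity
  refine (lt_numLevels_iff hc).2 ⟨_, hl, ?_⟩
  have h1 := (abs_le.1 (abs_chargeLevel_zero_sub_le hl)).1
  rw [mul_div_cancel₀ _ two_ne_zero, Real.sqrt_sq (by positivity), inv_inv] at h1
  linarith

/-- The supremum of the first excited level. -/
def firstLevel : ℝ := sSup (chargeLevel 1 '' Set.Ioi 0)

theorem bddAbove_chargeLevel_one : BddAbove (chargeLevel 1 '' Set.Ioi 0) :=
  ⟨remBound, by rintro _ ⟨lam, hl, rfl⟩; exact chargeLevel_one_le hl⟩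

theorem firstLevel_pos : 0 < firstLevel :=
  (chargeLevel_pos 1 one_pos).trans_le
    (le_csSup bddAbove_chargeLevel_one ⟨1, Set.mem_Ioi.2 one_pos, rfl⟩)

/-- The count requires the level to exceed `c` somewhere, so equality with the supremum still gives
a single bound state; this puts the endpoint `-α₀` in the regime `N = 1`. -/
theorem one_lt_numLevels_iff {c : ℝ} (hc : 0 < c) : 1 < numLevels c ↔ c < firstLevel := by
  rw [lt_numLevels_iff hc, firstLevel, lt_csSup_iff bddAbove_chargeLevel_one
    ⟨_, 1, Set.mem_Ioi.2 one_pos, rfl⟩]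
  simp

/-- At the root the lowest-index level is `1/|α|`, so `1/|α|` and `(2 E)^(-1/2)` differ by at most
`remBound`; multiplication by `|α|` gives `|α| (2 E)^(-1/2) → 1`. -/
theorem isEquivalent_levelRoot : Asymptotics.IsEquivalent (𝓝[<] 0)
    (fun α : ℝ => levelRoot 0 (-α)⁻¹) (fun α : ℝ => α ^ 2 / 2) := by
  have hb : Tendsto (fun α : ℝ => -α * (√(2 * levelRoot 0 (-α)⁻¹))⁻¹) (𝓝[<] 0) (𝓝 1) := by
    rw [tendsto_iff_norm_sub_tendsto_zero]
    have hz : Tendsto (fun α : ℝ => -α * remBound) (𝓝[<] 0) (𝓝 0) := by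
      have : Continuous fun α : ℝ => -α * remBound := by fun_prop
      simpa using (this.tendsto 0).mono_left nhdsWithin_le_nhds
    refine squeeze_zero' (Eventually.of_forall fun _ => norm_nonneg _) ?_ hz
    filter_upwards [self_mem_nhdsWithin] with α hα
    have hα' : 0 < -α := neg_pos.2 hα
    have hc : 0 < (-α)⁻¹ := inv_pos.2 hα'
    obtain ⟨h0, h1⟩ := levelRoot_spec hc (numLevels_pos hc)
    have h2 := abs_chargeLevel_zero_sub_le h0
    rw [h1, abs_sub_comm] at h2
    rw [Real.norm_eq_abs]
    calc _ = |-α * ((√(2 * levelRoot 0 (-α)⁻¹))⁻¹ - (-α)⁻¹)| := by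
          rw [mul_sub, mul_inv_cancel₀ hα'.ne']
      _ = -α * |(√(2 * levelRoot 0 (-α)⁻¹))⁻¹ - (-α)⁻¹| := by rw [abs_mul, abs_of_pos hα']
      _ ≤ _ := by gcongr
  have hne : ∀ᶠ α : ℝ in 𝓝[<] 0, α ^ 2 / 2 ≠ 0 := by
    filter_upwards [self_mem_nhdsWithin] with α hα
    have : α ≠ 0 := ne_of_lt hα
    positivity
  refine (Asymptotics.isEquivalent_iff_tendsto_one hne).2 ?_
  have h3 := (hb.pow 2).inv₀ (by norm_num)
  rw [one_pow, inv_one] at h3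
  refine h3.congr' ?_
  filter_upwards [self_mem_nhdsWithin] with α hα
  have hα' : 0 < -α := neg_pos.2 hα
  have hc : 0 < (-α)⁻¹ := inv_pos.2 hα'
  obtain ⟨h0, -⟩ := levelRoot_spec hc (numLevels_pos hc)
  rw [mul_pow, inv_pow, Real.sq_sqrt (by positivity), Pi.div_apply, neg_sq]
  have : α ≠ 0 := ne_of_lt hα
  field_simp


/-! ### Perron–Frobenius: simplicity of the top eigenvalue -/

/-- Equality in the triangle inequality: after a rotation making the integral positive, `‖f‖ - Re f`
is nonnegative with integral zero. -/
theorem exists_phase_of_norm_integral_eq {β : Type*} [MeasurableSpace β] {ν : Measure β}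
    {f : β → ℂ} (hf : Integrable f ν) (h : ∫ z, ‖f z‖ ∂ν = ‖∫ z, f z ∂ν‖) :
    ∃ c : ℂ, ∀ᵐ z ∂ν, f z = c * ‖f z‖ := by
  set w := ∫ z, f z ∂ν with hw
  by_cases hw0 : w = 0
  · refine ⟨0, ?_⟩
    rw [hw0, norm_zero, integral_eq_zero_iff_of_nonneg (fun _ => norm_nonneg _) hf.norm] at h
    filter_upwards [h] with z hz
    simpa using hz
  · have hn : (‖w‖ : ℂ) ≠ 0 := by simpa using hw0
    set u := starRingEnd ℂ w / ‖w‖ with hu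
    have huw : u * w = ‖w‖ := by
      rw [hu, div_mul_eq_mul_div, Complex.conj_mul', sq, mul_div_assoc, div_self hn, mul_one]
    have hun : ‖u‖ = 1 := by
      rw [hu, norm_div, RCLike.norm_conj, Complex.norm_real, norm_norm, div_self (by simpa using hw0)]
    have hre : ∫ z, (u * f z).re ∂ν = ‖w‖ := by
      have h1 := integral_re (𝕜 := ℂ) (hf.const_mul u)
      rw [integral_const_mul, ← hw, huw] at h1
      simpa using h1
    have hi : Integrable (fun z => (u * f z).re) ν := (hf.const_mul u).re
    have hle (z : β) : (u * f z).re ≤ ‖f z‖ := by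
      have := Complex.re_le_norm (u * f z)
      rwa [norm_mul, hun, one_mul] at this
    have h0 : ∫ z, (‖f z‖ - (u * f z).re) ∂ν = 0 := by
      rw [integral_sub hf.norm hi, h, hre, sub_self]
    rw [integral_eq_zero_iff_of_nonneg (fun z => sub_nonneg.2 (hle z)) (hf.norm.sub hi)] at h0
    refine ⟨starRingEnd ℂ u, ?_⟩
    filter_upwards [h0] with z hz
    have h1 : (u * f z).re = ‖u * f z‖ := by
      rw [norm_mul, hun, one_mul]
      simp only [Pi.zero_apply] at hz
      linarith
    have h2 : u * f z = (‖f z‖ : ℂ) := by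
      have h3 := Complex.re_eq_norm.1 h1
      have h4 := Complex.eq_re_of_ofReal_le (r := 0) (by simpa using h3)
      rw [h4, h1, norm_mul, hun, one_mul]
    rw [← h2, ← mul_assoc, Complex.conj_mul', hun]
    simp

theorem ae_snd_of_ae_timeLine {P : ℝ → Prop} (h : ∀ᵐ z ∂timeLine, P z.2) : ∀ᵐ x : ℝ, P x := by
  have h1 := Measure.ae_ae_of_ae_prod h
  have : (ae ((volume : Measure ℝ).restrict (Set.Ioi 0))).NeBot := by
    rw [ae_neBot, ne_eq, Measure.restrict_eq_zero]
    simp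
  exact h1.exists.choose_spec

/-- The absolute value of a charge. -/
def absLp (q : L2Line) : L2Line := (Lp.memLp q).norm.ofReal.toLp (fun x => (‖q x‖ : ℂ))

theorem absLp_ae (q : L2Line) : ∀ᵐ x, absLp q x = (‖q x‖ : ℂ) := MemLp.coeFn_toLp _

section
variable {ω lam μ : ℝ}

theorem ae_norm_kerDiag_mul (hω : 0 < ω) (f : ℝ → ℂ) (x : ℝ) : ∀ᵐ z ∂timeLine, 0 < kerDiag ω lam z.1 x z.2 ∧
    ‖(kerDiag ω lam z.1 x z.2 : ℂ) * f z.2‖ = kerDiag ω lam z.1 x z.2 * ‖f z.2‖ := by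
  filter_upwards [ae_timeLine_pos] with z hz
  have h : 0 < kerDiag ω lam z.1 x z.2 := mul_pos (Real.exp_pos _) (heat_pos hω hz _ _ _)
  exact ⟨h, by rw [norm_mul, Complex.norm_real, Real.norm_of_nonneg h.le]⟩

variable (hω : 0 < ω) (hl : 0 < lam)

theorem chargeOp_ae_timeLine (q : L2Line) : ∀ᵐ x, Integrable
    (fun z : ℝ × ℝ => (kerDiag ω lam z.1 x z.2 : ℂ) * q z.2) timeLine ∧
    chargeOp hω hl q x = ∫ z, (kerDiag ω lam z.1 x z.2 : ℂ) * q z.2 ∂timeLine := by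
  filter_upwards [(schurFamily_kerDiag hω hl).op_ae q, (schurFamily_kerDiag hω hl).ae_integrable q]
    with x h1 h2
  exact ⟨h2, h1⟩

theorem chargeOp_absLp_ae (q : L2Line) : ∀ᵐ x, chargeOp hω hl (absLp q) x
    = ((∫ z, ‖(kerDiag ω lam z.1 x z.2 : ℂ) * q z.2‖ ∂timeLine : ℝ) : ℂ) := by
  have hs : ∀ᵐ z ∂timeLine, absLp q z.2 = (‖q z.2‖ : ℂ) :=
    Measure.quasiMeasurePreserving_snd.ae (absLp_ae q)
  filter_upwards [chargeOp_ae_timeLine hω hl (absLp q)] with x hx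
  rw [hx.2, ← integral_complex_ofReal]
  refine integral_congr_ae ?_
  filter_upwards [hs, ae_norm_kerDiag_mul (lam := lam) hω q x] with z h1 h2
  rw [h1, h2.2]
  push_cast
  rfl

/-- As the kernel is positive, `K |q| ≥ |K q| = μ |q|`, while `μ` bounds the form; hence equality
holds almost everywhere on `q ≠ 0`. At one such point the triangle inequality for the integral
defining `K q` is an equality, and the strictly positive kernel transfers the constant phase to `q`.
-/
theorem exists_phase_of_top (hμ : 0 < μ) (htop : ∀ x, quad (chargeOp hω hl) x ≤ μ * ‖x‖ ^ 2)
    {q : L2Line} (h0 : q ≠ 0) (hq : chargeOp hω hl q = (μ : ℂ) • q) :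
    ∃ c : ℂ, ∀ᵐ x, q x = c * ‖q x‖ := by
  have hK := chargeOp_ae_timeLine hω hl q
  rw [hq] at hK
  have hnorm : ∀ᵐ x, Integrable (fun z : ℝ × ℝ => (kerDiag ω lam z.1 x z.2 : ℂ) * q z.2) timeLine ∧
      μ * ‖q x‖ = ‖∫ z, (kerDiag ω lam z.1 x z.2 : ℂ) * q z.2 ∂timeLine‖ := by
    filter_upwards [hK, Lp.coeFn_smul (μ : ℂ) q] with x h1 h2
    refine ⟨h1.1, ?_⟩
    rw [← h1.2, h2, Pi.smul_apply, smul_eq_mul, norm_mul, Complex.norm_real,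
      Real.norm_of_nonneg hμ.le]
  have hquad : quad (chargeOp hω hl) (absLp q) - μ * ‖absLp q‖ ^ 2
      = ∫ x, (‖q x‖ * ((∫ z, ‖(kerDiag ω lam z.1 x z.2 : ℂ) * q z.2‖ ∂timeLine) - μ * ‖q x‖)) ∧
      Integrable fun x =>
        ‖q x‖ * ((∫ z, ‖(kerDiag ω lam z.1 x z.2 : ℂ) * q z.2‖ ∂timeLine) - μ * ‖q x‖) := by
    have hi := L2.integrable_inner (𝕜 := ℂ) (chargeOp hω hl (absLp q)) (absLp q)
    have hir : Integrable fun x => (inner ℂ (chargeOp hω hl (absLp q) x) (absLp q x)).re := hi.re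
    have hi2 := (integrable_norm_sq (absLp q)).const_mul μ
    have hr : (fun x => (inner ℂ (chargeOp hω hl (absLp q) x) (absLp q x)).re - μ * ‖absLp q x‖ ^ 2)
        =ᵐ[volume] fun x => ‖q x‖ *
          ((∫ z, ‖(kerDiag ω lam z.1 x z.2 : ℂ) * q z.2‖ ∂timeLine) - μ * ‖q x‖) := by
      filter_upwards [chargeOp_absLp_ae hω hl q, absLp_ae q] with x h1 h2
      rw [h1, h2, RCLike.inner_apply, Complex.conj_ofReal, ← Complex.ofReal_mul, Complex.ofReal_re,
        Complex.norm_real, norm_norm]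
      ring
    refine ⟨?_, (hir.sub hi2).congr hr⟩
    rw [← integral_congr_ae hr, integral_sub hir hi2, integral_const_mul, ← norm_sq_eq_integral,
      quad, L2.inner_def]
    congr 1
    exact (integral_re hi).symm
  have hnn : ∀ᵐ x, 0 ≤ ‖q x‖ *
      ((∫ z, ‖(kerDiag ω lam z.1 x z.2 : ℂ) * q z.2‖ ∂timeLine) - μ * ‖q x‖) := by
    filter_upwards [hnorm] with x hx
    refine mul_nonneg (norm_nonneg _) (sub_nonneg.2 ?_)
    rw [hx.2]
    exact norm_integral_le_integral_norm _
  have hz : ∫ x, (‖q x‖ *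
      ((∫ z, ‖(kerDiag ω lam z.1 x z.2 : ℂ) * q z.2‖ ∂timeLine) - μ * ‖q x‖)) = 0 :=
    le_antisymm (by rw [← hquad.1]; linarith [htop (absLp q)]) (integral_nonneg_of_ae hnn)
  rw [integral_eq_zero_iff_of_nonneg_ae hnn hquad.2] at hz
  have hfr : ∃ᶠ x in ae (volume : Measure ℝ), q x ≠ 0 := by
    intro hcon
    refine h0 ((Lp.eq_zero_iff_ae_eq_zero).2 ?_)
    filter_upwards [hcon] with x hx
    simpa using hx
  obtain ⟨x, hx, h1, h2⟩ := (hfr.and_eventually (hz.and hnorm)).exists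
  have h3 : ∫ z, ‖(kerDiag ω lam z.1 x z.2 : ℂ) * q z.2‖ ∂timeLine
      = ‖∫ z, (kerDiag ω lam z.1 x z.2 : ℂ) * q z.2 ∂timeLine‖ := by
    rw [← h2.2]
    have := (mul_eq_zero.1 h1).resolve_left (by simpa using hx)
    linarith
  obtain ⟨c, hc⟩ := exists_phase_of_norm_integral_eq h2.1 h3
  refine ⟨c, ae_snd_of_ae_timeLine ?_⟩
  filter_upwards [hc, ae_norm_kerDiag_mul (lam := lam) hω q x] with z h4 h5
  rw [h5.2] at h4
  refine mul_left_cancel₀ (Complex.ofReal_ne_zero.2 h5.1.ne') (h4.trans ?_)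
  push_cast
  ring

/-- With a constant phase, a zero of `q` at `x` means that `|q|` integrated against a strictly
positive kernel vanishes, which forces `q = 0`; this applies at almost every `x`. -/
theorem ae_ne_zero_of_top (hμ : 0 < μ) (htop : ∀ x, quad (chargeOp hω hl) x ≤ μ * ‖x‖ ^ 2)
    {q : L2Line} (h0 : q ≠ 0) (hq : chargeOp hω hl q = (μ : ℂ) • q) : ∀ᵐ x, q x ≠ 0 := by
  obtain ⟨c, hc⟩ := exists_phase_of_top hω hl hμ htop h0 hq
  have hK := chargeOp_ae_timeLine hω hl q
  rw [hq] at hK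
  have hs : ∀ᵐ z ∂timeLine, q z.2 = c * ‖q z.2‖ := Measure.quasiMeasurePreserving_snd.ae hc
  have hc0 : c ≠ 0 := by
    rintro rfl
    refine h0 ((Lp.eq_zero_iff_ae_eq_zero).2 ?_)
    filter_upwards [hc] with x hx
    simpa using hx
  filter_upwards [hK, Lp.coeFn_smul (μ : ℂ) q] with x h1 h2 hx
  have h3 := h1.2
  rw [h2, Pi.smul_apply, hx, smul_zero] at h3
  have h4 : ∫ z, (kerDiag ω lam z.1 x z.2 : ℂ) * q z.2 ∂timeLine
      = c * ((∫ z, ‖(kerDiag ω lam z.1 x z.2 : ℂ) * q z.2‖ ∂timeLine : ℝ) : ℂ) := by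
    rw [← integral_complex_ofReal, ← integral_const_mul]
    refine integral_congr_ae ?_
    filter_upwards [hs, ae_norm_kerDiag_mul (lam := lam) hω q x] with z h5 h6
    rw [h6.2]
    nth_rewrite 1 [h5]
    push_cast
    ring
  rw [h4, eq_comm, mul_eq_zero, or_iff_right hc0, Complex.ofReal_eq_zero,
    integral_eq_zero_iff_of_nonneg (fun _ => norm_nonneg _) h1.1.norm] at h3
  refine h0 ((Lp.eq_zero_iff_ae_eq_zero).2 (ae_snd_of_ae_timeLine ?_))
  filter_upwards [h3, ae_norm_kerDiag_mul (lam := lam) hω q x] with z h5 h6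
  rw [h6.2] at h5
  simpa using (mul_eq_zero.1 h5).resolve_left h6.1.ne'

/-- Two functions of constant phase that vanish almost nowhere have a product of constant phase with
nonzero integral. -/
theorem inner_ne_zero_of_top (hμ : 0 < μ) (htop : ∀ x, quad (chargeOp hω hl) x ≤ μ * ‖x‖ ^ 2)
    {q r : L2Line} (h0 : q ≠ 0) (hq : chargeOp hω hl q = (μ : ℂ) • q) (hr0 : r ≠ 0)
    (hr : chargeOp hω hl r = (μ : ℂ) • r) : inner ℂ q r ≠ 0 := by
  intro h
  obtain ⟨c, hc⟩ := exists_phase_of_top hω hl hμ htop h0 hq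
  obtain ⟨d, hd⟩ := exists_phase_of_top hω hl hμ htop hr0 hr
  have nq := ae_ne_zero_of_top hω hl hμ htop h0 hq
  have nr := ae_ne_zero_of_top hω hl hμ htop hr0 hr
  have hi : Integrable (fun x => ‖q x‖ * ‖r x‖) := (Lp.memLp q).norm.integrable_mul (Lp.memLp r).norm
  have e : inner ℂ q r = (starRingEnd ℂ c * d) * ((∫ x, ‖q x‖ * ‖r x‖ : ℝ) : ℂ) := by
    rw [L2.inner_def, ← integral_complex_ofReal, ← integral_const_mul]
    refine integral_congr_ae ?_
    filter_upwards [hc, hd] with x h1 h2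
    rw [RCLike.inner_apply]
    nth_rewrite 1 [h1, h2]
    rw [map_mul, Complex.conj_ofReal]
    push_cast
    ring
  obtain ⟨x, h1, h2, h3, h4⟩ := (hc.and (hd.and (nq.and nr))).exists
  have hc0 : c ≠ 0 := by rintro rfl; exact h3 (by simpa using h1)
  have hd0 : d ≠ 0 := by rintro rfl; exact h4 (by simpa using h2)
  rw [e, mul_eq_zero, or_iff_right (mul_ne_zero ((map_ne_zero _).2 hc0) hd0),
    Complex.ofReal_eq_zero, integral_eq_zero_iff_of_nonneg
      (fun _ => mul_nonneg (norm_nonneg _) (norm_nonneg _)) hi] at h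
  obtain ⟨y, h5, h6, h7⟩ := (h.and (nq.and nr)).exists
  simp [h6, h7] at h5

/-- The top eigenvector of the charge operator is unique up to a factor. -/
theorem exists_eq_smul_of_top (hμ : 0 < μ) (htop : ∀ x, quad (chargeOp hω hl) x ≤ μ * ‖x‖ ^ 2)
    {q r : L2Line} (h0 : q ≠ 0) (hq : chargeOp hω hl q = (μ : ℂ) • q)
    (hr : chargeOp hω hl r = (μ : ℂ) • r) : ∃ c : ℂ, r = c • q := by
  have hn : inner ℂ q q ≠ 0 := inner_self_ne_zero.2 h0
  refine ⟨inner ℂ q r / inner ℂ q q, ?_⟩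
  by_contra hcon
  refine inner_ne_zero_of_top hω hl hμ htop h0 hq (sub_ne_zero.2 hcon) ?_ ?_
  · rw [map_sub, map_smul, hr, hq, smul_sub, smul_comm]
  · rw [inner_sub_right, inner_smul_right, div_mul_cancel₀ _ hn, sub_self]

end

/-! ### Scaling to `ω = 1` -/

theorem quasiMeasurePreserving_mul {s : ℝ} (hs : s ≠ 0) :
    Measure.QuasiMeasurePreserving (fun x : ℝ => s * x) volume volume := by
  refine ⟨measurable_const_mul s, ?_⟩
  rw [Real.map_volume_mul_left hs]
  exact Measure.smul_absolutelyContinuous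

theorem memLp_comp_mul {s : ℝ} (hs : s ≠ 0) (q : L2Line) : MemLp (fun x => q (s * x)) 2 volume := by
  refine MemLp.comp_of_map (f := fun x : ℝ => s * x) ?_ (measurable_const_mul s).aemeasurable
  rw [Real.map_volume_mul_left hs]
  exact (Lp.memLp q).smul_measure ENNReal.ofReal_ne_top

/-- The dilation `q ↦ q (s ·)`. -/
def dilate {s : ℝ} (hs : s ≠ 0) (q : L2Line) : L2Line := (memLp_comp_mul hs q).toLp _

theorem dilate_ae {s : ℝ} (hs : s ≠ 0) (q : L2Line) : ∀ᵐ x, dilate hs q x = q (s * x) :=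
  MemLp.coeFn_toLp _

theorem dilate_dilate {s t : ℝ} (hs : s ≠ 0) (ht : t ≠ 0) (h : t * s = 1) (q : L2Line) :
    dilate hs (dilate ht q) = q := by
  rw [Lp.ext_iff]
  filter_upwards [dilate_ae hs (dilate ht q),
    (quasiMeasurePreserving_mul hs).ae (dilate_ae ht q)] with x h1 h2
  rw [h1, h2, ← mul_assoc, h, one_mul]

/-- The dilation as a linear equivalence. -/
def dilateEquiv {s : ℝ} (hs : s ≠ 0) : L2Line ≃ₗ[ℂ] L2Line where
  toFun := dilate hs
  invFun := dilate (inv_ne_zero hs)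
  map_add' q r := by
    rw [Lp.ext_iff]
    filter_upwards [dilate_ae hs (q + r), dilate_ae hs q, dilate_ae hs r,
      Lp.coeFn_add (dilate hs q) (dilate hs r),
      (quasiMeasurePreserving_mul hs).ae (Lp.coeFn_add q r)] with x h1 h2 h3 h4 h5
    rw [h1, h4, Pi.add_apply, h2, h3, h5, Pi.add_apply]
  map_smul' c q := by
    rw [Lp.ext_iff]
    filter_upwards [dilate_ae hs (c • q), dilate_ae hs q, Lp.coeFn_smul c (dilate hs q),
      (quasiMeasurePreserving_mul hs).ae (Lp.coeFn_smul c q)] with x h1 h2 h3 h4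
    rw [h1, RingHom.id_apply, h3, Pi.smul_apply, h2, h4, Pi.smul_apply]
  left_inv := dilate_dilate _ _ (mul_inv_cancel₀ hs)
  right_inv := dilate_dilate _ _ (inv_mul_cancel₀ hs)

theorem greenKernel_scale {ω : ℝ} (hω : 0 < ω) (lam x y x' y' : ℝ) :
    greenKernel ω lam x y x' y'
      = greenKernel 1 (lam / ω) (√ω * x) (√ω * y) (√ω * x') (√ω * y') := by
  have hs : √ω ^ 2 = ω := Real.sq_sqrt hω.le
  unfold greenKernel
  congr 1
  refine integral_congr_ae (Eventually.of_forall fun ν => ?_)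
  simp only [div_one]
  congr 2
  rw [← mul_sub, ← mul_sub, mul_pow, mul_pow, mul_pow, mul_pow, hs]
  ring

/-- The Jacobian of the dilation is the only factor that appears; it turns the coupling `α` into `α
/ √ω`. -/
theorem kOp_dilate {ω : ℝ} (hω : 0 < ω) (lam : ℝ) (q : L2Line) (x : ℝ) :
    kOp ω lam (dilate (Real.sqrt_ne_zero'.2 hω) q) x
      = ((√ω)⁻¹ : ℝ) * kOp 1 (lam / ω) q (√ω * x) := by
  have hs : 0 < √ω := Real.sqrt_pos.2 hω
  have h := Measure.integral_comp_mul_left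
    (fun z => (greenKernel 1 (lam / ω) (√ω * x) (√ω * x) z z : ℂ) * q z) √ω
  rw [abs_of_pos (inv_pos.2 hs), Complex.real_smul] at h
  rw [kOp, kOp, ← h]
  refine integral_congr_ae ?_
  filter_upwards [dilate_ae (Real.sqrt_ne_zero'.2 hω) q] with z hz
  rw [hz, greenKernel_scale hω]

theorem solvesCharge_dilate_iff {ω : ℝ} (hω : 0 < ω) (α lam : ℝ) (q : L2Line) :
    SolvesCharge ω α lam (dilate (Real.sqrt_ne_zero'.2 hω) q)
      ↔ SolvesCharge 1 (α / √ω) (lam / ω) q := by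
  have hs : √ω ≠ 0 := Real.sqrt_ne_zero'.2 hω
  have h1 : SolvesCharge ω α lam (dilate hs q) ↔ ∀ᵐ x : ℝ,
      q (√ω * x) + ((α / √ω : ℝ) : ℂ) * kOp 1 (lam / ω) q (√ω * x) = 0 := by
    refine eventually_congr ?_
    filter_upwards [dilate_ae hs q] with x hx
    rw [hx, kOp_dilate hω, div_eq_mul_inv α, Complex.ofReal_mul, mul_assoc]
  rw [h1]
  constructor
  · intro h
    filter_upwards [(quasiMeasurePreserving_mul (inv_ne_zero hs)).ae h] with x hx
    rwa [mul_inv_cancel_left₀ hs] at hx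
  · exact fun h => (quasiMeasurePreserving_mul hs).ae h

theorem rank_chargeSpace_scale {ω e : ℝ} (hω : 0 < ω) (he : 0 < e) (α : ℝ) :
    Module.rank ℂ (chargeSpace hω he α)
      = Module.rank ℂ (chargeSpace one_pos (div_pos he hω) (α / √ω)) := by
  have hs : √ω ≠ 0 := Real.sqrt_ne_zero'.2 hω
  have h : chargeSpace one_pos (div_pos he hω) (α / √ω)
      = (chargeSpace hω he α).comap (dilateEquiv hs : L2Line →ₗ[ℂ] L2Line) := by
    ext q
    rw [Submodule.mem_comap, mem_chargeSpace, mem_chargeSpace, ← solvesCharge_iff,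
      ← solvesCharge_iff]
    exact (solvesCharge_dilate_iff hω α e q).symm
  rw [h]
  exact ((dilateEquiv hs).ofSubmodule' (chargeSpace hω he α)).rank_eq.symm

/-! ### Assembly: spectrum, ground state charge, critical coupling, weak coupling -/

/-- The number of bound states. -/
def boundCount (ω α : ℝ) : ℕ := numLevels (-(α / √ω))⁻¹

/-- The binding energies. -/
def bindingEnergy (n : ℕ) (α ω : ℝ) : ℝ := ω * levelRoot n (-(α / √ω))⁻¹

section
variable {ω α : ℝ}

theorem inv_neg_div_sqrt_pos (hω : 0 < ω) (hα : α < 0) : 0 < (-(α / √ω))⁻¹ :=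
  inv_pos.2 (neg_pos.2 (div_neg_of_neg_of_pos hα (Real.sqrt_pos.2 hω)))

theorem isNegativeSpectrum (hω : 0 < ω) (hα : α < 0) :
    IsNegativeSpectrum ω α (boundCount ω α) (fun n => bindingEnergy n α ω) where
  pos n hn := mul_pos hω (levelRoot_spec (inv_neg_div_sqrt_pos hω hα) hn).1
  antitone m n hmn hn := mul_le_mul_of_nonneg_left
    (levelRoot_antitone (inv_neg_div_sqrt_pos hω hα) hmn hn) hω.le
  rank_eq e he := by
    rw [← (chargeEquiv hω he α).rank_eq, rank_chargeSpace_scale hω he, rank_chargeSpace_one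
      (div_neg_of_neg_of_pos hα (Real.sqrt_pos.2 hω)) (div_pos he hω)]
    congr 3
    ext n
    rw [bindingEnergy, eq_div_iff hω.ne', mul_comm]

/-- After dilation both charges are eigenvectors of the charge operator for `ω = 1`. The eigenvalue
is the level of index zero, hence the top of the form, and there the eigenvector is unique up to a
factor. -/
theorem ground_charge_unique (hω : 0 < ω) (hα : α < 0) {q q' : L2Line}
    (hq : SolvesCharge ω α (bindingEnergy 0 α ω) q)
    (hq' : SolvesCharge ω α (bindingEnergy 0 α ω) q') (hn : ‖q‖ = ‖q'‖) :
    ∃ c : ℂ, ‖c‖ = 1 ∧ q' = c • q := by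
  rcases eq_or_ne q 0 with rfl | h0
  · rw [norm_zero, eq_comm, norm_eq_zero] at hn
    exact ⟨1, norm_one, by rw [hn, smul_zero]⟩
  have hs : √ω ≠ 0 := Real.sqrt_ne_zero'.2 hω
  have hβ : α / √ω < 0 := div_neg_of_neg_of_pos hα (Real.sqrt_pos.2 hω)
  have hc := inv_neg_div_sqrt_pos hω hα
  set D := dilateEquiv hs
  obtain ⟨hl, hL⟩ := levelRoot_spec hc (numLevels_pos hc)
  have key (r : L2Line) (hr : SolvesCharge ω α (bindingEnergy 0 α ω) r) :
      chargeOp one_pos hl (D.symm r) = (((-(α / √ω))⁻¹ : ℝ) : ℂ) • D.symm r := by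
    have h1 : SolvesCharge ω α (bindingEnergy 0 α ω) (D (D.symm r)) := by
      rwa [D.apply_symm_apply]
    have h2 := (solvesCharge_dilate_iff hω _ _ _).1 h1
    rw [bindingEnergy, mul_div_cancel_left₀ _ hω.ne', solvesCharge_iff one_pos hl,
      ← mem_chargeSpace, chargeSpace_eq one_pos hl hβ, Module.End.mem_eigenspace_iff] at h2
    exact h2
  have htop (x : L2Line) : quad (chargeOp one_pos hl) x ≤ (-(α / √ω))⁻¹ * ‖x‖ ^ 2 := by
    rw [chargeLevel_eq 0 hl] at hL
    nth_rewrite 2 [← hL]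
    exact quad_le_level_zero (quad_chargeOp_nonneg one_pos hl) x
  obtain ⟨c, hcq⟩ := exists_eq_smul_of_top one_pos hl hc htop
    (D.symm.map_ne_zero_iff.2 h0) (key q hq) (key q' hq')
  rw [← map_smul] at hcq
  have hcq' := D.symm.injective hcq
  refine ⟨c, ?_, hcq'⟩
  rw [hcq', norm_smul, eq_comm] at hn
  exact (mul_eq_right₀ (norm_ne_zero_iff.2 h0)).1 hn

/-- The height to be exceeded is `√ω / |α|`, and it lies below `firstLevel` exactly if `|α| > √ω /
firstLevel`. -/
theorem exists_critical_coupling (hω : 0 < ω) : ∃ α₀ : ℝ, 0 < α₀ ∧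
    (∀ α : ℝ, -α₀ ≤ α → α < 0 → boundCount ω α = 1) ∧
    (∀ α : ℝ, α < -α₀ → 1 < boundCount ω α) := by
  have hs : 0 < √ω := Real.sqrt_pos.2 hω
  have hF := firstLevel_pos
  have key (α : ℝ) (hα : α < 0) : 1 < boundCount ω α ↔ α < -(√ω / firstLevel) := by
    rw [boundCount, one_lt_numLevels_iff (inv_neg_div_sqrt_pos hω hα), ← neg_div, inv_div,
      div_lt_iff₀ (neg_pos.2 hα), lt_neg, div_lt_iff₀ hF, mul_comm]
  refine ⟨√ω / firstLevel, by positivity, fun α h hα => ?_, fun α h => ?_⟩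
  · have h1 : 0 < boundCount ω α := numLevels_pos (inv_neg_div_sqrt_pos hω hα)
    have h2 := (key α hα).not.2 (not_lt.2 h)
    omega
  · exact (key α (h.trans (neg_neg_of_pos (by positivity)))).2 h

/-- The powers of `ω` cancel: `ω (α/√ω)² / 2 = α² / 2`. -/
theorem isEquivalent_bindingEnergy (hω : 0 < ω) : Asymptotics.IsEquivalent (𝓝[<] 0)
    (fun α : ℝ => bindingEnergy 0 α ω) (fun α : ℝ => α ^ 2 / 2) := by
  have hs : 0 < √ω := Real.sqrt_pos.2 hω
  have ht : Tendsto (fun α : ℝ => α / √ω) (𝓝[<] 0) (𝓝[<] 0) := by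
    refine tendsto_nhdsWithin_iff.2 ⟨?_, ?_⟩
    · have : Continuous fun α : ℝ => α / √ω := by fun_prop
      simpa using (this.tendsto 0).mono_left nhdsWithin_le_nhds
    · filter_upwards [self_mem_nhdsWithin] with α hα
      exact div_neg_of_neg_of_pos hα hs
  have h := (Asymptotics.IsEquivalent.refl (u := fun _ : ℝ => ω)).mul
    (isEquivalent_levelRoot.comp_tendsto ht)
  refine h.congr_right (Eventually.of_forall fun α => ?_)
  simp only [Pi.mul_apply, Function.comp_apply]
  rw [div_pow, Real.sq_sqrt hω.le]
  field_simp

end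

end

end ZeroRange

open ZeroRange in
theorem mainTheorem1 :
    (∀ ω α : ℝ, 0 < ω → 0 ≤ α → ∀ e : ℝ, 0 < e → eigenspace ω α e = ⊥) ∧
    ∃ (N : ℝ → ℝ → ℕ) (E : ℕ → ℝ → ℝ → ℝ),
      (∀ ω α : ℝ, 0 < ω → α < 0 →
        IsNegativeSpectrum ω α (N ω α) (fun n => E n α ω) ∧
        N ω α = N 1 (α / √ω) ∧
        (∀ n < N ω α, E n α ω = ω * E n (α / √ω) 1) ∧
        (∀ e : ℝ, 0 < e →
          (∀ u ∈ eigenspace ω α e, ∃! q : L2Line,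
            (∀ᵐ p : ℝ × ℝ, u p = potential ω e q p) ∧ SolvesCharge ω α e q) ∧
          (∀ q : L2Line, SolvesCharge ω α e q →
            ∃ u ∈ eigenspace ω α e, ∀ᵐ p : ℝ × ℝ, u p = potential ω e q p)) ∧
        (∀ q q' : L2Line, SolvesCharge ω α (E 0 α ω) q → SolvesCharge ω α (E 0 α ω) q' →
          ‖q‖ = ‖q'‖ → ∃ c : ℂ, ‖c‖ = 1 ∧ q' = c • q)) ∧
      (∀ ω : ℝ, 0 < ω → ∃ α₀ : ℝ, 0 < α₀ ∧
        (∀ α : ℝ, -α₀ ≤ α → α < 0 → N ω α = 1) ∧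
        (∀ α : ℝ, α < -α₀ → 1 < N ω α)) ∧
      (∀ ω : ℝ, 0 < ω →
        Asymptotics.IsEquivalent (𝓝[<] 0) (fun α : ℝ => E 0 α ω) (fun α : ℝ => α ^ 2 / 2)) := by
  refine ⟨fun ω α _ hα e he => eigenspace_eq_bot_of_nonneg hα he, boundCount, bindingEnergy,
    fun ω α hω hα => ⟨isNegativeSpectrum hω hα, ?_, fun n _ => ?_, fun e he =>
      ⟨fun u hu => existsUnique_charge hω he hu, fun q hq => exists_eigenvector_of_charge hω he hq⟩,
      fun q q' => ground_charge_unique hω hα⟩,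
    fun ω hω => exists_critical_coupling hω, fun ω hω => isEquivalent_bindingEnergy hω⟩
  · simp [boundCount]
  · simp [bindingEnergy]
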